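/- **Setting.** Let $K$ be a field of characteristic $0$, let $X$ be a smooth variety over $K$ (integral, separated, of finite type), and let $E$ be a simple normal crossing divisor on $X$. A *rational Rees algebra* on $X$ is a finitely generated graded $\mathcal O_X$-algebra $R=\bigoplus_{a\in\mathbb Q_{\ge0}}R_at^a\subseteq\mathcal O_X[t^{1/w}]$ (for some integer $w\ge 1$) with ideal sheaves $R_a$ and $R_0=\mathcal O_X$. Let $p\in X$ be a point with $p\in V(\sum_{a>0}R_a)$. Everything below is meant at $p$, i.e. for the germs over $\mathcal O=\mathcal O_{X,p}$, with maximal ideal $\mathfrak m$. Coordinates $z$ at $p$ are functions whose differentials form a basis of $\Omega_{\mathcal O/K}$ and such that those of them which vanish at $p$ form a regular system of parameters; they are compatible with $E$ if each component of $E$ through $p$ is $V(z_i)$ for some $i$. Write $D_{z^\alpha}=\frac1{\alpha!}\frac{\partial^{|\alpha|}}{\partial z^\alpha}$. A partial system of parameters compatible with $E$ consists of distinct vanishing members of compatible coordinates; such a parameter is *divisorial* if it defines a component of $E$, and *free* otherwise. *Centers.* A *Rees center* at $p$ is $\mathcal A=\mathcal O[x_1t^{1/a_1},\dots,x_kt^{1/a_k}]^{\rm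 int}$ ($k\ge0$, $a_i\in\mathbb Q_{>0}$, $x_1,\dots,x_k$ a partial system of parameters compatible with $E$), where ${}^{\rm int}$ is the integral closure in the smallest ring $\mathcal O[t^{1/w}]$ containing the generators. If $R$ is a Rees algebra, ${}^{\rm Int}$ denotes the integral closure in the smallest ring $\mathcal O[t^{1/w}]$ containing both $R$ and the given elements, and $\mathcal A$ is *admissible* for $R$ if $R\subseteq\mathcal A^{\rm Int}$. Put $b_i=a_i$ if $x_i$ is free and $b_i=(a_i)_+$ if $x_i$ is divisorial, where $a<a_+$, and $a_+<b$ for rational $a<b$; the presentation is ordered so that $b_1\le\dots\le b_k$, and its invariant is $(b_1,\dots,b_k)$. Finite sequences are compared lexicographically after being prolonged by $\infty$. The invariant $\mathrm{inv}_p(R)$ is the largest invariant of the admissible centers at $p$, and an admissible center which has a presentation with this invariant is called *maximal admissible*. *Order and maximal contact.* $\mathrm{ord}_p(R)$ is the minimum of $\mathrm{ord}_p(f)/b$ over the non-zero $ft^b\in R$ with $b>0$. If $a=\mathrm{ord}_p(R)$ and $R=\mathcal O[f_jt^{b_j}]$, let $T=T^{1/a}(R)$ be the ideal generated by the $D_{z^\alpha}f_j$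 with $|\alpha|=b_ja-1$. A *maximal contact* of $R$ is a tuple $\bar x$, free parameters first, of vanishing members of compatible coordinates $z$ such that, for some generators $f_jt^{b_j}$ of $R$, the free members of $\bar x$ lie in $T$, $\partial_{z_i}T$ generates the unit ideal for each divisorial member $z_i$ of $\bar x$, and $\partial_{z_i}T$ does not generate the unit ideal for any vanishing $z_i$ which is not in $\bar x$. Put $\mathrm{inv}(\bar x)=(1,\dots,1,1_+,\dots,1_+)$, with $1$ for the free and $1_+$ for the divisorial members. *Procedure.* Put $R_1=R$ and $H_0=X$. Given $R_i$ and $\bar x_1,\dots,\bar x_{i-1}$, with $H_{i-1}=V(\bar x_1,\dots,\bar x_{i-1})$ and with $R_{i|H_{i-1}}$ non-trivial in positive degrees, let $a_i=\mathrm{ord}_p(R_{i|H_{i-1}})$ and choose parameters $\bar x_i$, forming with $\bar x_1,\dots,\bar x_{i-1}$ a partial system of parameters compatible with $E$, whose restriction to $H_{i-1}$ is a maximal contact for $R_{i|H_{i-1}}$ (with respect to the restrictions of those components of $E$ that do not contain $H_{i-1}$). Choose compatible coordinates extending $\bar x_1,\dots,\bar x_i$, and generators $R_i=\mathcal O[(\bar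 x_1t^{1/a_1},\dots,\bar x_{i-1}t^{1/a_{i-1}})^{\rm Int},f_jt^{b_j}]$, and let $$R_{i+1}=C_{\bar x_it^{1/a_i}}(R_i)=\mathcal O\big[(\bar x_1t^{1/a_1},\dots,\bar x_it^{1/a_i})^{\rm Int},\ D_{\bar x_i^\alpha}(f_j)\,t^{\,b_j-|\alpha|/a_i}\ :\ |\alpha|<b_ja_i\big].$$ The procedure stops at $R_{k+1}$ if $R_{k+1|H_k}$ is zero in all positive degrees. $R_{i+1}$ is *nested* at $H_i$ if it contains $(\bar x_1t^{1/a_1},\dots,\bar x_it^{1/a_i})^{\rm Int}$ and, for some $K$-algebra splitting of $\widehat{\mathcal O}_{X,p}\to\widehat{\mathcal O}_{H_i,p}$, $\widehat{\mathcal O}R_{i+1}=\widehat{\mathcal O}[(\bar x_1t^{1/a_1},\dots,\bar x_it^{1/a_i})^{\rm Int},R_{i+1|H_i}]$. **Proposition.** There is a unique Rees center $\mathcal A$ that is maximal admissible for $R$ at $p$. It is produced by the procedure, independently of the choices: each run of the procedure can be continued until it stops, and, whenever a run stops, at $R_{k+1}$ say, then 1. $a_1<\dots<a_k$, $\ \mathcal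 A=\mathcal O_X[\bar x_1t^{1/a_1},\dots,\bar x_kt^{1/a_k}]^{\rm int}$ at $p$, and $R_{k+1}=\mathcal A^{\rm Int}$; 2. $a_i=\mathrm{ord}_p(R_{i|H_{i-1}})$, and $\bar x_i$ is a maximal contact for $R_{i|H_{i-1}}$; 3. $\mathrm{inv}_p(R)=(a_1\,\mathrm{inv}(\bar x_1),\dots,a_k\,\mathrm{inv}(\bar x_k))$, where $a\cdot1=a$ and $a\cdot1_+=a_+$. Moreover the choices can be made in such a way that the procedure stops and each $R_i$, $i\ge 2$, is nested at $H_{i-1}$. -/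

import Mathlib

open scoped NNRat KaehlerDifferential

universe u

namespace WeightedCenters

noncomputable section

/-! ### Graded subalgebras of `A[t^ℚ≥0]`

A rational Rees algebra over a ring `A` is a graded subalgebra of the monoid algebra of `ℚ≥0`
over `A`; the element `f t^q` is `AddMonoidAlgebra.single q f`. -/

/-- The ring `A[t^q : q ∈ ℚ≥0]`. -/
abbrev TAlg (A : Type u) [CommRing A] : Type u := AddMonoidAlgebra A ℚ≥0

/-- The homogeneous element `f t^q`. -/
abbrev mono {A : Type u} [CommRing A] (q : ℚ≥0) (f : A) : TAlg A := AddMonoidAlgebra.single q f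

section Graded

variable {A : Type u} [CommRing A]

/-- The group of rational numbers generated by the degrees of the non-zero homogeneous elements
of `S`. If `S` is finitely generated, this is `(1/w)ℤ`, where `A[t^(1/w)]` is the smallest such
ring which contains `S`. -/
def degreeGroup (S : Subalgebra A (TAlg A)) : AddSubgroup ℚ :=
  AddSubgroup.closure {q : ℚ | ∃ r : ℚ≥0, q = (r : ℚ) ∧ ∃ f : A, f ≠ 0 ∧ mono r f ∈ S}

/-- The ring `A[t^q : q ∈ G, q ≥ 0]`; it is `A[t^(1/w)]` if `G = (1/w)ℤ`. -/
def supportedIn (A : Type u) [CommRing A] (G : AddSubgroup ℚ) : Subalgebra A (TAlg A) :=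
  Algebra.adjoin A {F | ∃ q : ℚ≥0, (q : ℚ) ∈ G ∧ F = mono q (1 : A)}

/-- The integral closure of `S` in `A[t^q : q ∈ G, q ≥ 0]`. -/
def intClosureIn (G : AddSubgroup ℚ) (S : Subalgebra A (TAlg A)) : Subalgebra A (TAlg A) :=
  (integralClosure S (TAlg A)).restrictScalars A ⊓ supportedIn A G

/-- The algebra `A[x t^(1/a) : (x, a) ∈ L]`. -/
def weightedAlg (L : List (A × ℚ≥0)) : Subalgebra A (TAlg A) :=
  Algebra.adjoin A {F | ∃ y ∈ L, F = mono (1 / y.2) y.1}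

/-- The Rees center `A[x t^(1/a) : (x, a) ∈ L]^int`, where the integral closure is taken in the
smallest ring `A[t^(1/w)]` which contains the generators. -/
def center (L : List (A × ℚ≥0)) : Subalgebra A (TAlg A) :=
  intClosureIn (degreeGroup (weightedAlg L)) (weightedAlg L)

/-- The algebra `𝒜^Int`: the integral closure of `𝒜` in the smallest ring `A[t^(1/w)]` which
contains both `R` and `𝒜`. -/
def IntFor (R 𝒜 : Subalgebra A (TAlg A)) : Subalgebra A (TAlg A) :=
  intClosureIn (degreeGroup R ⊔ degreeGroup 𝒜) 𝒜

/-- `𝒜` is admissible for `R`. -/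
def Admissible (R 𝒜 : Subalgebra A (TAlg A)) : Prop := R ≤ IntFor R 𝒜

/-- The `B`-algebra generated by the image of `S` in `B[t^ℚ≥0]`. For `B = A ⧸ I` it is the
restriction of `S` to `V(I)`; for a completion `B` of `A` it is `B · S`. -/
def extend {B : Type u} [CommRing B] (φ : A →+* B) (S : Subalgebra A (TAlg A)) :
    Subalgebra B (TAlg B) :=
  Algebra.adjoin B (AddMonoidAlgebra.mapRingHom ℚ≥0 φ '' (S : Set (TAlg A)))

/-- `q` is the order of `S` at the point with maximal ideal `𝔪`: the least value of
`ord(f) / b` over the non-zero homogeneous elements `f t^b` of `S` with `b > 0`. -/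
def IsOrder (𝔪 : Ideal A) (S : Subalgebra A (TAlg A)) (q : ℚ≥0) : Prop :=
  IsLeast {r : ℚ≥0 | ∃ (b : ℚ≥0) (f : A) (n : ℕ),
    0 < b ∧ mono b f ∈ S ∧ f ∈ 𝔪 ^ n ∧ f ∉ 𝔪 ^ (n + 1) ∧ r = n / b} q

end Graded

/-! ### Coordinates -/

/-- A coordinate system at a point with local `K`-algebra `A` and maximal ideal `𝔪`: functions `z`
whose differentials form a basis of `Ω[A⁄K]`, such that those `z i` which vanish at the point
form a system of local parameters, together with the partial derivatives `∂ i = ∂/∂(z i)`, which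
are the derivations dual to the `d (z i)`. (At a closed point all `z i` of such a system vanish.) -/
structure CoordSystem (K : Type u) [Field K] (A : Type u) [CommRing A] [Algebra K A]
    (𝔪 : Ideal A) (n : ℕ) where
  /-- the coordinate functions -/
  z : Fin n → A
  /-- the partial derivatives -/
  der : Fin n → Derivation K A A
  der_apply : ∀ i j, der i (z j) = if i = j then 1 else 0
  span_diff : Submodule.span A (Set.range fun i => KaehlerDifferential.D K A (z i)) = ⊤
  span_param : Ideal.span {y | y ∈ Set.range z ∧ y ∈ 𝔪} = 𝔪

section Coord

variable {K : Type u} [Field K] {A : Type u} [CommRing A] [Algebra K A] {𝔪 : Ideal A} {n : ℕ}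

/-- The operator `D_{z^α} = (1 / α!) ∂^|α| / ∂ z^α`. -/
def CoordSystem.diffOp (c : CoordSystem K A 𝔪 n) (α : Fin n → ℕ) (f : A) : A :=
  (∏ i, (Nat.factorial (α i) : K))⁻¹ •
    (List.finRange n).foldr (fun i g => (fun h => c.der i h)^[α i] g) f

/-- The coordinate system is compatible with the divisor whose components through the point have
the local ideals `J ∈ E`: each of them is `V(z i)` for some `i`. -/
def CoordSystem.Compatible (c : CoordSystem K A 𝔪 n) (E : Set (Ideal A)) : Prop :=
  ∀ J ∈ E, ∃ i, J = Ideal.span {c.z i}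

/-- The members of `l` are distinct local parameters of the coordinate system. -/
def CoordSystem.Extends (c : CoordSystem K A 𝔪 n) (l : List A) : Prop :=
  l.Nodup ∧ ∀ x ∈ l, x ∈ Set.range c.z ∧ x ∈ 𝔪

end Coord

/-- `l` is a partial system of local parameters compatible with `E`. -/
def IsPartialSystem (K : Type u) [Field K] {A : Type u} [CommRing A] [Algebra K A] (𝔪 : Ideal A)
    (E : Set (Ideal A)) (l : List A) : Prop :=
  ∃ (n : ℕ) (c : CoordSystem K A 𝔪 n), c.Compatible E ∧ c.Extends l

/-! ### The invariant -/

/-- The ordered set `ℚ_+` (non-negative part): `(a, false)` is `a` and `(a, true)` is `a_+`, so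
that `a < a_+`, and `a_+ < b` if `a < b`. -/
abbrev QPlus : Type := ℚ≥0 ×ₗ Bool

/-- Finite sequences in `ℚ_+`, prolonged by `∞`, with the lexicographic order. -/
abbrev InvSeq : Type := Lex (ℕ → WithTop QPlus)

/-- A finite sequence, prolonged by `∞`. -/
def toInvSeq (l : List QPlus) : InvSeq :=
  toLex fun n => (l[n]?).elim ⊤ fun b => (b : WithTop QPlus)

section Invariant

variable {A : Type u} [CommRing A]

/-- The parameter `x` is divisorial: it defines a component of the divisor. -/
def IsDivisorial (E : Set (Ideal A)) (x : A) : Prop := Ideal.span {x} ∈ E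

open Classical in
/-- The symbol of `x t^(1/a)`: `a_+` if `x` is divisorial, and `a` if `x` is free. -/
def symbol (E : Set (Ideal A)) (a : ℚ≥0) (x : A) : QPlus :=
  toLex (a, decide (IsDivisorial E x))

/-- The data `x_1 t^(1/a_1), …, x_k t^(1/a_k)` of a presentation of a center compatible with `E`:
`x_1, …, x_k` is a partial system of local parameters compatible with `E`, the weights are
positive and `b_1 ≤ … ≤ b_k`. -/
def IsPresentation (K : Type u) [Field K] [Algebra K A] (𝔪 : Ideal A) (E : Set (Ideal A))
    (L : List (A × ℚ≥0)) : Prop :=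
  IsPartialSystem K 𝔪 E (L.map Prod.fst) ∧ (∀ y ∈ L, 0 < y.2) ∧
    (L.map fun y => symbol E y.2 y.1).Pairwise (· ≤ ·)

/-- The invariant `(b_1, …, b_k)` of a presentation. -/
def invOf (E : Set (Ideal A)) (L : List (A × ℚ≥0)) : InvSeq :=
  toInvSeq (L.map fun y => symbol E y.2 y.1)

/-- The set of the invariants of the presentations of the centers compatible with `E` which are
admissible for `R`. -/
def admissibleInvs (K : Type u) [Field K] [Algebra K A] (𝔪 : Ideal A) (E : Set (Ideal A))
    (R : Subalgebra A (TAlg A)) : Set InvSeq :=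
  {β | ∃ L, IsPresentation K 𝔪 E L ∧ Admissible R (center L) ∧ β = invOf E L}

/-- `β` is the resolution invariant `inv_p(R)`. -/
def IsResolutionInv (K : Type u) [Field K] [Algebra K A] (𝔪 : Ideal A) (E : Set (Ideal A))
    (R : Subalgebra A (TAlg A)) (β : InvSeq) : Prop :=
  IsGreatest (admissibleInvs K 𝔪 E R) β

/-- `𝒜` is a maximal admissible center for `R` (at the point, compatible with `E`). -/
def IsMaximalAdmissible (K : Type u) [Field K] [Algebra K A] (𝔪 : Ideal A) (E : Set (Ideal A))
    (R 𝒜 : Subalgebra A (TAlg A)) : Prop :=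
  ∃ L, IsPresentation K 𝔪 E L ∧ 𝒜 = center L ∧ Admissible R 𝒜 ∧
    IsResolutionInv K 𝔪 E R (invOf E L)

end Invariant

/-! ### Maximal contact -/

section MaxContact

variable {K : Type u} [Field K] {A : Type u} [CommRing A] [Algebra K A] {𝔪 : Ideal A} {n : ℕ}

/-- The cotangent ideal `T^(1/a)`, generated by the `D_{z^α}(f_j)` with `|α| = b_j a - 1`, of the
algebra with the generators `f_j t^(b_j)`. -/
def cotangentIdeal (c : CoordSystem K A 𝔪 n) {s : ℕ} (f : Fin s → A) (b : Fin s → ℚ≥0)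
    (a : ℚ≥0) : Ideal A :=
  Ideal.span {g | ∃ (j : Fin s) (α : Fin n → ℕ),
    ((∑ i, α i : ℕ) : ℚ≥0) + 1 = b j * a ∧ g = c.diffOp α (f j)}

/-- `x` is a maximal contact for `S`, and `a` is the order of `S`, at the point. The free members
of `x` come first; they lie in the cotangent ideal `T`. For a divisorial member the corresponding
partial derivative of `T` is the unit ideal, and for the parameters which are not in `x` it is not. -/
def IsMaximalContact (K : Type u) [Field K] {A : Type u} [CommRing A] [Algebra K A] (𝔪 : Ideal A)
    (E : Set (Ideal A)) (S : Subalgebra A (TAlg A)) (a : ℚ≥0) (x : List A) : Prop :=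
  IsOrder 𝔪 S a ∧
  x.Pairwise (fun y y' => IsDivisorial E y → IsDivisorial E y') ∧
  ∃ (n : ℕ) (c : CoordSystem K A 𝔪 n) (s : ℕ) (f : Fin s → A) (b : Fin s → ℚ≥0),
    c.Compatible E ∧ c.Extends x ∧
    S = Algebra.adjoin A (Set.range fun j => mono (b j) (f j)) ∧
    (∀ i, c.z i ∈ x → ¬ IsDivisorial E (c.z i) → c.z i ∈ cotangentIdeal c f b a) ∧
    (∀ i, c.z i ∈ x → IsDivisorial E (c.z i) →
      Ideal.span ((fun h => c.der i h) '' (cotangentIdeal c f b a : Set A)) = ⊤) ∧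
    (∀ i, c.z i ∈ 𝔪 → c.z i ∉ x →
      Ideal.span ((fun h => c.der i h) '' (cotangentIdeal c f b a : Set A)) ≠ ⊤)

end MaxContact

/-! ### The milling procedure -/

section Milling

variable {A : Type u} [CommRing A]

/-- A state of the procedure: the blocks `(x̄_1, a_1), …, (x̄_i, a_i)` found so far, and the
current algebra `R_{i+1}`. -/
abbrev State (A : Type u) [CommRing A] : Type u := List (List A × ℚ≥0) × Subalgebra A (TAlg A)

/-- All coordinates of the blocks, each with the weight of its block. -/
def coords (bl : List (List A × ℚ≥0)) : List (A × ℚ≥0) :=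
  bl.flatMap fun y => y.1.map fun x => (x, y.2)

/-- The ideal of `H_i = V(x̄_1, …, x̄_i)`. -/
def idealOf (bl : List (List A × ℚ≥0)) : Ideal A := Ideal.span {x | ∃ y ∈ bl, x ∈ y.1}

/-- The components of the restricted divisor on `V(I)`: the restrictions of those components which
do not contain `V(I)`. -/
def restrictDiv (E : Set (Ideal A)) (I : Ideal A) : Set (Ideal (A ⧸ I)) :=
  {J' | J' ≠ ⊥ ∧ ∃ J ∈ E, J' = J.map (Ideal.Quotient.mk I)}

/-- The part `(x̄_1 t^(1/a_1), …, x̄_i t^(1/a_i))^Int`, with the integral closure taken in the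
smallest ring `A[t^(1/w)]` which contains these elements and `S`. -/
def intPart (S : Subalgebra A (TAlg A)) (bl : List (List A × ℚ≥0)) : Subalgebra A (TAlg A) :=
  IntFor S (weightedAlg (coords bl))

/-- The algebra `R_{i+1}` is nested at `H_i`: it contains `(x̄_1 t^(1/a_1), …, x̄_i t^(1/a_i))^Int`
and over the completed local ring `Ô` it is generated by this part and by its restriction to `H_i`,
which is viewed in `Ô` through a splitting `σ` of `Ô → Ô_{H_i}`. -/
def IsNested (K : Type u) [Field K] [Algebra K A] (𝔪 : Ideal A) (s : State A) : Prop :=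
  intPart s.2 s.1 ≤ s.2 ∧
  ∃ σ : (AdicCompletion 𝔪 A ⧸ (idealOf s.1).map (algebraMap A (AdicCompletion 𝔪 A))) →ₐ[K]
      AdicCompletion 𝔪 A,
    (∀ y, Ideal.Quotient.mk _ (σ y) = y) ∧
    extend (algebraMap A (AdicCompletion 𝔪 A)) s.2 =
      extend (algebraMap A (AdicCompletion 𝔪 A)) (intPart s.2 s.1) ⊔
      Algebra.adjoin (AdicCompletion 𝔪 A)
        {F | ∃ (q : ℚ≥0) (f : A), mono q f ∈ s.2 ∧
          F = mono q (σ (Ideal.Quotient.mk _ (algebraMap A (AdicCompletion 𝔪 A) f)))}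

/-- The (nested) coefficient ideal: the algebra generated by
`(x̄_1 t^(1/a_1), …, x̄_i t^(1/a_i))^Int` for the blocks `bl`, and by the elements
`D_{x^α}(f_j) t^(b_j - |α| / a)` with `|α| < b_j a`, where `α` involves only the derivatives with
respect to the members of `x` in the coordinate system `c`. -/
def coeffAlg {K : Type u} [Field K] [Algebra K A] {𝔪 : Ideal A} {n : ℕ}
    (S : Subalgebra A (TAlg A)) (bl : List (List A × ℚ≥0)) (c : CoordSystem K A 𝔪 n)
    (x : List A) (a : ℚ≥0) {s : ℕ} (f : Fin s → A) (b : Fin s → ℚ≥0) : Subalgebra A (TAlg A) :=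
  intPart S bl ⊔
  Algebra.adjoin A {F | ∃ (j : Fin s) (α : Fin n → ℕ),
    (∀ i, c.z i ∉ x → α i = 0) ∧ ((∑ i, α i : ℕ) : ℚ≥0) < b j * a ∧
    F = mono (b j - ((∑ i, α i : ℕ) : ℚ≥0) / a) (c.diffOp α (f j))}

/-- One step of the procedure, from `R_i` (with the blocks up to `i - 1`) to `R_{i+1}`:
`a = a_i` is the order of `R_i` restricted to `H_{i-1}`, the restriction of `x = x̄_i` is a maximal
contact of it, `x̄_1, …, x̄_i` belong to a coordinate system `c` compatible with `E`, and `R_{i+1}`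
is the coefficient ideal, computed with `c` and some presentation
`R_i = 𝒪[(x̄_1 t^(1/a_1), …, x̄_{i-1} t^(1/a_{i-1}))^Int, f_j t^(b_j)]`. -/
def MillingStep (K : Type u) [Field K] [Algebra K A] (𝔪 : Ideal A) (E : Set (Ideal A))
    (s s' : State A) : Prop :=
  ∃ (x : List A) (a : ℚ≥0),
    s'.1 = s.1 ++ [(x, a)] ∧
    IsMaximalContact K (𝔪.map (Ideal.Quotient.mk (idealOf s.1))) (restrictDiv E (idealOf s.1))
      (extend (Ideal.Quotient.mk (idealOf s.1)) s.2) a (x.map (Ideal.Quotient.mk (idealOf s.1))) ∧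
    ∃ (n : ℕ) (c : CoordSystem K A 𝔪 n) (m : ℕ) (f : Fin m → A) (b : Fin m → ℚ≥0),
      c.Compatible E ∧ c.Extends ((coords s'.1).map Prod.fst) ∧
      s.2 = intPart s.2 s.1 ⊔ Algebra.adjoin A (Set.range fun j => mono (b j) (f j)) ∧
      s'.2 = coeffAlg s.2 s'.1 c x a f b

/-- The procedure has come to its end: the restriction of the algebra to `H_k` vanishes in all
positive degrees. -/
def Terminated (s : State A) : Prop := extend (Ideal.Quotient.mk (idealOf s.1)) s.2 = ⊥

/-- A run of the procedure, with arbitrary choices, from one state to another one. -/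
def MillingRun (K : Type u) [Field K] [Algebra K A] (𝔪 : Ideal A) (E : Set (Ideal A)) :
    State A → State A → Prop :=
  Relation.ReflTransGen (MillingStep K 𝔪 E)

/-- A run of the procedure in which all the algebras that are produced are nested. -/
def NestedMillingRun (K : Type u) [Field K] [Algebra K A] (𝔪 : Ideal A) (E : Set (Ideal A)) :
    State A → State A → Prop :=
  Relation.ReflTransGen fun s s' => MillingStep K 𝔪 E s s' ∧ IsNested K 𝔪 s'

/-- The invariant `inv(x̄) = (1, …, 1, 1_+, …, 1_+)`, multiplied by `a`. -/
def blockInv (E : Set (Ideal A)) (a : ℚ≥0) (x : List A) : List QPlus := x.map (symbol E a)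

end Milling

/-! ### Schemes -/

section Schemes

open CategoryTheory AlgebraicGeometry

/-- The stalk at `p` of the ideal sheaf `I`. -/
def stalkIdeal {X : Scheme.{u}} (I : X.IdealSheafData) (p : X) : Ideal (X.presheaf.stalk p) :=
  ⨆ (U : X.affineOpens) (hp : p ∈ U.1), (I.ideal U).map (X.presheaf.germ U.1 p hp).hom

/-- A rational Rees algebra on `X`: quasi-coherent ideals `R_a`, for `a ∈ ℚ≥0`, such that
`R_0 = 𝒪_X`, `R_a R_b ⊆ R_{a+b}`, and `⨁ R_a t^a` is a finitely generated `𝒪_X`-algebra. -/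
structure RationalRees (X : Scheme.{u}) where
  /-- the ideal `R_a` -/
  ideal : ℚ≥0 → X.IdealSheafData
  ideal_zero : ideal 0 = ⊤
  mul_le : ∀ a b, ideal a * ideal b ≤ ideal (a + b)
  fg : ∀ U : X.affineOpens, (Algebra.adjoin Γ(X, U)
    {F : TAlg Γ(X, U) | ∃ q, ∃ f ∈ (ideal q).ideal U, F = mono q f}).FG

/-- A simple normal crossing divisor: a finite set of closed integral subschemes (the components)
such that at each point `q` of `X` there is a regular system of parameters, and each component
through `q` is there the zero locus of one of the parameters. -/
structure SNCDivisor (X : Scheme.{u}) where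
  /-- the ideal sheaves of the components -/
  components : Set X.IdealSheafData
  finite : components.Finite
  integral : ∀ I ∈ components, IsIntegral I.subscheme
  snc : ∀ q : X, ∃ (d : ℕ) (x : Fin d → X.presheaf.stalk q),
    ringKrullDim (X.presheaf.stalk q) = d ∧
    Ideal.span (Set.range x) = IsLocalRing.maximalIdeal (X.presheaf.stalk q) ∧
    ∀ I ∈ components, q ∈ I.support → ∃ j, stalkIdeal I q = Ideal.span {x j}

variable {K : Type u} [Field K] {X : Scheme.{u}}

/-- The local ring of the `K`-scheme `X` at `p`. -/
def LocalRing (_π : X ⟶ Spec (CommRingCat.of K)) (p : X) : Type u := X.presheaf.stalk p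

instance (π : X ⟶ Spec (CommRingCat.of K)) (p : X) : CommRing (LocalRing π p) :=
  inferInstanceAs (CommRing (X.presheaf.stalk p))

instance (π : X ⟶ Spec (CommRingCat.of K)) (p : X) : IsLocalRing (LocalRing π p) :=
  inferInstanceAs (IsLocalRing (X.presheaf.stalk p))

instance (π : X ⟶ Spec (CommRingCat.of K)) (p : X) : Algebra K (LocalRing π p) :=
  RingHom.toAlgebra (R := K) (S := X.presheaf.stalk p)
    ((X.presheaf.germ ⊤ p trivial).hom.comp
      ((π.appTop).hom.comp (Scheme.ΓSpecIso (CommRingCat.of K)).inv.hom))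

/-- The maximal ideal of the local ring at `p`. -/
def maxIdeal (π : X ⟶ Spec (CommRingCat.of K)) (p : X) : Ideal (LocalRing π p) :=
  IsLocalRing.maximalIdeal (LocalRing π p)

/-- The germ at `p` of a Rees algebra. -/
def RationalRees.germ (R : RationalRees X) (π : X ⟶ Spec (CommRingCat.of K)) (p : X) :
    Subalgebra (LocalRing π p) (TAlg (LocalRing π p)) :=
  Algebra.adjoin _ {F | ∃ q, ∃ f ∈ stalkIdeal (R.ideal q) p, F = mono (A := LocalRing π p) q f}

/-- The point `p` lies on the vertex `V(R) = V(∑_{a > 0} R_a)`. -/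
def RationalRees.MemVertex (R : RationalRees X) (p : X) : Prop :=
  ∀ a : ℚ≥0, 0 < a → p ∈ (R.ideal a).support

/-- The ideals in the local ring at `p` of the components through `p`. -/
def SNCDivisor.germs (E : SNCDivisor X) (π : X ⟶ Spec (CommRingCat.of K)) (p : X) :
    Set (Ideal (LocalRing π p)) :=
  {J | ∃ I ∈ E.components, p ∈ I.support ∧ J = stalkIdeal I p}

end Schemes

end

end WeightedCenters

/-!
The center of a presentation `x_1 t^(1/a_1), …, x_k t^(1/a_k)` is monomial: a homogeneous element
`f t^q` is integral over `A[x_i t^(1/a_i)]` if and only if `f` lies in the ideal `wIdeal L q`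
generated by the monomials in the `x_i` of weight at least `q`, where `x_i` has the weight `1 / a_i`
(`CoordSystem.intClosureIn_eq`, `IsPresentation.center_eq`). The upper bound holds since the leading
forms with respect to this filtration form a polynomial ring over a domain, by the quasi-regularity
of the parameters (`coeff_mem_of_aeval_mem`). Hence a center is admissible for `R` exactly if
`f ∈ wIdeal L q` for all `f t^q ∈ R`, and the rest is a study of these filtrations. In
characteristic `0`, membership in them is decided by derivatives: the Euler derivation
`∑ z_i ∂/∂z_i` multiplies the graded pieces of the filtration by powers of `(z_i)` by integers, which
replaces Taylor expansions in the completion (`CoordSystem.mem_filtration_of_diffOp_mem`).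

For a run of the procedure which ends with the coordinates `L`, three things are shown.

* The weights increase, as passing to the coefficient algebra makes the order of the restriction
  grow (`Reached.lt_order`, `StepData.order`).
* The center of `L` is admissible: going backwards through the run, the bound for the derivatives
  of the generators along a block, which belong to the next algebra, gives the bound for the
  generators themselves (`MillingRun.mem_of_terminated`).
* No other admissible presentation `L'` has a larger invariant, and one with the same invariant
  defines the same center: going forwards, the parameters of each block can be exchanged one by one
  for members of `L'` of the same symbol, without changing the filtration of `L'`, unless the
  invariant of `L'` is smaller (`StepData.exists_presentation`, `MillingRun.compare`). A free
  parameter lies in the cotangent ideal, hence is a combination of members of `L'` of weight at most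
  `a`; for a divisorial parameter, the component which it defines has to occur in `L'`, because the
  corresponding derivative of the cotangent ideal is the unit ideal.

A maximal contact exists after an enlargement of the generators which makes the cotangent ideal
independent of the coordinates; its free members are found greedily, by replacing coordinates with
elements of the cotangent ideal (`CoordSystem.exists_contact`, `Reached.exists_step`). Each step
enlarges the ideal of the blocks, so that the procedure terminates by the Noetherian property.
For nestedness, the generators are changed by the Euler derivation into functions which are constant
along the blocks up to a high order (`CoordSystem.flatten`); the splitting of the completed local
ring whose image consists of the functions that are constant along the blocks then changes the
generators only by elements of the part of the blocks (`CoordSystem.exists_splitting`,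
`FlatGens.isNested`, `StepData.exists_flatGens`).

All this takes place over a Noetherian local `K`-algebra with coordinates compatible with the
divisor. For the local ring of a smooth scheme, a regular system of parameters extends to
coordinates, since the residue field is formally smooth over `K` (`exists_coordSystem`).
-/

set_option linter.unusedSectionVars false

namespace WeightedCenters

/-! ### Homogeneous subalgebras of `A[t^ℚ≥0]` -/

section GradedSubalgebras

variable {A : Type u} [CommRing A]

/-- A family of ideals `J q`, `q ∈ ℚ≥0`, such that `⨁ J q t^q` is a subalgebra. -/
structure IsMulFamily (J : ℚ≥0 → Ideal A) : Prop where
  zero : J 0 = ⊤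
  mul_le : ∀ q r, J q * J r ≤ J (q + r)

/-- The subalgebra `⨁ J q t^q`. -/
def filtAlg (J : ℚ≥0 → Ideal A) (hJ : IsMulFamily J) : Subalgebra A (TAlg A) where
  carrier := {F | ∀ q, F.coeff q ∈ J q}
  mul_mem' := by
    classical
    intro F G hF hG q
    rw [AddMonoidAlgebra.coeff_mul]
    refine Ideal.sum_mem _ fun a _ => Ideal.sum_mem _ fun b _ => ?_
    dsimp only
    split_ifs with h
    · exact h ▸ hJ.mul_le a b (Ideal.mul_mem_mul (hF a) (hG b))
    · exact Ideal.zero_mem _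
  add_mem' := by
    intro F G hF hG q
    exact Ideal.add_mem _ (hF q) (hG q)
  algebraMap_mem' := by
    classical
    intro a q
    rw [AddMonoidAlgebra.coe_algebraMap]
    simp only [Function.comp_apply, Algebra.algebraMap_self, RingHom.id_apply]
    rw [AddMonoidAlgebra.coeff_single, Finsupp.single_apply]
    split_ifs with h
    · rw [← h, hJ.zero]; trivial
    · exact Ideal.zero_mem _

theorem forall_coeff_mono_mem {J : ℚ≥0 → Ideal A} {q : ℚ≥0} {f : A} :
    (∀ r, (mono q f).coeff r ∈ J r) ↔ f ∈ J q := by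
  classical
  constructor
  · intro h
    simpa [AddMonoidAlgebra.coeff_single, Finsupp.single_apply] using h q
  · intro h r
    rw [AddMonoidAlgebra.coeff_single, Finsupp.single_apply]
    split_ifs with h'
    · exact h' ▸ h
    · exact Ideal.zero_mem _

theorem mono_mem_filtAlg {J : ℚ≥0 → Ideal A} {hJ : IsMulFamily J} {q : ℚ≥0} {f : A} :
    mono q f ∈ filtAlg J hJ ↔ f ∈ J q := forall_coeff_mono_mem

theorem mono_mul_mono (q r : ℚ≥0) (f g : A) : mono q f * mono r g = mono (q + r) (f * g) :=
  AddMonoidAlgebra.single_mul_single ..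

theorem mono_pow (q : ℚ≥0) (f : A) (n : ℕ) : mono q f ^ n = mono (n * q) (f ^ n) := by
  rw [AddMonoidAlgebra.single_pow, nsmul_eq_mul]

theorem mono_add (q : ℚ≥0) (f g : A) : mono q (f + g) = mono q f + mono q g :=
  AddMonoidAlgebra.single_add ..

theorem smul_mono (a : A) (q : ℚ≥0) (f : A) : a • mono q f = mono q (a * f) := by
  rw [AddMonoidAlgebra.smul_single, smul_eq_mul]

theorem algebraMap_eq_mono (a : A) : algebraMap A (TAlg A) a = mono 0 a := by
  rw [AddMonoidAlgebra.coe_algebraMap]; rfl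

theorem mono_zero_mem (S : Subalgebra A (TAlg A)) (a : A) : mono 0 a ∈ S := by
  rw [← algebraMap_eq_mono]; exact S.algebraMap_mem a

theorem sum_mono (F : TAlg A) : F.coeff.sum (fun q f => mono q f) = F :=
  AddMonoidAlgebra.sum_coeff_single F

/-- The ideal `{f | f t^q ∈ S}`. -/
def degIdeal (S : Subalgebra A (TAlg A)) (q : ℚ≥0) : Ideal A where
  carrier := {f | mono q f ∈ S}
  add_mem' := by
    intro f g hf hg
    simp only [Set.mem_ofPred_eq, mono_add] at *
    exact S.add_mem hf hg
  zero_mem' := by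
    simp only [Set.mem_ofPred_eq, AddMonoidAlgebra.single_zero]
    exact S.zero_mem
  smul_mem' := by
    intro a f hf
    simp only [Set.mem_ofPred_eq, smul_eq_mul, ← smul_mono] at *
    exact S.smul_mem hf a

theorem mem_degIdeal {S : Subalgebra A (TAlg A)} {q : ℚ≥0} {f : A} :
    f ∈ degIdeal S q ↔ mono q f ∈ S := Iff.rfl

theorem isMulFamily_degIdeal (S : Subalgebra A (TAlg A)) : IsMulFamily (degIdeal S) where
  zero := by
    rw [Ideal.eq_top_iff_one]
    exact mono_zero_mem S 1
  mul_le q r := by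
    rw [Ideal.mul_le]
    intro f hf g hg
    rw [mem_degIdeal, ← mono_mul_mono]
    exact S.mul_mem hf hg

/-- `S` is a homogeneous subalgebra. -/
def IsHomog (S : Subalgebra A (TAlg A)) : Prop := ∀ F ∈ S, ∀ q, mono q (F.coeff q) ∈ S

theorem isHomog_filtAlg {J : ℚ≥0 → Ideal A} (hJ : IsMulFamily J) : IsHomog (filtAlg J hJ) :=
  fun _ hF q => mono_mem_filtAlg.2 (hF q)

theorem isHomog_adjoin {s : Set (TAlg A)} (hs : ∀ F ∈ s, ∃ q f, F = mono q f) :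
    IsHomog (Algebra.adjoin A s) := by
  have : Algebra.adjoin A s ≤ filtAlg _ (isMulFamily_degIdeal (Algebra.adjoin A s)) := by
    refine Algebra.adjoin_le fun F hF => ?_
    obtain ⟨q, f, rfl⟩ := hs F hF
    exact mono_mem_filtAlg.2 (Algebra.subset_adjoin hF)
  exact fun F hF q => this hF q

theorem IsHomog.inf {S S' : Subalgebra A (TAlg A)} (h : IsHomog S) (h' : IsHomog S') :
    IsHomog (S ⊓ S') := fun F hF q => ⟨h F hF.1 q, h' F hF.2 q⟩

theorem IsHomog.sup {S S' : Subalgebra A (TAlg A)} (h : IsHomog S) (h' : IsHomog S') :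
    IsHomog (S ⊔ S') := by
  have : S ⊔ S' ≤ filtAlg _ (isMulFamily_degIdeal (S ⊔ S')) :=
    sup_le (fun F hF q => (le_sup_left : S ≤ S ⊔ S') (h F hF q))
      (fun F hF q => (le_sup_right : S' ≤ S ⊔ S') (h' F hF q))
  exact fun F hF q => this hF q

theorem IsHomog.le_iff {S S' : Subalgebra A (TAlg A)} (h : IsHomog S) :
    S ≤ S' ↔ ∀ q f, mono q f ∈ S → mono q f ∈ S' := by
  refine ⟨fun hle q f hf => hle hf, fun hle F hF => ?_⟩
  rw [← sum_mono F]
  exact S'.sum_mem fun q _ => hle _ _ (h F hF q)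

theorem IsHomog.le_filtAlg_iff {S : Subalgebra A (TAlg A)} (h : IsHomog S)
    {J : ℚ≥0 → Ideal A} (hJ : IsMulFamily J) :
    S ≤ filtAlg J hJ ↔ ∀ q f, mono q f ∈ S → f ∈ J q := by
  rw [h.le_iff]
  simp only [mono_mem_filtAlg]

theorem adjoin_mono_le_filtAlg {ι : Type*} {f : ι → A} {b : ι → ℚ≥0} {J : ℚ≥0 → Ideal A}
    {hJ : IsMulFamily J} (h : ∀ j, f j ∈ J (b j)) :
    Algebra.adjoin A (Set.range fun j => mono (b j) (f j)) ≤ filtAlg J hJ := by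
  refine Algebra.adjoin_le ?_
  rintro _ ⟨j, rfl⟩
  exact mono_mem_filtAlg.2 (h j)

theorem IsMulFamily.map {B : Type u} [CommRing B] (φ : A →+* B) {J : ℚ≥0 → Ideal A}
    (hJ : IsMulFamily J) : IsMulFamily fun q => (J q).map φ where
  zero := by simp only [hJ.zero, Ideal.map_top]
  mul_le q r := by
    rw [← Ideal.map_mul]
    exact Ideal.map_mono (hJ.mul_le q r)

theorem IsMulFamily.comap {B : Type u} [CommRing B] (φ : A →+* B) {J : ℚ≥0 → Ideal B}
    (hJ : IsMulFamily J) : IsMulFamily fun q => (J q).comap φ where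
  zero := by simp only [hJ.zero, Ideal.comap_top]
  mul_le q r := by
    rw [Ideal.mul_le]
    intro f hf g hg
    rw [Ideal.mem_comap, map_mul]
    exact hJ.mul_le q r (Ideal.mul_mem_mul hf hg)

section Extend

variable {B : Type u} [CommRing B] (φ : A →+* B)

theorem mapRingHom_mono (q : ℚ≥0) (f : A) :
    AddMonoidAlgebra.mapRingHom ℚ≥0 φ (mono q f) = mono q (φ f) :=
  AddMonoidAlgebra.mapRingHom_single ..

theorem mono_mem_extend {S : Subalgebra A (TAlg A)} {q : ℚ≥0} {f : A} (h : mono q f ∈ S) :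
    mono q (φ f) ∈ extend φ S := by
  rw [← mapRingHom_mono]
  exact Algebra.subset_adjoin ⟨_, h, rfl⟩

theorem extend_le_iff {S : Subalgebra A (TAlg A)} (hS : IsHomog S) {S' : Subalgebra B (TAlg B)} :
    extend φ S ≤ S' ↔ ∀ q f, mono q f ∈ S → mono q (φ f) ∈ S' := by
  refine ⟨fun h q f hf => h (mono_mem_extend φ hf), fun h => Algebra.adjoin_le ?_⟩
  rintro _ ⟨F, hF, rfl⟩
  rw [← sum_mono F, Finsupp.sum, map_sum]
  refine S'.sum_mem fun q _ => ?_
  rw [mapRingHom_mono]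
  exact h _ _ (hS F hF q)

theorem extend_mono {S S' : Subalgebra A (TAlg A)} (h : S ≤ S') : extend φ S ≤ extend φ S' :=
  Algebra.adjoin_mono (Set.image_mono h)

theorem extend_sup {S S' : Subalgebra A (TAlg A)} (hS : IsHomog S) (hS' : IsHomog S') :
    extend φ (S ⊔ S') = extend φ S ⊔ extend φ S' := by
  apply le_antisymm
  · have h : S ⊔ S' ≤ filtAlg _ ((isMulFamily_degIdeal (extend φ S ⊔ extend φ S')).comap φ) := by
      refine sup_le ?_ ?_
      · rw [hS.le_filtAlg_iff]
        exact fun q f hf => (le_sup_left : extend φ S ≤ _) (mono_mem_extend φ hf)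
      · rw [hS'.le_filtAlg_iff]
        exact fun q f hf => (le_sup_right : extend φ S' ≤ _) (mono_mem_extend φ hf)
    rw [extend_le_iff φ (hS.sup hS')]
    rw [(hS.sup hS').le_filtAlg_iff] at h
    exact h
  · exact sup_le (extend_mono φ le_sup_left) (extend_mono φ le_sup_right)

theorem extend_adjoin {ι : Type*} (f : ι → A) (b : ι → ℚ≥0) :
    extend φ (Algebra.adjoin A (Set.range fun j => mono (b j) (f j))) =
      Algebra.adjoin B (Set.range fun j => mono (b j) (φ (f j))) := by
  have hS : IsHomog (Algebra.adjoin A (Set.range fun j => mono (b j) (f j))) :=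
    isHomog_adjoin (by rintro _ ⟨j, rfl⟩; exact ⟨_, _, rfl⟩)
  apply le_antisymm
  · have h : Algebra.adjoin A (Set.range fun j => mono (b j) (f j)) ≤ filtAlg _
      ((isMulFamily_degIdeal (Algebra.adjoin B
        (Set.range fun j => mono (b j) (φ (f j))))).comap φ) :=
      adjoin_mono_le_filtAlg fun j => Algebra.subset_adjoin ⟨j, rfl⟩
    rw [extend_le_iff φ hS]
    rw [hS.le_filtAlg_iff] at h
    exact h
  · refine Algebra.adjoin_le ?_
    rintro _ ⟨j, rfl⟩
    exact mono_mem_extend φ (Algebra.subset_adjoin ⟨j, rfl⟩)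

/-- Membership in a filtration passes to the restriction. -/
theorem mem_map_of_mono_mem_extend {S : Subalgebra A (TAlg A)} (hS : IsHomog S)
    {J : ℚ≥0 → Ideal A} (hJ : IsMulFamily J) (h : ∀ q f, mono q f ∈ S → f ∈ J q)
    {q : ℚ≥0} {g : B} (hg : mono q g ∈ extend φ S) : g ∈ (J q).map φ := by
  have : extend φ S ≤ filtAlg _ (hJ.map φ) := by
    rw [extend_le_iff φ hS]
    exact fun q f hf => mono_mem_filtAlg.2 (Ideal.mem_map_of_mem φ (h q f hf))
  exact mono_mem_filtAlg.1 (this hg)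

end Extend

open Classical in
/-- The family of ideals which defines `supportedIn A G`. -/
noncomputable def supportFamily (A : Type u) [CommRing A] (G : AddSubgroup ℚ) (q : ℚ≥0) : Ideal A :=
  if (q : ℚ) ∈ G then ⊤ else ⊥

theorem isMulFamily_supportFamily (G : AddSubgroup ℚ) : IsMulFamily (supportFamily A G) where
  zero := by simp [supportFamily, G.zero_mem]
  mul_le q r := by
    unfold supportFamily
    by_cases hq : (q : ℚ) ∈ G
    · by_cases hr : (r : ℚ) ∈ G
      · have : ((q + r : ℚ≥0) : ℚ) ∈ G := by push_cast; exact G.add_mem hq hr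
        rw [if_pos this]; exact le_top
      · simp [hr]
    · simp [hq]

theorem supportedIn_eq (G : AddSubgroup ℚ) :
    supportedIn A G = filtAlg _ (isMulFamily_supportFamily G) := by
  apply le_antisymm
  · refine Algebra.adjoin_le ?_
    rintro _ ⟨q, hq, rfl⟩
    refine mono_mem_filtAlg.2 ?_
    simp [supportFamily, hq]
  · rw [(isHomog_filtAlg _).le_iff]
    intro q f hf
    rw [mono_mem_filtAlg, supportFamily] at hf
    split_ifs at hf with hq
    · have : mono q f = f • mono q (1 : A) := by rw [smul_mono, mul_one]
      rw [this]
      have h1 : mono q (1 : A) ∈ supportedIn A G := Algebra.subset_adjoin ⟨q, hq, rfl⟩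
      exact Subalgebra.smul_mem _ h1 _
    · rw [(Submodule.mem_bot A).1 hf, mono, AddMonoidAlgebra.single_zero]
      exact Subalgebra.zero_mem _

theorem mono_mem_supportedIn {G : AddSubgroup ℚ} {q : ℚ≥0} {f : A} :
    mono q f ∈ supportedIn A G ↔ (f ≠ 0 → (q : ℚ) ∈ G) := by
  rw [supportedIn_eq, mono_mem_filtAlg, supportFamily]
  split_ifs with h
  · simp [h]
  · simp only [Submodule.mem_bot, h]
    tauto

theorem isHomog_supportedIn (G : AddSubgroup ℚ) : IsHomog (supportedIn A G) := by
  rw [supportedIn_eq]; exact isHomog_filtAlg _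

theorem supportedIn_mono {G G' : AddSubgroup ℚ} (h : G ≤ G') :
    supportedIn A G ≤ supportedIn A G' := by
  rw [(isHomog_supportedIn G).le_iff]
  intro q f
  rw [mono_mem_supportedIn, mono_mem_supportedIn]
  exact fun h1 h2 => h (h1 h2)

theorem degreeGroup_le_iff {S : Subalgebra A (TAlg A)} (hS : IsHomog S) {G : AddSubgroup ℚ} :
    degreeGroup S ≤ G ↔ S ≤ supportedIn A G := by
  rw [hS.le_iff, degreeGroup, AddSubgroup.closure_le]
  simp only [mono_mem_supportedIn]
  constructor
  · intro h q f hf hf0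
    exact h ⟨q, rfl, f, hf0, hf⟩
  · rintro h _ ⟨q, rfl, f, hf0, hf⟩
    exact h q f hf hf0

theorem le_supportedIn {S : Subalgebra A (TAlg A)} (hS : IsHomog S) :
    S ≤ supportedIn A (degreeGroup S) := (degreeGroup_le_iff hS).1 le_rfl

theorem degreeGroup_mono {S S' : Subalgebra A (TAlg A)} (h : S ≤ S') :
    degreeGroup S ≤ degreeGroup S' :=
  AddSubgroup.closure_mono fun _ ⟨r, hr, f, hf, hS⟩ => ⟨r, hr, f, hf, h hS⟩

end GradedSubalgebras

/-! ### Monomial filtrations -/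

/-- A decreasing multiplicative filtration by ideals, indexed by the rational numbers. -/
structure IsFiltration {A : Type u} [CommRing A] (J : ℚ → Ideal A) : Prop where
  antitone : Antitone J
  zero : J 0 = ⊤
  mul_le : ∀ q r, J q * J r ≤ J (q + r)

section Filtrations

variable {A : Type u} [CommRing A]

theorem IsFiltration.eq_top {J : ℚ → Ideal A} (hJ : IsFiltration J) {q : ℚ} (hq : q ≤ 0) :
    J q = ⊤ := top_unique (hJ.zero ▸ hJ.antitone hq)

theorem IsFiltration.isMulFamily {J : ℚ → Ideal A} (hJ : IsFiltration J) :
    IsMulFamily fun q : ℚ≥0 => J q where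
  zero := by simpa using hJ.zero
  mul_le q r := by simpa using hJ.mul_le q r

theorem IsFiltration.mul_mem {J : ℚ → Ideal A} (hJ : IsFiltration J) {q r s : ℚ} {f g : A}
    (hf : f ∈ J q) (hg : g ∈ J r) (h : s ≤ q + r) : f * g ∈ J s :=
  hJ.antitone h (hJ.mul_le q r (Ideal.mul_mem_mul hf hg))

theorem IsFiltration.sup_const {J : ℚ → Ideal A} (hJ : IsFiltration J) (P : Ideal A) :
    IsFiltration fun q => J q ⊔ P where
  antitone q r h := sup_le_sup_right (hJ.antitone h) _
  zero := by simp [hJ.zero]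
  mul_le q r := by
    rw [Ideal.mul_sup, Ideal.sup_mul]
    exact sup_le (sup_le (le_sup_of_le_left (hJ.mul_le q r)) (le_sup_of_le_right Ideal.mul_le_left))
      (le_sup_of_le_right Ideal.mul_le_right)

theorem IsFiltration.pow_mem {J : ℚ → Ideal A} (hJ : IsFiltration J) {w : ℚ} {P : Ideal A}
    (hP : P ≤ J w) (l : ℕ) : P ^ l ≤ J (l * w) := by
  induction l with
  | zero => simp [hJ.zero]
  | succ l ih =>
    rw [pow_succ]
    refine (Ideal.mul_mono ih hP).trans ((hJ.mul_le _ _).trans (hJ.antitone ?_))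
    push_cast; linarith

/-- The ideal generated by the products of members of `L` of total weight at least `q`, where
`(x, a) ∈ L` has the weight `1 / a`; it is the degree `q` part of the center defined by `L`. -/
def wIdeal (L : List (A × ℚ≥0)) (q : ℚ) : Ideal A :=
  Ideal.span {m | ∃ M : Multiset (A × ℚ≥0), (∀ y ∈ M, y ∈ L) ∧
    q ≤ (M.map fun y => 1 / (y.2 : ℚ)).sum ∧ m = (M.map Prod.fst).prod}

theorem isFiltration_wIdeal (L : List (A × ℚ≥0)) : IsFiltration (wIdeal L) where
  antitone q r h := Ideal.span_mono fun _ ⟨M, h1, h2, h3⟩ => ⟨M, h1, h.trans h2, h3⟩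
  zero := by
    rw [Ideal.eq_top_iff_one]
    exact Ideal.subset_span ⟨0, by simp, by simp, by simp⟩
  mul_le q r := by
    rw [wIdeal, wIdeal, Ideal.span_mul_span', Ideal.span_le]
    rintro _ ⟨_, ⟨M, h1, h2, rfl⟩, _, ⟨M', h1', h2', rfl⟩, rfl⟩
    refine Ideal.subset_span ⟨M + M', ?_, ?_, ?_⟩
    · intro y hy
      rcases Multiset.mem_add.1 hy with hy | hy
      exacts [h1 y hy, h1' y hy]
    · rw [Multiset.map_add, Multiset.sum_add]; exact add_le_add h2 h2'
    · simp

theorem mem_wIdeal {L : List (A × ℚ≥0)} {y : A × ℚ≥0} (hy : y ∈ L) {q : ℚ} (hq : q ≤ 1 / y.2) :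
    y.1 ∈ wIdeal L q :=
  Ideal.subset_span ⟨{y}, by simpa using hy, by simpa using hq, by simp⟩

theorem wIdeal_multiset_prod_mem {J : ℚ → Ideal A} (hJ : IsFiltration J) (M : Multiset (A × ℚ≥0))
    (h : ∀ y ∈ M, y.1 ∈ J (1 / y.2)) :
    (M.map Prod.fst).prod ∈ J (M.map fun y => 1 / (y.2 : ℚ)).sum := by
  induction M using Multiset.induction_on with
  | empty => simp [hJ.zero]
  | cons y M ih =>
    rw [Multiset.map_cons, Multiset.map_cons, Multiset.sum_cons, Multiset.prod_cons]
    exact hJ.mul_mem (h y (by simp)) (ih fun z hz => h z (by simp [hz])) le_rfl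

/-- The monomial filtration is the smallest filtration in which the members of `L` have at least
their weights. -/
theorem wIdeal_le {L : List (A × ℚ≥0)} {J : ℚ → Ideal A} (hJ : IsFiltration J)
    (h : ∀ y ∈ L, y.1 ∈ J (1 / y.2)) (q : ℚ) : wIdeal L q ≤ J q := by
  rw [wIdeal, Ideal.span_le]
  rintro _ ⟨M, h1, h2, rfl⟩
  exact hJ.antitone h2 (wIdeal_multiset_prod_mem hJ M fun y hy => h y (h1 y hy))

theorem wIdeal_mono {L L' : List (A × ℚ≥0)} (h : ∀ y ∈ L, y ∈ L') (q : ℚ) :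
    wIdeal L q ≤ wIdeal L' q :=
  wIdeal_le (isFiltration_wIdeal L') (fun y hy => mem_wIdeal (h y hy) le_rfl) q

/-- For `q > 0` a product of weight at least `q` contains a member of `L`. -/
theorem wIdeal_le_span {L : List (A × ℚ≥0)} {q : ℚ} (hq : 0 < q) :
    wIdeal L q ≤ Ideal.span {x | ∃ y ∈ L, y.1 = x} := by
  rw [wIdeal, Ideal.span_le]
  rintro _ ⟨M, h1, h2, rfl⟩
  induction M using Multiset.induction_on with
  | empty => simp at h2; linarith
  | cons y M ih =>
    rw [Multiset.map_cons, Multiset.prod_cons]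
    exact Ideal.mul_mem_right _ _ (Ideal.subset_span ⟨y, h1 y (by simp), rfl⟩)

/-- A product either contains the member `y`, or is a product of the other members. -/
theorem wIdeal_le_span_sup {L L' : List (A × ℚ≥0)} {y : A × ℚ≥0}
    (h : ∀ z ∈ L, z = y ∨ z ∈ L') (q : ℚ) :
    wIdeal L q ≤ Ideal.span {y.1} ⊔ wIdeal L' q := by
  rw [wIdeal, Ideal.span_le]
  rintro _ ⟨M, h1, h2, rfl⟩
  by_cases hy : y ∈ M
  · obtain ⟨M', rfl⟩ := Multiset.exists_cons_of_mem hy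
    rw [Multiset.map_cons, Multiset.prod_cons]
    exact Ideal.mem_sup_left (Ideal.mul_mem_right _ _ (Ideal.subset_span rfl))
  · refine Ideal.mem_sup_right (Ideal.subset_span ⟨M, fun z hz => ?_, h2, rfl⟩)
    rcases h z (h1 z hz) with rfl | h
    exacts [absurd hz hy, h]

/-- A product of positive weight at least `q` is a member of weight at least `q`, or has at least
two factors. -/
theorem wIdeal_le_span_sup_sq {L : List (A × ℚ≥0)} {𝔪 : Ideal A} (hL : ∀ y ∈ L, y.1 ∈ 𝔪) {q : ℚ}
    (hq : 0 < q) :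
    wIdeal L q ≤ Ideal.span {x | ∃ y ∈ L, q ≤ 1 / y.2 ∧ y.1 = x} ⊔ 𝔪 ^ 2 := by
  rw [wIdeal, Ideal.span_le]
  rintro _ ⟨M, h1, h2, rfl⟩
  induction M using Multiset.induction_on with
  | empty => simp at h2; linarith
  | cons y M _ =>
    induction M using Multiset.induction_on with
    | empty =>
      refine Ideal.mem_sup_left (Ideal.subset_span ⟨y, h1 y (by simp), ?_, by simp⟩)
      simpa using h2
    | cons z M _ =>
      refine Ideal.mem_sup_right ?_
      rw [Multiset.map_cons, Multiset.prod_cons, Multiset.map_cons, Multiset.prod_cons, ← mul_assoc]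
      refine Ideal.mul_mem_right _ _ ?_
      rw [pow_two]
      exact Ideal.mul_mem_mul (hL y (h1 y (by simp))) (hL z (h1 z (by simp)))

/-- A derivation which lowers the weights of the members of `L` by at most `c` lowers the
filtration by at most `c`. -/
theorem derivation_wIdeal {K : Type u} [Field K] [Algebra K A] {L : List (A × ℚ≥0)}
    (δ : Derivation K A A) {c : ℚ} (hc : 0 ≤ c) (h : ∀ y ∈ L, δ y.1 ∈ wIdeal L (1 / y.2 - c))
    {q : ℚ} {f : A} (hf : f ∈ wIdeal L q) : δ f ∈ wIdeal L (q - c) := by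
  have hJ := isFiltration_wIdeal L
  have key : ∀ M : Multiset (A × ℚ≥0), (∀ y ∈ M, y ∈ L) →
      δ (M.map Prod.fst).prod ∈ wIdeal L ((M.map fun y => 1 / (y.2 : ℚ)).sum - c) := by
    intro M
    induction M using Multiset.induction_on with
    | empty => intro _; simp
    | cons y M ih =>
      intro hM
      rw [Multiset.map_cons, Multiset.map_cons, Multiset.sum_cons, Multiset.prod_cons,
        Derivation.leibniz, smul_eq_mul, smul_eq_mul]
      refine Ideal.add_mem _ ?_ ?_
      · exact hJ.mul_mem (mem_wIdeal (hM y (by simp)) le_rfl)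
          (ih fun z hz => hM z (by simp [hz])) (by linarith)
      · exact hJ.mul_mem (wIdeal_multiset_prod_mem hJ M
          fun z hz => mem_wIdeal (hM z (by simp [hz])) le_rfl) (h y (hM y (by simp)))
          (by linarith)
  refine Submodule.span_induction ?_ ?_ ?_ ?_ hf
  · rintro _ ⟨M, h1, h2, rfl⟩
    exact hJ.antitone (by linarith) (key M h1)
  · simp
  · intro x y _ _ hx hy
    rw [map_add]; exact Ideal.add_mem _ hx hy
  · intro a x hx hx'
    rw [smul_eq_mul, Derivation.leibniz, smul_eq_mul, smul_eq_mul]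
    refine Ideal.add_mem _ (Ideal.mul_mem_left _ _ hx') (Ideal.mul_mem_right _ _ ?_)
    exact hJ.antitone (by linarith) hx

/-- A derivation lowers the filtration by at most the largest weight. -/
theorem derivation_wIdeal_of_le {K : Type u} [Field K] [Algebra K A] {L : List (A × ℚ≥0)}
    (δ : Derivation K A A) {c : ℚ} (hc : 0 ≤ c) (h : ∀ y ∈ L, δ y.1 = 0 ∨ 1 / (y.2 : ℚ) ≤ c)
    {q : ℚ} {f : A} (hf : f ∈ wIdeal L q) : δ f ∈ wIdeal L (q - c) := by
  refine derivation_wIdeal δ hc (fun y hy => ?_) hf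
  rcases h y hy with h | h
  · rw [h]; exact Ideal.zero_mem _
  · rw [(isFiltration_wIdeal L).eq_top (by linarith)]; trivial

theorem map_wIdeal_le {B : Type u} [CommRing B] (φ : A →+* B) (L : List (A × ℚ≥0)) (q : ℚ) :
    (wIdeal L q).map φ ≤ wIdeal (L.map fun y => (φ y.1, y.2)) q := by
  rw [wIdeal, Ideal.map_span, Ideal.span_le]
  rintro _ ⟨_, ⟨M, h1, h2, rfl⟩, rfl⟩
  refine Ideal.subset_span ⟨M.map fun y => (φ y.1, y.2), ?_, ?_, ?_⟩
  · intro z hz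
    obtain ⟨y, hy, rfl⟩ := Multiset.mem_map.1 hz
    exact List.mem_map.2 ⟨y, h1 y hy, rfl⟩
  · simpa using h2
  · rw [map_multiset_prod]; simp

theorem wIdeal_map_le {B : Type u} [CommRing B] (φ : A →+* B) (L : List (A × ℚ≥0)) (q : ℚ) :
    wIdeal (L.map fun y => (φ y.1, y.2)) q ≤ (wIdeal L q).map φ := by
  have hJ : IsFiltration fun q => (wIdeal L q).map φ :=
    { antitone := fun q r h => Ideal.map_mono ((isFiltration_wIdeal L).antitone h)
      zero := by simp only [(isFiltration_wIdeal L).zero, Ideal.map_top]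
      mul_le := fun q r => by
        rw [← Ideal.map_mul]; exact Ideal.map_mono ((isFiltration_wIdeal L).mul_le q r) }
  refine wIdeal_le hJ (fun y hy => ?_) q
  obtain ⟨z, hz, rfl⟩ := List.mem_map.1 hy
  exact Ideal.mem_map_of_mem φ (mem_wIdeal hz le_rfl)

end Filtrations

/-! ### Derivations in a coordinate system -/

section Coordinates

variable {K : Type u} [Field K] {A : Type u} [CommRing A] [Algebra K A] {𝔪 : Ideal A} {n : ℕ}

/-- The multi-index `α + e_i`. -/
def incr (α : Fin n → ℕ) (i : Fin n) : Fin n → ℕ := α + Pi.single i 1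

theorem incr_self (α : Fin n → ℕ) (i : Fin n) : incr α i i = α i + 1 := by
  simp [incr]

theorem incr_of_ne (α : Fin n → ℕ) {i k : Fin n} (h : k ≠ i) : incr α i k = α k := by
  simp [incr, h]

theorem sum_incr (α : Fin n → ℕ) (i : Fin n) :
    ∑ k, incr α i k = ∑ k, α k + 1 := by
  classical
  simp [incr, Finset.sum_add_distrib, Pi.single_apply]

/-- Induction on multi-indices. -/
theorem multiIndex_induction {p : (Fin n → ℕ) → Prop} (h0 : p 0)
    (hs : ∀ (α : Fin n → ℕ) i, p α → p (incr α i)) (α : Fin n → ℕ) : p α := by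
  classical
  obtain ⟨N, hN⟩ : ∃ N, ∑ k, α k = N := ⟨_, rfl⟩
  induction N generalizing α with
  | zero =>
    have : α = 0 := by
      funext k
      exact (Finset.sum_eq_zero_iff.1 hN) k (Finset.mem_univ k)
    exact this ▸ h0
  | succ N ih =>
    obtain ⟨i, hi⟩ : ∃ i, α i ≠ 0 := by
      by_contra! h
      simp [h] at hN
    have hα : α = incr (α - Pi.single i 1) i := by
      funext k
      by_cases hk : k = i
      · subst hk; rw [incr_self]; simp; omega
      · rw [incr_of_ne _ hk]; simp [hk]
    rw [hα] at hN ⊢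
    rw [sum_incr] at hN
    exact hs _ _ (ih _ (by omega))

namespace CoordSystem

variable (c : CoordSystem K A 𝔪 n)

theorem derivation_ext {δ δ' : Derivation K A A} (h : ∀ i, δ (c.z i) = δ' (c.z i)) : δ = δ' := by
  have : δ.liftKaehlerDifferential = δ'.liftKaehlerDifferential := by
    refine LinearMap.ext_on c.span_diff ?_
    rintro _ ⟨i, rfl⟩
    simp only [Derivation.liftKaehlerDifferential_comp_D, h]
  ext f
  rw [← Derivation.liftKaehlerDifferential_comp_D δ, this,
    Derivation.liftKaehlerDifferential_comp_D]

/-- The chain rule `δ = ∑ δ(z_i) ∂/∂z_i`. -/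
theorem derivation_eq (δ : Derivation K A A) : δ = ∑ i, δ (c.z i) • c.der i := by
  classical
  refine c.derivation_ext fun j => ?_
  rw [← Derivation.coeFnAddMonoidHom_apply (∑ i, δ (c.z i) • c.der i), map_sum, Finset.sum_apply]
  simp [c.der_apply]

theorem derivation_apply (δ : Derivation K A A) (f : A) :
    δ f = ∑ i, δ (c.z i) * c.der i f := by
  conv_lhs => rw [c.derivation_eq δ]
  rw [← Derivation.coeFnAddMonoidHom_apply, map_sum, Finset.sum_apply]
  simp

theorem der_comm (i j : Fin n) (f : A) : c.der i (c.der j f) = c.der j (c.der i f) := by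
  have : ⁅c.der i, c.der j⁆ = 0 := by
    refine c.derivation_ext fun k => ?_
    rw [Derivation.commutator_apply, c.der_apply, c.der_apply]
    split_ifs <;> simp
  have h := congrArg (fun δ : Derivation K A A => δ f) this
  simpa [Derivation.commutator_apply, sub_eq_zero] using h

theorem z_injective [Nontrivial A] : Function.Injective c.z := by
  intro i j h
  by_contra hij
  have h1 := c.der_apply i j
  rw [← h, c.der_apply] at h1
  simp [hij] at h1

theorem iterate_der_comm (i j : Fin n) (m : ℕ) (f : A) :
    c.der i ((fun h => c.der j h)^[m] f) = (fun h => c.der j h)^[m] (c.der i f) := by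
  induction m generalizing f with
  | zero => rfl
  | succ m ih => rw [Function.iterate_succ_apply, ih, c.der_comm, Function.iterate_succ_apply]

theorem foldr_der_of_notMem {l : List (Fin n)} {i : Fin n} (hi : i ∉ l) (α : Fin n → ℕ) (f : A) :
    l.foldr (fun k g => (fun h => c.der k h)^[incr α i k] g) f =
      l.foldr (fun k g => (fun h => c.der k h)^[α k] g) f := by
  induction l with
  | nil => rfl
  | cons k l ih =>
    simp only [List.mem_cons, not_or] at hi
    rw [List.foldr_cons, List.foldr_cons, ih hi.2]
    have : incr α i k = α k := incr_of_ne _ (Ne.symm hi.1)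
    rw [this]

theorem foldr_der_of_mem {l : List (Fin n)} (hl : l.Nodup) {i : Fin n} (hi : i ∈ l)
    (α : Fin n → ℕ) (f : A) :
    l.foldr (fun k g => (fun h => c.der k h)^[incr α i k] g) f =
      c.der i (l.foldr (fun k g => (fun h => c.der k h)^[α k] g) f) := by
  induction l with
  | nil => simp at hi
  | cons k l ih =>
    rw [List.nodup_cons] at hl
    rw [List.foldr_cons, List.foldr_cons]
    by_cases hk : i = k
    · subst hk
      rw [c.foldr_der_of_notMem hl.1]
      have : incr α i i = α i + 1 := incr_self _ _
      rw [this, Function.iterate_succ_apply']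
    · have hi' : i ∈ l := by simpa [hk] using hi
      rw [ih hl.2 hi', c.iterate_der_comm]
      have : incr α i k = α k := incr_of_ne _ (Ne.symm hk)
      rw [this]

theorem diffOp_zero (f : A) : c.diffOp 0 f = f := by
  have : ∀ l : List (Fin n),
      l.foldr (fun k g => (fun h => c.der k h)^[(0 : Fin n → ℕ) k] g) f = f := by
    intro l
    induction l with
    | nil => rfl
    | cons k l ih => rw [List.foldr_cons, ih]; rfl
  rw [diffOp, this]; simp

theorem prod_factorial_incr (α : Fin n → ℕ) (i : Fin n) :
    (∏ k, (Nat.factorial (incr α i k) : K)) =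
      ((α i + 1 : ℕ) : K) * ∏ k, (Nat.factorial (α k) : K) := by
  classical
  rw [← Finset.mul_prod_erase _ _ (Finset.mem_univ i), ← Finset.mul_prod_erase _ _
      (Finset.mem_univ i)]
  have h1 : incr α i i = α i + 1 := incr_self _ _
  rw [h1, Nat.factorial_succ, Nat.cast_mul, mul_assoc]
  congr 2
  refine Finset.prod_congr rfl fun k hk => ?_
  have : incr α i k = α k := incr_of_ne _ (Finset.mem_erase.1 hk).1
  rw [this]

theorem diffOp_incr [CharZero K] (α : Fin n → ℕ) (i : Fin n) (f : A) :
    c.diffOp (incr α i) f = ((α i + 1 : ℕ) : K)⁻¹ • c.der i (c.diffOp α f) := by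
  rw [diffOp, diffOp, c.foldr_der_of_mem (List.nodup_finRange n) (List.mem_finRange i),
    prod_factorial_incr, mul_inv, mul_smul, Derivation.map_smul]

theorem der_diffOp [CharZero K] (α : Fin n → ℕ) (i : Fin n) (f : A) :
    c.der i (c.diffOp α f) = ((α i + 1 : ℕ) : K) • c.diffOp (incr α i) f := by
  have h : ((α i + 1 : ℕ) : K) ≠ 0 := by exact_mod_cast Nat.succ_ne_zero (α i)
  rw [diffOp_incr, smul_smul, mul_inv_cancel₀ h, one_smul]

theorem diffOp_der (α : Fin n → ℕ) (i : Fin n) (f : A) :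
    c.diffOp α (c.der i f) = c.der i (c.diffOp α f) := by
  rw [diffOp, diffOp, Derivation.map_smul]
  congr 1
  induction List.finRange n with
  | nil => rfl
  | cons k l ih => rw [List.foldr_cons, List.foldr_cons, ih, c.iterate_der_comm]

end CoordSystem

theorem algebra_smul_mem {I : Ideal A} (k : K) {f : A} (hf : f ∈ I) : k • f ∈ I := by
  rw [Algebra.smul_def]; exact Ideal.mul_mem_left _ _ hf

theorem natCast_mul_mem_iff [CharZero K] {I : Ideal A} {l : ℕ} (hl : l ≠ 0) {f : A}
    (hf : (l : A) * f ∈ I) : f ∈ I := by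
  have h := algebra_smul_mem (K := K) ((l : K)⁻¹) hf
  rw [← nsmul_eq_mul, ← Nat.cast_smul_eq_nsmul K l f, smul_smul, inv_mul_cancel₀, one_smul] at h
  · exact h
  · exact_mod_cast hl

/-! ### Derivations and powers of ideals -/

theorem derivation_pow_le (δ : Derivation K A A) {Q : Ideal A} (l : ℕ) {f : A}
    (hf : f ∈ Q ^ (l + 1)) : δ f ∈ Q ^ l := by
  induction l generalizing f with
  | zero => simp
  | succ l ih =>
    rw [pow_succ] at hf
    refine Submodule.mul_induction_on hf ?_ ?_
    · intro g hg h hh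
      rw [Derivation.leibniz, smul_eq_mul, smul_eq_mul]
      refine Ideal.add_mem _ (Ideal.mul_mem_right _ _ hg) ?_
      rw [pow_succ', ]
      exact Ideal.mul_mem_mul hh (ih hg)
    · intro x y hx hy
      rw [map_add]; exact Ideal.add_mem _ hx hy

theorem derivation_pow_sub (δ : Derivation K A A) {Q : Ideal A} (l : ℕ) {f : A}
    (hf : f ∈ Q ^ l) : δ f ∈ Q ^ (l - 1) := by
  rcases l with _ | l
  · simp
  · exact derivation_pow_le δ l hf

theorem derivation_pow_of_le (δ : Derivation K A A) {Q : Ideal A} (hδ : ∀ x ∈ Q, δ x ∈ Q) (l : ℕ)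
    {f : A} (hf : f ∈ Q ^ l) : δ f ∈ Q ^ l := by
  induction l generalizing f with
  | zero => simp
  | succ l ih =>
    rw [pow_succ] at hf ⊢
    refine Submodule.mul_induction_on hf ?_ ?_
    · intro g hg h hh
      rw [Derivation.leibniz, smul_eq_mul, smul_eq_mul, mul_comm h]
      exact Ideal.add_mem _ (Ideal.mul_mem_mul hg (hδ h hh)) (Ideal.mul_mem_mul (ih hg) hh)
    · intro x y hx hy
      rw [map_add]; exact Ideal.add_mem _ hx hy

theorem derivation_span_le (δ : Derivation K A A) {s : Set A} {I : Ideal A}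
    (hsI : Ideal.span s ≤ I) (h : ∀ x ∈ s, δ x ∈ I) {f : A} (hf : f ∈ Ideal.span s) : δ f ∈ I := by
  refine Submodule.span_induction h ?_ ?_ ?_ hf
  · simp
  · intro x y _ _ hx hy
    rw [map_add]; exact Ideal.add_mem _ hx hy
  · intro a x hx hx'
    rw [smul_eq_mul, Derivation.leibniz, smul_eq_mul, smul_eq_mul]
    exact Ideal.add_mem _ (Ideal.mul_mem_left _ _ hx') (Ideal.mul_mem_right _ _ (hsI hx))

namespace CoordSystem

variable (c : CoordSystem K A 𝔪 n)

/-- The ideal generated by the coordinates with indices in `τ`. -/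
def paramIdeal (τ : Finset (Fin n)) : Ideal A := Ideal.span {x | ∃ i ∈ τ, c.z i = x}

theorem z_mem_paramIdeal {τ : Finset (Fin n)} {i : Fin n} (hi : i ∈ τ) : c.z i ∈ c.paramIdeal τ :=
  Ideal.subset_span ⟨i, hi, rfl⟩

theorem paramIdeal_le {τ : Finset (Fin n)} {I : Ideal A} :
    c.paramIdeal τ ≤ I ↔ ∀ i ∈ τ, c.z i ∈ I := by
  rw [paramIdeal, Ideal.span_le]
  constructor
  · exact fun h i hi => h ⟨i, hi, rfl⟩
  · rintro h _ ⟨i, hi, rfl⟩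
    exact h i hi

theorem der_paramIdeal {τ : Finset (Fin n)} {i : Fin n} (hi : i ∉ τ) {f : A}
    (hf : f ∈ c.paramIdeal τ) : c.der i f ∈ c.paramIdeal τ := by
  refine derivation_span_le _ le_rfl ?_ hf
  rintro _ ⟨j, hj, rfl⟩
  rw [c.der_apply, if_neg (by rintro rfl; exact hi hj)]
  exact Ideal.zero_mem _

open Classical in
/-- The indices of the coordinates which vanish at the point. -/
noncomputable def vanishing : Finset (Fin n) := Finset.univ.filter fun i => c.z i ∈ 𝔪

theorem mem_vanishing {i : Fin n} : i ∈ c.vanishing ↔ c.z i ∈ 𝔪 := by simp [vanishing]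

theorem paramIdeal_vanishing : c.paramIdeal c.vanishing = 𝔪 := by
  conv_rhs => rw [← c.span_param]
  rw [paramIdeal]
  congr 1
  ext x
  constructor
  · rintro ⟨i, hi, rfl⟩
    exact ⟨⟨i, rfl⟩, c.mem_vanishing.1 hi⟩
  · rintro ⟨⟨i, rfl⟩, hi⟩
    exact ⟨i, c.mem_vanishing.2 hi, rfl⟩

/-- The Euler derivation `∑ z_i ∂/∂z_i`, where the sum is over `τ`. -/
noncomputable def euler (τ : Finset (Fin n)) : Derivation K A A := ∑ i ∈ τ, c.z i • c.der i

theorem euler_apply (τ : Finset (Fin n)) (f : A) :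
    c.euler τ f = ∑ i ∈ τ, c.z i * c.der i f := by
  rw [euler, ← Derivation.coeFnAddMonoidHom_apply, map_sum, Finset.sum_apply]
  simp

theorem euler_mem (τ : Finset (Fin n)) (f : A) : c.euler τ f ∈ c.paramIdeal τ := by
  rw [euler_apply]
  exact Ideal.sum_mem _ fun i hi => Ideal.mul_mem_right _ _ (c.z_mem_paramIdeal hi)

theorem euler_z {τ : Finset (Fin n)} {i : Fin n} (hi : i ∈ τ) : c.euler τ (c.z i) = c.z i := by
  classical
  rw [euler_apply]
  simp [c.der_apply, hi]

theorem euler_mem_of_der_mem {τ : Finset (Fin n)} {f : A} {I : Ideal A}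
    (h : ∀ i ∈ τ, c.z i * c.der i f ∈ I) : c.euler τ f ∈ I := by
  rw [euler_apply]
  exact Ideal.sum_mem _ h

/-- The Euler derivation acts on `P ^ l / P ^ (l + 1)` as multiplication by `l`. -/
theorem euler_sub_mem (τ : Finset (Fin n)) (l : ℕ) {f : A} (hf : f ∈ c.paramIdeal τ ^ l) :
    c.euler τ f - l * f ∈ c.paramIdeal τ ^ (l + 1) := by
  induction l generalizing f with
  | zero => simpa using c.euler_mem τ f
  | succ l ih =>
    set P := c.paramIdeal τ with hP
    -- the case `l = 1` for the elements of `P`, which carries the induction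
    have h1 : ∀ x ∈ P, c.euler τ x - x ∈ P ^ 2 := by
      intro x hx
      refine Submodule.span_induction ?_ ?_ ?_ ?_ hx
      · rintro _ ⟨i, hi, rfl⟩
        rw [c.euler_z hi, sub_self]; exact Ideal.zero_mem _
      · simp
      · intro x y _ _ hx hy
        rw [map_add, add_sub_add_comm]; exact Ideal.add_mem _ hx hy
      · intro a x hx hx'
        rw [smul_eq_mul, Derivation.leibniz, smul_eq_mul, smul_eq_mul]
        have : a * c.euler τ x + x * c.euler τ a - a * x =
          a * (c.euler τ x - x) + x * c.euler τ a := by ring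
        rw [this, pow_two]
        rw [pow_two] at hx'
        exact Ideal.add_mem _ (Ideal.mul_mem_left _ _ hx')
          (Ideal.mul_mem_mul hx (c.euler_mem τ a))
    rw [pow_succ] at hf
    refine Submodule.mul_induction_on hf ?_ ?_
    · intro g hg x hx
      rw [Derivation.leibniz, smul_eq_mul, smul_eq_mul]
      have : g * c.euler τ x + x * c.euler τ g - ((l + 1 : ℕ) : A) * (g * x) =
        g * (c.euler τ x - x) + (c.euler τ g - l * g) * x := by push_cast; ring
      rw [this]
      refine Ideal.add_mem _ ?_ ?_
      · rw [show l + 1 + 1 = l + 2 from rfl, pow_add]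
        exact Ideal.mul_mem_mul hg (h1 x hx)
      · rw [pow_succ]
        exact Ideal.mul_mem_mul (ih hg) hx
    · intro x y hx hy
      rw [map_add, mul_add, add_sub_add_comm]; exact Ideal.add_mem _ hx hy

/-- If `f ∈ P ^ l` with `l > 0`, and `f` is carried into `I ⊇ P ^ (l + 1)` by the Euler derivation,
then `f ∈ I`. -/
theorem mem_of_euler_mem [CharZero K] {τ : Finset (Fin n)} {l : ℕ} (hl : l ≠ 0) {f : A}
    {I : Ideal A} (hf : f ∈ c.paramIdeal τ ^ l) (hI : c.paramIdeal τ ^ (l + 1) ≤ I)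
    (h : c.euler τ f ∈ I) : f ∈ I := by
  refine natCast_mul_mem_iff (K := K) hl ?_
  have := Ideal.sub_mem _ h (hI (c.euler_sub_mem τ l hf))
  simpa using this

end CoordSystem

end Coordinates

/-! ### Taylor expansion without power series -/

section Taylor

variable {K : Type u} [Field K] {A : Type u} [CommRing A] [Algebra K A] {𝔪 : Ideal A} {n : ℕ}

/-- The filtration by the powers of an ideal. -/
theorem isFiltration_pow (Q : Ideal A) : IsFiltration fun q : ℚ => Q ^ ⌈q⌉₊ where
  antitone _ _ h := Ideal.pow_le_pow_right (Nat.ceil_mono h)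
  zero := by simp
  mul_le q r := by
    rw [← pow_add]
    exact Ideal.pow_le_pow_right (Nat.ceil_add_le q r)

namespace CoordSystem

variable (c : CoordSystem K A 𝔪 n)

theorem diffOp_mem_pow [CharZero K] {Q : Ideal A} {l : ℕ} {f : A} (hf : f ∈ Q ^ l)
    (α : Fin n → ℕ) : c.diffOp α f ∈ Q ^ (l - ∑ i, α i) := by
  induction α using multiIndex_induction with
  | h0 => simpa [c.diffOp_zero] using hf
  | hs α i ih =>
    rw [diffOp_incr, sum_incr, ← Nat.sub_sub]
    exact algebra_smul_mem _ (derivation_pow_sub _ _ ih)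

/-- A family of ideals which is lowered by `w` by the derivations in the directions `τ` is lowered
accordingly by the operators `D_{z^α}`, for `α` with support in `τ`. -/
theorem diffOp_mem_of_der [CharZero K] {J : ℚ → Ideal A} {τ : Finset (Fin n)} {w : ℚ}
    (hJ : ∀ i ∈ τ, ∀ q, ∀ f ∈ J q, c.der i f ∈ J (q - w)) {q : ℚ} {f : A} (hf : f ∈ J q)
    (α : Fin n → ℕ) (hα : ∀ i, i ∉ τ → α i = 0) :
    c.diffOp α f ∈ J (q - ((∑ i, α i : ℕ) : ℚ) * w) := by
  induction α using multiIndex_induction with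
  | h0 => simpa [c.diffOp_zero] using hf
  | hs α i ih =>
    have hi : i ∈ τ := by
      by_contra h
      have := hα i h
      rw [incr_self] at this
      omega
    have hα' : ∀ k, k ∉ τ → α k = 0 := fun k hk => by
      have := hα k hk
      rwa [incr_of_ne _ (by rintro rfl; exact hk hi)] at this
    rw [diffOp_incr, sum_incr]
    have := hJ i hi _ _ (ih hα')
    refine algebra_smul_mem _ ?_
    convert this using 2
    push_cast; ring

/-- If the derivatives of `f` in the directions `τ`, and the restriction of `f` to the zero locus of
the coordinates in `τ`, have the order expected from `f ∈ J b`, then `f ∈ J b`. -/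
theorem mem_filtration_of_der_mem [CharZero K] {J : ℚ → Ideal A} (hJ : IsFiltration J)
    {τ : Finset (Fin n)} {w : ℚ} (hw : 0 < w) (hz : ∀ i ∈ τ, c.z i ∈ J w)
    {b : ℚ} {f : A} (hf : f ∈ J b ⊔ c.paramIdeal τ)
    (hd : ∀ i ∈ τ, ∀ q, ∀ f ∈ J q, c.der i f ∈ J (q - w))
    (h : ∀ i ∈ τ, c.der i f ∈ J (b - w)) : f ∈ J b := by
  set P := c.paramIdeal τ with hP
  have hE : ∀ g : A, (∀ i ∈ τ, c.der i g ∈ J (b - w)) → c.euler τ g ∈ J b := fun g hg =>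
    c.euler_mem_of_der_mem fun i hi => hJ.mul_mem (hz i hi) (hg i hi) (by linarith)
  -- modulo `P ^ (l + 2)`, the Euler derivation multiplies the part of `f` in `P ^ (l + 1)` by
  -- `l + 1`, and it maps `f` into `J b`; hence this part may be pushed into higher and higher powers of `P`
  have key : ∀ l : ℕ, f ∈ J b ⊔ P ^ (l + 1) := by
    intro l
    induction l with
    | zero => simpa using hf
    | succ l ih =>
      obtain ⟨g, hg, k, hk, rfl⟩ := Submodule.mem_sup.1 ih
      refine Ideal.add_mem _ (Ideal.mem_sup_left hg) ?_
      refine c.mem_of_euler_mem (Nat.succ_ne_zero l) hk le_sup_right (Ideal.mem_sup_left ?_)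
      have h1 := hE _ h
      have h2 := hE g fun i hi => hd i hi b g hg
      rw [map_add] at h1
      simpa using Ideal.sub_mem _ h1 h2
  obtain ⟨N, hN⟩ := exists_nat_ge (b / w)
  have hPN : P ^ (N + 1) ≤ J b := by
    refine (hJ.pow_mem (c.paramIdeal_le.2 hz) (N + 1)).trans (hJ.antitone ?_)
    rw [div_le_iff₀ hw] at hN
    push_cast
    linarith
  exact sup_le le_rfl hPN (key N)

/-- If all the `D_{z^α} f`, for `α` with support in `τ`, restrict on the zero locus of the
coordinates in `τ` to functions of the order expected from `f ∈ J b`, then `f ∈ J b`. -/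
theorem mem_filtration_of_diffOp_mem [CharZero K] {J : ℚ → Ideal A} (hJ : IsFiltration J)
    {τ : Finset (Fin n)} {w : ℚ} (hw : 0 < w) (hz : ∀ i ∈ τ, c.z i ∈ J w)
    {b : ℚ} {f : A} (hd : ∀ i ∈ τ, ∀ q, ∀ f ∈ J q, c.der i f ∈ J (q - w))
    (h : ∀ α : Fin n → ℕ, (∀ i, i ∉ τ → α i = 0) → ((∑ i, α i : ℕ) : ℚ) * w < b →
      c.diffOp α f ∈ J (b - ((∑ i, α i : ℕ) : ℚ) * w) ⊔ c.paramIdeal τ) : f ∈ J b := by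
  obtain ⟨N, hN⟩ := exists_nat_ge (b / w)
  rw [div_le_iff₀ hw] at hN
  -- descending induction on `|α|`: there is nothing to show if `|α|` is large
  have key : ∀ (d : ℕ) (α : Fin n → ℕ), (∀ i, i ∉ τ → α i = 0) → N ≤ ∑ i, α i + d →
      c.diffOp α f ∈ J (b - ((∑ i, α i : ℕ) : ℚ) * w) := by
    intro d
    induction d with
    | zero =>
      intro α _ hα
      have : (N : ℚ) ≤ ((∑ i, α i : ℕ) : ℚ) := by exact_mod_cast hα
      rw [hJ.eq_top (by nlinarith)]
      trivial
    | succ d ih =>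
      intro α hα hαd
      by_cases hlt : ((∑ i, α i : ℕ) : ℚ) * w < b
      · refine c.mem_filtration_of_der_mem hJ hw hz (h α hα hlt) hd fun i hi => ?_
        rw [c.der_diffOp]
        refine algebra_smul_mem _ ?_
        have := ih (incr α i) (fun k hk => ?_) (by rw [sum_incr]; omega)
        · rw [sum_incr] at this
          convert this using 2
          push_cast; ring
        · rw [incr_of_ne _ (by rintro rfl; exact hk hi)]
          exact hα k hk
      · rw [hJ.eq_top (by linarith)]
        trivial
  have := key N 0 (fun _ _ => rfl) (by simp)
  simpa [c.diffOp_zero] using this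

/-- A function has order at least `l` if its derivatives of order less than `l` vanish at the
point. -/
theorem mem_pow_of_diffOp_mem [CharZero K] {l : ℕ} {f : A}
    (h : ∀ α : Fin n → ℕ, ∑ i, α i < l → c.diffOp α f ∈ 𝔪) : f ∈ 𝔪 ^ l := by
  have := c.mem_filtration_of_diffOp_mem (isFiltration_pow 𝔪) (τ := c.vanishing) (w := 1)
    (b := l) (f := f) one_pos (fun i hi => by simpa using c.mem_vanishing.1 hi) ?_ ?_
  · simpa using this
  · intro i _ q g hg
    have := derivation_pow_sub (c.der i) _ hg
    rwa [← Nat.ceil_sub_one] at this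
  · intro α _ hα
    rw [c.paramIdeal_vanishing]
    refine Ideal.mem_sup_right (h α ?_)
    rw [mul_one] at hα
    exact_mod_cast hα

/-- If the derivatives of `f ∈ 𝔪 ^ m` of order `m` which involve a vanishing coordinate outside of
`σ` vanish at the point, then the leading form of `f` is a polynomial in the coordinates in `σ`. -/
theorem mem_pow_sup_of_der_mem [CharZero K] {σ : Finset (Fin n)}
    {m : ℕ} {f : A} (hf : f ∈ 𝔪 ^ m)
    (h : ∀ (α : Fin n → ℕ) (i : Fin n), i ∈ c.vanishing → i ∉ σ → ∑ k, α k + 1 = m →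
      c.der i (c.diffOp α f) ∈ 𝔪) : f ∈ c.paramIdeal σ ^ m ⊔ 𝔪 ^ (m + 1) := by
  induction m generalizing f with
  | zero => simp
  | succ m ih =>
    refine c.mem_of_euler_mem (τ := c.vanishing) (Nat.succ_ne_zero m)
      (by rwa [c.paramIdeal_vanishing]) (by rw [c.paramIdeal_vanishing]; exact le_sup_right) ?_
    refine c.euler_mem_of_der_mem fun i hi => ?_
    have him := c.mem_vanishing.1 hi
    by_cases hiσ : i ∈ σ
    -- the Euler derivation is `∑ z_i ∂_i`; for `i ∈ σ` the induction applies to `∂_i f`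
    · have h1 := ih (f := c.der i f) (derivation_pow_le _ _ hf) (fun α j hj hjσ hα => by
        rw [c.diffOp_der, c.der_diffOp, Derivation.map_smul]
        exact algebra_smul_mem _ (h _ j hj hjσ (by rw [sum_incr]; omega)))
      obtain ⟨g, hg, k, hk, hgk⟩ := Submodule.mem_sup.1 h1
      rw [← hgk, mul_add]
      refine Ideal.add_mem _ (Ideal.mem_sup_left ?_) (Ideal.mem_sup_right ?_)
      · rw [pow_succ']
        exact Ideal.mul_mem_mul (c.z_mem_paramIdeal hiσ) hg
      · rw [pow_succ' 𝔪 (m + 1)]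
        exact Ideal.mul_mem_mul him hk
    -- for `i ∉ σ` all derivatives of `∂_i f` of order at most `m` vanish at the point
    · refine Ideal.mem_sup_right ?_
      rw [pow_succ' 𝔪 (m + 1)]
      refine Ideal.mul_mem_mul him (c.mem_pow_of_diffOp_mem fun α hα => ?_)
      rw [c.diffOp_der]
      rcases Nat.lt_or_ge (∑ k, α k) m with hlt | hge
      · have := derivation_pow_sub (c.der i) _ (c.diffOp_mem_pow hf α)
        refine Ideal.pow_le_self ?_ this
        omega
      · exact h α i hi hiσ (by omega)

end CoordSystem

end Taylor

/-! ### Quasi-regularity of the monomial filtrations -/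

section QuasiRegular

open MvPolynomial

variable {K : Type u} [Field K] {A : Type u} [CommRing A] [Algebra K A]

/-- The part of weight greater than `q` of the monomial filtration. -/
def wIdealGt (L : List (A × ℚ≥0)) (q : ℚ) : Ideal A where
  carrier := {f | ∃ r, q < r ∧ f ∈ wIdeal L r}
  zero_mem' := ⟨q + 1, by linarith, Ideal.zero_mem _⟩
  add_mem' := by
    rintro f g ⟨r, hr, hf⟩ ⟨s, hs, hg⟩
    exact ⟨min r s, lt_min hr hs, Ideal.add_mem _ ((isFiltration_wIdeal L).antitone
      (min_le_left _ _) hf) ((isFiltration_wIdeal L).antitone (min_le_right _ _) hg)⟩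
  smul_mem' := by
    rintro a f ⟨r, hr, hf⟩
    exact ⟨r, hr, Ideal.mul_mem_left _ _ hf⟩

theorem wIdealGt_le (L : List (A × ℚ≥0)) (q : ℚ) : wIdealGt L q ≤ wIdeal L q := by
  rintro f ⟨r, hr, hf⟩
  exact (isFiltration_wIdeal L).antitone hr.le hf

theorem mul_mem_wIdealGt {L : List (A × ℚ≥0)} {q r : ℚ} {f g : A} (hf : f ∈ wIdeal L q)
    (hg : g ∈ wIdealGt L r) : f * g ∈ wIdealGt L (q + r) := by
  obtain ⟨s, hs, hg⟩ := hg
  exact ⟨q + s, by linarith, (isFiltration_wIdeal L).mul_mem hf hg le_rfl⟩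

/-- A finite set of rational numbers has a common denominator. -/
theorem exists_common_denominator (s : Multiset ℚ) :
    ∃ N : ℕ, 0 < N ∧ ∀ q ∈ s, ∃ k : ℤ, q * N = k := by
  induction s using Multiset.induction_on with
  | empty => exact ⟨1, one_pos, by simp⟩
  | cons r s ih =>
    obtain ⟨N, hN, h⟩ := ih
    refine ⟨r.den * N, Nat.mul_pos r.den_pos hN, fun q hq => ?_⟩
    rcases Multiset.mem_cons.1 hq with rfl | hq
    · refine ⟨q.num * N, ?_⟩
      have := Rat.mul_den_eq_num q
      push_cast
      rw [← this]; ring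
    · obtain ⟨k, hk⟩ := h q hq
      refine ⟨r.den * k, ?_⟩
      push_cast
      rw [← hk]; ring

/-- The jumps of the monomial filtration lie in `(1 / N) ℤ` for a common denominator `N` of the
weights. -/
theorem wIdealGt_le_of_denominator {L : List (A × ℚ≥0)} {N : ℕ} (hN : 0 < N)
    (hL : ∀ y ∈ L, ∃ k : ℤ, 1 / (y.2 : ℚ) * N = k) {q : ℚ} (hq : ∃ k : ℤ, q * N = k) :
    wIdealGt L q ≤ wIdeal L (q + 1 / N) := by
  rintro f ⟨r, hr, hf⟩
  refine Ideal.span_mono ?_ hf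
  rintro m ⟨M, h1, h2, h3⟩
  refine ⟨M, h1, ?_, h3⟩
  have hM : ∃ k : ℤ, (M.map fun y => 1 / (y.2 : ℚ)).sum * N = k := by
    clear h2 h3
    induction M using Multiset.induction_on with
    | empty => exact ⟨0, by simp⟩
    | cons y M ih =>
      obtain ⟨k, hk⟩ := ih fun z hz => h1 z (by simp [hz])
      obtain ⟨k', hk'⟩ := hL y (h1 y (by simp))
      refine ⟨k' + k, ?_⟩
      rw [Multiset.map_cons, Multiset.sum_cons, add_mul, hk, hk']
      push_cast; ring
  obtain ⟨k, hk⟩ := hM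
  obtain ⟨k', hk'⟩ := hq
  have hN' : (0 : ℚ) < N := by exact_mod_cast hN
  have h4 : q * N < (M.map fun y => 1 / (y.2 : ℚ)).sum * N :=
    mul_lt_mul_of_pos_right (hr.trans_le h2) hN'
  rw [hk, hk'] at h4
  have h5 : k' + 1 ≤ k := by exact_mod_cast h4
  have h6 : ((k' : ℚ) + 1) ≤ k := by exact_mod_cast h5
  rw [← hk, ← hk'] at h6
  rw [← mul_le_mul_iff_left₀ hN']
  have : (q + 1 / N) * N = q * N + 1 := by field_simp
  rw [this]
  exact h6

variable {ι : Type} {x : ι → A} {δ : ι → Derivation K A A}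
  {a : ι → ℚ≥0} {L : List (A × ℚ≥0)}

/-- The monomial `x ^ α` lies in the part of the filtration determined by its weight. -/
theorem monomial_mem_wIdeal (hL : ∀ y, y ∈ L ↔ ∃ i, y = (x i, a i)) (α : ι →₀ ℕ) :
    (α.prod fun i k => x i ^ k) ∈ wIdeal L (Finsupp.weight (fun i => 1 / (a i : ℚ)) α) := by
  classical
  have hJ := isFiltration_wIdeal L
  induction α using Finsupp.induction_linear with
  | zero => simp [hJ.zero]
  | add α β hα hβ =>
    rw [Finsupp.prod_add_index' (by simp) (by intros; rw [pow_add]), map_add]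
    exact hJ.mul_mem hα hβ le_rfl
  | single i k =>
    rw [Finsupp.prod_single_index (by simp), Finsupp.weight_single, nsmul_eq_mul]
    have h1 : Ideal.span {x i} ≤ wIdeal L (1 / (a i : ℚ)) := by
      rw [Ideal.span_singleton_le_iff_mem]
      exact mem_wIdeal ((hL (x i, a i)).2 ⟨i, rfl⟩) le_rfl
    exact hJ.pow_mem h1 k (Ideal.pow_mem_pow (Ideal.mem_span_singleton_self _) k)

theorem aeval_mem_wIdeal (hL : ∀ y, y ∈ L ↔ ∃ i, y = (x i, a i)) {Φ : MvPolynomial ι A} {q : ℚ}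
    (hΦ : IsWeightedHomogeneous (fun i => 1 / (a i : ℚ)) Φ q) : aeval x Φ ∈ wIdeal L q := by
  rw [aeval_def, eval₂_eq]
  refine Ideal.sum_mem _ fun α hα => Ideal.mul_mem_left _ _ ?_
  have := monomial_mem_wIdeal hL α
  rwa [hΦ (mem_support_iff.1 hα)] at this

/-- Each element of the filtration has a leading form. -/
theorem exists_leadingForm (hL : ∀ y, y ∈ L ↔ ∃ i, y = (x i, a i)) {q : ℚ} {f : A}
    (hf : f ∈ wIdeal L q) : ∃ Φ : MvPolynomial ι A,
      IsWeightedHomogeneous (fun i => 1 / (a i : ℚ)) Φ q ∧ f - aeval x Φ ∈ wIdealGt L q := by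
  classical
  refine Submodule.span_induction ?_ ?_ ?_ ?_ hf
  · rintro _ ⟨M, h1, h2, rfl⟩
    have hM : ∃ α : ι →₀ ℕ, (M.map Prod.fst).prod = (α.prod fun i k => x i ^ k) ∧
        Finsupp.weight (fun i => 1 / (a i : ℚ)) α = (M.map fun y => 1 / (y.2 : ℚ)).sum := by
      clear h2
      induction M using Multiset.induction_on with
      | empty => exact ⟨0, by simp, by simp⟩
      | cons y M ih =>
        obtain ⟨α, hα, hα'⟩ := ih fun z hz => h1 z (by simp [hz])
        obtain ⟨i, rfl⟩ := (hL y).1 (h1 y (by simp))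
        refine ⟨Finsupp.single i 1 + α, ?_, ?_⟩
        · rw [Finsupp.prod_add_index' (by simp) (by intros; rw [pow_add]), ← hα,
            Finsupp.prod_single_index (by simp)]
          simp
        · rw [map_add, hα', Finsupp.weight_single]
          simp
    obtain ⟨α, hα, hα'⟩ := hM
    -- a monomial of weight greater than `q` has the leading form `0` in weight `q`
    rcases h2.eq_or_lt with h2 | h2
    · refine ⟨monomial α 1, isWeightedHomogeneous_monomial _ _ _ (hα'.trans h2.symm), ?_⟩
      rw [aeval_monomial, map_one, one_mul, hα, sub_self]
      exact Ideal.zero_mem _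
    · refine ⟨0, isWeightedHomogeneous_zero _ _ _, ?_⟩
      rw [map_zero, sub_zero]
      exact ⟨_, h2, Ideal.subset_span ⟨M, h1, le_rfl, rfl⟩⟩
  · exact ⟨0, isWeightedHomogeneous_zero _ _ _, by simp⟩
  · rintro f g _ _ ⟨Φ, hΦ, hf⟩ ⟨Ψ, hΨ, hg⟩
    refine ⟨Φ + Ψ, hΦ.add hΨ, ?_⟩
    rw [map_add, add_sub_add_comm]
    exact Ideal.add_mem _ hf hg
  · rintro b f _ ⟨Φ, hΦ, hf⟩
    refine ⟨C b * Φ, hΦ.C_mul b, ?_⟩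
    rw [map_mul, aeval_C, Algebra.algebraMap_self, RingHom.id_apply, smul_eq_mul, ← mul_sub]
    exact Ideal.mul_mem_left _ _ hf

variable [DecidableEq ι]

theorem der_wIdeal_of_dual (hδ : ∀ i j, δ i (x j) = if i = j then 1 else 0)
    (hL : ∀ y, y ∈ L ↔ ∃ i, y = (x i, a i)) (i : ι) {q : ℚ} {f : A} (hf : f ∈ wIdeal L q) :
    δ i f ∈ wIdeal L (q - 1 / (a i : ℚ)) := by
  refine derivation_wIdeal_of_le (δ i) (by positivity) (fun y hy => ?_) hf
  obtain ⟨j, rfl⟩ := (hL y).1 hy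
  by_cases h : i = j
  · subst h; exact Or.inr le_rfl
  · left; simp [hδ, h]

theorem der_monomial (hδ : ∀ i j, δ i (x j) = if i = j then 1 else 0) (i : ι) (α : ι →₀ ℕ) :
    δ i (aeval x (monomial α (1 : A))) = aeval x (pderiv i (monomial α (1 : A))) := by
  induction α using Finsupp.induction_linear with
  | zero =>
    rw [show monomial (0 : ι →₀ ℕ) (1 : A) = 1 from rfl, map_one, pderiv_one, map_zero]
    exact (δ i).map_one_eq_zero
  | add α β hα hβ =>
    rw [show monomial (α + β) (1 : A) = monomial α 1 * monomial β 1 by simp [monomial_mul]]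
    rw [map_mul, Derivation.leibniz, Derivation.leibniz, hα, hβ]
    simp only [smul_eq_mul, map_add, map_mul]
  | single j k =>
    rw [show monomial (Finsupp.single j k) (1 : A) = X j ^ k by rw [X_pow_eq_monomial]]
    rw [map_pow, aeval_X, Derivation.leibniz_pow, Derivation.leibniz_pow, hδ, pderiv_X]
    by_cases h : i = j
    · subst h; simp
    · simp [h, Ne.symm h]

/-- Up to terms of higher weight, the derivation `δ i` acts on leading forms as `∂ / ∂ X_i`. -/
theorem der_aeval_sub_mem (hδ : ∀ i j, δ i (x j) = if i = j then 1 else 0)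
    (hL : ∀ y, y ∈ L ↔ ∃ i, y = (x i, a i)) (i : ι) {Φ : MvPolynomial ι A} {q : ℚ}
    (hΦ : IsWeightedHomogeneous (fun i => 1 / (a i : ℚ)) Φ q) :
    δ i (aeval x Φ) - aeval x (pderiv i Φ) ∈ wIdeal L q := by
  have hsum : δ i (aeval x Φ) - aeval x (pderiv i Φ) = ∑ α ∈ Φ.support,
      (δ i (aeval x (monomial α (coeff α Φ))) - aeval x (pderiv i (monomial α (coeff α Φ)))) := by
    conv_lhs => rw [Φ.as_sum]
    rw [map_sum, map_sum, map_sum, map_sum, ← Finset.sum_sub_distrib]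
  rw [hsum]
  refine Ideal.sum_mem _ fun α hα => ?_
  have h1 : monomial α (coeff α Φ) = C (coeff α Φ) * monomial α 1 := by
    rw [C_mul_monomial, mul_one]
  rw [h1, map_mul, aeval_C, Algebra.algebraMap_self, RingHom.id_apply, Derivation.leibniz,
    der_monomial hδ, pderiv_C_mul, map_mul, aeval_C, Algebra.algebraMap_self, RingHom.id_apply,
    smul_eq_mul, smul_eq_mul, add_sub_cancel_left]
  refine Ideal.mul_mem_right _ _ (aeval_mem_wIdeal hL ?_)
  exact isWeightedHomogeneous_monomial _ _ _ (hΦ (mem_support_iff.1 hα))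

/-- The parameters `x` are quasi-regular: if a weighted homogeneous polynomial takes on `x` a value
of higher weight, then its coefficients vanish on the zero locus of `x`. -/
theorem coeff_mem_of_aeval_mem [CharZero K] (hδ : ∀ i j, δ i (x j) = if i = j then 1 else 0)
    (ha : ∀ i, 0 < a i)
    (hL : ∀ y, y ∈ L ↔ ∃ i, y = (x i, a i)) {P : Ideal A} (hP : ∀ i, x i ∈ P)
    {Φ : MvPolynomial ι A} {q : ℚ}
    (hΦ : IsWeightedHomogeneous (fun i => 1 / (a i : ℚ)) Φ q) (h : aeval x Φ ∈ wIdealGt L q)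
    (α : ι →₀ ℕ) : coeff α Φ ∈ P := by
  -- by induction on the degree of `α`, applied to the derivatives of `Φ`
  obtain ⟨d, hd⟩ : ∃ d, α.degree = d := ⟨_, rfl⟩
  induction d generalizing Φ q α with
  | zero =>
    have hα : α = 0 := (Finsupp.degree_eq_zero_iff α).1 hd
    subst hα
    by_cases hc : coeff 0 Φ = 0
    · rw [hc]; exact Ideal.zero_mem _
    have hq : q = 0 := by simpa using (hΦ hc).symm
    subst hq
    -- all weights are positive, so that a form of weight `0` is constant
    have hΦ0 : Φ = C (coeff 0 Φ) := by
      ext β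
      rw [coeff_C]
      split_ifs with hβ
      · rw [hβ]
      · by_contra hβ'
        have h1 := hΦ hβ'
        obtain ⟨i, hi⟩ := Finsupp.ne_iff.1 (Ne.symm hβ)
        rw [Finsupp.weight_apply, Finsupp.sum] at h1
        have h2 := (Finset.sum_eq_zero_iff_of_nonneg (fun j _ => by positivity)).1 h1 i
          (Finsupp.mem_support_iff.2 (by simpa using hi))
        have h3 : (0 : ℚ) < 1 / (a i : ℚ) := by
          have := ha i
          positivity
        rw [nsmul_eq_mul, mul_eq_zero] at h2
        rcases h2 with h2 | h2
        · exact hi (by exact_mod_cast h2)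
        · exact h3.ne' h2
    rw [hΦ0, aeval_C] at h
    obtain ⟨r, hr, h⟩ := h
    refine (Ideal.span_le.2 ?_) (wIdeal_le_span hr h)
    rintro _ ⟨y, hy, rfl⟩
    obtain ⟨i, rfl⟩ := (hL y).1 hy
    exact hP i
  | succ d ih =>
    obtain ⟨i, hi⟩ : ∃ i, α i ≠ 0 := by
      by_contra! hα
      have : α = 0 := Finsupp.ext hα
      simp [this] at hd
    set β := α - Finsupp.single i 1 with hβ
    have hαβ : α = β + Finsupp.single i 1 := by
      rw [hβ, tsub_add_cancel_of_le]
      rw [Finsupp.single_le_iff]; omega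
    have hw : (1 / (a i : ℚ)) = (fun i => 1 / (a i : ℚ)) i := rfl
    have h1 : IsWeightedHomogeneous (fun i => 1 / (a i : ℚ)) (pderiv i Φ) (q - 1 / (a i : ℚ)) :=
      hΦ.pderiv (by simp)
    have hwi : (0 : ℚ) < 1 / (a i : ℚ) := by
      have := ha i
      positivity
    have h2 : aeval x (pderiv i Φ) ∈ wIdealGt L (q - 1 / (a i : ℚ)) := by
      have h3 : δ i (aeval x Φ) ∈ wIdealGt L (q - 1 / (a i : ℚ)) := by
        obtain ⟨r, hr, h⟩ := h
        exact ⟨r - 1 / (a i : ℚ), by linarith, der_wIdeal_of_dual hδ hL i h⟩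
      have h4 : δ i (aeval x Φ) - aeval x (pderiv i Φ) ∈ wIdealGt L (q - 1 / (a i : ℚ)) :=
        ⟨q, by linarith, der_aeval_sub_mem hδ hL i hΦ⟩
      simpa using Ideal.sub_mem _ h3 h4
    have h5 := ih h1 h2 β (by
      rw [hαβ, map_add, Finsupp.degree_single] at hd; omega)
    rw [coeff_pderiv, ← hαβ] at h5
    refine natCast_mul_mem_iff (K := K) (l := β i + 1) (by omega) ?_
    rw [mul_comm]
    push_cast
    exact h5

end QuasiRegular

section QuasiRegular

open MvPolynomial

variable {K : Type u} [Field K] {A : Type u} [CommRing A] [Algebra K A]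
variable {ι : Type} {x : ι → A} {δ : ι → Derivation K A A} {a : ι → ℚ≥0} {L : List (A × ℚ≥0)}

theorem aeval_mem_wIdealGt (hL : ∀ y, y ∈ L ↔ ∃ i, y = (x i, a i)) {P : Ideal A}
    (hP : P ≤ wIdealGt L 0) {Φ : MvPolynomial ι A} {q : ℚ}
    (hΦ : IsWeightedHomogeneous (fun i => 1 / (a i : ℚ)) Φ q) (hc : ∀ α, coeff α Φ ∈ P) :
    aeval x Φ ∈ wIdealGt L q := by
  rw [aeval_def, eval₂_eq]
  refine Ideal.sum_mem _ fun α hα => ?_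
  have := monomial_mem_wIdeal hL α
  rw [hΦ (mem_support_iff.1 hα)] at this
  rw [mul_comm]
  have h := mul_mem_wIdealGt this (hP (hc α))
  rwa [add_zero] at h

end QuasiRegular

/-! ### Local rings with coordinates are domains -/

section Domain

open MvPolynomial

variable {K : Type u} [Field K] [CharZero K] {A : Type u} [CommRing A] [Algebra K A]
  [IsLocalRing A] [IsNoetherianRing A] {𝔪 : Ideal A} {n : ℕ}

/-- A non-zero element of a Noetherian local ring has an order. -/
theorem exists_order (h𝔪 : 𝔪 = IsLocalRing.maximalIdeal A) {f : A} (hf : f ≠ 0) :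
    ∃ m, f ∈ 𝔪 ^ m ∧ f ∉ 𝔪 ^ (m + 1) := by
  classical
  have hex : ∃ m, f ∉ 𝔪 ^ m := by
    by_contra! h
    have h1 : f ∈ ⨅ i, 𝔪 ^ i := (Submodule.mem_iInf _).2 h
    rw [Ideal.iInf_pow_eq_bot_of_isLocalRing 𝔪 (h𝔪 ▸ Ideal.IsPrime.ne_top inferInstance)] at h1
    exact hf h1
  obtain ⟨m, hm⟩ : ∃ m, Nat.find hex = m + 1 := by
    refine Nat.exists_eq_succ_of_ne_zero fun h => ?_
    have := Nat.find_spec hex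
    rw [h] at this
    simp at this
  exact ⟨m, not_not.1 (Nat.find_min hex (by omega)), hm ▸ Nat.find_spec hex⟩

/-- A Noetherian local ring with a coordinate system is a domain, since its associated graded ring
is a polynomial ring over the residue field. -/
theorem CoordSystem.isDomain (c : CoordSystem K A 𝔪 n) (h𝔪 : 𝔪 = IsLocalRing.maximalIdeal A) :
    IsDomain A := by
  classical
  have hprime : 𝔪.IsPrime := h𝔪 ▸ inferInstance
  let x : {i // i ∈ c.vanishing} → A := fun i => c.z i
  -- with all weights equal to `1`, the monomial filtration is the `𝔪`-adic one
  let L : List (A × ℚ≥0) := c.vanishing.toList.map fun i => (c.z i, 1)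
  have hL : ∀ y, y ∈ L ↔ ∃ i, y = (x i, (1 : ℚ≥0)) := by
    intro y
    simp only [L, List.mem_map, Finset.mem_toList, x, Subtype.exists]
    constructor
    · rintro ⟨i, hi, rfl⟩; exact ⟨i, hi, rfl⟩
    · rintro ⟨i, hi, rfl⟩; exact ⟨i, hi, rfl⟩
  have hx : ∀ i, x i ∈ 𝔪 := fun i => c.mem_vanishing.1 i.2
  have hδ : ∀ i j : {i // i ∈ c.vanishing}, c.der i (x j) = if i = j then 1 else 0 := by
    intro i j
    rw [c.der_apply]
    exact if_congr Subtype.coe_inj rfl rfl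
  have hle : ∀ q, wIdeal L q ≤ 𝔪 ^ ⌈q⌉₊ := fun q => by
    refine wIdeal_le (isFiltration_pow 𝔪) (fun y hy => ?_) q
    obtain ⟨i, rfl⟩ := (hL y).1 hy
    simpa using hx i
  have hge : ∀ m : ℕ, 𝔪 ^ m ≤ wIdeal L m := by
    intro m
    have h1 : 𝔪 ≤ wIdeal L 1 := by
      conv_lhs => rw [← c.paramIdeal_vanishing]
      rw [c.paramIdeal_le]
      intro i hi
      exact mem_wIdeal ((hL _).2 ⟨⟨i, hi⟩, rfl⟩) (by simp)
    simpa using (isFiltration_wIdeal L).pow_mem h1 m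
  have hGt : ∀ m : ℕ, wIdealGt L m ≤ 𝔪 ^ (m + 1) := by
    rintro m f ⟨r, hr, hf⟩
    refine Ideal.pow_le_pow_right ?_ (hle r hf)
    exact Nat.succ_le_of_lt (Nat.lt_ceil.2 hr)
  have hP : 𝔪 ≤ wIdealGt L 0 := fun f hf =>
    ⟨1, one_pos, by simpa using hge 1 (by simpa using hf)⟩
  -- a non-zero element has a leading form which is not zero modulo `𝔪`
  have key : ∀ {f : A}, f ≠ 0 → ∃ (m : ℕ) (Φ : MvPolynomial {i // i ∈ c.vanishing} A),
      IsWeightedHomogeneous (fun _ => 1 / ((1 : ℚ≥0) : ℚ)) Φ (m : ℚ) ∧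
      f ∈ wIdeal L m ∧ f - aeval x Φ ∈ wIdealGt L m ∧ Φ.map (Ideal.Quotient.mk 𝔪) ≠ 0 := by
    intro f hf
    obtain ⟨m, hm, hm'⟩ := exists_order h𝔪 hf
    obtain ⟨Φ, hΦ, hfΦ⟩ := exists_leadingForm (x := x) (a := fun _ => 1) hL (hge m hm)
    refine ⟨m, Φ, hΦ, hge m hm, hfΦ, fun h => hm' ?_⟩
    have h1 : ∀ α, coeff α Φ ∈ 𝔪 := fun α => by
      rw [← Ideal.Quotient.eq_zero_iff_mem, ← coeff_map, h, coeff_zero]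
    have h2 := aeval_mem_wIdealGt (x := x) (a := fun _ => 1) hL hP hΦ h1
    exact hGt m (by simpa using Ideal.add_mem _ hfΦ h2)
  -- if `f g = 0`, then the product of the leading forms vanishes over the residue field
  have : NoZeroDivisors A := by
    refine ⟨fun {f g} hfg => ?_⟩
    by_contra! h
    obtain ⟨m, Φ, hΦ, hf, hfΦ, hΦ0⟩ := key h.1
    obtain ⟨l, Ψ, hΨ, hg, hgΨ, hΨ0⟩ := key h.2
    have h1 : aeval x (Φ * Ψ) ∈ wIdealGt L ((m : ℚ) + l) := by
      have h2 : aeval x (Φ * Ψ) = f * g - (g * (f - aeval x Φ) + aeval x Φ * (g - aeval x Ψ)) := by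
        rw [map_mul]; ring
      rw [h2, hfg, zero_sub]
      refine Submodule.neg_mem _ (Ideal.add_mem _ ?_ ?_)
      · rw [add_comm (m : ℚ)]
        exact mul_mem_wIdealGt hg hfΦ
      · exact mul_mem_wIdealGt (aeval_mem_wIdeal (x := x) (a := fun _ => 1) hL hΦ) hgΨ
    have h3 : (Φ * Ψ).map (Ideal.Quotient.mk 𝔪) = 0 := by
      ext α
      rw [coeff_map, coeff_zero, Ideal.Quotient.eq_zero_iff_mem]
      exact coeff_mem_of_aeval_mem (δ := fun i : {i // i ∈ c.vanishing} => c.der i) hδ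
        (fun _ => one_pos) hL hx (hΦ.mul hΨ) h1 α
    rw [map_mul] at h3
    rcases mul_eq_zero.1 h3 with h | h
    exacts [hΦ0 h, hΨ0 h]
  exact NoZeroDivisors.to_isDomain A

end Domain

/-! ### Restriction and exchange of coordinates -/

section Operations

variable {K : Type u} [Field K] {A : Type u} [CommRing A] [Algebra K A] {𝔪 : Ideal A} {n : ℕ}

/-- The derivation of `A ⧸ I` induced by a derivation of `A` which preserves `I`. -/
noncomputable def quotDerivation (I : Ideal A) (δ : Derivation K A A) (h : ∀ f ∈ I, δ f ∈ I) :
    Derivation K (A ⧸ I) (A ⧸ I) :=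
  Derivation.mk' (M := A ⧸ I)
    ((Submodule.liftQ (I.restrictScalars K)
      ((Ideal.Quotient.mkₐ K I).toLinearMap ∘ₗ (δ : A →ₗ[K] A))
      (fun f hf => Ideal.Quotient.eq_zero_iff_mem.2 (h f hf)) : A ⧸ I →ₗ[K] A ⧸ I))
    (by
      intro x y
      obtain ⟨f, rfl⟩ := Ideal.Quotient.mk_surjective x
      obtain ⟨g, rfl⟩ := Ideal.Quotient.mk_surjective y
      change Ideal.Quotient.mk I (δ (f * g)) = Ideal.Quotient.mk I f • Ideal.Quotient.mk I (δ g) +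
        Ideal.Quotient.mk I g • Ideal.Quotient.mk I (δ f)
      rw [Derivation.leibniz]
      simp)

theorem quotDerivation_mk (I : Ideal A) (δ : Derivation K A A) (h : ∀ f ∈ I, δ f ∈ I) (f : A) :
    quotDerivation I δ h (Ideal.Quotient.mk I f) = Ideal.Quotient.mk I (δ f) := rfl

namespace CoordSystem

variable (c : CoordSystem K A 𝔪 n)

/-- The chain rule for derivations into a module. -/
theorem derivation_module_apply {M : Type u} [AddCommGroup M] [Module A M] [Module K M]
    [IsScalarTower K A M] (d : Derivation K A M) (f : A) :
    d f = ∑ i, c.der i f • d (c.z i) := by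
  classical
  let ℓ : Ω[A⁄K] →ₗ[A] M := d.liftKaehlerDifferential
  let ℓ' : Ω[A⁄K] →ₗ[A] M :=
    ∑ i, ((c.der i).liftKaehlerDifferential).smulRight (d (c.z i))
  have h : ℓ = ℓ' := by
    refine LinearMap.ext_on c.span_diff ?_
    rintro _ ⟨j, rfl⟩
    simp [ℓ, ℓ', c.der_apply]
  have h1 := LinearMap.congr_fun h (KaehlerDifferential.D K A f)
  simpa [ℓ, ℓ'] using h1

/-- The restriction of a coordinate system to the zero locus of the coordinates in `τ`. -/
noncomputable def quot (I : Ideal A) (τ : Finset (Fin n)) (hI : I = c.paramIdeal τ) {n' : ℕ}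
    (e : Fin n' ≃ {i // i ∉ τ}) : CoordSystem K (A ⧸ I) (𝔪.map (Ideal.Quotient.mk I)) n' where
  z j := Ideal.Quotient.mk I (c.z (e j))
  der j := quotDerivation I (c.der (e j))
    (fun f hf => by rw [hI] at hf ⊢; exact c.der_paramIdeal (e j).2 hf)
  der_apply i j := by
    rw [quotDerivation_mk, c.der_apply]
    by_cases h : i = j
    · simp [h]
    · have : (e i : Fin n) ≠ e j := fun h' => h (e.injective (Subtype.ext h'))
      simp [h, this]
  span_diff := by
    rw [← top_le_iff, ← KaehlerDifferential.span_range_derivation, Submodule.span_le]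
    rintro _ ⟨y, rfl⟩
    obtain ⟨f, rfl⟩ := Ideal.Quotient.mk_surjective y
    have h := c.derivation_module_apply
      ((KaehlerDifferential.D K (A ⧸ I)).compAlgebraMap A) f
    change KaehlerDifferential.D K (A ⧸ I) (Ideal.Quotient.mk I f) = ∑ i, c.der i f •
      KaehlerDifferential.D K (A ⧸ I) (Ideal.Quotient.mk I (c.z i)) at h
    rw [h]
    refine Submodule.sum_mem _ fun i _ => ?_
    rw [← algebraMap_smul (A ⧸ I) (c.der i f)]
    refine Submodule.smul_mem _ _ ?_
    by_cases hi : i ∈ τ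
    · have : Ideal.Quotient.mk I (c.z i) = 0 := by
        rw [Ideal.Quotient.eq_zero_iff_mem, hI]; exact c.z_mem_paramIdeal hi
      rw [this, map_zero]
      exact Submodule.zero_mem _
    · refine Submodule.subset_span ⟨e.symm ⟨i, hi⟩, ?_⟩
      simp
  span_param := by
    apply le_antisymm
    · rw [Ideal.span_le]
      exact fun y hy => hy.2
    · rw [Ideal.map_le_iff_le_comap]
      conv_lhs => rw [← c.span_param]
      rw [Ideal.span_le]
      rintro _ ⟨⟨i, rfl⟩, hi⟩
      rw [SetLike.mem_coe, Ideal.mem_comap]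
      by_cases hiτ : i ∈ τ
      · have : Ideal.Quotient.mk I (c.z i) = 0 := by
          rw [Ideal.Quotient.eq_zero_iff_mem, hI]; exact c.z_mem_paramIdeal hiτ
        rw [this]
        exact Ideal.zero_mem _
      · refine Ideal.subset_span ⟨⟨e.symm ⟨i, hiτ⟩, by simp⟩, Ideal.mem_map_of_mem _ hi⟩

theorem quot_z (I : Ideal A) (τ : Finset (Fin n)) (hI : I = c.paramIdeal τ) {n' : ℕ}
    (e : Fin n' ≃ {i // i ∉ τ}) (j : Fin n') :
    (c.quot I τ hI e).z j = Ideal.Quotient.mk I (c.z (e j)) := rfl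

/-- An enumeration of the coordinates outside of `τ`. -/
theorem exists_enum (τ : Finset (Fin n)) : ∃ n', Nonempty (Fin n' ≃ {i // i ∉ τ}) :=
  ⟨_, ⟨(Fintype.equivFin {i // i ∉ τ}).symm⟩⟩

theorem maximalIdeal_quot [IsLocalRing A] {I : Ideal A} [IsLocalRing (A ⧸ I)]
    (h𝔪 : 𝔪 = IsLocalRing.maximalIdeal A) :
    𝔪.map (Ideal.Quotient.mk I) = IsLocalRing.maximalIdeal (A ⧸ I) := by
  rw [h𝔪]
  exact (IsLocalRing.map_maximalIdeal_of_surjective (Ideal.Quotient.mk I)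
      Ideal.Quotient.mk_surjective)

/-- The coordinate `z i` may be replaced by any function `y`, vanishing at the point, whose
derivative with respect to `z i` is a unit. -/
theorem exists_exchange [IsLocalRing A] [IsNoetherianRing A]
    (h𝔪 : 𝔪 = IsLocalRing.maximalIdeal A) {i : Fin n} (hi : c.z i ∈ 𝔪) {y : A} (hy : y ∈ 𝔪)
    (hu : c.der i y ∉ 𝔪) : ∃ c' : CoordSystem K A 𝔪 n, c'.z i = y ∧ (∀ j, j ≠ i → c'.z j = c.z j) ∧
      ∃ v : A, v * c.der i y = 1 ∧ (∀ f, c'.der i f = v * c.der i f) ∧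
        ∀ j, j ≠ i → ∀ f, c'.der j f = c.der j f - v * c.der j y * c.der i f := by
  classical
  have hunit : IsUnit (c.der i y) := by
    by_contra h
    exact hu (h𝔪.ge ((IsLocalRing.mem_maximalIdeal _).2 h))
  obtain ⟨v, hv⟩ := hunit.exists_left_inv
  have hDy : KaehlerDifferential.D K A y = ∑ j, c.der j y • KaehlerDifferential.D K A (c.z j) :=
    c.derivation_module_apply _ y
  refine ⟨⟨Function.update c.z i y, fun j => if j = i then v • c.der i
    else c.der j - (v * c.der j y) • c.der i, ?_, ?_, ?_⟩, by simp, fun j hj => by simp [hj],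
    v, hv, fun f => by simp, fun j hj f => by simp [hj]⟩
  · intro j k
    by_cases hj : j = i
    · subst hj
      by_cases hk : k = j
      · subst hk; simp [hv]
      · simp [hk, c.der_apply, Ne.symm hk]
    · by_cases hk : k = i
      · subst hk
        have h1 : v * c.der j y * c.der k y = c.der j y := by
          rw [mul_assoc, mul_comm, mul_assoc, mul_comm _ v, hv, mul_one]
        simp [hj, h1]
      · simp [hj, hk, c.der_apply, Ne.symm hk]
  · rw [← top_le_iff, ← c.span_diff, Submodule.span_le]
    have hother : ∀ j, j ≠ i → KaehlerDifferential.D K A (c.z j) ∈ Submodule.span A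
        (Set.range fun j => KaehlerDifferential.D K A (Function.update c.z i y j)) := fun j hj =>
      Submodule.subset_span ⟨j, by simp [hj]⟩
    rintro _ ⟨j, rfl⟩
    by_cases hj : j = i
    · subst hj
      have h1 : KaehlerDifferential.D K A (c.z j) = v • (KaehlerDifferential.D K A y -
          ∑ k ∈ Finset.univ.erase j, c.der k y • KaehlerDifferential.D K A (c.z k)) := by
        rw [hDy, ← Finset.add_sum_erase _ _ (Finset.mem_univ j), add_sub_cancel_right, smul_smul,
          hv, one_smul]
      change KaehlerDifferential.D K A (c.z j) ∈ _
      rw [h1]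
      refine Submodule.smul_mem _ _ (Submodule.sub_mem _ ?_ ?_)
      · exact Submodule.subset_span ⟨j, by simp⟩
      · exact Submodule.sum_mem _ fun k hk =>
          Submodule.smul_mem _ _ (hother k (Finset.mem_erase.1 hk).1)
    · exact hother j hj
  · set Q := Ideal.span {x | x ∈ Set.range (Function.update c.z i y) ∧ x ∈ 𝔪} with hQ
    have hQle : Q ≤ 𝔪 := by
      rw [hQ, Ideal.span_le]; exact fun x hx => hx.2
    have hyQ : y ∈ Q := Ideal.subset_span ⟨⟨i, by simp⟩, hy⟩
    have hzQ : ∀ j, j ≠ i → c.z j ∈ 𝔪 → c.z j ∈ Q := fun j hj hj' =>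
      Ideal.subset_span ⟨⟨j, by simp [hj]⟩, hj'⟩
    refine le_antisymm hQle ?_
    -- by the Euler derivation, `z i` is modulo `𝔪 ^ 2` a combination of `y` and the other
    -- parameters; then Nakayama's lemma applies
    have hle : 𝔪 ≤ Q ⊔ 𝔪 • 𝔪 := by
      conv_lhs => rw [← c.paramIdeal_vanishing]
      rw [c.paramIdeal_le]
      intro j hj
      by_cases hji : j = i
      · subst hji
        have h1 : c.euler c.vanishing y - y ∈ 𝔪 ^ 2 := by
          have := c.euler_sub_mem c.vanishing 1 (f := y) (by rwa [c.paramIdeal_vanishing, pow_one])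
          rw [c.paramIdeal_vanishing] at this
          simpa using this
        rw [c.euler_apply, ← Finset.add_sum_erase _ _ hj] at h1
        have h2 : c.z j = v * (c.z j * c.der j y +
            ∑ k ∈ c.vanishing.erase j, c.z k * c.der k y - y) +
            v * (y - ∑ k ∈ c.vanishing.erase j, c.z k * c.der k y) := by
          have : c.z j = c.z j * (v * c.der j y) := by rw [hv, mul_one]
          conv_lhs => rw [this]
          ring
        rw [h2]
        refine Ideal.add_mem _ (Ideal.mem_sup_right (Ideal.mul_mem_left _ _ ?_))
          (Ideal.mem_sup_left (Ideal.mul_mem_left _ _ (Ideal.sub_mem _ hyQ ?_)))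
        · rwa [smul_eq_mul, ← pow_two]
        · refine Ideal.sum_mem _ fun k hk => Ideal.mul_mem_right _ _ ?_
          rw [Finset.mem_erase] at hk
          exact hzQ k hk.1 (c.mem_vanishing.1 hk.2)
      · exact Ideal.mem_sup_left (hzQ j hji (c.mem_vanishing.1 hj))
    refine Submodule.le_of_le_smul_of_le_jacobson_bot (IsNoetherian.noetherian 𝔪) ?_ hle
    rw [IsLocalRing.jacobson_eq_maximalIdeal ⊥ bot_ne_top, h𝔪]

end CoordSystem

end Operations

/-! ### Integral closures of monomial algebras -/

/-- Products in `R[t^ℚ≥0]` of elements with coefficients in given subgroups. -/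
theorem coeff_mul_mem {R : Type*} [CommRing R] {I J H : ℚ≥0 → AddSubmonoid R}
    (h : ∀ q r, ∀ f ∈ I q, ∀ g ∈ J r, f * g ∈ H (q + r)) {F G : AddMonoidAlgebra R ℚ≥0}
    (hF : ∀ q : ℚ≥0, F.coeff q ∈ I q) (hG : ∀ q : ℚ≥0, G.coeff q ∈ J q) (q : ℚ≥0) :
    (F * G).coeff q ∈ H q := by
  classical
  rw [AddMonoidAlgebra.coeff_mul]
  refine AddSubmonoid.sum_mem _ fun a _ => AddSubmonoid.sum_mem _ fun b _ => ?_
  dsimp only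
  split_ifs with hab
  · exact hab ▸ h a b _ (hF a) _ (hG b)
  · exact AddSubmonoid.zero_mem _

section UpperBound

open MvPolynomial

variable {K : Type u} [Field K] {A : Type u} [CommRing A] [Algebra K A]

theorem coeff_mul_mem_wIdeal {L : List (A × ℚ≥0)} {c d : ℚ} {F G : TAlg A}
    (hF : ∀ q : ℚ≥0, F.coeff q ∈ wIdeal L (c + q)) (hG : ∀ q : ℚ≥0, G.coeff q ∈ wIdeal L (d + q))
        (q : ℚ≥0) :
    (F * G).coeff q ∈ wIdeal L (c + d + q) :=
  coeff_mul_mem (I := fun q => (wIdeal L (c + q)).toAddSubmonoid)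
    (J := fun q => (wIdeal L (d + q)).toAddSubmonoid)
    (H := fun q => (wIdeal L (c + d + q)).toAddSubmonoid)
    (fun q r f hf g hg => (isFiltration_wIdeal L).mul_mem hf hg (by push_cast; linarith)) hF hG q

theorem coeff_mul_mem_wIdealGt {L : List (A × ℚ≥0)} {c d : ℚ} {F G : TAlg A}
    (hF : ∀ q : ℚ≥0, F.coeff q ∈ wIdeal L (c + q)) (hG : ∀ q : ℚ≥0, G.coeff q ∈ wIdealGt L (d + q))
        (q : ℚ≥0) :
    (F * G).coeff q ∈ wIdealGt L (c + d + q) :=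
  coeff_mul_mem (I := fun q => (wIdeal L (c + q)).toAddSubmonoid)
    (J := fun q => (wIdealGt L (d + q)).toAddSubmonoid)
    (H := fun q => (wIdealGt L (c + d + q)).toAddSubmonoid)
    (fun q r f hf g hg => by
      have := mul_mem_wIdealGt hf hg
      have h : c + (q : ℚ) + (d + r) = c + d + ((q + r : ℚ≥0) : ℚ) := by push_cast; ring
      rwa [h] at this) hF hG q

variable {ι : Type} {x : ι → A} {δ : ι → Derivation K A A} {a : ι → ℚ≥0} {L : List (A × ℚ≥0)}

/-- `Ψ` collects the leading forms of the coefficients of `F`, if `F` has weight at least `c`. -/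
def IsLeading (x : ι → A) (a : ι → ℚ≥0) (L : List (A × ℚ≥0)) (c : ℚ) (F : TAlg A)
    (Ψ : AddMonoidAlgebra (MvPolynomial ι A) ℚ≥0) : Prop :=
  (∀ q : ℚ≥0, IsWeightedHomogeneous (fun i => 1 / (a i : ℚ)) (Ψ.coeff q) (c + q)) ∧
  ∀ q : ℚ≥0, F.coeff q - aeval x (Ψ.coeff q) ∈ wIdealGt L (c + q)

theorem IsLeading.coeff_mem (hL : ∀ y, y ∈ L ↔ ∃ i, y = (x i, a i)) {c : ℚ} {F : TAlg A}
    {Ψ : AddMonoidAlgebra (MvPolynomial ι A) ℚ≥0} (h : IsLeading x a L c F Ψ) (q : ℚ≥0) :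
    F.coeff q ∈ wIdeal L (c + q) := by
  have := Ideal.add_mem _ (wIdealGt_le _ _ (h.2 q)) (aeval_mem_wIdeal hL (h.1 q))
  rwa [sub_add_cancel] at this

theorem IsLeading.mul (hL : ∀ y, y ∈ L ↔ ∃ i, y = (x i, a i)) {c d : ℚ} {F G : TAlg A}
    {Ψ Ξ : AddMonoidAlgebra (MvPolynomial ι A) ℚ≥0} (hF : IsLeading x a L c F Ψ)
    (hG : IsLeading x a L d G Ξ) : IsLeading x a L (c + d) (F * G) (Ψ * Ξ) := by
  constructor
  · intro q
    exact coeff_mul_mem (R := MvPolynomial ι A)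
      (I := fun q => (weightedHomogeneousSubmodule A (fun i => 1 / (a i : ℚ))
          (c + q)).toAddSubmonoid)
      (J := fun q => (weightedHomogeneousSubmodule A (fun i => 1 / (a i : ℚ))
          (d + q)).toAddSubmonoid)
      (H := fun q =>
        (weightedHomogeneousSubmodule A (fun i => 1 / (a i : ℚ)) (c + d + q)).toAddSubmonoid)
      (fun q r f hf g hg => by
        have := IsWeightedHomogeneous.mul (φ := f) (ψ := g) hf hg
        have h : c + (q : ℚ) + (d + r) = c + d + ((q + r : ℚ≥0) : ℚ) := by push_cast; ring
        rwa [h] at this) hF.1 hG.1 q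
  · intro q
    let ev := AddMonoidAlgebra.mapRingHom ℚ≥0 (aeval x : MvPolynomial ι A →ₐ[A] A).toRingHom
    have hev : ∀ (Θ : AddMonoidAlgebra (MvPolynomial ι A) ℚ≥0) q,
        (ev Θ).coeff q = aeval x (Θ.coeff q) := fun Θ q =>
      AddMonoidAlgebra.coeff_mapRingHom _ _ _
    rw [← hev, map_mul]
    have h1 : F * G - ev Ψ * ev Ξ = G * (F - ev Ψ) + ev Ψ * (G - ev Ξ) := by ring
    have h2 := coeff_mul_mem_wIdealGt (F := G) (G := F - ev Ψ) (hG.coeff_mem hL)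
      (fun q : ℚ≥0 => by have := hF.2 q; rwa [← hev] at this) q
    have h3 := coeff_mul_mem_wIdealGt (F := ev Ψ) (G := G - ev Ξ)
      (fun q : ℚ≥0 => by rw [hev]; exact aeval_mem_wIdeal hL (hF.1 q))
      (fun q : ℚ≥0 => by have := hG.2 q; rwa [← hev] at this) q
    rw [add_comm d c] at h2
    have h4 := Ideal.add_mem _ h2 h3
    have h5 : (F * G).coeff q - (ev Ψ * ev Ξ).coeff q = (F * G - ev Ψ * ev Ξ).coeff q := rfl
    rw [h5, h1]
    exact h4

theorem IsLeading.pow (hL : ∀ y, y ∈ L ↔ ∃ i, y = (x i, a i)) {c : ℚ} {F : TAlg A}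
    {Ψ : AddMonoidAlgebra (MvPolynomial ι A) ℚ≥0} (hF : IsLeading x a L c F Ψ) (m : ℕ) :
    IsLeading x a L (m * c) (F ^ m) (Ψ ^ m) := by
  classical
  induction m with
  | zero =>
    simp only [pow_zero, Nat.cast_zero, zero_mul]
    rw [AddMonoidAlgebra.one_def, AddMonoidAlgebra.one_def]
    constructor
    · intro q
      rw [AddMonoidAlgebra.coeff_single, Finsupp.single_apply]
      split_ifs with h
      · rw [← h]; simpa using isWeightedHomogeneous_one A _
      · exact isWeightedHomogeneous_zero A _ _
    · intro q
      rw [AddMonoidAlgebra.coeff_single, AddMonoidAlgebra.coeff_single, Finsupp.single_apply,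
        Finsupp.single_apply]
      split_ifs <;> simp
  | succ m ih =>
    rw [pow_succ, pow_succ]
    have := ih.mul hL hF
    convert this using 1
    push_cast; ring

theorem exists_isLeading (hL : ∀ y, y ∈ L ↔ ∃ i, y = (x i, a i)) {c : ℚ} {F : TAlg A}
    (hF : ∀ q : ℚ≥0, F.coeff q ∈ wIdeal L (c + q)) : ∃ Ψ, IsLeading x a L c F Ψ := by
  classical
  choose Φ h1 h2 using fun q : ℚ≥0 => exists_leadingForm hL (hF q)
  have hc : ∀ q, (∑ r ∈ F.coeff.support, AddMonoidAlgebra.single r (Φ r)).coeff q =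
      if q ∈ F.coeff.support then Φ q else 0 := by
    intro q
    rw [AddMonoidAlgebra.coeff_sum, Finsupp.finsetSum_apply]
    simp [AddMonoidAlgebra.coeff_single, Finsupp.single_apply]
  refine ⟨∑ r ∈ F.coeff.support, AddMonoidAlgebra.single r (Φ r), fun q => ?_, fun q => ?_⟩
  · rw [hc]
    split_ifs
    · exact h1 q
    · exact isWeightedHomogeneous_zero A _ _
  · rw [hc]
    split_ifs with h
    · exact h2 q
    · rw [Finsupp.notMem_support_iff.1 h]; simp

variable [DecidableEq ι]

/-- The associated graded ring of a monomial filtration is reduced. -/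
theorem coeff_mem_wIdealGt_of_pow [CharZero K] (hδ : ∀ i j, δ i (x j) = if i = j then 1 else 0)
    (ha : ∀ i, 0 < a i)
    (hL : ∀ y, y ∈ L ↔ ∃ i, y = (x i, a i)) {P : Ideal A} [P.IsPrime] (hP : ∀ i, x i ∈ P)
    (hPL : P ≤ wIdealGt L 0) {c : ℚ} {F : TAlg A} (hF : ∀ q : ℚ≥0, F.coeff q ∈ wIdeal L (c + q))
        {m : ℕ}
    (hm : ∀ q : ℚ≥0, (F ^ m).coeff q ∈ wIdealGt L (m * c + q)) (q : ℚ≥0) :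
    F.coeff q ∈ wIdealGt L (c + q) := by
  obtain ⟨Ψ, hΨ⟩ := exists_isLeading hL hF
  let ρ := AddMonoidAlgebra.mapRingHom ℚ≥0 (map (σ := ι) (Ideal.Quotient.mk P))
  -- by quasi-regularity, the leading form of `F ^ m` vanishes modulo `P`
  have h0 : ρ Ψ ^ m = 0 := by
    rw [← map_pow, ← AddMonoidAlgebra.coeff_inj]
    ext r α
    rw [AddMonoidAlgebra.coeff_mapRingHom, coeff_map]
    refine Ideal.Quotient.eq_zero_iff_mem.2 (coeff_mem_of_aeval_mem hδ ha hL hP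
      ((hΨ.pow hL m).1 r) ?_ α)
    have := Ideal.sub_mem _ (hm r) ((hΨ.pow hL m).2 r)
    rwa [sub_sub_cancel] at this
  -- `(A ⧸ P)[X][t^ℚ≥0]` is reduced
  have h1 : ρ Ψ = 0 := IsReduced.eq_zero _ ⟨m, h0⟩
  have h2 : ∀ α, coeff α (Ψ.coeff q) ∈ P := fun α => by
    rw [← Ideal.Quotient.eq_zero_iff_mem, ← coeff_map, ← AddMonoidAlgebra.coeff_mapRingHom]
    change coeff α ((ρ Ψ).coeff q) = 0
    rw [h1]
    rfl
  have h3 := Ideal.add_mem _ (hΨ.2 q) (aeval_mem_wIdealGt hL hPL (hΨ.1 q) h2)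
  rwa [sub_add_cancel] at h3

/-- The monomial filtration of a part of a system of parameters defines an integrally closed
algebra. -/
theorem mem_filtAlg_of_isIntegral [CharZero K] (hδ : ∀ i j, δ i (x j) = if i = j then 1 else 0)
    (ha : ∀ i, 0 < a i)
    (hL : ∀ y, y ∈ L ↔ ∃ i, y = (x i, a i)) {P : Ideal A} [P.IsPrime] (hP : ∀ i, x i ∈ P)
    (hPL : P ≤ wIdealGt L 0) {F : TAlg A}
    (hF : IsIntegral (filtAlg _ (isFiltration_wIdeal L).isMulFamily) F) :
    F ∈ filtAlg _ (isFiltration_wIdeal L).isMulFamily := by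
  classical
  obtain ⟨p, hp, hpF⟩ := hF
  -- `F ^ m` is a combination of smaller powers of `F`
  have hFm : F ^ p.natDegree = -∑ i ∈ Finset.range p.natDegree, (p.coeff i : TAlg A) * F ^ i := by
    rw [hp.as_sum] at hpF
    simp only [Polynomial.eval₂_add, Polynomial.eval₂_X_pow, Polynomial.eval₂_finsetSum,
      Polynomial.eval₂_mul, Polynomial.eval₂_C] at hpF
    exact eq_neg_of_add_eq_zero_left hpF
  -- all weights and all degrees which occur in `F` lie in `(1 / N) ℤ`
  obtain ⟨N, hN, hden⟩ := exists_common_denominator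
    ((L : Multiset (A × ℚ≥0)).map (fun y => 1 / (y.2 : ℚ)) +
        (F.coeff.support.val.map fun q : ℚ≥0 => (q : ℚ) : Multiset ℚ))
  have hN' : (0 : ℚ) < N := by exact_mod_cast hN
  have hLN : ∀ y ∈ L, ∃ k : ℤ, 1 / (y.2 : ℚ) * N = k := fun y hy =>
    hden _ (Multiset.mem_add.2 (Or.inl (Multiset.mem_map.2 ⟨y, hy, rfl⟩)))
  have hFN : ∀ q ∈ F.coeff.support, ∃ k : ℤ, (q : ℚ) * N = k := fun q hq =>
    hden _ (Multiset.mem_add.2 (Or.inr (Multiset.mem_map.2 ⟨q, hq, rfl⟩)))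
  have hpow : ∀ c, (∀ q : ℚ≥0, F.coeff q ∈ wIdeal L (c + q)) → ∀ (i : ℕ) (q : ℚ≥0),
      (F ^ i).coeff q ∈ wIdeal L (i * c + q) := by
    intro c hc i
    obtain ⟨Ψ, hΨ⟩ := exists_isLeading hL hc
    exact (hΨ.pow hL i).coeff_mem hL
  -- the weight bound may be improved as long as it is negative
  have step : ∀ k : ℕ, (∀ q : ℚ≥0, F.coeff q ∈ wIdeal L (-((k + 1 : ℕ) : ℚ) / N + q)) →
      ∀ q : ℚ≥0, F.coeff q ∈ wIdeal L (-(k : ℚ) / N + q) := by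
    intro k hk q
    have hneg : -((k + 1 : ℕ) : ℚ) / N < 0 := div_neg_of_neg_of_pos (by push_cast; linarith) hN'
    have h1 := coeff_mem_wIdealGt_of_pow hδ ha hL hP hPL hk (m := p.natDegree) (fun q : ℚ≥0 => by
      rw [hFm]
      change -(∑ i ∈ Finset.range p.natDegree, (p.coeff i : TAlg A) * F ^ i).coeff q ∈ _
      rw [AddMonoidAlgebra.coeff_sum, Finsupp.finsetSum_apply]
      refine Ideal.neg_mem_iff _ |>.2 (Ideal.sum_mem _ fun i hi => ?_)
      have h2 := coeff_mul_mem_wIdeal (c := 0) (F := (p.coeff i : TAlg A)) (fun q : ℚ≥0 => by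
        simpa using (p.coeff i).2 q) (hpow _ hk i) q
      refine ⟨_, ?_, h2⟩
      have h3 : (i : ℚ) + 1 ≤ p.natDegree := by exact_mod_cast Finset.mem_range.1 hi
      nlinarith) q
    by_cases hq : q ∈ F.coeff.support
    · obtain ⟨l, hl⟩ := hFN q hq
      have h2 := wIdealGt_le_of_denominator hN hLN (q := -((k + 1 : ℕ) : ℚ) / N + q)
        ⟨-((k + 1 : ℕ) : ℤ) + l, by
          rw [add_mul, div_mul_cancel₀ _ hN'.ne', hl]; push_cast; ring⟩ h1
      refine (isFiltration_wIdeal L).antitone (le_of_eq ?_) h2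
      push_cast
      field_simp
      ring
    · rw [Finsupp.notMem_support_iff.1 hq]; exact Ideal.zero_mem _
  -- a very negative bound holds trivially
  obtain ⟨k, hk⟩ : ∃ k : ℕ, ∀ q ∈ F.coeff.support, (q : ℚ) ≤ k / N := by
    refine ⟨⌈((F.coeff.support.sup id : ℚ≥0) : ℚ) * N⌉₊, fun q hq => ?_⟩
    rw [le_div_iff₀ hN']
    refine le_trans ?_ (Nat.le_ceil _)
    refine mul_le_mul_of_nonneg_right ?_ hN'.le
    exact_mod_cast Finset.le_sup (f := id) hq
  have start : ∀ q : ℚ≥0, F.coeff q ∈ wIdeal L (-(k : ℚ) / N + q) := by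
    intro q
    by_cases hq : q ∈ F.coeff.support
    · rw [(isFiltration_wIdeal L).eq_top]
      · exact Submodule.mem_top
      · have := hk q hq
        rw [neg_div]; linarith
    · rw [Finsupp.notMem_support_iff.1 hq]; exact Ideal.zero_mem _
  have fin : ∀ k : ℕ, (∀ q : ℚ≥0, F.coeff q ∈ wIdeal L (-(k : ℚ) / N + q)) →
      ∀ q : ℚ≥0, F.coeff q ∈ wIdeal L q := by
    intro k
    induction k with
    | zero => intro h q; simpa using h q
    | succ k ih => intro h; exact ih (step k h)
  exact fin k start

end UpperBound

section Centers

variable {A : Type u} [CommRing A]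

/-- The algebra `⨁ I_q t^q`, where `I_q` is the degree `q` part of the monomial filtration. -/
def monoAlg (L : List (A × ℚ≥0)) : Subalgebra A (TAlg A) :=
  filtAlg _ (isFiltration_wIdeal L).isMulFamily

theorem mono_mem_monoAlg {L : List (A × ℚ≥0)} {q : ℚ≥0} {f : A} :
    mono q f ∈ monoAlg L ↔ f ∈ wIdeal L q :=
  mono_mem_filtAlg (hJ := (isFiltration_wIdeal L).isMulFamily)

theorem isHomog_monoAlg (L : List (A × ℚ≥0)) : IsHomog (monoAlg L) := isHomog_filtAlg _

theorem monoAlg_congr {L L' : List (A × ℚ≥0)} (h : ∀ q, wIdeal L q = wIdeal L' q) :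
    monoAlg L = monoAlg L' := by
  ext F
  change (∀ q : ℚ≥0, F.coeff q ∈ wIdeal L q) ↔ (∀ q : ℚ≥0, F.coeff q ∈ wIdeal L' q)
  simp_rw [h]

/-- The group generated by the weights. -/
def weightGroup (L : List (A × ℚ≥0)) : AddSubgroup ℚ :=
  AddSubgroup.closure {q : ℚ | ∃ y ∈ L, q = 1 / (y.2 : ℚ)}

theorem weightedAlg_le_monoAlg (L : List (A × ℚ≥0)) : weightedAlg L ≤ monoAlg L := by
  refine Algebra.adjoin_le ?_
  rintro _ ⟨y, hy, rfl⟩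
  exact mono_mem_monoAlg.2 (mem_wIdeal hy (by simp))

theorem isHomog_weightedAlg (L : List (A × ℚ≥0)) : IsHomog (weightedAlg L) :=
  isHomog_adjoin (by rintro _ ⟨y, -, rfl⟩; exact ⟨_, _, rfl⟩)

theorem weightedAlg_le_supportedIn (L : List (A × ℚ≥0)) :
    weightedAlg L ≤ supportedIn A (weightGroup L) := by
  refine Algebra.adjoin_le ?_
  rintro _ ⟨y, hy, rfl⟩
  exact mono_mem_supportedIn.2 fun _ => AddSubgroup.subset_closure ⟨y, hy, by push_cast; rfl⟩

theorem degreeGroup_weightedAlg {L : List (A × ℚ≥0)} (h : ∀ y ∈ L, y.1 ≠ 0) :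
    degreeGroup (weightedAlg L) = weightGroup L := by
  apply le_antisymm
  · exact (degreeGroup_le_iff (isHomog_weightedAlg L)).2 (weightedAlg_le_supportedIn L)
  · refine (AddSubgroup.closure_le _).2 ?_
    rintro _ ⟨y, hy, rfl⟩
    exact AddSubgroup.subset_closure ⟨1 / y.2, by push_cast; rfl, y.1, h y hy,
      Algebra.subset_adjoin ⟨y, hy, rfl⟩⟩

theorem multiset_prod_mono_mem_weightedAlg {L : List (A × ℚ≥0)} (M : Multiset (A × ℚ≥0))
    (hM : ∀ y ∈ M, y ∈ L) :
    mono (M.map fun y => 1 / y.2).sum (M.map Prod.fst).prod ∈ weightedAlg L := by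
  induction M using Multiset.induction_on with
  | empty => simpa using mono_zero_mem (weightedAlg L) (1 : A)
  | cons y M ih =>
    rw [Multiset.map_cons, Multiset.map_cons, Multiset.sum_cons, Multiset.prod_cons,
      ← mono_mul_mono]
    exact mul_mem (Algebra.subset_adjoin ⟨y, hM y (Multiset.mem_cons_self _ _), rfl⟩)
      (ih fun z hz => hM z (Multiset.mem_cons_of_mem hz))

/-- A monomial of too large weight is a root of a monomial of the right weight. -/
theorem isIntegral_mono {S : Subalgebra A (TAlg A)} {q s : ℚ≥0} (hqs : q ≤ s) {f : A}
    (hf : mono s f ∈ S) : IsIntegral S (mono q f) := by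
  rcases eq_or_ne q 0 with rfl | hq
  · exact isIntegral_algebraMap (x := (⟨mono 0 f, mono_zero_mem S f⟩ : S))
  have hs : s ≠ 0 := fun h => hq (le_antisymm (h ▸ hqs) (zero_le))
  have hv : (q / s).den ≠ 0 := (q / s).den_ne_zero
  have hle : q / s ≤ 1 := div_le_one_of_le₀ hqs (zero_le)
  have huv : (q / s).num ≤ (q / s).den := by
    have h1 := NNRat.num_div_den (q / s)
    rw [← h1, div_le_one (by positivity)] at hle
    exact_mod_cast hle
  have h2 : ((q / s).den : ℚ≥0) * q = (q / s).num * s := by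
    have h1 := NNRat.num_div_den (q / s)
    have h3 : ((q / s).den : ℚ≥0) ≠ 0 := by exact_mod_cast hv
    field_simp at h1
    rw [mul_comm, ← h1, mul_comm]
  refine IsIntegral.of_pow (Nat.pos_of_ne_zero hv) ?_
  have h4 : mono q f ^ (q / s).den ∈ S := by
    have h5 : mono q f ^ (q / s).den =
        mono s f ^ (q / s).num * mono 0 (f ^ ((q / s).den - (q / s).num)) := by
      rw [mono_pow, mono_pow, mono_mul_mono, ← pow_add, Nat.add_sub_cancel' huv, h2, add_zero]
    rw [h5]
    exact mul_mem (pow_mem hf _) (mono_zero_mem S _)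
  exact isIntegral_algebraMap (x := (⟨_, h4⟩ : S))

theorem isIntegral_of_le {S S' : Subalgebra A (TAlg A)} (h : S ≤ S') {F : TAlg A}
    (hF : IsIntegral S F) : IsIntegral S' F := by
  obtain ⟨p, hp, hpF⟩ := hF
  refine ⟨p.map (Subalgebra.inclusion h).toRingHom, hp.map _, ?_⟩
  rw [Polynomial.eval₂_map]
  exact hpF

theorem coe_weight_sum {α : Type*} (M : Multiset (α × ℚ≥0)) :
    (((M.map fun y => 1 / y.2).sum : ℚ≥0) : ℚ) = (M.map fun y => 1 / (y.2 : ℚ)).sum := by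
  induction M using Multiset.induction_on with
  | empty => simp
  | cons y M ih =>
    rw [Multiset.map_cons, Multiset.map_cons, Multiset.sum_cons, Multiset.sum_cons, ← ih]
    push_cast
    rfl

theorem monoAlg_le_integralClosure {L : List (A × ℚ≥0)} {S : Subalgebra A (TAlg A)}
    (hS : weightedAlg L ≤ S) {F : TAlg A} (hF : F ∈ monoAlg L) : IsIntegral S F := by
  rw [← sum_mono F, Finsupp.sum]
  refine IsIntegral.sum _ fun q _ => ?_
  have h : F.coeff q ∈ wIdeal L q := hF q
  refine Submodule.span_induction (p := fun f _ => IsIntegral S (mono q f)) ?_ ?_ ?_ ?_ h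
  · rintro _ ⟨M, hM, hq, rfl⟩
    have hqs : q ≤ (M.map fun y => 1 / y.2).sum := by
      have h1 := coe_weight_sum M
      rw [← h1] at hq
      exact_mod_cast hq
    exact isIntegral_mono hqs (hS (multiset_prod_mono_mem_weightedAlg M hM))
  · simpa [mono] using isIntegral_zero
  · intro f g _ _ hf hg
    rw [mono_add]; exact hf.add hg
  · intro r f _ hf
    have : mono q (r • f) = mono 0 r * mono q f := by rw [mono_mul_mono, zero_add]; rfl
    rw [this]
    exact (isIntegral_algebraMap (x := (⟨mono 0 r, mono_zero_mem S r⟩ : S))).mul hf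

end Centers

section Params

variable {K : Type u} [Field K] {A : Type u} [CommRing A] [Algebra K A] {𝔪 : Ideal A} {n : ℕ}

namespace CoordSystem

variable (c : CoordSystem K A 𝔪 n)

theorem paramIdeal_le_maximal {τ : Finset (Fin n)} (hτ : τ ⊆ c.vanishing) :
    c.paramIdeal τ ≤ 𝔪 := c.paramIdeal_le.2 fun _ hi => c.mem_vanishing.1 (hτ hi)

/-- The ideal generated by a part of a system of parameters is prime. -/
theorem isPrime_paramIdeal [CharZero K] [IsLocalRing A] [IsNoetherianRing A]
    (h𝔪 : 𝔪 = IsLocalRing.maximalIdeal A) {τ : Finset (Fin n)} (hτ : τ ⊆ c.vanishing) :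
    (c.paramIdeal τ).IsPrime := by
  have hne : c.paramIdeal τ ≠ ⊤ := fun h => by
    have := c.paramIdeal_le_maximal hτ
    rw [h, top_le_iff] at this
    exact Ideal.IsPrime.ne_top (I := 𝔪) (h𝔪 ▸ inferInstance) this
  have : Nontrivial (A ⧸ c.paramIdeal τ) := Ideal.Quotient.nontrivial_iff.2 hne
  have : IsLocalRing (A ⧸ c.paramIdeal τ) :=
    IsLocalRing.of_surjective' (Ideal.Quotient.mk _) Ideal.Quotient.mk_surjective
  obtain ⟨n', ⟨e⟩⟩ := exists_enum τ
  rw [← Ideal.Quotient.isDomain_iff_prime]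
  exact (c.quot _ τ rfl e).isDomain (maximalIdeal_quot h𝔪)

theorem ne_zero_of_extends [Nontrivial A] {l : List A} (h : c.Extends l) {x : A} (hx : x ∈ l) :
    x ≠ 0 := by
  rintro rfl
  obtain ⟨⟨i, hi⟩, -⟩ := h.2 _ hx
  have := c.der_apply i i
  rw [hi, map_zero, if_pos rfl] at this
  exact zero_ne_one this

/-- The indices of the members of a partial system of parameters. -/
theorem exists_indices {l : List A} (h : c.Extends l) : ∃ τ : Finset (Fin n), τ ⊆ c.vanishing ∧
    (∀ i, i ∈ τ ↔ c.z i ∈ l) ∧ Ideal.span {x | x ∈ l} = c.paramIdeal τ := by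
  classical
  refine ⟨Finset.univ.filter fun i => c.z i ∈ l, fun i hi => ?_, fun i => by simp, ?_⟩
  · exact c.mem_vanishing.2 (h.2 _ (by simpa using hi)).2
  · rw [paramIdeal]
    congr 1
    ext x
    constructor
    · intro hx
      obtain ⟨⟨i, rfl⟩, -⟩ := h.2 x hx
      exact ⟨i, by simpa using hx, rfl⟩
    · rintro ⟨i, hi, rfl⟩
      simpa using hi

theorem degreeGroup_weightedAlg [Nontrivial A] {L : List (A × ℚ≥0)}
    (hL : c.Extends (L.map Prod.fst)) :
    degreeGroup (weightedAlg L) = weightGroup L :=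
  WeightedCenters.degreeGroup_weightedAlg fun _ hy =>
    c.ne_zero_of_extends hL (List.mem_map_of_mem hy)

variable [CharZero K] [IsLocalRing A] [IsNoetherianRing A]

/-- The monomial filtration of a weighted partial system of parameters is integrally closed. -/
theorem mem_monoAlg_of_isIntegral (h𝔪 : 𝔪 = IsLocalRing.maximalIdeal A) {L : List (A × ℚ≥0)}
    (hL : c.Extends (L.map Prod.fst)) (ha : ∀ y ∈ L, 0 < y.2) {S : Subalgebra A (TAlg A)}
    (hS : S ≤ monoAlg L) {F : TAlg A} (hF : IsIntegral S F) : F ∈ monoAlg L := by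
  classical
  obtain ⟨τ, hτ, hτL, hspan⟩ := c.exists_indices hL
  have hprime := c.isPrime_paramIdeal h𝔪 hτ
  have hmem : ∀ i : Fin L.length, (L.get i).1 ∈ L.map Prod.fst := fun i =>
    List.mem_map_of_mem (List.get_mem L i)
  choose σ hσ using fun i => (hL.2 _ (hmem i)).1
  have hinj : Function.Injective fun i : Fin L.length => (L.get i).1 := by
    intro i j hij
    have := hL.1
    rw [List.nodup_iff_injective_get] at this
    have h1 := @this (Fin.cast (by simp) i) (Fin.cast (by simp) j) (by simpa using hij)
    simpa [Fin.ext_iff] using h1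
  have hδ : ∀ i j : Fin L.length, c.der (σ i) (L.get j).1 = if i = j then 1 else 0 := by
    intro i j
    rw [← hσ j, c.der_apply]
    refine if_congr ⟨fun h => hinj ?_, fun h => by rw [h]⟩ rfl rfl
    change (L.get i).1 = (L.get j).1
    rw [← hσ i, ← hσ j, h]
  refine mem_filtAlg_of_isIntegral (ι := Fin L.length) (x := fun i => (L.get i).1)
    (δ := fun i => c.der (σ i)) (a := fun i => (L.get i).2) hδ (fun i => ha _ (List.get_mem L i))
    (fun y => by
      rw [List.mem_iff_get]
      exact ⟨fun ⟨i, hi⟩ => ⟨i, hi.symm⟩, fun ⟨i, hi⟩ => ⟨i, hi.symm⟩⟩) (P := c.paramIdeal τ)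
    (fun i => ?_) ?_ (isIntegral_of_le hS hF)
  · rw [← hspan]; exact Ideal.subset_span (hmem i)
  · rw [← hspan, Ideal.span_le]
    intro x hx
    obtain ⟨y, hy, rfl⟩ := List.mem_map.1 hx
    have := ha y hy
    exact ⟨1 / y.2, by positivity, mem_wIdeal hy le_rfl⟩

theorem intClosureIn_eq (h𝔪 : 𝔪 = IsLocalRing.maximalIdeal A) {L : List (A × ℚ≥0)}
    (hL : c.Extends (L.map Prod.fst)) (ha : ∀ y ∈ L, 0 < y.2) {S : Subalgebra A (TAlg A)}
    (hS : S ≤ monoAlg L) (hS' : weightedAlg L ≤ S) (G : AddSubgroup ℚ) :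
    intClosureIn G S = monoAlg L ⊓ supportedIn A G := by
  rw [intClosureIn]
  congr 1
  apply le_antisymm
  · intro F hF
    exact c.mem_monoAlg_of_isIntegral h𝔪 hL ha hS hF
  · intro F hF
    exact monoAlg_le_integralClosure hS' hF

/-- The center is the part of the monomial algebra with degrees in the group of the weights. -/
theorem center_eq (h𝔪 : 𝔪 = IsLocalRing.maximalIdeal A) {L : List (A × ℚ≥0)}
    (hL : c.Extends (L.map Prod.fst)) (ha : ∀ y ∈ L, 0 < y.2) :
    center L = monoAlg L ⊓ supportedIn A (weightGroup L) := by
  rw [center, c.intClosureIn_eq h𝔪 hL ha (weightedAlg_le_monoAlg L) le_rfl,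
    c.degreeGroup_weightedAlg hL]

theorem weightedAlg_le_center (h𝔪 : 𝔪 = IsLocalRing.maximalIdeal A) {L : List (A × ℚ≥0)}
    (hL : c.Extends (L.map Prod.fst)) (ha : ∀ y ∈ L, 0 < y.2) : weightedAlg L ≤ center L := by
  rw [c.center_eq h𝔪 hL ha]
  exact le_inf (weightedAlg_le_monoAlg L) (weightedAlg_le_supportedIn L)

theorem degreeGroup_center (h𝔪 : 𝔪 = IsLocalRing.maximalIdeal A) {L : List (A × ℚ≥0)}
    (hL : c.Extends (L.map Prod.fst)) (ha : ∀ y ∈ L, 0 < y.2) :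
    degreeGroup (center L) = weightGroup L := by
  apply le_antisymm
  · rw [c.center_eq h𝔪 hL ha]
    exact (degreeGroup_le_iff ((isHomog_monoAlg L).inf (isHomog_supportedIn _))).2 inf_le_right
  · rw [← c.degreeGroup_weightedAlg hL]
    exact degreeGroup_mono (c.weightedAlg_le_center h𝔪 hL ha)

theorem intFor_center (h𝔪 : 𝔪 = IsLocalRing.maximalIdeal A) {L : List (A × ℚ≥0)}
    (hL : c.Extends (L.map Prod.fst)) (ha : ∀ y ∈ L, 0 < y.2) (R : Subalgebra A (TAlg A)) :
    IntFor R (center L) = monoAlg L ⊓ supportedIn A (degreeGroup R ⊔ weightGroup L) := by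
  rw [IntFor, c.degreeGroup_center h𝔪 hL ha, c.intClosureIn_eq h𝔪 hL ha ?_
    (c.weightedAlg_le_center h𝔪 hL ha)]
  rw [c.center_eq h𝔪 hL ha]
  exact inf_le_left

/-- A center is admissible if and only if the algebra lies in the monomial algebra. -/
theorem admissible_center_iff (h𝔪 : 𝔪 = IsLocalRing.maximalIdeal A) {L : List (A × ℚ≥0)}
    (hL : c.Extends (L.map Prod.fst)) (ha : ∀ y ∈ L, 0 < y.2) {R : Subalgebra A (TAlg A)}
    (hR : IsHomog R) : Admissible R (center L) ↔ R ≤ monoAlg L := by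
  rw [Admissible, c.intFor_center h𝔪 hL ha, le_inf_iff]
  exact and_iff_left ((le_supportedIn hR).trans (supportedIn_mono le_sup_left))

theorem intPart_eq (h𝔪 : 𝔪 = IsLocalRing.maximalIdeal A) {bl : List (List A × ℚ≥0)}
    (hL : c.Extends ((coords bl).map Prod.fst)) (ha : ∀ y ∈ coords bl, 0 < y.2)
    (S : Subalgebra A (TAlg A)) :
    intPart S bl = monoAlg (coords bl) ⊓
      supportedIn A (degreeGroup S ⊔ weightGroup (coords bl)) := by
  rw [intPart, IntFor, c.degreeGroup_weightedAlg hL,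
    c.intClosureIn_eq h𝔪 hL ha (weightedAlg_le_monoAlg _) le_rfl]

end CoordSystem

end Params

/-! ### Maximal contact -/

section Contact

theorem floor_mul_add_le (p q : ℚ≥0) : ⌊p + q⌋₊ ≤ ⌈p⌉₊ + ⌊q⌋₊ := by
  have h1 : p + q ≤ (⌈p⌉₊ : ℚ≥0) + q := by gcongr; exact Nat.le_ceil p
  have h2 := Nat.floor_le_floor h1
  rw [add_comm ((⌈p⌉₊ : ℕ) : ℚ≥0), Nat.floor_add_natCast (zero_le)] at h2
  omega

theorem floor_add_le' (p q : ℚ≥0) : ⌊p + q⌋₊ ≤ ⌊p⌋₊ + ⌊q⌋₊ + 1 := by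
  have := floor_mul_add_le p q
  have := Nat.ceil_le_floor_add_one p
  omega

theorem isMulFamily_contact {A : Type u} [CommRing A] {𝔪 : Ideal A} (X : Ideal A) (hX : X ≤ 𝔪)
    (a : ℚ≥0) :
    IsMulFamily fun b : ℚ≥0 => X ^ ⌈b * a⌉₊ ⊔ 𝔪 ^ (⌊b * a⌋₊ + 1) where
  zero := by simp
  mul_le b d := by
    rw [Ideal.sup_mul, Ideal.mul_sup, Ideal.mul_sup, ← pow_add, ← pow_add, add_mul]
    have hXm : ∀ l, X ^ l ≤ 𝔪 ^ l := fun l => Ideal.pow_right_mono hX l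
    refine sup_le (sup_le ?_ ?_) (sup_le ?_ ?_)
    · exact le_sup_of_le_left (Ideal.pow_le_pow_right (Nat.ceil_add_le _ _))
    · refine le_sup_of_le_right ((Ideal.mul_mono_left (hXm _)).trans ?_)
      rw [← pow_add]
      refine Ideal.pow_le_pow_right ?_
      have := floor_mul_add_le (b * a) (d * a)
      omega
    · refine le_sup_of_le_right ((Ideal.mul_mono_right (hXm _)).trans ?_)
      rw [← pow_add]
      refine Ideal.pow_le_pow_right ?_
      have := floor_mul_add_le (d * a) (b * a)
      rw [add_comm (d * a)] at this
      omega
    · refine le_sup_of_le_right (Ideal.pow_le_pow_right ?_)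
      have := floor_add_le' (b * a) (d * a)
      omega

variable {K : Type u} [Field K] [CharZero K] {A : Type u} [CommRing A] [Algebra K A]
  [IsLocalRing A] {𝔪 : Ideal A} {E : Set (Ideal A)}

theorem le_of_span_ne_top (h𝔪 : 𝔪 = IsLocalRing.maximalIdeal A) {s : Set A}
    (h : Ideal.span s ≠ ⊤) {f : A} (hf : f ∈ s) : f ∈ 𝔪 := by
  rw [h𝔪]
  exact IsLocalRing.le_maximalIdeal h (Ideal.subset_span hf)

variable [IsNoetherianRing A]

/-- An element of degree `b` has at least the order `b a`. -/
theorem IsOrder.mem_pow (h𝔪 : 𝔪 = IsLocalRing.maximalIdeal A) {S : Subalgebra A (TAlg A)} {a : ℚ≥0}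
    (h : IsOrder 𝔪 S a) {b : ℚ≥0} {f : A} (hf : mono b f ∈ S) : f ∈ 𝔪 ^ ⌈b * a⌉₊ := by
  rcases eq_or_ne f 0 with rfl | hf0
  · exact Ideal.zero_mem _
  rcases eq_or_ne b 0 with rfl | hb
  · simp
  obtain ⟨n, hn, hn'⟩ := exists_order h𝔪 hf0
  have h1 := h.2 ⟨b, f, n, pos_iff_ne_zero.2 hb, hf, hn, hn', rfl⟩
  refine Ideal.pow_le_pow_right (Nat.ceil_le.2 ?_) hn
  rwa [le_div_iff₀ (pos_iff_ne_zero.2 hb), mul_comm] at h1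

/-- If `x` is a maximal contact for `S`, then, up to terms of higher order, the elements of `S` are
polynomials in `x`. -/
theorem IsMaximalContact.mem (h𝔪 : 𝔪 = IsLocalRing.maximalIdeal A) {S : Subalgebra A (TAlg A)}
    {a : ℚ≥0} {x : List A} (h : IsMaximalContact K 𝔪 E S a x) {b : ℚ≥0} {g : A}
    (hg : mono b g ∈ S) :
    g ∈ Ideal.span {y | y ∈ x} ^ ⌈b * a⌉₊ ⊔ 𝔪 ^ (⌊b * a⌋₊ + 1) := by
  obtain ⟨hord, -, n, c, s, f, d, -, hcx, hS, -, -, hrest⟩ := h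
  have hx𝔪 : Ideal.span {y | y ∈ x} ≤ 𝔪 := by
    rw [Ideal.span_le]
    exact fun y hy => (hcx.2 y hy).2
  obtain ⟨σ, hσ, hσx, hspan⟩ := c.exists_indices hcx
  have hfam := isMulFamily_contact (𝔪 := 𝔪) _ hx𝔪 a
  have hle : S ≤ filtAlg _ hfam := by
    rw [hS]
    refine adjoin_mono_le_filtAlg fun j => ?_
    have hj : mono (d j) (f j) ∈ S := by rw [hS]; exact Algebra.subset_adjoin ⟨j, rfl⟩
    have hfj := hord.mem_pow h𝔪 hj
    by_cases hint : ((⌊d j * a⌋₊ : ℕ) : ℚ≥0) = d j * a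
    · have h1 : ⌈d j * a⌉₊ = ⌊d j * a⌋₊ := by rw [← hint]; simp
      rw [h1] at hfj ⊢
      rw [hspan]
      refine c.mem_pow_sup_of_der_mem hfj fun α i hi hiσ hα => ?_
      refine le_of_span_ne_top h𝔪 (hrest i (c.mem_vanishing.1 hi) fun hix => hiσ ((hσx i).2 hix))
        ⟨_, Ideal.subset_span ⟨j, α, ?_, rfl⟩, rfl⟩
      rw [← hint, ← hα]; push_cast; rfl
    · refine Ideal.mem_sup_right (Ideal.pow_le_pow_right ?_ hfj)
      have h2 := lt_of_le_of_ne (Nat.floor_le (zero_le : (0 : ℚ≥0) ≤ d j * a)) hint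
      exact Nat.succ_le_of_lt (Nat.lt_ceil.2 h2)
  exact mono_mem_filtAlg.1 (hle hg)

theorem IsMaximalContact.ne_nil (h𝔪 : 𝔪 = IsLocalRing.maximalIdeal A) {S : Subalgebra A (TAlg A)}
    {a : ℚ≥0} (ha : 0 < a) {x : List A} (h : IsMaximalContact K 𝔪 E S a x) : x ≠ [] := by
  rintro rfl
  obtain ⟨b, f, m, hb, hf, hm, hm', hab⟩ := h.1.1
  have h1 := h.mem h𝔪 hf
  have hm2 : b * a = m := by rw [hab]; field_simp
  have hm0 : m ≠ 0 := by
    rintro rfl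
    rw [Nat.cast_zero] at hm2
    exact (mul_pos hb ha).ne' hm2
  rw [hm2] at h1
  simp only [List.not_mem_nil, Nat.ceil_natCast, Nat.floor_natCast] at h1
  have h2 : Ideal.span {y : A | False} = ⊥ := by simp
  rw [h2, ← Ideal.zero_eq_bot, zero_pow hm0, Ideal.zero_eq_bot, bot_sup_eq] at h1
  exact hm' h1

end Contact

/-! ### Blocks and coordinates -/

section Blocks

variable {A : Type u} [CommRing A]

theorem coords_append {A : Type u} (bl bl' : List (List A × ℚ≥0)) :
    coords (bl ++ bl') = coords bl ++ coords bl' :=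
  List.flatMap_append

theorem coords_singleton {A : Type u} (x : List A) (a : ℚ≥0) :
    coords [(x, a)] = x.map fun y => (y, a) := by
  simp [coords]

theorem mem_coords_fst {A : Type u} {bl : List (List A × ℚ≥0)} {x : A} :
    x ∈ (coords bl).map Prod.fst ↔ ∃ y ∈ bl, x ∈ y.1 := by
  simp only [coords, List.mem_map, List.mem_flatMap]
  constructor
  · rintro ⟨_, ⟨y, hy, z, hz, rfl⟩, rfl⟩
    exact ⟨y, hy, hz⟩
  · rintro ⟨y, hy, hx⟩
    exact ⟨_, ⟨y, hy, x, hx, rfl⟩, rfl⟩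

theorem mem_coords {A : Type u} {bl : List (List A × ℚ≥0)} {z : A × ℚ≥0} :
    z ∈ coords bl ↔ ∃ y ∈ bl, z.1 ∈ y.1 ∧ z.2 = y.2 := by
  simp only [coords, List.mem_flatMap, List.mem_map]
  constructor
  · rintro ⟨y, hy, x, hx, rfl⟩
    exact ⟨y, hy, hx, rfl⟩
  · rintro ⟨y, hy, hx, h⟩
    exact ⟨y, hy, z.1, hx, Prod.ext rfl h.symm⟩

theorem idealOf_eq (bl : List (List A × ℚ≥0)) :
    idealOf bl = Ideal.span {x | x ∈ (coords bl).map Prod.fst} := by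
  simp_rw [mem_coords_fst]
  rfl

theorem weightGroup_append {A : Type u} (L L' : List (A × ℚ≥0)) :
    weightGroup (L ++ L') = weightGroup L ⊔ weightGroup L' := by
  rw [weightGroup, weightGroup, weightGroup, ← AddSubgroup.closure_union]
  congr 1
  ext q
  simp only [List.mem_append, Set.mem_union]
  constructor
  · rintro ⟨y, hy | hy, rfl⟩
    exacts [Or.inl ⟨y, hy, rfl⟩, Or.inr ⟨y, hy, rfl⟩]
  · rintro (⟨y, hy, rfl⟩ | ⟨y, hy, rfl⟩)
    exacts [⟨y, Or.inl hy, rfl⟩, ⟨y, Or.inr hy, rfl⟩]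

theorem wIdeal_coords_le_idealOf {bl : List (List A × ℚ≥0)} {q : ℚ} (hq : 0 < q) :
    wIdeal (coords bl) q ≤ idealOf bl := by
  refine (wIdeal_le_span hq).trans ?_
  rw [idealOf_eq]
  refine Ideal.span_mono ?_
  rintro _ ⟨y, hy, rfl⟩
  exact List.mem_map_of_mem hy

end Blocks

/-! ### The states which are reached by the procedure -/

section States

variable {K : Type u} [Field K] {A : Type u} [CommRing A] [Algebra K A]
  {𝔪 : Ideal A} {E : Set (Ideal A)}

/-- The properties of the states which are reached from `([], R)` by the procedure. -/
structure Reached (K : Type u) [Field K] [Algebra K A] (𝔪 : Ideal A) (E : Set (Ideal A))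
    (R : Subalgebra A (TAlg A)) (s : State A) : Prop where
  coord : ∃ (n : ℕ) (c : CoordSystem K A 𝔪 n), c.Compatible E ∧ c.Extends
      ((coords s.1).map Prod.fst)
  pos : ∀ y ∈ s.1, 0 < y.2
  incr : s.1.Pairwise fun y y' => y.2 < y'.2
  sorted : ((coords s.1).map fun y => symbol E y.2 y.1).Pairwise (· ≤ ·)
  gens : ∃ (m : ℕ) (f : Fin m → A) (b : Fin m → ℚ≥0),
    s.2 = intPart s.2 s.1 ⊔ Algebra.adjoin A (Set.range fun j => mono (b j) (f j))
  group : degreeGroup s.2 ⊔ weightGroup (coords s.1) = degreeGroup R ⊔ weightGroup (coords s.1)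
  order : ∃ a : ℚ≥0, (∀ y ∈ s.1, y.2 ≤ a) ∧ ∀ b : ℚ≥0, 0 < b → ∀ f, mono b f ∈ s.2 →
    f ∈ idealOf s.1 ⊔ 𝔪 ^ (⌊b * a⌋₊ + 1)

theorem Reached.pos_coords {R : Subalgebra A (TAlg A)} {s : State A} (h : Reached K 𝔪 E R s) :
    ∀ y ∈ coords s.1, 0 < y.2 := by
  intro y hy
  obtain ⟨z, hz, -, h2⟩ := mem_coords.1 hy
  rw [h2]
  exact h.pos z hz

/-- A divisorial parameter cuts out a component of the restricted divisor, and conversely. -/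
theorem isDivisorial_quot_iff [IsLocalRing A] (h𝔪 : 𝔪 = IsLocalRing.maximalIdeal A) {n : ℕ}
    (c : CoordSystem K A 𝔪 n) (hcE : c.Compatible E) {τ : Finset (Fin n)} (hτ : τ ⊆ c.vanishing)
    {i : Fin n} (hi : i ∈ c.vanishing) (hiτ : i ∉ τ) {P : Ideal A} (hP : P = c.paramIdeal τ) :
    IsDivisorial (restrictDiv E P) (Ideal.Quotient.mk P (c.z i)) ↔ IsDivisorial E (c.z i) := by
  classical
  have hmap : ∀ y, (Ideal.span {y}).map (Ideal.Quotient.mk P) =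
      Ideal.span {Ideal.Quotient.mk P y} := fun y => by rw [Ideal.map_span, Set.image_singleton]
  have hzne : Ideal.Quotient.mk P (c.z i) ≠ 0 := by
    intro h
    rw [Ideal.Quotient.eq_zero_iff_mem, hP] at h
    have h1 := c.paramIdeal_le_maximal hτ (c.der_paramIdeal hiτ h)
    rw [c.der_apply, if_pos rfl, h𝔪] at h1
    exact (Ideal.ne_top_iff_one _).1 (Ideal.IsPrime.ne_top inferInstance) h1
  constructor
  · rintro ⟨hne, J, hJ, hJi⟩
    obtain ⟨k, rfl⟩ := hcE J hJ
    rw [hmap] at hJi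
    have hkτ : k ∉ τ := fun hk => hne <| by
      rw [hJi, Ideal.span_singleton_eq_bot, Ideal.Quotient.eq_zero_iff_mem, hP]
      exact c.z_mem_paramIdeal hk
    -- otherwise `z k` lies in the ideal of the `z j`, `j ∈ τ ∪ {i}`; a contradiction by `∂_k`
    have hki : k = i := by
      by_contra hki
      have h1 : Ideal.Quotient.mk P (c.z k) ∈ Ideal.span {Ideal.Quotient.mk P (c.z i)} := by
        rw [hJi]; exact Ideal.mem_span_singleton_self _
      rw [← hmap, Ideal.mem_quotient_iff_mem_sup, sup_comm, hP] at h1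
      have hins : c.paramIdeal τ ⊔ Ideal.span {c.z i} ≤ c.paramIdeal (insert i τ) := by
        refine sup_le (c.paramIdeal_le.2 fun j hj =>
          c.z_mem_paramIdeal (Finset.mem_insert_of_mem hj)) ?_
        rw [Ideal.span_singleton_le_iff_mem]
        exact c.z_mem_paramIdeal (Finset.mem_insert_self _ _)
      have h2 := c.der_paramIdeal (i := k) (by simp [hki, hkτ]) (hins h1)
      have h3 := c.paramIdeal_le_maximal (Finset.insert_subset hi hτ) h2
      rw [c.der_apply, if_pos rfl, h𝔪] at h3
      exact (Ideal.ne_top_iff_one _).1 (Ideal.IsPrime.ne_top inferInstance) h3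
    rw [IsDivisorial, ← hki]
    exact hJ
  · intro h
    exact ⟨by rwa [Ne, Ideal.span_singleton_eq_bot], _, h, (hmap _).symm⟩

theorem symbol_le_symbol_of_lt {a a' : ℚ≥0} (h : a < a') (x x' : A) :
    symbol E a x < symbol E a' x' := by
  rw [symbol, symbol, Prod.Lex.toLex_lt_toLex]
  exact Or.inl h

theorem symbol_le_symbol {a : ℚ≥0} {x x' : A} (h : IsDivisorial E x → IsDivisorial E x') :
    symbol E a x ≤ symbol E a x' := by
  rw [symbol, symbol, Prod.Lex.toLex_le_toLex]
  refine Or.inr ⟨rfl, ?_⟩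
  by_cases h1 : IsDivisorial E x
  · simp [h1, h h1]
  · simp [h1]

/-- An algebra generated by homogeneous elements which form a finite set is generated by a finite
family. -/
theorem exists_range_eq {s : Set (TAlg A)} (hs : s.Finite) (hm : ∀ F ∈ s, ∃ q f, F = mono q f) :
    ∃ (m : ℕ) (f : Fin m → A) (b : Fin m → ℚ≥0), s = Set.range fun j => mono (b j) (f j) := by
  have := hs.fintype
  let e := (Fintype.equivFin s).symm
  choose q f h using fun j => hm (e j) (e j).2
  refine ⟨_, f, q, ?_⟩
  ext F
  constructor
  · intro hF
    exact ⟨e.symm ⟨F, hF⟩, by simp [← h]⟩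
  · rintro ⟨j, rfl⟩
    simp only [← h]
    exact (e j).2

end States

/-! ### A step of the procedure -/

section Step

variable {K : Type u} [Field K] {A : Type u} [CommRing A] [Algebra K A]
  {𝔪 : Ideal A} {E : Set (Ideal A)}

theorem CoordSystem.diffOp_add [CharZero K] {n : ℕ} (c : CoordSystem K A 𝔪 n) (α : Fin n → ℕ)
    (f g : A) : c.diffOp α (f + g) = c.diffOp α f + c.diffOp α g := by
  induction α using multiIndex_induction with
  | h0 => simp only [c.diffOp_zero]
  | hs α i ih => rw [c.diffOp_incr, c.diffOp_incr, c.diffOp_incr, ih, map_add, smul_add]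

theorem CoordSystem.Extends.mono {n : ℕ} {c : CoordSystem K A 𝔪 n} {l l' : List A}
    (h : c.Extends l') (hl : l.Sublist l') : c.Extends l :=
  ⟨h.1.sublist hl, fun x hx => h.2 x (hl.subset hx)⟩

theorem isLocalRing_quot [IsLocalRing A] {P : Ideal A} (hP : P ≠ ⊤) : IsLocalRing (A ⧸ P) :=
  have : Nontrivial (A ⧸ P) := Ideal.Quotient.nontrivial_iff.2 hP
  IsLocalRing.of_surjective' (Ideal.Quotient.mk _) Ideal.Quotient.mk_surjective

theorem idealOf_le_maximal {bl : List (List A × ℚ≥0)} {n : ℕ} {c : CoordSystem K A 𝔪 n}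
    (h : c.Extends ((coords bl).map Prod.fst)) : idealOf bl ≤ 𝔪 := by
  rw [idealOf_eq, Ideal.span_le]
  exact fun x hx => (h.2 x hx).2

theorem idealOf_append {bl : List (List A × ℚ≥0)} {x : List A} {a : ℚ≥0} :
    idealOf (bl ++ [(x, a)]) = idealOf bl ⊔ Ideal.span {y | y ∈ x} := by
  rw [idealOf, idealOf, ← Ideal.span_union]
  congr 1
  ext y
  simp [or_and_right, exists_or]

theorem isHomog_intPart {S : Subalgebra A (TAlg A)} [CharZero K] [IsLocalRing A]
    [IsNoetherianRing A] (h𝔪 : 𝔪 = IsLocalRing.maximalIdeal A) {n : ℕ} (c : CoordSystem K A 𝔪 n)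
    {bl : List (List A × ℚ≥0)} (hL : c.Extends ((coords bl).map Prod.fst))
    (ha : ∀ y ∈ coords bl, 0 < y.2) : IsHomog (intPart S bl) := by
  rw [c.intPart_eq h𝔪 hL ha]
  exact (isHomog_monoAlg _).inf (isHomog_supportedIn _)

/-- Pulling a product of powers back along a quotient map. -/
theorem comap_contact {P : Ideal A} {x : List A} {k l : ℕ} {f : A}
    (h : Ideal.Quotient.mk P f ∈ Ideal.span {y | y ∈ x.map (Ideal.Quotient.mk P)} ^ k ⊔
      𝔪.map (Ideal.Quotient.mk P) ^ l) : f ∈ P ⊔ (Ideal.span {y | y ∈ x} ^ k ⊔ 𝔪 ^ l) := by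
  have h1 : Ideal.span {y | y ∈ x.map (Ideal.Quotient.mk P)} =
      (Ideal.span {y | y ∈ x}).map (Ideal.Quotient.mk P) := by
    rw [Ideal.map_span]
    congr 1
    ext y
    simp [Set.mem_image]
  rw [h1, ← Ideal.map_pow, ← Ideal.map_pow, ← Ideal.map_sup, Ideal.mem_quotient_iff_mem_sup] at h
  rwa [sup_comm]

variable [CharZero K] [IsLocalRing A] [IsNoetherianRing A]

theorem Reached.isHomog (h𝔪 : 𝔪 = IsLocalRing.maximalIdeal A) {R : Subalgebra A (TAlg A)}
    {s : State A} (h : Reached K 𝔪 E R s) : IsHomog s.2 := by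
  obtain ⟨n, c, -, hcx⟩ := h.coord
  obtain ⟨m, f, b, hgen⟩ := h.gens
  rw [hgen]
  exact (isHomog_intPart h𝔪 c hcx h.pos_coords).sup
    (isHomog_adjoin (by rintro _ ⟨j, rfl⟩; exact ⟨_, _, rfl⟩))

theorem Reached.ne_top (h𝔪 : 𝔪 = IsLocalRing.maximalIdeal A) {R : Subalgebra A (TAlg A)}
    {s : State A} (h : Reached K 𝔪 E R s) : idealOf s.1 ≠ ⊤ := by
  obtain ⟨n, c, -, hcx⟩ := h.coord
  intro h1
  have := idealOf_le_maximal hcx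
  rw [h1, top_le_iff, h𝔪] at this
  exact Ideal.IsPrime.ne_top inferInstance this

/-- The algebra of the elements which vanish, modulo `P`, to an order greater than `a` times their
degree. -/
theorem isMulFamily_order (P 𝔪 : Ideal A) (a : ℚ≥0) : IsMulFamily fun b : ℚ≥0 =>
    if b = 0 then (⊤ : Ideal A) else P ⊔ 𝔪 ^ (⌊b * a⌋₊ + 1) where
  zero := by simp
  mul_le p q := by
    by_cases hp : p = 0
    · subst hp; simp
    by_cases hq : q = 0
    · subst hq; simp
    have hpq : p + q ≠ 0 := by simp [hp]
    simp only [hp, hq, hpq, if_false]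
    rw [Ideal.sup_mul, Ideal.mul_sup (𝔪 ^ _)]
    refine sup_le (Ideal.mul_le_left.trans le_sup_left)
      (sup_le (Ideal.mul_le_right.trans le_sup_left) (le_sup_of_le_right ?_))
    rw [← pow_add]
    refine Ideal.pow_le_pow_right ?_
    have := floor_add_le' (p * a) (q * a)
    rw [← add_mul] at this
    omega

/-- The order of the restriction exceeds the weights which have been found before. -/
theorem Reached.lt_order (h𝔪 : 𝔪 = IsLocalRing.maximalIdeal A) {R : Subalgebra A (TAlg A)}
    {s : State A} (h : Reached K 𝔪 E R s) {a : ℚ≥0}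
    (ha : IsOrder (𝔪.map (Ideal.Quotient.mk (idealOf s.1)))
      (extend (Ideal.Quotient.mk (idealOf s.1)) s.2) a) :
    (∀ y ∈ s.1, y.2 < a) ∧ 0 < a := by
  obtain ⟨a', h1, h2⟩ := h.order
  suffices a' < a from ⟨fun y hy => (h1 y hy).trans_lt this, (zero_le).trans_lt this⟩
  obtain ⟨b, g, k, hb, hg, hk, hk', rfl⟩ := ha.1
  have hfam := isMulFamily_order (idealOf s.1) 𝔪 a'
  -- an element which computes the order of the restriction vanishes to a higher order than `b a'`
  have h3 := mem_map_of_mono_mem_extend _ (h.isHomog h𝔪) hfam (fun q f hf => by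
    by_cases hq : q = 0
    · simp [hq]
    · simp only [hq, if_false]
      exact h2 q (pos_iff_ne_zero.2 hq) f hf) hg
  simp only [hb.ne', if_false] at h3
  rw [Ideal.map_sup, Ideal.map_quotient_self, bot_sup_eq, Ideal.map_pow] at h3
  by_contra hle
  rw [not_lt, div_le_iff₀ hb] at hle
  refine hk' (Ideal.pow_le_pow_right ?_ h3)
  have : k ≤ ⌊b * a'⌋₊ := Nat.le_floor (by rwa [mul_comm])
  omega

/-- On `V(x̄_1, …, x̄_i)` the elements of `R_i` are polynomials in `x̄_i`, up to higher order. -/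
theorem Reached.mem_of_contact (h𝔪 : 𝔪 = IsLocalRing.maximalIdeal A) {R : Subalgebra A (TAlg A)}
    {s : State A} (h : Reached K 𝔪 E R s) {x : List A} {a : ℚ≥0}
    (hmc : IsMaximalContact K (𝔪.map (Ideal.Quotient.mk (idealOf s.1)))
        (restrictDiv E (idealOf s.1))
      (extend (Ideal.Quotient.mk (idealOf s.1)) s.2) a (x.map (Ideal.Quotient.mk (idealOf s.1))))
    {b : ℚ≥0} {f : A} (hf : mono b f ∈ s.2) :
    f ∈ idealOf s.1 ⊔ (Ideal.span {y | y ∈ x} ^ ⌈b * a⌉₊ ⊔ 𝔪 ^ (⌊b * a⌋₊ + 1)) := by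
  have := isLocalRing_quot (h.ne_top h𝔪)
  exact comap_contact (hmc.mem (CoordSystem.maximalIdeal_quot h𝔪) (mono_mem_extend _ hf))

theorem mono_mem_coeffAlg {S : Subalgebra A (TAlg A)} {bl : List (List A × ℚ≥0)} {n : ℕ}
    {c : CoordSystem K A 𝔪 n} {x : List A} {a : ℚ≥0} {m : ℕ} {f : Fin m → A} {b : Fin m → ℚ≥0}
    (j : Fin m) {α : Fin n → ℕ} (h1 : ∀ i, c.z i ∉ x → α i = 0)
    (h2 : ((∑ i, α i : ℕ) : ℚ≥0) < b j * a) :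
    mono (b j - ((∑ i, α i : ℕ) : ℚ≥0) / a) (c.diffOp α (f j)) ∈ coeffAlg S bl c x a f b :=
  (le_sup_right : _ ≤ coeffAlg S bl c x a f b) (Algebra.subset_adjoin ⟨j, α, h1, h2, rfl⟩)

theorem gen_mem_coeffAlg {S : Subalgebra A (TAlg A)} {bl : List (List A × ℚ≥0)} {n : ℕ}
    {c : CoordSystem K A 𝔪 n} {x : List A} {a : ℚ≥0} (ha : 0 < a) {m : ℕ} {f : Fin m → A}
    {b : Fin m → ℚ≥0} (j : Fin m) : mono (b j) (f j) ∈ coeffAlg S bl c x a f b := by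
  rcases eq_or_ne (b j) 0 with hj | hj
  · rw [hj]; exact mono_zero_mem _ _
  · have := mono_mem_coeffAlg (S := S) (bl := bl) (c := c) (x := x) (a := a) (f := f) (b := b) j
      (α := 0) (fun _ _ => rfl) (by simpa using mul_pos (pos_iff_ne_zero.2 hj) ha)
    simpa [c.diffOp_zero] using this

theorem monoAlg_mono {L L' : List (A × ℚ≥0)} (h : ∀ y ∈ L, y ∈ L') : monoAlg L ≤ monoAlg L' :=
  fun _ hF q => wIdeal_mono h q (hF q)

/-- A step of the procedure, with the coordinates and generators which are used. -/
structure StepData (K : Type u) [Field K] [Algebra K A] (𝔪 : Ideal A) (E : Set (Ideal A))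
    (s s' : State A) (x : List A) (a : ℚ≥0) {n : ℕ} (c : CoordSystem K A 𝔪 n) {m : ℕ}
    (f : Fin m → A) (b : Fin m → ℚ≥0) : Prop where
  fst : s'.1 = s.1 ++ [(x, a)]
  contact : IsMaximalContact K (𝔪.map (Ideal.Quotient.mk (idealOf s.1)))
      (restrictDiv E (idealOf s.1))
      (extend (Ideal.Quotient.mk (idealOf s.1)) s.2) a (x.map (Ideal.Quotient.mk (idealOf s.1)))
  compat : c.Compatible E
  extends_coords : c.Extends ((coords s'.1).map Prod.fst)
  gens : s.2 = intPart s.2 s.1 ⊔ Algebra.adjoin A (Set.range fun j => mono (b j) (f j))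
  snd : s'.2 = coeffAlg s.2 s'.1 c x a f b

theorem MillingStep.exists_stepData {s s' : State A} (h : MillingStep K 𝔪 E s s') :
    ∃ (x : List A) (a : ℚ≥0) (n : ℕ) (c : CoordSystem K A 𝔪 n) (m : ℕ) (f : Fin m → A)
      (b : Fin m → ℚ≥0), StepData K 𝔪 E s s' x a c f b := by
  obtain ⟨x, a, h1, h2, n, c, m, f, b, h3, h4, h5, h6⟩ := h
  exact ⟨x, a, n, c, m, f, b, ⟨h1, h2, h3, h4, h5, h6⟩⟩

section StepData

variable {s s' : State A} {x : List A} {a : ℚ≥0} {n : ℕ} {c : CoordSystem K A 𝔪 n} {m : ℕ}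
    {f : Fin m → A} {b : Fin m → ℚ≥0} {R : Subalgebra A (TAlg A)}

theorem StepData.coords_eq (h : StepData K 𝔪 E s s' x a c f b) :
    coords s'.1 = coords s.1 ++ x.map fun y => (y, a) := by
  rw [h.fst, coords_append, coords_singleton]

theorem StepData.fst_coords_eq (h : StepData K 𝔪 E s s' x a c f b) :
    (coords s'.1).map Prod.fst = (coords s.1).map Prod.fst ++ x := by
  rw [h.coords_eq, List.map_append, List.map_map]
  simp [Function.comp_def]

theorem StepData.extends_old (h : StepData K 𝔪 E s s' x a c f b) :
    c.Extends ((coords s.1).map Prod.fst) := by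
  refine CoordSystem.Extends.mono h.extends_coords ?_
  rw [h.fst_coords_eq]
  exact List.sublist_append_left _ _

theorem StepData.extends_new (h : StepData K 𝔪 E s s' x a c f b) : c.Extends x := by
  refine CoordSystem.Extends.mono h.extends_coords ?_
  rw [h.fst_coords_eq]
  exact List.sublist_append_right _ _

theorem StepData.idealOf_eq (h : StepData K 𝔪 E s s' x a c f b) :
    idealOf s'.1 = idealOf s.1 ⊔ Ideal.span {y | y ∈ x} := by
  rw [h.fst, idealOf_append]

theorem StepData.exists_indices (h : StepData K 𝔪 E s s' x a c f b) :
    ∃ τ σ : Finset (Fin n), τ ⊆ c.vanishing ∧ σ ⊆ c.vanishing ∧ Disjoint τ σ ∧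
      (∀ i, i ∈ τ ↔ c.z i ∈ (coords s.1).map Prod.fst) ∧ (∀ i, i ∈ σ ↔ c.z i ∈ x) ∧
      idealOf s.1 = c.paramIdeal τ ∧ Ideal.span {y | y ∈ x} = c.paramIdeal σ := by
  obtain ⟨τ, h1, h2, h3⟩ := c.exists_indices h.extends_old
  obtain ⟨σ, h4, h5, h6⟩ := c.exists_indices h.extends_new
  refine ⟨τ, σ, h1, h4, ?_, h2, h5, by rw [WeightedCenters.idealOf_eq, h3], h6⟩
  rw [Finset.disjoint_left]
  intro i hi hi'
  have := h.extends_coords.1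
  rw [h.fst_coords_eq, List.nodup_append] at this
  exact this.2.2 _ ((h2 i).1 hi) _ ((h5 i).1 hi') rfl

/-- The derivatives along the new parameters preserve the old ideal. -/
theorem StepData.diffOp_mem_idealOf (h : StepData K 𝔪 E s s' x a c f b) {α : Fin n → ℕ}
    (hα : ∀ i, c.z i ∉ x → α i = 0) {g : A} (hg : g ∈ idealOf s.1) :
    c.diffOp α g ∈ idealOf s.1 := by
  obtain ⟨τ, σ, -, -, hd, -, hσx, hP, -⟩ := h.exists_indices
  refine c.diffOp_mem_of_der (J := fun _ => idealOf s.1) (τ := σ) (w := 0) (fun i hi q g hg => ?_)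
    (q := 0) hg α (fun i hi => hα i fun hx => hi ((hσx i).2 hx))
  rw [hP] at hg ⊢
  exact c.der_paramIdeal (Finset.disjoint_right.1 hd hi) hg

theorem StepData.weight_pos (h𝔪 : 𝔪 = IsLocalRing.maximalIdeal A)
    (h : StepData K 𝔪 E s s' x a c f b) (hs : Reached K 𝔪 E R s) : 0 < a :=
  (hs.lt_order h𝔪 h.contact.1).2

theorem StepData.pos (h𝔪 : 𝔪 = IsLocalRing.maximalIdeal A)
    (h : StepData K 𝔪 E s s' x a c f b) (hs : Reached K 𝔪 E R s) : ∀ y ∈ s'.1, 0 < y.2 := by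
  rw [h.fst]
  intro y hy
  rcases List.mem_append.1 hy with hy | hy
  · exact hs.pos y hy
  · rw [List.mem_singleton.1 hy]; exact h.weight_pos h𝔪 hs

theorem StepData.pos_coords (h𝔪 : 𝔪 = IsLocalRing.maximalIdeal A)
    (h : StepData K 𝔪 E s s' x a c f b) (hs : Reached K 𝔪 E R s) :
    ∀ y ∈ coords s'.1, 0 < y.2 := by
  intro y hy
  obtain ⟨z, hz, -, h2⟩ := mem_coords.1 hy
  rw [h2]
  exact h.pos h𝔪 hs z hz

theorem StepData.ne_nil (h𝔪 : 𝔪 = IsLocalRing.maximalIdeal A)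
    (h : StepData K 𝔪 E s s' x a c f b) (hs : Reached K 𝔪 E R s) : x ≠ [] := by
  have := isLocalRing_quot (hs.ne_top h𝔪)
  have := h.contact.ne_nil (CoordSystem.maximalIdeal_quot h𝔪) (h.weight_pos h𝔪 hs)
  rintro rfl
  exact this rfl

theorem StepData.isHomog (h𝔪 : 𝔪 = IsLocalRing.maximalIdeal A)
    (h : StepData K 𝔪 E s s' x a c f b) (hs : Reached K 𝔪 E R s) : IsHomog s'.2 := by
  rw [h.snd]
  exact (isHomog_intPart h𝔪 c h.extends_coords (h.pos_coords h𝔪 hs)).sup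
    (isHomog_adjoin (by rintro _ ⟨j, α, -, -, rfl⟩; exact ⟨_, _, rfl⟩))

theorem StepData.le (h𝔪 : 𝔪 = IsLocalRing.maximalIdeal A)
    (h : StepData K 𝔪 E s s' x a c f b) (hs : Reached K 𝔪 E R s) : s.2 ≤ s'.2 := by
  conv_lhs => rw [h.gens]
  refine sup_le ?_ (Algebra.adjoin_le ?_)
  · rw [h.snd]
    refine le_trans ?_ (le_sup_left : intPart s.2 s'.1 ≤ _)
    rw [c.intPart_eq h𝔪 h.extends_old hs.pos_coords,
      c.intPart_eq h𝔪 h.extends_coords (h.pos_coords h𝔪 hs), h.coords_eq, weightGroup_append]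
    exact inf_le_inf (monoAlg_mono fun y hy => List.mem_append_left _ hy)
      (supportedIn_mono (sup_le_sup_left le_sup_left _))
  · rintro _ ⟨j, rfl⟩
    rw [h.snd]
    exact gen_mem_coeffAlg (h.weight_pos h𝔪 hs) j

theorem StepData.gen_mem (h : StepData K 𝔪 E s s' x a c f b) (j : Fin m) :
    mono (b j) (f j) ∈ s.2 := by
  rw [h.gens]
  exact (le_sup_right : _ ≤ intPart s.2 s.1 ⊔ _) (Algebra.subset_adjoin ⟨j, rfl⟩)

theorem StepData.weight_mem (h : StepData K 𝔪 E s s' x a c f b) (hx : x ≠ []) :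
    1 / (a : ℚ) ∈ weightGroup (coords s'.1) := by
  obtain ⟨y, hy⟩ := List.exists_mem_of_ne_nil x hx
  refine AddSubgroup.subset_closure ⟨(y, a), ?_, rfl⟩
  rw [h.coords_eq]
  exact List.mem_append_right _ (List.mem_map_of_mem hy)

theorem StepData.degreeGroup_eq (h𝔪 : 𝔪 = IsLocalRing.maximalIdeal A)
    (h : StepData K 𝔪 E s s' x a c f b) (hs : Reached K 𝔪 E R s) :
    degreeGroup s'.2 ⊔ weightGroup (coords s'.1) = degreeGroup s.2 ⊔ weightGroup (coords s'.1) := by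
  apply le_antisymm
  · refine sup_le ((degreeGroup_le_iff (h.isHomog h𝔪 hs)).2 ?_) le_sup_right
    rw [h.snd, coeffAlg]
    refine sup_le ?_ (Algebra.adjoin_le ?_)
    · rw [c.intPart_eq h𝔪 h.extends_coords (h.pos_coords h𝔪 hs)]
      exact inf_le_right
    · rintro _ ⟨j, α, -, hα, rfl⟩
      refine mono_mem_supportedIn.2 fun hne => ?_
      have hf0 : f j ≠ 0 := fun h0 => hne (by
        rw [h0]
        have := c.diffOp_mem_of_der (J := fun _ => (⊥ : Ideal A)) (τ := Finset.univ) (w := 0)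
          (fun i _ q g hg => by
            rw [Ideal.mem_bot] at hg ⊢; rw [hg, map_zero]) (q := 0) (Ideal.zero_mem _) α (by simp)
        exact this)
      have h1 : ((b j : ℚ≥0) : ℚ) ∈ degreeGroup s.2 :=
        AddSubgroup.subset_closure ⟨b j, rfl, f j, hf0, h.gen_mem j⟩
      have ha := h.weight_pos h𝔪 hs
      have h2 : ((∑ i, α i : ℕ) : ℚ≥0) / a ≤ b j := by
        rw [div_le_iff₀ ha]; exact hα.le
      rw [NNRat.coe_sub h2]
      refine AddSubgroup.sub_mem _ ((le_sup_left : degreeGroup s.2 ≤ _) h1)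
        ((le_sup_right : weightGroup (coords s'.1) ≤ _) ?_)
      have h3 := AddSubgroup.nsmul_mem _ (h.weight_mem (h.ne_nil h𝔪 hs)) (∑ i, α i)
      rw [nsmul_eq_mul, mul_one_div] at h3
      rw [NNRat.coe_div, NNRat.coe_natCast]
      exact h3
  · exact sup_le_sup_right (degreeGroup_mono (h.le h𝔪 hs)) _

/-- After the step, the order of the restriction to the new zero locus is greater than `a`. -/
theorem StepData.order (h𝔪 : 𝔪 = IsLocalRing.maximalIdeal A)
    (h : StepData K 𝔪 E s s' x a c f b) (hs : Reached K 𝔪 E R s) {d : ℚ≥0} (hd : 0 < d) {g : A}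
    (hg : mono d g ∈ s'.2) : g ∈ idealOf s'.1 ⊔ 𝔪 ^ (⌊d * a⌋₊ + 1) := by
  have ha := h.weight_pos h𝔪 hs
  have hfam := isMulFamily_order (idealOf s'.1) 𝔪 a
  have hle : s'.2 ≤ filtAlg _ hfam := by
    rw [h.snd, coeffAlg]
    refine sup_le ?_ (Algebra.adjoin_le ?_)
    · rw [c.intPart_eq h𝔪 h.extends_coords (h.pos_coords h𝔪 hs)]
      refine inf_le_left.trans (((isHomog_monoAlg _).le_filtAlg_iff hfam).2 fun q g hg => ?_)
      by_cases hq : q = 0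
      · simp [hq]
      · simp only [hq, if_false]
        exact Ideal.mem_sup_left (wIdeal_coords_le_idealOf
          (by exact_mod_cast pos_iff_ne_zero.2 hq) (mono_mem_monoAlg.1 hg))
    · rintro _ ⟨j, α, hαx, hα, rfl⟩
      refine mono_mem_filtAlg.2 ?_
      have h2 : ((∑ i, α i : ℕ) : ℚ≥0) / a < b j := by rwa [div_lt_iff₀ ha]
      have h3 : b j - ((∑ i, α i : ℕ) : ℚ≥0) / a ≠ 0 := (tsub_pos_of_lt h2).ne'
      simp only [h3, if_false]
      rw [tsub_mul, div_mul_cancel₀ _ ha.ne', Nat.floor_sub_natCast, h.idealOf_eq]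
      have hfj := hs.mem_of_contact h𝔪 h.contact (h.gen_mem j)
      obtain ⟨g1, hg1, g', hg', hfg⟩ := Submodule.mem_sup.1 hfj
      obtain ⟨g2, hg2, g3, hg3, rfl⟩ := Submodule.mem_sup.1 hg'
      have hadd : ∀ u v : A, c.diffOp α (u + v) = c.diffOp α u + c.diffOp α v := by
        intro u v
        exact c.diffOp_add α u v
      rw [← hfg, hadd, hadd]
      refine Ideal.add_mem _ (Ideal.mem_sup_left (Ideal.mem_sup_left
        (h.diffOp_mem_idealOf hαx hg1))) (Ideal.add_mem _ ?_ ?_)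
      · refine Ideal.mem_sup_left (Ideal.mem_sup_right ?_)
        have h4 := c.diffOp_mem_pow hg2 α
        have h5 : ∑ i, α i < ⌈b j * a⌉₊ := Nat.lt_ceil.2 hα
        exact Ideal.pow_le_self (by omega) h4
      · refine Ideal.mem_sup_right ?_
        have h4 := c.diffOp_mem_pow hg3 α
        have h5 : ∑ i, α i ≤ ⌊b j * a⌋₊ := Nat.le_floor hα.le
        rwa [show ⌊b j * a⌋₊ + 1 - ∑ i, α i = ⌊b j * a⌋₊ - ∑ i, α i + 1 by omega] at h4
  have h1 := mono_mem_filtAlg.1 (hle hg)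
  simpa only [hd.ne', if_false] using h1

theorem finite_derivatives (x : List A) (a : ℚ≥0) (c : CoordSystem K A 𝔪 n) (f : Fin m → A)
    (b : Fin m → ℚ≥0) :
    {F | ∃ (j : Fin m) (α : Fin n → ℕ), (∀ i, c.z i ∉ x → α i = 0) ∧
      ((∑ i, α i : ℕ) : ℚ≥0) < b j * a ∧
      F = mono (b j - ((∑ i, α i : ℕ) : ℚ≥0) / a) (c.diffOp α (f j))}.Finite := by
  have : {p : Fin m × (Fin n → ℕ) | p.2 ∈ Set.Icc 0 fun _ => ⌊b p.1 * a⌋₊}.Finite := by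
    have : {p : Fin m × (Fin n → ℕ) | p.2 ∈ Set.Icc 0 fun _ => ⌊b p.1 * a⌋₊} ⊆
        ⋃ j : Fin m, Prod.mk j '' Set.Icc 0 fun _ => ⌊b j * a⌋₊ := by
      rintro ⟨j, α⟩ hα
      exact Set.mem_iUnion.2 ⟨j, α, hα, rfl⟩
    exact (Set.finite_iUnion fun j => (Set.finite_Icc _ _).image _).subset this
  refine (this.image fun p => mono (b p.1 - ((∑ i, p.2 i : ℕ) : ℚ≥0) / a)
    (c.diffOp p.2 (f p.1))).subset ?_
  rintro _ ⟨j, α, -, hα, rfl⟩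
  refine ⟨(j, α), ⟨fun _ => Nat.zero_le _, fun i => ?_⟩, rfl⟩
  exact (Finset.single_le_sum (f := α) (fun _ _ => Nat.zero_le _) (Finset.mem_univ i)).trans
    (Nat.le_floor hα.le)

/-- A block parameter is divisorial if and only if its restriction is. -/
theorem StepData.isDivisorial_iff (h𝔪 : 𝔪 = IsLocalRing.maximalIdeal A)
    (h : StepData K 𝔪 E s s' x a c f b) {y : A} (hy : y ∈ x) :
    IsDivisorial (restrictDiv E (idealOf s.1)) (Ideal.Quotient.mk (idealOf s.1) y) ↔
      IsDivisorial E y := by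
  obtain ⟨τ, σ, hτ, hσ, hd, -, hσx, hP, -⟩ := h.exists_indices
  obtain ⟨⟨i, rfl⟩, -⟩ := h.extends_new.2 y hy
  have hi := (hσx i).2 hy
  exact isDivisorial_quot_iff h𝔪 c h.compat hτ (hσ hi) (Finset.disjoint_right.1 hd hi) hP

/-- The properties in `Reached` are preserved by the steps of the procedure. -/
theorem StepData.reached (h𝔪 : 𝔪 = IsLocalRing.maximalIdeal A)
    (h : StepData K 𝔪 E s s' x a c f b) (hs : Reached K 𝔪 E R s) : Reached K 𝔪 E R s' where
  coord := ⟨n, c, h.compat, h.extends_coords⟩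
  pos := h.pos h𝔪 hs
  incr := by
    rw [h.fst, List.pairwise_append]
    refine ⟨hs.incr, List.pairwise_singleton _ _, fun y hy y' hy' => ?_⟩
    rw [List.mem_singleton.1 hy']
    exact (hs.lt_order h𝔪 h.contact.1).1 y hy
  sorted := by
    rw [h.coords_eq, List.map_append, List.pairwise_append, List.map_map]
    refine ⟨hs.sorted, ?_, ?_⟩
    · rw [List.pairwise_map]
      have := h.contact.2.1
      rw [List.pairwise_map] at this
      refine this.imp_of_mem fun hy hy' hyy' => symbol_le_symbol ?_
      rwa [h.isDivisorial_iff h𝔪 hy, h.isDivisorial_iff h𝔪 hy'] at hyy'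
    · intro u hu v hv
      obtain ⟨y, hy, rfl⟩ := List.mem_map.1 hu
      obtain ⟨y', hy', rfl⟩ := List.mem_map.1 hv
      obtain ⟨z, hz, -, hz2⟩ := mem_coords.1 hy
      refine (symbol_le_symbol_of_lt ?_ _ _).le
      change y.2 < a
      rw [hz2]
      exact (hs.lt_order h𝔪 h.contact.1).1 z hz
  gens := by
    obtain ⟨m', f', b', hF⟩ := exists_range_eq (finite_derivatives x a c f b)
      (by rintro _ ⟨j, α, -, -, rfl⟩; exact ⟨_, _, rfl⟩)
    refine ⟨m', f', b', ?_⟩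
    rw [← hF]
    conv_lhs => rw [h.snd, coeffAlg]
    congr 1
    rw [c.intPart_eq h𝔪 h.extends_coords (h.pos_coords h𝔪 hs),
      c.intPart_eq h𝔪 h.extends_coords (h.pos_coords h𝔪 hs), h.degreeGroup_eq h𝔪 hs]
  group := by
    rw [h.degreeGroup_eq h𝔪 hs]
    have h1 := hs.group
    rw [h.coords_eq, weightGroup_append, ← sup_assoc, h1, sup_assoc]
  order := by
    refine ⟨a, fun y hy => ?_, fun d hd g hg => h.order h𝔪 hs hd hg⟩
    rw [h.fst] at hy
    rcases List.mem_append.1 hy with hy | hy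
    · exact ((hs.lt_order h𝔪 h.contact.1).1 y hy).le
    · rw [List.mem_singleton.1 hy]

theorem StepData.idealOf_lt (h𝔪 : 𝔪 = IsLocalRing.maximalIdeal A)
    (h : StepData K 𝔪 E s s' x a c f b) (hs : Reached K 𝔪 E R s) : idealOf s.1 < idealOf s'.1 := by
  refine lt_of_le_of_ne (by rw [h.idealOf_eq]; exact le_sup_left) fun heq => ?_
  obtain ⟨τ, σ, hτ, hσ, hd, -, hσx, hP, -⟩ := h.exists_indices
  obtain ⟨y, hy⟩ := List.exists_mem_of_ne_nil x (h.ne_nil h𝔪 hs)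
  obtain ⟨⟨i, rfl⟩, -⟩ := h.extends_new.2 y hy
  have h1 : c.z i ∈ idealOf s.1 := by
    rw [heq, h.idealOf_eq]
    exact Ideal.mem_sup_right (Ideal.subset_span hy)
  rw [hP] at h1
  have h2 := c.paramIdeal_le_maximal hτ
    (c.der_paramIdeal (Finset.disjoint_right.1 hd ((hσx i).2 hy)) h1)
  rw [c.der_apply, if_pos rfl, h𝔪] at h2
  exact (Ideal.ne_top_iff_one _).1 (Ideal.IsPrime.ne_top inferInstance) h2

end StepData

theorem MillingRun.reached (h𝔪 : 𝔪 = IsLocalRing.maximalIdeal A) {R : Subalgebra A (TAlg A)}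
    {s s' : State A} (hs : Reached K 𝔪 E R s) (h : MillingRun K 𝔪 E s s') :
    Reached K 𝔪 E R s' := by
  induction h with
  | refl => exact hs
  | tail _ h ih =>
    obtain ⟨x, a, n, c, m, f, b, h⟩ := h.exists_stepData
    exact h.reached h𝔪 ih

end Step

/-! ### The end of the procedure bounds the algebra -/

section Backward

variable {K : Type u} [Field K] {A : Type u} [CommRing A] [Algebra K A]
  {𝔪 : Ideal A} {E : Set (Ideal A)}

theorem MillingStep.prefix {s s' : State A} (h : MillingStep K 𝔪 E s s') : s.1 <+: s'.1 := by
  obtain ⟨x, a, h1, -⟩ := h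
  rw [h1]
  exact List.prefix_append _ _

theorem MillingRun.prefix {s s' : State A} (h : MillingRun K 𝔪 E s s') : s.1 <+: s'.1 := by
  induction h with
  | refl => exact List.prefix_rfl
  | tail _ h ih => exact ih.trans h.prefix

theorem mono_zero_mem_bot {B : Type u} [CommRing B] {q : ℚ≥0} {f : B}
    (h : mono q f ∈ (⊥ : Subalgebra B (TAlg B))) (hq : 0 < q) : f = 0 := by
  obtain ⟨g, hg⟩ := Algebra.mem_bot.1 h
  rw [algebraMap_eq_mono] at hg
  have h1 := congrArg (fun F : TAlg B => F.coeff q) hg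
  simp only [AddMonoidAlgebra.coeff_single, Finsupp.single_apply, if_pos, if_neg hq.ne] at h1
  exact h1.symm

theorem Terminated.mem {s : State A} (h : Terminated s) {q : ℚ≥0} (hq : 0 < q) {f : A}
    (hf : mono q f ∈ s.2) : f ∈ idealOf s.1 := by
  rw [← Ideal.Quotient.eq_zero_iff_mem]
  refine mono_zero_mem_bot ?_ hq
  rw [← h]
  exact mono_mem_extend _ hf

variable [CharZero K] [IsLocalRing A] [IsNoetherianRing A] {R : Subalgebra A (TAlg A)}

/-- If a run ends with the coordinates `L`, then each of its algebras lies in the monomial algebra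
of `L`, up to the ideal of the current subvariety. -/
theorem MillingRun.mem_of_terminated (h𝔪 : 𝔪 = IsLocalRing.maximalIdeal A) {s e : State A}
    (hs : Reached K 𝔪 E R s) (h : MillingRun K 𝔪 E s e) (he : Terminated e) {q : ℚ≥0} {f : A}
    (hf : mono q f ∈ s.2) : f ∈ wIdeal (coords e.1) q ⊔ idealOf s.1 := by
  induction h using Relation.ReflTransGen.head_induction_on generalizing q f with
  | refl =>
    rcases eq_or_ne q 0 with rfl | hq
    · rw [NNRat.coe_zero, (isFiltration_wIdeal _).zero]; simp
    · exact Ideal.mem_sup_right (he.mem (pos_iff_ne_zero.2 hq) hf)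
  | @head s s' hstep hrun ih =>
    obtain ⟨x, a, n, c, m, g, b, hd⟩ := hstep.exists_stepData
    have hs' := hd.reached h𝔪 hs
    have he' := MillingRun.reached h𝔪 hs' hrun
    have ha := hd.weight_pos h𝔪 hs
    obtain ⟨τ, σ, hτ, hσ, hdisj, hτs, hσx, hP, hX⟩ := hd.exists_indices
    set L := coords e.1 with hL
    have hJ : IsFiltration fun q : ℚ => wIdeal L q ⊔ idealOf s.1 :=
      (isFiltration_wIdeal L).sup_const _
    obtain ⟨rest, hrest⟩ := MillingRun.prefix hrun
    rw [hd.fst] at hrest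
    -- the members of the final center: the earlier blocks, the block `x` and the later blocks
    have hmemL : ∀ y ∈ L, y ∈ coords s.1 ∨ (y.1 ∈ x ∧ y.2 = a) ∨ a ≤ y.2 := by
      intro y hy
      rw [hL, ← hrest, coords_append, coords_append, coords_singleton, List.mem_append,
        List.mem_append] at hy
      rcases hy with (hy | hy) | hy
      · exact Or.inl hy
      · obtain ⟨z, hz, rfl⟩ := List.mem_map.1 hy
        exact Or.inr (Or.inl ⟨hz, rfl⟩)
      · obtain ⟨z, hz, -, hz2⟩ := mem_coords.1 hy
        refine Or.inr (Or.inr ?_)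
        have := he'.incr
        rw [← hrest, List.pairwise_append] at this
        rw [hz2]
        exact (this.2.2 (x, a) (by simp) z hz).le
    have hxL : ∀ y ∈ x, (y, a) ∈ L := by
      intro y hy
      rw [hL, ← hrest, coords_append, coords_append, coords_singleton]
      exact List.mem_append_left _ (List.mem_append_right _ (List.mem_map_of_mem hy))
    have hsL : ∀ y ∈ coords s.1, y ∈ L := by
      intro y hy
      rw [hL, ← hrest, coords_append, coords_append]
      exact List.mem_append_left _ (List.mem_append_left _ hy)
    -- the derivatives along the block `x` lower the degree by at most `1 / a`, since the members of
    -- higher degree belong to the earlier blocks and have the derivative `0`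
    have hder : ∀ i ∈ σ, ∀ q : ℚ, ∀ f ∈ wIdeal L q ⊔ idealOf s.1,
        c.der i f ∈ wIdeal L (q - 1 / (a : ℚ)) ⊔ idealOf s.1 := by
      intro i hi q f hf
      obtain ⟨f1, hf1, f2, hf2, rfl⟩ := Submodule.mem_sup.1 hf
      rw [map_add]
      refine Ideal.add_mem _ (Ideal.mem_sup_left ?_) (Ideal.mem_sup_right ?_)
      · refine derivation_wIdeal_of_le _ (by positivity) (fun y hy => ?_) hf1
        rcases hmemL y hy with hy | ⟨hy, hya⟩ | hya
        · left
          obtain ⟨k, hk⟩ := (hd.extends_old.2 _ (List.mem_map_of_mem hy)).1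
          rw [← hk, c.der_apply, if_neg]
          rintro rfl
          exact Finset.disjoint_right.1 hdisj hi ((hτs i).2 (hk ▸ List.mem_map_of_mem hy))
        · right; rw [hya]
        · right
          have ha' : (0 : ℚ) < a := by exact_mod_cast ha
          have hya' : (a : ℚ) ≤ y.2 := by exact_mod_cast hya
          exact one_div_le_one_div_of_le ha' hya'
      · rw [hP] at hf2 ⊢
        exact c.der_paramIdeal (Finset.disjoint_right.1 hdisj hi) hf2
    have hle : s.2 ≤ filtAlg _ hJ.isMulFamily := by
      conv_lhs => rw [hd.gens]
      refine sup_le ?_ (adjoin_mono_le_filtAlg fun j => ?_)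
      · rw [c.intPart_eq h𝔪 hd.extends_old hs.pos_coords]
        refine inf_le_left.trans ((monoAlg_mono hsL).trans fun F hF q => ?_)
        exact Ideal.mem_sup_left (hF q)
      -- the derivatives of a generator are elements of the next algebra, to which the induction
      -- applies; Taylor expansion along the block `x` gives the bound for the generator
      · refine c.mem_filtration_of_diffOp_mem hJ (τ := σ) (w := 1 / (a : ℚ)) (by positivity)
          (fun i hi => Ideal.mem_sup_left (mem_wIdeal (hxL _ ((hσx i).1 hi)) le_rfl)) hder
          fun α hα hlt => ?_
        have hlt' : ((∑ i, α i : ℕ) : ℚ≥0) / a < b j := by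
          rw [mul_one_div] at hlt
          exact_mod_cast hlt
        have h1 := mono_mem_coeffAlg (S := s.2) (bl := s'.1) (c := c) (x := x) (a := a) (f := g)
          (b := b) j (fun i hi => hα i fun h => hi ((hσx i).1 h)) ((div_lt_iff₀ ha).1 hlt')
        rw [← hd.snd] at h1
        have h2 := ih hs' h1
        rw [NNRat.coe_sub hlt'.le, NNRat.coe_div, NNRat.coe_natCast, hd.idealOf_eq, hX,
          ← sup_assoc] at h2
        rwa [mul_one_div]
    exact mono_mem_filtAlg.1 (hle hf)

/-- If a run which starts with `R` ends, then its coordinates define an admissible center. -/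
theorem MillingRun.le_monoAlg (h𝔪 : 𝔪 = IsLocalRing.maximalIdeal A) {e : State A}
    (hs : Reached K 𝔪 E R ([], R)) (h : MillingRun K 𝔪 E ([], R) e) (he : Terminated e) :
    R ≤ monoAlg (coords e.1) := by
  refine (IsHomog.le_iff (hs.isHomog h𝔪)).2 fun q f hf => mono_mem_monoAlg.2 ?_
  have h1 := h.mem_of_terminated h𝔪 hs he hf
  have h2 : idealOf ([] : List (List A × ℚ≥0)) = ⊥ := by simp [idealOf]
  rwa [h2, sup_bot_eq] at h1

end Backward

/-! ### Exchange of parameters in presentations -/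

section Lex

theorem toInvSeq_lt {p N R : List QPlus} {r : QPlus} (hr : r ∈ R) (hR : R.Pairwise (· ≤ ·))
    (hN : ∀ v ∈ N, r < v) : toInvSeq (p ++ R) < toInvSeq (p ++ N) := by
  obtain ⟨u, R, rfl⟩ := List.exists_cons_of_ne_nil (List.ne_nil_of_mem hr)
  have hu : u ≤ r := by
    rcases List.mem_cons.1 hr with rfl | h
    · exact le_rfl
    · exact (List.pairwise_cons.1 hR).1 r h
  refine ⟨p.length, fun j hj => ?_, ?_⟩
  · change ((p ++ u :: R)[j]?).elim ⊤ _ = ((p ++ N)[j]?).elim ⊤ _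
    rw [List.getElem?_append_left hj, List.getElem?_append_left hj]
  · change ((p ++ u :: R)[p.length]?).elim ⊤ _ < ((p ++ N)[p.length]?).elim ⊤ _
    rw [List.getElem?_append_right le_rfl, List.getElem?_append_right le_rfl, Nat.sub_self]
    cases N with
    | nil => exact WithTop.coe_lt_top u
    | cons v N => exact WithTop.coe_lt_coe.2 (hu.trans_lt (hN v (List.mem_cons_self ..)))

theorem cons_replicate_append {α : Type*} (k : ℕ) (u : α) (l : List α) :
    u :: (List.replicate k u ++ l) = List.replicate k u ++ u :: l := by
  induction k with
  | zero => rfl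
  | succ k ih => rw [List.replicate_succ, List.cons_append, List.cons_append, ih]

theorem weight_le_of_symbol_le {A : Type u} [CommRing A] {E : Set (Ideal A)} {a a' : ℚ≥0} {x x' : A}
    (h : symbol E a x ≤ symbol E a' x') : a ≤ a' := by
  rw [symbol, symbol, Prod.Lex.toLex_le_toLex] at h
  rcases h with h | h
  exacts [h.le, h.1.le]

theorem symbol_eq_iff {A : Type u} [CommRing A] {E : Set (Ideal A)} {a a' : ℚ≥0} {x x' : A} :
    symbol E a x = symbol E a' x' ↔ a = a' ∧ (IsDivisorial E x ↔ IsDivisorial E x') := by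
  rw [symbol, symbol, toLex_inj, Prod.mk.injEq, decide_eq_decide]

end Lex

section Exchange

variable {K : Type u} [Field K] {A : Type u} [CommRing A] [Algebra K A]
  {𝔪 : Ideal A} {E : Set (Ideal A)} {n : ℕ}

theorem weightGroup_congr {L L' : List (A × ℚ≥0)}
    (h : L.map (fun y => symbol E y.2 y.1) = L'.map fun y => symbol E y.2 y.1) :
    weightGroup L = weightGroup L' := by
  have key : ∀ {L L' : List (A × ℚ≥0)},
      L.map (fun y => symbol E y.2 y.1) = L'.map (fun y => symbol E y.2 y.1) →
      ∀ y ∈ L, ∃ y' ∈ L', y.2 = y'.2 := by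
    intro L L' h y hy
    have h1 : symbol E y.2 y.1 ∈ L'.map fun y => symbol E y.2 y.1 :=
      h ▸ List.mem_map_of_mem (f := fun y : A × ℚ≥0 => symbol E y.2 y.1) hy
    obtain ⟨y', hy', h2⟩ := List.mem_map.1 h1
    exact ⟨y', hy', (symbol_eq_iff.1 h2).1.symm⟩
  rw [weightGroup, weightGroup]
  congr 1
  ext q
  constructor
  · rintro ⟨y, hy, rfl⟩
    obtain ⟨y', hy', h1⟩ := key h y hy
    exact ⟨y', hy', by rw [h1]⟩
  · rintro ⟨y, hy, rfl⟩
    obtain ⟨y', hy', h1⟩ := key h.symm y hy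
    exact ⟨y', hy', by rw [h1]⟩

namespace CoordSystem

variable (c : CoordSystem K A 𝔪 n)

theorem one_notMem [IsLocalRing A] (h𝔪 : 𝔪 = IsLocalRing.maximalIdeal A) : (1 : A) ∉ 𝔪 := by
  rw [h𝔪]
  exact (Ideal.ne_top_iff_one _).1 (Ideal.IsPrime.ne_top inferInstance)

theorem z_notMem_paramIdeal [IsLocalRing A] (h𝔪 : 𝔪 = IsLocalRing.maximalIdeal A)
    {τ : Finset (Fin n)} (hτ : τ ⊆ c.vanishing) {i : Fin n} (hi : i ∉ τ) :
    c.z i ∉ c.paramIdeal τ := by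
  intro h
  have h1 := c.paramIdeal_le_maximal hτ (c.der_paramIdeal hi h)
  rw [c.der_apply, if_pos rfl] at h1
  exact one_notMem h𝔪 h1

theorem paramIdeal_insert [DecidableEq (Fin n)] (τ : Finset (Fin n)) (i : Fin n) :
    c.paramIdeal (insert i τ) = c.paramIdeal τ ⊔ Ideal.span {c.z i} := by
  apply le_antisymm
  · refine c.paramIdeal_le.2 fun j hj => ?_
    rcases Finset.mem_insert.1 hj with rfl | hj
    · exact Ideal.mem_sup_right (Ideal.mem_span_singleton_self _)
    · exact Ideal.mem_sup_left (c.z_mem_paramIdeal hj)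
  · refine sup_le (c.paramIdeal_le.2 fun j hj =>
      c.z_mem_paramIdeal (Finset.mem_insert_of_mem hj)) ?_
    rw [Ideal.span_singleton_le_iff_mem]
    exact c.z_mem_paramIdeal (Finset.mem_insert_self _ _)

/-- Choice of a parameter which may be exchanged for `y`: modulo `Q` and `𝔪 ^ 2` the function `y`
is a non-zero combination of the parameters in `σ`. -/
theorem exists_der_notMem {σ : Finset (Fin n)} (hσ : σ ⊆ c.vanishing) {Q : Ideal A}
    (hQ : ∀ i ∈ σ, ∀ q ∈ Q, c.der i q ∈ Q) {y : A} (hy : y ∈ Q ⊔ c.paramIdeal σ ⊔ 𝔪 ^ 2)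
    (hy' : y ∉ Q ⊔ 𝔪 ^ 2) : ∃ i ∈ σ, c.der i y ∉ 𝔪 := by
  by_contra! h
  have hmul : ∀ {u v}, u ∈ 𝔪 → v ∈ 𝔪 → u * v ∈ 𝔪 ^ 2 := fun hu hv => by
    rw [pow_two]; exact Ideal.mul_mem_mul hu hv
  have hz : ∀ i ∈ σ, c.z i ∈ 𝔪 := fun i hi => c.mem_vanishing.1 (hσ hi)
  have h1 : c.euler σ y ∈ 𝔪 ^ 2 := c.euler_mem_of_der_mem fun i hi => hmul (hz i hi) (h i hi)
  obtain ⟨y1, hy1, w, hw, rfl⟩ := Submodule.mem_sup.1 hy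
  obtain ⟨q, hq, g, hg, rfl⟩ := Submodule.mem_sup.1 hy1
  have hle := c.paramIdeal_le_maximal hσ
  have h2 : c.euler σ g - g ∈ 𝔪 ^ 2 := by
    have := c.euler_sub_mem σ 1 (f := g) (by simpa using hg)
    simpa using Ideal.pow_right_mono hle 2 this
  have h3 : c.euler σ q ∈ Q := c.euler_mem_of_der_mem fun i hi => Ideal.mul_mem_left _ _
      (hQ i hi q hq)
  have h4 : c.euler σ w ∈ 𝔪 ^ 2 := c.euler_mem_of_der_mem fun i hi => by
    have := derivation_pow_le (c.der i) 1 hw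
    rw [pow_one] at this
    exact hmul (hz i hi) this
  refine hy' ?_
  have h5 : q + g + w = (q - c.euler σ q) +
      (c.euler σ (q + g + w) - (c.euler σ g - g) - c.euler σ w + w) := by
    rw [map_add, map_add]; ring
  rw [h5]
  refine Ideal.add_mem _ (Ideal.mem_sup_left (Ideal.sub_mem _ hq h3)) (Ideal.mem_sup_right ?_)
  exact Ideal.add_mem _ (Ideal.sub_mem _ (Ideal.sub_mem _ h1 h2) h4) hw

end CoordSystem

/-- If `y` has weight `1 / a` and involves the member `r` of weight `1 / a` linearly, then `r` may
be replaced by `y` without change of the monomial filtration. -/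
theorem wIdeal_exchange [IsLocalRing A] (h𝔪 : 𝔪 = IsLocalRing.maximalIdeal A)
    {L L'' : List (A × ℚ≥0)} {r : A} {a : ℚ≥0} (ha : 0 < a) (hrL : (r, a) ∈ L)
    (hL : ∀ z ∈ L, z = (r, a) ∨ z ∈ L'') (hL'' : ∀ z ∈ L'', z ∈ L)
    (hL𝔪 : ∀ z ∈ L, z.1 ∈ 𝔪) (δ : Derivation K A A) (hδr : δ r = 1) (hδ : ∀ z ∈ L'', δ z.1 = 0)
    {y : A} (hy : y ∈ wIdeal L (1 / (a : ℚ))) (hδy : δ y ∉ 𝔪) (q : ℚ) :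
    wIdeal ((y, a) :: L'') q = wIdeal L q := by
  have ha' : (0 : ℚ) < 1 / (a : ℚ) := by positivity
  apply le_antisymm
  · refine wIdeal_le (isFiltration_wIdeal L) (fun z hz => ?_) q
    rcases List.mem_cons.1 hz with rfl | hz
    · exact hy
    · exact mem_wIdeal (hL'' z hz) le_rfl
  · refine wIdeal_le (isFiltration_wIdeal _) (fun z hz => ?_) q
    rcases hL z hz with rfl | hz
    -- `y = e r + w` with `w` in the ideal of `L''`; since `δ y` is a unit, `e` is a unit
    · obtain ⟨g, hg, w, hw, hgw⟩ := Submodule.mem_sup.1 (wIdeal_le_span_sup hL _ hy)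
      obtain ⟨e, rfl⟩ := Ideal.mem_span_singleton'.1 hg
      have hw𝔪 : δ w ∈ 𝔪 := by
        have h1 := derivation_wIdeal_of_le (c := 0) δ le_rfl (fun z hz => Or.inl (hδ z hz)) hw
        rw [sub_zero] at h1
        refine (wIdeal_le_span ha').trans ?_ h1
        rw [Ideal.span_le]
        rintro _ ⟨z, hz, rfl⟩
        exact hL𝔪 z (hL'' z hz)
      have he : IsUnit e := by
        by_contra hne
        have he𝔪 : e ∈ 𝔪 := h𝔪.ge ((IsLocalRing.mem_maximalIdeal _).2 hne)
        refine hδy ?_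
        rw [← hgw, map_add, Derivation.leibniz, hδr]
        refine Ideal.add_mem _ (Ideal.add_mem _ ?_ ?_) hw𝔪
        · simpa using he𝔪
        · exact Ideal.mul_mem_right _ _ (hL𝔪 _ hrL)
      obtain ⟨v, hv⟩ := he.exists_left_inv
      have h1 : r = v * (y - w) := by rw [← hgw, add_sub_cancel_right, ← mul_assoc, hv, one_mul]
      change r ∈ wIdeal _ (1 / (a : ℚ))
      rw [h1]
      refine Ideal.mul_mem_left _ _ (Ideal.sub_mem _ (mem_wIdeal (List.mem_cons_self ..) le_rfl) ?_)
      exact wIdeal_mono (fun z hz => List.mem_cons_of_mem _ hz) _ hw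
    · exact mem_wIdeal (List.mem_cons_of_mem _ hz) le_rfl

/-- Exchange of a member of a presentation. The members between the new and the old position have
the same symbol, hence the sequence of symbols does not change. -/
theorem exists_presentation_exchange [IsLocalRing A] [IsNoetherianRing A]
    (h𝔪 : 𝔪 = IsLocalRing.maximalIdeal A) (c : CoordSystem K A 𝔪 n) (hcE : c.Compatible E)
    {L0 R1 R2 : List (A × ℚ≥0)} {a : ℚ≥0} {i : Fin n} {y : A}
    (hL : c.Extends ((L0 ++ (R1 ++ (c.z i, a) :: R2)).map Prod.fst))
    (hpos : ∀ z ∈ L0 ++ (R1 ++ (c.z i, a) :: R2), 0 < z.2)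
    (hsorted : ((L0 ++ (R1 ++ (c.z i, a) :: R2)).map fun y => symbol E y.2 y.1).Pairwise (· ≤ ·))
    (hR1 : ∀ z ∈ R1, symbol E z.2 z.1 = symbol E a (c.z i))
    (hy𝔪 : y ∈ 𝔪) (hy : y ∈ wIdeal (L0 ++ (R1 ++ (c.z i, a) :: R2)) (1 / (a : ℚ)))
    (hu : c.der i y ∉ 𝔪) (hdiv : IsDivisorial E y ↔ IsDivisorial E (c.z i))
    (hspan : IsDivisorial E (c.z i) → Ideal.span {c.z i} = Ideal.span {y}) :
    IsPresentation K 𝔪 E ((L0 ++ [(y, a)]) ++ (R1 ++ R2)) ∧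
    (((L0 ++ [(y, a)]) ++ (R1 ++ R2)).map fun y => symbol E y.2 y.1) =
      ((L0 ++ (R1 ++ (c.z i, a) :: R2)).map fun y => symbol E y.2 y.1) ∧
    ∀ q, wIdeal ((L0 ++ [(y, a)]) ++ (R1 ++ R2)) q = wIdeal (L0 ++ (R1 ++ (c.z i, a) :: R2)) q := by
  have hsym : (((L0 ++ [(y, a)]) ++ (R1 ++ R2)).map fun y => symbol E y.2 y.1) =
      ((L0 ++ (R1 ++ (c.z i, a) :: R2)).map fun y => symbol E y.2 y.1) := by
    have hya : symbol E a y = symbol E a (c.z i) := symbol_eq_iff.2 ⟨rfl, hdiv⟩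
    have h1 : (R1.map fun y => symbol E y.2 y.1) =
        List.replicate R1.length (symbol E a (c.z i)) := by
      rw [List.eq_replicate_iff]
      refine ⟨by simp, fun b hb => ?_⟩
      obtain ⟨z, hz, rfl⟩ := List.mem_map.1 hb
      exact hR1 z hz
    simp only [List.map_append, List.map_cons, List.map_nil, List.append_assoc, h1, hya]
    congr 1
    exact cons_replicate_append _ _ _
  set Lr := L0 ++ (R1 ++ R2) with hLr
  have hold : (L0 ++ (R1 ++ (c.z i, a) :: R2)).Perm ((c.z i, a) :: Lr) :=
    (List.Perm.append_left _ List.perm_middle).trans List.perm_middle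
  have hnew : ((L0 ++ [(y, a)]) ++ (R1 ++ R2)).Perm ((y, a) :: Lr) := by
    rw [List.append_assoc, List.singleton_append]
    exact List.perm_middle
  have hi𝔪 : c.z i ∈ 𝔪 := (hL.2 _ (by simp)).2
  -- replace the coordinate `z i` by `y`
  obtain ⟨c', hc'i, hc'j, -⟩ := c.exists_exchange h𝔪 hi𝔪 hy𝔪 hu
  have hnd : (c.z i :: Lr.map Prod.fst).Nodup := ((hold.map Prod.fst).nodup_iff).1 hL.1
  have hother : ∀ x ∈ Lr.map Prod.fst, x ∈ 𝔪 ∧ ∃ j, j ≠ i ∧ c.z j = x := by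
    intro x hx
    obtain ⟨⟨j, hj⟩, h2⟩ := hL.2 x ((hold.map Prod.fst).mem_iff.2 (List.mem_cons_of_mem _ hx))
    refine ⟨h2, j, ?_, hj⟩
    rintro rfl
    rw [← hj] at hx
    exact (List.nodup_cons.1 hnd).1 hx
  refine ⟨⟨⟨n, c', fun J hJ => ?_, ?_, ?_⟩, ?_, ?_⟩, hsym, fun q => ?_⟩
  · obtain ⟨k, rfl⟩ := hcE J hJ
    by_cases hk : k = i
    · subst hk
      exact ⟨k, by rw [hc'i]; exact hspan hJ⟩
    · exact ⟨k, by rw [hc'j k hk]⟩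
  · rw [(hnew.map Prod.fst).nodup_iff, List.map_cons, List.nodup_cons]
    refine ⟨fun hmem => ?_, (List.nodup_cons.1 hnd).2⟩
    obtain ⟨-, j, hj, hjy⟩ := hother _ hmem
    have : c.der i (c.z j) = 0 := by rw [c.der_apply, if_neg (Ne.symm hj)]
    rw [hjy] at this
    exact hu (by rw [this]; exact Ideal.zero_mem _)
  · intro x hx
    rw [(hnew.map Prod.fst).mem_iff, List.map_cons, List.mem_cons] at hx
    rcases hx with rfl | hx
    · exact ⟨⟨i, hc'i⟩, hy𝔪⟩
    · obtain ⟨h2, j, hj, rfl⟩ := hother x hx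
      exact ⟨⟨j, hc'j j hj⟩, h2⟩
  · intro z hz
    rw [hnew.mem_iff, List.mem_cons] at hz
    rcases hz with rfl | hz
    · exact hpos (c.z i, a) (by simp)
    · exact hpos z (hold.mem_iff.2 (List.mem_cons_of_mem _ hz))
  · rw [hsym]; exact hsorted
  · have h1 : ∀ q, wIdeal ((L0 ++ [(y, a)]) ++ (R1 ++ R2)) q = wIdeal ((y, a) :: Lr) q := fun q =>
      le_antisymm (wIdeal_mono (fun z hz => hnew.mem_iff.1 hz) q)
        (wIdeal_mono (fun z hz => hnew.mem_iff.2 hz) q)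
    rw [h1]
    refine wIdeal_exchange h𝔪 (hpos (c.z i, a) (by simp)) (by simp)
      (fun z hz => List.mem_cons.1 (hold.mem_iff.1 hz))
      (fun z hz => hold.mem_iff.2 (List.mem_cons_of_mem _ hz))
      (fun z hz => (hL.2 _ (List.mem_map_of_mem hz)).2) (c.der i) (by simp [c.der_apply])
      (fun z hz => ?_) hy hu q
    obtain ⟨-, j, hj, hjz⟩ := hother _ (List.mem_map_of_mem hz)
    rw [← hjz, c.der_apply, if_neg (Ne.symm hj)]

end Exchange

/-! ### The procedure follows every admissible center -/

section Forward

variable {K : Type u} [Field K] {A : Type u} [CommRing A] [Algebra K A]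
  {𝔪 : Ideal A} {E : Set (Ideal A)} {n : ℕ}

theorem cotangentIdeal_le [CharZero K] (c : CoordSystem K A 𝔪 n) {S : Subalgebra A (TAlg A)} {m : ℕ}
    {f : Fin m → A} {b : Fin m → ℚ≥0} (hS : ∀ j, mono (b j) (f j) ∈ S) {L : List (A × ℚ≥0)}
    (hSL : S ≤ monoAlg L) {a : ℚ≥0} (ha : 0 < a) (hL : ∀ z ∈ L, z.1 = 0 ∨ a ≤ z.2) :
    cotangentIdeal c f b a ≤ wIdeal L (1 / (a : ℚ)) := by
  rw [cotangentIdeal, Ideal.span_le]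
  rintro _ ⟨j, α, hα, rfl⟩
  have ha' : (0 : ℚ) < a := by exact_mod_cast ha
  have h1 := c.diffOp_mem_of_der (J := wIdeal L) (τ := Finset.univ) (w := 1 / (a : ℚ))
    (fun i _ q f hf => derivation_wIdeal_of_le _ (by positivity) (fun z hz => by
      rcases hL z hz with h | h
      · left; rw [h, map_zero]
      · right
        have h' : (a : ℚ) ≤ z.2 := by exact_mod_cast h
        exact one_div_le_one_div_of_le ha' h') hf)
    (mono_mem_monoAlg.1 (hSL (hS j))) α (by simp)
  refine (isFiltration_wIdeal L).antitone (le_of_eq ?_) h1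
  have h2 : (((∑ i, α i : ℕ) : ℚ) + 1) = b j * a := by exact_mod_cast hα
  field_simp
  linarith

theorem CoordSystem.der_mem_of_divisor (c : CoordSystem K A 𝔪 n) (hcE : c.Compatible E) {w : A}
    (hw : w ∈ 𝔪) (hdiv : w = 0 ∨ Ideal.span {w} ∈ E) {i : Fin n}
    (hne : Ideal.span {w} ∈ E → Ideal.span {w} ≠ Ideal.span {c.z i}) : c.der i w ∈ 𝔪 := by
  rcases hdiv with rfl | hdiv
  · rw [map_zero]; exact Ideal.zero_mem _
  obtain ⟨k, hk⟩ := hcE _ hdiv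
  have hki : i ≠ k := by rintro rfl; exact hne hdiv hk
  have hz : c.z k ∈ 𝔪 := by
    rw [← Ideal.span_singleton_le_iff_mem, ← hk, Ideal.span_singleton_le_iff_mem]; exact hw
  obtain ⟨e, he⟩ := Ideal.mem_span_singleton'.1 (hk ▸ Ideal.mem_span_singleton_self w)
  rw [← he, Derivation.leibniz, c.der_apply, if_neg hki, smul_zero, zero_add, smul_eq_mul]
  exact Ideal.mul_mem_right _ _ hz

theorem derivation_sup_sq_le (δ : Derivation K A A) {s : Set A} (hs : Ideal.span s ≤ 𝔪)
    (h : ∀ x ∈ s, δ x ∈ 𝔪) {f : A} (hf : f ∈ Ideal.span s ⊔ 𝔪 ^ 2) : δ f ∈ 𝔪 := by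
  obtain ⟨g, hg, w, hw, rfl⟩ := Submodule.mem_sup.1 hf
  rw [map_add]
  refine Ideal.add_mem _ (derivation_span_le δ hs h hg) ?_
  have := derivation_pow_le δ 1 hw
  rwa [pow_one] at this

theorem symbol_eq_of_le {a w : ℚ≥0} {z r : A} (h : symbol E w z ≤ symbol E a r) (hw : a ≤ w)
    (hz : IsDivisorial E r → w = a → IsDivisorial E z) : symbol E w z = symbol E a r := by
  have hwa : w = a := le_antisymm (weight_le_of_symbol_le h) hw
  refine symbol_eq_iff.2 ⟨hwa, fun hd => ?_, fun hd => hz hd hwa⟩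
  rw [symbol, symbol, Prod.Lex.toLex_le_toLex] at h
  rcases h with h | h
  · exact absurd h (not_lt.2 hw)
  · by_contra hr
    have h2 := h.2
    simp only [hd, hr, decide_true, decide_false] at h2
    exact absurd h2 (by decide)

variable [CharZero K] [IsLocalRing A] [IsNoetherianRing A] {R : Subalgebra A (TAlg A)}

/-- However the symbols of the state `s` are continued by a sequence `N` of symbols of larger
weights, the resulting invariant is larger than the one of the presentation `L'`. -/
def Exceeds (E : Set (Ideal A)) (L' : List (A × ℚ≥0)) (s : State A) : Prop :=
  ∀ N : List QPlus, (∀ μ ∈ N, ∀ y ∈ s.1, y.2 < (ofLex μ).1) →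
    toInvSeq (L'.map fun y => symbol E y.2 y.1) <
      toInvSeq ((coords s.1).map (fun y => symbol E y.2 y.1) ++ N)

/-- The list `L` is a presentation which has the same invariant and the same monomial filtration
as `L'`. -/
def IsEquivPresentation (K : Type u) [Field K] [Algebra K A] (𝔪 : Ideal A) (E : Set (Ideal A))
    (L' L : List (A × ℚ≥0)) : Prop :=
  IsPresentation K 𝔪 E L ∧
    (L.map fun y => symbol E y.2 y.1) = (L'.map fun y => symbol E y.2 y.1) ∧
    ∀ q, wIdeal L q = wIdeal L' q

theorem StepData.exceeds_of_mem {s s' : State A} {x : List A} {a : ℚ≥0} {c : CoordSystem K A 𝔪 n}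
    {m : ℕ} {f : Fin m → A} {b : Fin m → ℚ≥0} (h : StepData K 𝔪 E s s' x a c f b)
    {L' Rem : List (A × ℚ≥0)} {u v : List A} (hx : x = u ++ v)
    (hL : IsEquivPresentation K 𝔪 E L' ((coords s.1 ++ u.map fun y => (y, a)) ++ Rem))
    {z : A × ℚ≥0} (hz : z ∈ Rem) (hza : z.2 ≤ a) (hv : ∀ y ∈ v, symbol E z.2 z.1 < symbol E a y) :
    Exceeds E L' s' := by
  intro N hN
  rw [← hL.2.1, h.coords_eq, hx]
  simp only [List.map_append, List.append_assoc]
  rw [← List.append_assoc, ← List.append_assoc (List.map _ (coords s.1))]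
  have hsort := hL.1.2.2
  rw [List.map_append, List.pairwise_append] at hsort
  refine toInvSeq_lt (List.mem_map_of_mem hz) hsort.2.1 fun μ hμ => ?_
  rcases List.mem_append.1 hμ with hμ | hμ
  · rw [List.map_map] at hμ
    obtain ⟨y, hy, rfl⟩ := List.mem_map.1 hμ
    exact hv y hy
  · have h1 : a < (ofLex μ).1 := hN μ hμ (x, a) (by rw [h.fst]; simp)
    have : toLex (ofLex μ) = μ := toLex_ofLex μ
    rw [← this, symbol, Prod.Lex.toLex_lt_toLex]
    exact Or.inl (hza.trans_lt h1)

/-- The parameters of the new block are exchanged one by one for members of weight `a` of the given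
presentation; this is possible unless the invariant of the presentation is too small. -/
theorem StepData.exists_presentation (h𝔪 : 𝔪 = IsLocalRing.maximalIdeal A) {s s' : State A}
    {x : List A} {a : ℚ≥0} {c : CoordSystem K A 𝔪 n} {m : ℕ} {f : Fin m → A} {b : Fin m → ℚ≥0}
    (h : StepData K 𝔪 E s s' x a c f b) (hs : Reached K 𝔪 E R s) {L' Y : List (A × ℚ≥0)}
    (hY : IsEquivPresentation K 𝔪 E L' (coords s.1 ++ Y)) (hYa : ∀ z ∈ Y, a ≤ z.2)
    (hsL' : s.2 ≤ monoAlg L') {u v : List A} (hx : x = u ++ v) :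
    (∃ Rem, IsEquivPresentation K 𝔪 E L' ((coords s.1 ++ u.map fun y => (y, a)) ++ Rem) ∧
      ∀ z ∈ Rem, a ≤ z.2) ∨ Exceeds E L' s' := by
  classical
  induction u using List.reverseRecOn generalizing v with
  | nil => exact Or.inl ⟨Y, by simpa using hY, hYa⟩
  | append_singleton u y ih =>
    rcases ih (v := y :: v) (by simpa using hx) with ⟨Rem, hRem, hRema⟩ | hex
    swap
    · exact Or.inr hex
    have ha := h.weight_pos h𝔪 hs
    have ha' : (0 : ℚ) < a := by exact_mod_cast ha
    set P := idealOf s.1 with hP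
    have hlocB := isLocalRing_quot (hs.ne_top h𝔪)
    have h𝔪B : 𝔪.map (Ideal.Quotient.mk P) = IsLocalRing.maximalIdeal (A ⧸ P) :=
      CoordSystem.maximalIdeal_quot h𝔪
    obtain ⟨-, hpw, nB, cB, mB, fB, bB, hcBE, hcBx, hSB, hfree, hdivs, -⟩ := h.contact
    set T := cotangentIdeal cB fB bB a with hT
    have hyx : y ∈ x := by rw [hx]; simp
    have hy𝔪 : y ∈ 𝔪 := (h.extends_new.2 y hyx).2
    obtain ⟨iB, hiB⟩ := (hcBx.2 _ (List.mem_map_of_mem hyx)).1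
    have hydiv := h.isDivisorial_iff h𝔪 hyx
    -- the current presentation, and coordinates for it
    set L0 := coords s.1 ++ u.map fun y => (y, a) with hL0
    set L := L0 ++ Rem with hL
    obtain ⟨⟨n', c', hc'E, hc'L⟩, hpos, hsort⟩ := hRem.1
    have hsL : s.2 ≤ monoAlg L := by rw [monoAlg_congr hRem.2.2]; exact hsL'
    have hL0L : ∀ z ∈ L0, z ∈ L := fun z hz => List.mem_append_left _ hz
    have hRemL : ∀ z ∈ Rem, z ∈ L := fun z hz => List.mem_append_right _ hz
    have hsC : ∀ z ∈ coords s.1, z ∈ L := fun z hz => hL0L z (List.mem_append_left _ hz)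
    have hmk0 : ∀ z ∈ coords s.1, Ideal.Quotient.mk P z.1 = 0 := fun z hz => by
      rw [Ideal.Quotient.eq_zero_iff_mem, hP, WeightedCenters.idealOf_eq]
      exact Ideal.subset_span (List.mem_map_of_mem hz)
    have hLa : ∀ z ∈ L, z ∈ coords s.1 ∨ a ≤ z.2 := by
      intro z hz
      rcases List.mem_append.1 hz with hz | hz
      · rcases List.mem_append.1 hz with hz | hz
        · exact Or.inl hz
        · obtain ⟨w, -, rfl⟩ := List.mem_map.1 hz
          exact Or.inr le_rfl
      · exact Or.inr (hRema z hz)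
    -- the cotangent ideal is contained in the part of weight `1 / a` of the presentation
    have hLB : extend (Ideal.Quotient.mk P) s.2 ≤
        monoAlg (L.map fun z => (Ideal.Quotient.mk P z.1, z.2)) := by
      refine (extend_le_iff _ (hs.isHomog h𝔪)).2 fun q g hg => mono_mem_monoAlg.2 ?_
      exact map_wIdeal_le _ _ _ (Ideal.mem_map_of_mem _ (mono_mem_monoAlg.1 (hsL hg)))
    have hTle : T ≤ (wIdeal L (1 / (a : ℚ))).map (Ideal.Quotient.mk P) := by
      refine (cotangentIdeal_le cB (fun j => ?_) hLB ha fun z hz => ?_).trans (wIdeal_map_le _ _ _)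
      · rw [hSB]; exact Algebra.subset_adjoin ⟨j, rfl⟩
      · obtain ⟨w, hw, rfl⟩ := List.mem_map.1 hz
        rcases hLa w hw with hw | hw
        exacts [Or.inl (hmk0 w hw), Or.inr hw]
    have hPle : P ≤ wIdeal L (1 / (a : ℚ)) := by
      rw [hP, WeightedCenters.idealOf_eq, Ideal.span_le]
      intro w hw
      obtain ⟨z, hz, rfl⟩ := List.mem_map.1 hw
      refine mem_wIdeal (hsC z hz) ?_
      obtain ⟨z', hz', -, hz2⟩ := mem_coords.1 hz
      have h1 := (hs.lt_order h𝔪 h.contact.1).1 z' hz'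
      rw [← hz2] at h1
      have h2 : (0 : ℚ) < z.2 := by exact_mod_cast hs.pos_coords z hz
      have h3 : (z.2 : ℚ) ≤ a := by exact_mod_cast h1.le
      exact one_div_le_one_div_of_le h2 h3
    have hTcomap : ∀ g, Ideal.Quotient.mk P g ∈ T → g ∈ wIdeal L (1 / (a : ℚ)) := fun g hg => by
      have h1 := hTle hg
      rw [Ideal.mem_quotient_iff_mem_sup, sup_eq_left.2 hPle] at h1
      exact h1
    -- modulo `𝔪 ^ 2`, this part is spanned by the members of weight at most `a`
    have hlin := wIdeal_le_span_sup_sq (L := L) (𝔪 := 𝔪)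
      (fun z hz => (hc'L.2 _ (List.mem_map_of_mem hz)).2) (q := 1 / (a : ℚ)) (by positivity)
    have hsmall : ∀ z ∈ L, 1 / (a : ℚ) ≤ 1 / z.2 → z ∈ L0 ∨ (z ∈ Rem ∧ z.2 = a) := by
      intro z hz h1
      rcases List.mem_append.1 hz with hz | hz
      · exact Or.inl hz
      · refine Or.inr ⟨hz, le_antisymm ?_ (hRema z hz)⟩
        have h2 : (0 : ℚ) < z.2 := by exact_mod_cast hpos z (hRemL z hz)
        exact_mod_cast (one_div_le_one_div ha' h2).1 h1
    -- the derivative along `y` of the earlier members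
    have hder0 : ∀ z ∈ L0, cB.der iB (Ideal.Quotient.mk P z.1) ∈ 𝔪.map (Ideal.Quotient.mk P) := by
      intro z hz
      rcases List.mem_append.1 hz with hz | hz
      · rw [hmk0 z hz, map_zero]; exact Ideal.zero_mem _
      · obtain ⟨w, hw, rfl⟩ := List.mem_map.1 hz
        have hwx : w ∈ x := by rw [hx]; simp [hw]
        obtain ⟨k, hk⟩ := (hcBx.2 _ (List.mem_map_of_mem hwx)).1
        rw [← hk, cB.der_apply, if_neg]
        · exact Ideal.zero_mem _
        · rintro rfl
          have hnd := hcBx.1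
          rw [hx, List.append_assoc, List.map_append, List.nodup_append] at hnd
          exact hnd.2.2 _ (List.mem_map_of_mem hw) _ (by simp) (hk.symm.trans hiB)
    -- the derivative along `y` of a divisorial member
    have hder1 : ∀ z ∈ Rem, IsDivisorial E z.1 →
        (Ideal.span {Ideal.Quotient.mk P z.1} ∈ restrictDiv E P →
          Ideal.span {Ideal.Quotient.mk P z.1} ≠ Ideal.span {Ideal.Quotient.mk P y}) →
        cB.der iB (Ideal.Quotient.mk P z.1) ∈ 𝔪.map (Ideal.Quotient.mk P) := by
      intro z hz hdiv hne
      refine cB.der_mem_of_divisor hcBE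
        (Ideal.mem_map_of_mem _ (hc'L.2 _ (List.mem_map_of_mem (hRemL z hz))).2) ?_ ?_
      · by_cases h0 : Ideal.Quotient.mk P z.1 = 0
        · exact Or.inl h0
        · refine Or.inr ⟨by rwa [Ne, Ideal.span_singleton_eq_bot], _, hdiv, ?_⟩
          rw [Ideal.map_span, Set.image_singleton]
      · rw [hiB]; exact hne
    -- it is enough to find a member which may be exchanged for `y`
    suffices hfind : Exceeds E L' s' ∨ ∃ i : Fin n', (c'.z i, a) ∈ Rem ∧ c'.der i y ∉ 𝔪 ∧
        y ∈ wIdeal L (1 / (a : ℚ)) ∧ (IsDivisorial E y ↔ IsDivisorial E (c'.z i)) ∧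
        (IsDivisorial E (c'.z i) → Ideal.span {c'.z i} = Ideal.span {y}) ∧
        (IsDivisorial E (c'.z i) → ∀ z ∈ Rem, z.2 = a → IsDivisorial E z.1) by
      rcases hfind with hex | ⟨i, hi, hu, hyw, hdi, hspan, hall⟩
      · exact Or.inr hex
      · obtain ⟨R1, R2, hR⟩ := List.append_of_mem hi
        have hLR : L = L0 ++ (R1 ++ (c'.z i, a) :: R2) := by rw [hL, hR]
        rw [hLR] at hc'L hpos hsort hyw
        have hR1 : ∀ z ∈ R1, symbol E z.2 z.1 = symbol E a (c'.z i) := by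
          intro z hz
          have hzRem : z ∈ Rem := by rw [hR]; exact List.mem_append_left _ hz
          refine symbol_eq_of_le ?_ (hRema z hzRem) fun hd hza => hall hd z hzRem hza
          rw [List.map_append, List.pairwise_append] at hsort
          have hsort2 := hsort.2.1
          rw [List.map_append, List.pairwise_append] at hsort2
          exact hsort2.2.2 _ (List.mem_map_of_mem (f := fun y : A × ℚ≥0 => symbol E y.2 y.1) hz) _
            (by simp)
        obtain ⟨h1, h2, h3⟩ := exists_presentation_exchange h𝔪 c' hc'E hc'L hpos hsort hR1 hy𝔪 hyw
            hu
          hdi hspan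
        refine Or.inl ⟨R1 ++ R2, ?_, fun z hz => hRema z ?_⟩
        · have : (coords s.1 ++ (u ++ [y]).map fun y => (y, a)) = L0 ++ [(y, a)] := by
            rw [hL0, List.map_append, List.append_assoc]; rfl
          rw [this]
          refine ⟨h1, h2.trans ?_, fun q => (h3 q).trans ?_⟩
          · rw [← hLR]; exact hRem.2.1
          · rw [← hLR]; exact hRem.2.2 q
        · rw [hR]
          rcases List.mem_append.1 hz with hz | hz
          · exact List.mem_append_left _ hz
          · exact List.mem_append_right _ (List.mem_cons_of_mem _ hz)
    by_cases hyE : IsDivisorial E y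
    · -- a divisorial parameter
      -- if a free member of weight `a` is left, then the invariant of the presentation is smaller
      by_cases hfreeRem : ∃ z ∈ Rem, z.2 = a ∧ ¬ IsDivisorial E z.1
      · obtain ⟨z, hz, hza, hzE⟩ := hfreeRem
        refine Or.inl (h.exceeds_of_mem (by simpa using hx : x = u ++ y :: v) hRem hz hza.le ?_)
        intro w hw
        have hwE : IsDivisorial E w := by
          rcases List.mem_cons.1 hw with rfl | hw'
          · exact hyE
          · rw [hx, List.map_append, List.pairwise_append] at hpw
            have hwx : w ∈ x := by rw [hx]; simp [hw']
            refine (h.isDivisorial_iff h𝔪 hwx).1 (hpw.2.2 _ ?_ _ (List.mem_map_of_mem hw')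
              (hydiv.2 hyE))
            simp
        rw [hza, symbol, symbol, Prod.Lex.toLex_lt_toLex]
        right
        simp [hzE, hwE]
      · push Not at hfreeRem
        right
        obtain ⟨k, hk⟩ := hc'E _ hyE
        have hk𝔪 : c'.z k ∈ 𝔪 := by
          rw [← Ideal.span_singleton_le_iff_mem, ← hk, Ideal.span_singleton_le_iff_mem]
          exact hy𝔪
        -- the component defined by `y` occurs among the remaining members of weight `a`: else
        -- `∂/∂y` would map the cotangent ideal into the maximal ideal
        have hmem : ∃ z ∈ Rem, z.2 = a ∧ Ideal.span {z.1} = Ideal.span {y} := by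
          by_contra! hno
          refine absurd (hdivs iB (by rw [hiB]; exact List.mem_map_of_mem hyx)
            (by rw [hiB]; exact hydiv.2 hyE)) ?_
          rw [← Ne, ← lt_top_iff_ne_top]
          refine lt_of_le_of_lt ?_ (lt_top_iff_ne_top.2
            (h𝔪B ▸ Ideal.IsPrime.ne_top inferInstance : 𝔪.map (Ideal.Quotient.mk P) ≠ ⊤))
          rw [Ideal.span_le]
          rintro _ ⟨g, hg, rfl⟩
          have h1 := Ideal.map_mono (f := Ideal.Quotient.mk P) hlin (hTle hg)
          rw [Ideal.map_sup, Ideal.map_pow, Ideal.map_span] at h1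
          refine derivation_sup_sq_le (cB.der iB) ?_ ?_ h1
          · rw [Ideal.span_le]
            rintro _ ⟨_, ⟨z, hz, -, rfl⟩, rfl⟩
            exact Ideal.mem_map_of_mem _ (hc'L.2 _ (List.mem_map_of_mem hz)).2
          · rintro _ ⟨_, ⟨z, hz, hz1, rfl⟩, rfl⟩
            rcases hsmall z hz hz1 with hz0 | ⟨hzR, hza⟩
            · exact hder0 z hz0
            · refine hder1 z hzR (hfreeRem z hzR hza) fun _ heq => ?_
              -- distinct components restrict to distinct components
              obtain ⟨τ, hτ, hτL, hspan⟩ := c'.exists_indices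
                (l := (coords s.1).map Prod.fst) (hc'L.mono (by
                  rw [hL, hL0, List.append_assoc, List.map_append]
                  exact List.sublist_append_left _ _))
              obtain ⟨⟨l, hl⟩, -⟩ := hc'L.2 _ (List.mem_map_of_mem hz)
              have hlk : l ≠ k := by
                rintro rfl
                exact hno z hzR hza (by rw [hk, hl])
              have hlτ : l ∉ τ := by
                intro hlτ
                have h2 := (hτL l).1 hlτ
                rw [hl] at h2
                have hnd := hc'L.1
                rw [hL, hL0, List.append_assoc, List.map_append, List.nodup_append] at hnd
                exact hnd.2.2 _ h2 _ (List.mem_map_of_mem (List.mem_append_right _ hzR)) rfl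
              refine c'.z_notMem_paramIdeal h𝔪 (τ := insert k τ) (i := l)
                (Finset.insert_subset (c'.mem_vanishing.2 hk𝔪) hτ) (by simp [hlk, hlτ]) ?_
              rw [c'.paramIdeal_insert, ← hspan, ← WeightedCenters.idealOf_eq, ← hP, ← hk, sup_comm,
                ← Ideal.mem_quotient_iff_mem_sup, Ideal.map_span, Set.image_singleton, ← heq, hl]
              exact Ideal.mem_span_singleton_self _
        obtain ⟨z, hz, hza, hzy⟩ := hmem
        obtain ⟨⟨i, hi⟩, -⟩ := hc'L.2 _ (List.mem_map_of_mem (hRemL z hz))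
        have hzi : z = (c'.z i, a) := Prod.ext hi.symm hza
        have hdi : IsDivisorial E (c'.z i) := by rw [IsDivisorial, hi, hzy]; exact hyE
        -- the member `z` differs from `y` by a unit
        refine ⟨i, hzi ▸ hz, fun hu => ?_, ?_, iff_of_true hyE hdi, fun _ => by rw [hi, hzy],
          fun _ => hfreeRem⟩
        · obtain ⟨e, he⟩ := Ideal.mem_span_singleton'.1
            (hzy ▸ Ideal.mem_span_singleton_self z.1 : z.1 ∈ Ideal.span {y})
          have h1 : c'.der i z.1 = 1 := by rw [← hi, c'.der_apply, if_pos rfl]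
          rw [← he, Derivation.leibniz] at h1
          refine CoordSystem.one_notMem (A := A) h𝔪 ?_
          rw [← h1]
          exact Ideal.add_mem _ (Ideal.mul_mem_left _ _ hu) (Ideal.mul_mem_right _ _ hy𝔪)
        · obtain ⟨e, he⟩ := Ideal.mem_span_singleton'.1
            (hzy.symm ▸ Ideal.mem_span_singleton_self y : y ∈ Ideal.span {z.1})
          rw [← he]
          exact Ideal.mul_mem_left _ _ (mem_wIdeal (hRemL z hz) (by rw [hza]))
    · -- a free parameter
      right
      have hyT : Ideal.Quotient.mk P y ∈ T := by
        rw [← hiB]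
        exact hfree iB (by rw [hiB]; exact List.mem_map_of_mem hyx)
          (by rw [hiB, hydiv]; exact hyE)
      have hyw := hTcomap y hyT
      -- `σ`: the remaining free members of weight `a`, one of which can be exchanged;
      -- `ρ`: all other members which occur in `y` modulo `𝔪 ^ 2`
      let σ : Finset (Fin n') := Finset.univ.filter fun i =>
        (c'.z i, a) ∈ Rem ∧ ¬ IsDivisorial E (c'.z i)
      let ρ : Finset (Fin n') := Finset.univ.filter fun i =>
        c'.z i ∈ L0.map Prod.fst ∨ ((c'.z i, a) ∈ Rem ∧ IsDivisorial E (c'.z i))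
      have hnd := hc'L.1
      rw [hL, List.map_append, List.nodup_append] at hnd
      have hdisj : ∀ i ∈ σ, i ∉ ρ := by
        intro i hi hi'
        simp only [σ, ρ, Finset.mem_filter, Finset.mem_univ, true_and] at hi hi'
        rcases hi' with hi' | hi'
        · exact hnd.2.2 _ hi' _ (List.mem_map_of_mem hi.1) rfl
        · exact hi.2 hi'.2
      have hσv : σ ⊆ c'.vanishing := by
        intro i hi
        simp only [σ, Finset.mem_filter, Finset.mem_univ, true_and] at hi
        exact c'.mem_vanishing.2 (hc'L.2 _ (List.mem_map_of_mem (hRemL _ hi.1))).2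
      have hρv : ρ ⊆ c'.vanishing := by
        intro i hi
        simp only [ρ, Finset.mem_filter, Finset.mem_univ, true_and] at hi
        refine c'.mem_vanishing.2 ?_
        rcases hi with hi | hi
        · refine (hc'L.2 _ ?_).2
          rw [hL, List.map_append]; exact List.mem_append_left _ hi
        · exact (hc'L.2 _ (List.mem_map_of_mem (hRemL _ hi.1))).2
      have hy1 : y ∈ c'.paramIdeal ρ ⊔ c'.paramIdeal σ ⊔ 𝔪 ^ 2 := by
        refine (sup_le_sup_right ?_ _ : _ ≤ c'.paramIdeal ρ ⊔ c'.paramIdeal σ ⊔ 𝔪 ^ 2) (hlin hyw)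
        rw [Ideal.span_le]
        rintro _ ⟨z, hz, hz1, rfl⟩
        obtain ⟨⟨i, hi⟩, -⟩ := hc'L.2 _ (List.mem_map_of_mem hz)
        rw [← hi]
        rcases hsmall z hz hz1 with hz0 | ⟨hzR, hza⟩
        · refine Ideal.mem_sup_left (c'.z_mem_paramIdeal ?_)
          simp only [ρ, Finset.mem_filter, Finset.mem_univ, true_and]
          exact Or.inl (hi ▸ List.mem_map_of_mem hz0)
        · have hzi : z = (c'.z i, a) := Prod.ext hi.symm hza
          by_cases hd : IsDivisorial E (c'.z i)
          · refine Ideal.mem_sup_left (c'.z_mem_paramIdeal ?_)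
            simp only [ρ, Finset.mem_filter, Finset.mem_univ, true_and]
            exact Or.inr ⟨hzi ▸ hzR, hd⟩
          · refine Ideal.mem_sup_right (c'.z_mem_paramIdeal ?_)
            simp only [σ, Finset.mem_filter, Finset.mem_univ, true_and]
            exact ⟨hzi ▸ hzR, hd⟩
      -- the derivatives along `y` of the members in `ρ` vanish at the point, but `∂y/∂y = 1`
      have hy2 : y ∉ c'.paramIdeal ρ ⊔ 𝔪 ^ 2 := by
        intro hy2
        have h1 := Ideal.mem_map_of_mem (Ideal.Quotient.mk P) hy2
        rw [Ideal.map_sup, Ideal.map_pow, CoordSystem.paramIdeal, Ideal.map_span] at h1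
        have h2 := derivation_sup_sq_le (cB.der iB) ?_ ?_ h1
        · rw [← hiB, cB.der_apply, if_pos rfl] at h2
          exact CoordSystem.one_notMem (A := A ⧸ P) h𝔪B h2
        · rw [Ideal.span_le]
          rintro _ ⟨_, ⟨i, hi, rfl⟩, rfl⟩
          exact Ideal.mem_map_of_mem _ (c'.mem_vanishing.1 (hρv hi))
        · rintro _ ⟨_, ⟨i, hi, rfl⟩, rfl⟩
          simp only [ρ, Finset.mem_filter, Finset.mem_univ, true_and] at hi
          rcases hi with hi | ⟨hi, hd⟩
          · obtain ⟨z, hz, hzi⟩ := List.mem_map.1 hi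
            rw [← hzi]
            exact hder0 z hz
          · refine hder1 _ hi hd fun hmem heq => hyE (hydiv.1 ?_)
            rw [IsDivisorial, ← heq]
            exact hmem
      obtain ⟨i, hi, hu⟩ := c'.exists_der_notMem hσv
        (fun i hi q hq => c'.der_paramIdeal (hdisj i hi) hq) hy1 hy2
      simp only [σ, Finset.mem_filter, Finset.mem_univ, true_and] at hi
      exact ⟨i, hi.1, hu, hyw, iff_of_false hyE hi.2, fun hd => absurd hd hi.2,
        fun hd => absurd hd hi.2⟩

end Forward

/-! ### Maximal admissible centers -/

section Maximal

variable {K : Type u} [Field K] {A : Type u} [CommRing A] [Algebra K A]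
  {𝔪 : Ideal A} {E : Set (Ideal A)}

/-- The coordinates of the state `s` may be continued to a presentation which is equivalent to `L'`,
unless the invariant of `L'` is too small. -/
def Tracks (K : Type u) [Field K] [Algebra K A] (𝔪 : Ideal A) (E : Set (Ideal A))
    (L' : List (A × ℚ≥0)) (s : State A) : Prop :=
  (∃ Y, IsEquivPresentation K 𝔪 E L' (coords s.1 ++ Y) ∧ s.2 ≤ monoAlg L') ∨ Exceeds E L' s

variable [CharZero K] [IsLocalRing A] [IsNoetherianRing A] {R : Subalgebra A (TAlg A)}

theorem StepData.le_monoAlg (h𝔪 : 𝔪 = IsLocalRing.maximalIdeal A) {s s' : State A}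
    {x : List A} {a : ℚ≥0} {n : ℕ} {c : CoordSystem K A 𝔪 n} {m : ℕ} {f : Fin m → A}
    {b : Fin m → ℚ≥0}
    (h : StepData K 𝔪 E s s' x a c f b) (hs : Reached K 𝔪 E R s) {Y : List (A × ℚ≥0)}
    (hY : ∀ z ∈ Y, a ≤ z.2) (hsL : s.2 ≤ monoAlg (coords s'.1 ++ Y)) :
    s'.2 ≤ monoAlg (coords s'.1 ++ Y) := by
  have ha := h.weight_pos h𝔪 hs
  have ha' : (0 : ℚ) < a := by exact_mod_cast ha
  obtain ⟨τ, σ, hτ, hσ, hd, hτs, hσx, -, -⟩ := h.exists_indices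
  rw [h.snd, coeffAlg]
  refine sup_le ?_ (Algebra.adjoin_le ?_)
  · rw [c.intPart_eq h𝔪 h.extends_coords (h.pos_coords h𝔪 hs)]
    exact inf_le_left.trans (monoAlg_mono fun z hz => List.mem_append_left _ hz)
  · rintro _ ⟨j, α, hα, hlt, rfl⟩
    have hle : ((∑ i, α i : ℕ) : ℚ≥0) / a ≤ b j := by rw [div_le_iff₀ ha]; exact hlt.le
    refine mono_mem_monoAlg.2 ?_
    have h1 := c.diffOp_mem_of_der (J := wIdeal (coords s'.1 ++ Y)) (τ := σ) (w := 1 / (a : ℚ))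
      (fun i hi _ q hq => derivation_wIdeal_of_le _ (by positivity) (fun z hz => by
        rw [h.coords_eq, List.append_assoc, List.mem_append, List.mem_append] at hz
        rcases hz with hz | hz | hz
        · left
          obtain ⟨k, hk⟩ := (h.extends_old.2 _ (List.mem_map_of_mem hz)).1
          rw [← hk, c.der_apply, if_neg]
          rintro rfl
          exact Finset.disjoint_right.1 hd hi ((hτs i).2 (hk ▸ List.mem_map_of_mem hz))
        · obtain ⟨w, -, rfl⟩ := List.mem_map.1 hz
          exact Or.inr le_rfl
        · right
          have h' : (a : ℚ) ≤ z.2 := by exact_mod_cast hY z hz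
          exact one_div_le_one_div_of_le ha' h') hq)
      (mono_mem_monoAlg.1 (hsL (h.gen_mem j))) α (fun i hi => hα i fun hx => hi ((hσx i).2 hx))
    rw [NNRat.coe_sub hle, NNRat.coe_div, NNRat.coe_natCast]
    rwa [mul_one_div] at h1

theorem StepData.tracks (h𝔪 : 𝔪 = IsLocalRing.maximalIdeal A) {s s' : State A}
    {x : List A} {a : ℚ≥0} {n : ℕ} {c : CoordSystem K A 𝔪 n} {m : ℕ} {f : Fin m → A}
    {b : Fin m → ℚ≥0}
    (h : StepData K 𝔪 E s s' x a c f b) (hs : Reached K 𝔪 E R s) {L' : List (A × ℚ≥0)}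
    (ht : Tracks K 𝔪 E L' s) : Tracks K 𝔪 E L' s' := by
  rcases ht with ⟨Y, hY, hsL'⟩ | hex
  · by_cases hYa : ∀ z ∈ Y, a ≤ z.2
    · rcases h.exists_presentation h𝔪 hs hY hYa hsL' (u := x) (v := []) (by simp) with
        ⟨Rem, hRem, hRema⟩ | hex
      · have hRem' := hRem
        rw [← h.coords_eq] at hRem'
        refine Or.inl ⟨Rem, hRem', ?_⟩
        rw [← monoAlg_congr hRem'.2.2] at hsL' ⊢
        exact h.le_monoAlg h𝔪 hs hRema hsL'
      · exact Or.inr hex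
    · push Not at hYa
      obtain ⟨z, hz, hza⟩ := hYa
      refine Or.inr (h.exceeds_of_mem (u := []) (v := x) rfl (by simpa using hY) hz hza.le
        fun y _ => symbol_le_symbol_of_lt hza _ _)
  · refine Or.inr fun N hN => ?_
    rw [h.coords_eq, List.map_append, List.append_assoc]
    refine hex _ fun μ hμ y hy => ?_
    rcases List.mem_append.1 hμ with hμ | hμ
    · rw [List.map_map] at hμ
      obtain ⟨w, -, rfl⟩ := List.mem_map.1 hμ
      exact (hs.lt_order h𝔪 h.contact.1).1 y hy
    · exact hN μ hμ y (by rw [h.fst]; exact List.mem_append_left _ hy)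

theorem MillingRun.tracks (h𝔪 : 𝔪 = IsLocalRing.maximalIdeal A) (hR : Reached K 𝔪 E R ([], R))
    {L' : List (A × ℚ≥0)} (hL' : IsPresentation K 𝔪 E L') (hRL' : R ≤ monoAlg L') {s : State A}
    (h : MillingRun K 𝔪 E ([], R) s) : Tracks K 𝔪 E L' s := by
  induction h with
  | refl => exact Or.inl ⟨L', ⟨hL', rfl, fun _ => rfl⟩, hRL'⟩
  | tail hrun hstep ih =>
    obtain ⟨x, a, n, c, m, f, b, h⟩ := hstep.exists_stepData
    exact h.tracks h𝔪 (MillingRun.reached h𝔪 hR hrun) ih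

theorem Reached.isPresentation {s : State A} (h : Reached K 𝔪 E R s) :
    IsPresentation K 𝔪 E (coords s.1) :=
  ⟨h.coord, h.pos_coords, h.sorted⟩

/-- Comparison of an admissible presentation with the coordinates of a run which has ended. -/
theorem MillingRun.compare (h𝔪 : 𝔪 = IsLocalRing.maximalIdeal A) (hR : Reached K 𝔪 E R ([], R))
    {L' : List (A × ℚ≥0)} (hL' : IsPresentation K 𝔪 E L') (hRL' : R ≤ monoAlg L') {s : State A}
    (h : MillingRun K 𝔪 E ([], R) s) :
    (IsEquivPresentation K 𝔪 E L' (coords s.1) ∧ s.2 ≤ monoAlg L') ∨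
      invOf E L' < invOf E (coords s.1) := by
  rcases h.tracks h𝔪 hR hL' hRL' with ⟨Y, hY, hs⟩ | hex
  · rcases Y with _ | ⟨y, Y⟩
    · left
      rw [List.append_nil] at hY
      exact ⟨hY, hs⟩
    · right
      rw [invOf, invOf, ← hY.2.1, List.map_append]
      have hsort := hY.1.2.2
      rw [List.map_append, List.pairwise_append] at hsort
      have := toInvSeq_lt (p := (coords s.1).map fun y => symbol E y.2 y.1) (N := [])
        (List.mem_map_of_mem (f := fun y : A × ℚ≥0 => symbol E y.2 y.1)
          (List.mem_cons_self : y ∈ y :: Y)) hsort.2.1 (by simp)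
      rwa [List.append_nil] at this
  · right
    have := hex [] (by simp)
    rwa [List.append_nil] at this

theorem IsPresentation.admissible_iff (h𝔪 : 𝔪 = IsLocalRing.maximalIdeal A) {L : List (A × ℚ≥0)}
    (hL : IsPresentation K 𝔪 E L) (hR : IsHomog R) : Admissible R (center L) ↔ R ≤ monoAlg L := by
  obtain ⟨⟨n, c, -, hc⟩, hpos, -⟩ := hL
  exact c.admissible_center_iff h𝔪 hc hpos hR

theorem IsPresentation.center_eq (h𝔪 : 𝔪 = IsLocalRing.maximalIdeal A) {L : List (A × ℚ≥0)}
    (hL : IsPresentation K 𝔪 E L) : center L = monoAlg L ⊓ supportedIn A (weightGroup L) := by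
  obtain ⟨⟨n, c, -, hc⟩, hpos, -⟩ := hL
  exact c.center_eq h𝔪 hc hpos

/-- The end of a run defines the resolution invariant. -/
theorem MillingRun.isResolutionInv (h𝔪 : 𝔪 = IsLocalRing.maximalIdeal A)
    (hR : Reached K 𝔪 E R ([], R)) {s : State A} (h : MillingRun K 𝔪 E ([], R) s)
    (hs : Terminated s) : IsResolutionInv K 𝔪 E R (invOf E (coords s.1)) := by
  have hsr := MillingRun.reached h𝔪 hR h
  have hhom := hR.isHomog h𝔪
  refine ⟨⟨_, hsr.isPresentation, (hsr.isPresentation.admissible_iff h𝔪 hhom).2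
    (h.le_monoAlg h𝔪 hR hs), rfl⟩, ?_⟩
  rintro _ ⟨L', hL', hadm, rfl⟩
  rcases h.compare h𝔪 hR hL' ((hL'.admissible_iff h𝔪 hhom).1 hadm) with ⟨h1, -⟩ | h1
  · rw [invOf, invOf, h1.2.1]
  · exact h1.le

/-- The end of a run is the only maximal admissible center. -/
theorem MillingRun.eq_center (h𝔪 : 𝔪 = IsLocalRing.maximalIdeal A)
    (hR : Reached K 𝔪 E R ([], R)) {s : State A} (h : MillingRun K 𝔪 E ([], R) s)
    (hs : Terminated s) {𝒜 : Subalgebra A (TAlg A)} (h𝒜 : IsMaximalAdmissible K 𝔪 E R 𝒜) :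
    𝒜 = center (coords s.1) := by
  have hsr := MillingRun.reached h𝔪 hR h
  have hhom := hR.isHomog h𝔪
  obtain ⟨L', hL', rfl, hadm, hinv⟩ := h𝒜
  have heq := hinv.unique (h.isResolutionInv h𝔪 hR hs)
  rcases h.compare h𝔪 hR hL' ((hL'.admissible_iff h𝔪 hhom).1 hadm) with ⟨h1, -⟩ | h1
  · rw [hL'.center_eq h𝔪, h1.1.center_eq h𝔪, monoAlg_congr h1.2.2, weightGroup_congr h1.2.1]
  · exact absurd heq h1.ne

theorem MillingRun.isMaximalAdmissible (h𝔪 : 𝔪 = IsLocalRing.maximalIdeal A)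
    (hR : Reached K 𝔪 E R ([], R)) {s : State A} (h : MillingRun K 𝔪 E ([], R) s)
    (hs : Terminated s) : IsMaximalAdmissible K 𝔪 E R (center (coords s.1)) :=
  have hp := (MillingRun.reached h𝔪 hR h).isPresentation
  ⟨_, hp, rfl, (hp.admissible_iff h𝔪 (hR.isHomog h𝔪)).2 (h.le_monoAlg h𝔪 hR hs),
    h.isResolutionInv h𝔪 hR hs⟩

/-- The last algebra of a run is `𝒜^Int`. -/
theorem MillingRun.snd_eq (h𝔪 : 𝔪 = IsLocalRing.maximalIdeal A)
    (hR : Reached K 𝔪 E R ([], R)) {s : State A} (h : MillingRun K 𝔪 E ([], R) s)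
    (hs : Terminated s) : s.2 = IntFor R (center (coords s.1)) := by
  have hsr := MillingRun.reached h𝔪 hR h
  obtain ⟨n, c, -, hc⟩ := hsr.coord
  have hpos := hsr.pos_coords
  rw [c.intFor_center h𝔪 hc hpos, ← hsr.group]
  apply le_antisymm
  · refine le_inf ?_ ((le_supportedIn (hsr.isHomog h𝔪)).trans (supportedIn_mono le_sup_left))
    rcases h.compare h𝔪 hR hsr.isPresentation (h.le_monoAlg h𝔪 hR hs) with ⟨-, h1⟩ | h1
    · exact h1
    · exact absurd h1 (lt_irrefl _)
  · obtain ⟨m, f, b, hgen⟩ := hsr.gens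
    rw [← c.intPart_eq h𝔪 hc hpos]
    exact (le_sup_left : intPart s.2 s.1 ≤ intPart s.2 s.1 ⊔ _).trans hgen.ge

theorem toInvSeq_blockInv (s : State A) :
    toInvSeq (s.1.flatMap fun y => blockInv E y.2 y.1) = invOf E (coords s.1) := by
  rw [invOf, coords, List.map_flatMap]
  congr 1
  refine List.flatMap_congr fun y _ => ?_
  rw [List.map_map]
  rfl

end Maximal

/-! ### Functions which are constant along some coordinates -/

section Flat

variable {K : Type u} [Field K] {A : Type u} [CommRing A] [Algebra K A] {𝔪 : Ideal A} {n : ℕ}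

namespace CoordSystem

variable (c : CoordSystem K A 𝔪 n)

theorem der_euler (τ : Finset (Fin n)) {l : Fin n} (hl : l ∈ τ) (f : A) :
    c.der l (c.euler τ f) = c.der l f + c.euler τ (c.der l f) := by
  classical
  rw [c.euler_apply, c.euler_apply, map_sum]
  have : ∀ i ∈ τ, c.der l (c.z i * c.der i f) =
      (if l = i then c.der i f else 0) + c.z i * c.der i (c.der l f) := by
    intro i _
    rw [Derivation.leibniz, c.der_apply, c.der_comm l i, smul_eq_mul, smul_eq_mul, add_comm]
    split_ifs <;> simp
  rw [Finset.sum_congr rfl this, Finset.sum_add_distrib, Finset.sum_ite_eq, if_pos hl]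

/-- A function with the same restriction to `V(z_τ)` as `f`, whose derivatives along the coordinates
in `τ` vanish to the order `k` on `V(z_τ)`. -/
noncomputable def flatten (τ : Finset (Fin n)) : ℕ → A → A
  | 0, f => f
  | k + 1, f => flatten τ k f - ((k + 1 : ℕ) : K)⁻¹ • c.euler τ (flatten τ k f)

theorem flatten_succ (τ : Finset (Fin n)) (k : ℕ) (f : A) : c.flatten τ (k + 1) f =
    c.flatten τ k f - ((k + 1 : ℕ) : K)⁻¹ • c.euler τ (c.flatten τ k f) := rfl

theorem sub_flatten_mem (τ : Finset (Fin n)) (k : ℕ) (f : A) :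
    f - c.flatten τ k f ∈ c.paramIdeal τ := by
  induction k with
  | zero => rw [flatten, sub_self]; exact Ideal.zero_mem _
  | succ k ih =>
    rw [flatten_succ, sub_sub_eq_add_sub, add_sub_right_comm]
    exact Ideal.add_mem _ ih (algebra_smul_mem _ (c.euler_mem _ _))

theorem der_flatten_mem [CharZero K] {τ : Finset (Fin n)} {l : Fin n} (hl : l ∈ τ) (k : ℕ) (f : A) :
    c.der l (c.flatten τ k f) ∈ c.paramIdeal τ ^ k := by
  induction k with
  | zero => simp
  | succ k ih =>
    rw [flatten_succ, map_sub, Derivation.map_smul, c.der_euler τ hl]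
    have h1 := c.euler_sub_mem τ k ih
    set g := c.der l (c.flatten τ k f)
    have hk : ((k + 1 : ℕ) : K) ≠ 0 := Nat.cast_ne_zero.2 (Nat.succ_ne_zero k)
    have h2 : g - ((k + 1 : ℕ) : K)⁻¹ • (g + c.euler τ g) =
        -(((k + 1 : ℕ) : K)⁻¹ • (c.euler τ g - k * g)) := by
      have h3 : g = ((k + 1 : ℕ) : K)⁻¹ • (((k + 1 : ℕ) : K) • g) := by
        rw [smul_smul, inv_mul_cancel₀ hk, one_smul]
      conv_lhs => arg 1; rw [h3]
      rw [← smul_sub, ← smul_neg]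
      congr 1
      rw [Nat.cast_succ, add_smul, one_smul, Nat.cast_smul_eq_nsmul, nsmul_eq_mul]
      ring
    rw [h2]
    exact Ideal.neg_mem_iff _ |>.2 (algebra_smul_mem _ h1)

/-- The flat function is obtained from `f` by applying the Euler operator. -/
theorem flatten_sub_mem (τ : Finset (Fin n)) {V : Ideal A} (hV : ∀ g ∈ V, c.euler τ g ∈ V) {f : A}
    (hf : c.euler τ f ∈ V) (k : ℕ) : f - c.flatten τ k f ∈ V := by
  induction k with
  | zero => rw [flatten, sub_self]; exact Ideal.zero_mem _
  | succ k ih =>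
    rw [flatten_succ, sub_sub_eq_add_sub, add_sub_right_comm]
    refine Ideal.add_mem _ ih (algebra_smul_mem _ ?_)
    have h1 := Ideal.sub_mem _ hf (hV _ ih)
    rwa [← map_sub, sub_sub_cancel] at h1

theorem mem_pow_of_flat [CharZero K] {τ : Finset (Fin n)} {f : A} (hf : f ∈ c.paramIdeal τ) {k : ℕ}
    (h : ∀ l ∈ τ, c.der l f ∈ c.paramIdeal τ ^ k) : f ∈ c.paramIdeal τ ^ (k + 1) := by
  have hE : c.euler τ f ∈ c.paramIdeal τ ^ (k + 1) := by
    refine c.euler_mem_of_der_mem fun l hl => ?_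
    rw [pow_succ']
    exact Ideal.mul_mem_mul (c.z_mem_paramIdeal hl) (h l hl)
  have key : ∀ j, j ≤ k → f ∈ c.paramIdeal τ ^ (j + 1) := by
    intro j
    induction j with
    | zero => intro _; simpa using hf
    | succ j ih =>
      intro hj
      exact c.mem_of_euler_mem (Nat.succ_ne_zero j) (ih (by omega)) le_rfl
        (Ideal.pow_le_pow_right (by omega) hE)
  exact key k le_rfl

end CoordSystem

end Flat

/-! ### Choice of a maximal contact -/

section Greedy

variable {K : Type u} [Field K] [CharZero K] {A : Type u} [CommRing A] [Algebra K A]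
  [IsLocalRing A] [IsNoetherianRing A] {𝔪 : Ideal A} {E : Set (Ideal A)} {n : ℕ}

/-- The coordinates outside of `τ` and of the divisor may be exchanged for functions in `T` until
the derivatives of `T` along the remaining ones vanish at the point. The functions can be taken to
be almost constant along the coordinates in `τ`, so that the derivatives along these do not change
modulo a power of their ideal. -/
theorem CoordSystem.exists_contact (h𝔪 : 𝔪 = IsLocalRing.maximalIdeal A)
    (c : CoordSystem K A 𝔪 n) (hcE : c.Compatible E) {τ : Finset (Fin n)} (hτ : τ ⊆ c.vanishing)
    {T : Ideal A} (hT : T ≤ 𝔪) (hPT : c.paramIdeal τ ≤ T) (N : ℕ) (Mk : Finset (Fin n))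
    (hMk : ∀ i ∈ Mk, c.z i ∈ T ∧ i ∉ τ ∧ ¬ IsDivisorial E (c.z i)) :
    ∃ (c' : CoordSystem K A 𝔪 n) (Mk' : Finset (Fin n)), c'.Compatible E ∧
      (∀ i ∈ τ, c'.z i = c.z i) ∧
      (∀ l ∈ τ, ∀ f, c'.der l f - c.der l f ∈ c.paramIdeal τ ^ N) ∧
      (∀ i ∈ Mk', c'.z i ∈ T ∧ i ∉ τ ∧ ¬ IsDivisorial E (c'.z i)) ∧
      ∀ i ∈ c'.vanishing, i ∉ τ → i ∉ Mk' → ¬ IsDivisorial E (c'.z i) →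
        ∀ f ∈ T, c'.der i f ∈ 𝔪 := by
  classical
  induction hk : (Finset.univ \ Mk).card using Nat.strong_induction_on generalizing c Mk with
  | _ k ih =>
  by_cases hdone : ∀ i ∈ c.vanishing, i ∉ τ → i ∉ Mk → ¬ IsDivisorial E (c.z i) →
      ∀ f ∈ T, c.der i f ∈ 𝔪
  · exact ⟨c, Mk, hcE, fun _ _ => rfl, fun l _ f => by rw [sub_self]; exact Ideal.zero_mem _, hMk,
        hdone⟩
  push Not at hdone
  obtain ⟨i, hi, hiτ, hiM, hiE, f, hf, hfi⟩ := hdone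
  -- `f` made constant along `τ` up to the order `N`, so that the exchange preserves the derivatives
  -- along `τ` up to this order
  set y := c.flatten τ N f with hy
  have hyf : f - y ∈ c.paramIdeal τ := c.sub_flatten_mem τ N f
  have hyT : y ∈ T := by
    have := Ideal.sub_mem _ hf (hPT hyf)
    rwa [sub_sub_cancel] at this
  have hyi : c.der i y ∉ 𝔪 := fun h => hfi <| by
    have h1 := c.paramIdeal_le_maximal hτ (c.der_paramIdeal hiτ hyf)
    rw [map_sub] at h1
    have := Ideal.add_mem _ h1 h
    rwa [sub_add_cancel] at this
  obtain ⟨c1, h1i, h1j, v, hv, -, hder⟩ := c.exists_exchange h𝔪 (c.mem_vanishing.1 hi) (hT hyT) hyi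
  have hyE : ¬ IsDivisorial E y := by
    intro hyE
    obtain ⟨k, hk⟩ := hcE _ hyE
    refine hyi (c.der_mem_of_divisor hcE (hT hyT) (Or.inr hyE) fun _ heq => hiE ?_)
    rw [IsDivisorial, ← heq]
    exact hyE
  have hc1E : c1.Compatible E := by
    intro J hJ
    obtain ⟨k, rfl⟩ := hcE J hJ
    have hk : k ≠ i := by rintro rfl; exact hiE hJ
    exact ⟨k, by rw [h1j k hk]⟩
  have hz1 : ∀ j ∈ τ, c1.z j = c.z j := fun j hj => h1j j (by rintro rfl; exact hiτ hj)
  have hP1 : c1.paramIdeal τ = c.paramIdeal τ := by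
    apply le_antisymm
    · exact c1.paramIdeal_le.2 fun j hj => by rw [hz1 j hj]; exact c.z_mem_paramIdeal hj
    · exact c.paramIdeal_le.2 fun j hj => by rw [← hz1 j hj]; exact c1.z_mem_paramIdeal hj
  have hder1 : ∀ l ∈ τ, ∀ f, c1.der l f - c.der l f ∈ c.paramIdeal τ ^ N := by
    intro l hl g
    rw [hder l (by rintro rfl; exact hiτ hl), sub_sub_cancel_left]
    exact (Ideal.neg_mem_iff _).2 (Ideal.mul_mem_right _ _ (Ideal.mul_mem_left _ _
      (c.der_flatten_mem hl N f)))
  obtain ⟨c', Mk', h1, h2, h3, h4, h5⟩ := ih _ (by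
      rw [← hk]
      refine Finset.card_lt_card (Finset.ssubset_iff_subset_ne.2
        ⟨Finset.sdiff_subset_sdiff le_rfl (Finset.subset_insert i Mk), fun h => ?_⟩)
      have : i ∈ Finset.univ \ Mk := by simp [hiM]
      rw [← h] at this
      simp at this) c1 hc1E
    (fun j hj => c1.mem_vanishing.2 (by rw [hz1 j hj]; exact c.mem_vanishing.1 (hτ hj)))
    (by rw [hP1]; exact hPT) (insert i Mk) (fun j hj => by
      rcases Finset.mem_insert.1 hj with rfl | hj'
      · rw [h1i]; exact ⟨hyT, hiτ, hyE⟩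
      · rw [h1j j (fun h => hiM (h ▸ hj'))]; exact hMk j hj') rfl
  refine ⟨c', Mk', h1, fun j hj => (h2 j hj).trans (hz1 j hj), fun l hl f => ?_, h4, h5⟩
  rw [hP1] at h3
  have := Ideal.add_mem _ (h3 l hl f) (hder1 l hl f)
  rwa [sub_add_sub_cancel] at this

end Greedy

/-! ### The cotangent ideal -/

section Cotangent

variable {K : Type u} [Field K] {A : Type u} [CommRing A] [Algebra K A] {𝔪 : Ideal A} {n : ℕ}

/-- The ideal generated by `I` and its first derivatives. -/
def diffIdeal (K : Type u) [Field K] {A : Type u} [CommRing A] [Algebra K A] (I : Ideal A) :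
    Ideal A :=
  I ⊔ Ideal.span {g | ∃ (δ : Derivation K A A) (h : A), h ∈ I ∧ g = δ h}

theorem diffIdeal_le {I J : Ideal A} :
    diffIdeal K I ≤ J ↔ I ≤ J ∧ ∀ (δ : Derivation K A A), ∀ h ∈ I, δ h ∈ J := by
  rw [diffIdeal, sup_le_iff, Ideal.span_le]
  refine and_congr_right fun _ => ⟨fun h δ g hg => h ⟨δ, g, hg, rfl⟩, ?_⟩
  rintro h _ ⟨δ, g, hg, rfl⟩
  exact h δ g hg

theorem der_mem_diffIdeal {I : Ideal A} (δ : Derivation K A A) {h : A} (hh : h ∈ I) :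
    δ h ∈ diffIdeal K I := (diffIdeal_le.1 le_rfl).2 δ h hh

theorem iterate_diffIdeal_le_pow {I 𝔪 : Ideal A} {l : ℕ} (m : ℕ) (h : I ≤ 𝔪 ^ (m + l)) :
    (diffIdeal K)^[m] I ≤ 𝔪 ^ l := by
  induction m generalizing I with
  | zero => simpa using h
  | succ m ih =>
    rw [Function.iterate_succ_apply]
    refine ih (diffIdeal_le.2 ⟨h.trans (Ideal.pow_le_pow_right (by omega)), fun δ g hg => ?_⟩)
    exact derivation_pow_le δ _ (by have := h hg; rwa [add_right_comm] at this)

/-- The cotangent ideal of the algebra generated by the `f j t^(b j)`, described without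
coordinates. -/
def contactIdeal (K : Type u) [Field K] {A : Type u} [CommRing A] [Algebra K A] {s : ℕ}
    (f : Fin s → A) (b : Fin s → ℚ≥0) (a : ℚ≥0) : Ideal A :=
  ⨆ (j : Fin s) (m : ℕ) (_ : (m : ℚ≥0) + 1 = b j * a), (diffIdeal K)^[m] (Ideal.span {f j})

theorem contactIdeal_le {s : ℕ} {f : Fin s → A} {b : Fin s → ℚ≥0} {a : ℚ≥0}
    (hf : ∀ j, f j ∈ 𝔪 ^ ⌈b j * a⌉₊) : contactIdeal K f b a ≤ 𝔪 := by
  refine iSup_le fun j => iSup_le fun m => iSup_le fun hm => ?_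
  conv_rhs => rw [← pow_one 𝔪]
  refine iterate_diffIdeal_le_pow m ?_
  rw [Ideal.span_singleton_le_iff_mem]
  have h1 : ⌈b j * a⌉₊ = m + 1 := by
    rw [← hm]
    exact_mod_cast Nat.ceil_natCast (R := ℚ≥0) (m + 1)
  rw [← h1]
  exact hf j

namespace CoordSystem

variable (c : CoordSystem K A 𝔪 n) [CharZero K]

theorem diffOp_mem_iterate_diffIdeal {I : Ideal A} {f : A} (hf : f ∈ I) (α : Fin n → ℕ) :
    c.diffOp α f ∈ (diffIdeal K)^[∑ i, α i] I := by
  induction α using multiIndex_induction with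
  | h0 => simpa [c.diffOp_zero] using hf
  | hs α i ih =>
    rw [c.diffOp_incr, sum_incr, Function.iterate_succ_apply']
    exact algebra_smul_mem _ (der_mem_diffIdeal _ ih)

theorem iterate_diffIdeal_le_span (f : A) (m : ℕ) : (diffIdeal K)^[m] (Ideal.span {f}) ≤
    Ideal.span {g | ∃ α : Fin n → ℕ, ∑ i, α i ≤ m ∧ g = c.diffOp α f} := by
  induction m with
  | zero =>
    rw [Function.iterate_zero_apply, Ideal.span_singleton_le_iff_mem]
    exact Ideal.subset_span ⟨0, by simp, (c.diffOp_zero f).symm⟩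
  | succ m ih =>
    rw [Function.iterate_succ_apply']
    have hle : Ideal.span {g | ∃ α : Fin n → ℕ, ∑ i, α i ≤ m ∧ g = c.diffOp α f} ≤
        Ideal.span {g | ∃ α : Fin n → ℕ, ∑ i, α i ≤ m + 1 ∧ g = c.diffOp α f} := by
      refine Ideal.span_mono ?_
      rintro _ ⟨α, hα, rfl⟩
      exact ⟨α, by omega, rfl⟩
    refine diffIdeal_le.2 ⟨ih.trans hle, fun δ h hh => derivation_span_le δ hle ?_ (ih hh)⟩
    rintro _ ⟨α, hα, rfl⟩
    rw [c.derivation_apply]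
    refine Ideal.sum_mem _ fun i _ => Ideal.mul_mem_left _ _ ?_
    rw [c.der_diffOp]
    refine algebra_smul_mem _ (Ideal.subset_span ⟨_, ?_, rfl⟩)
    rw [sum_incr]; omega

theorem incr_comm (α : Fin n → ℕ) (i l : Fin n) : incr (incr α i) l = incr (incr α l) i := by
  unfold incr; rw [add_right_comm]

theorem diffOp_incr_z_mul (γ : Fin n → ℕ) (l : Fin n) (g : A) :
    c.diffOp (incr γ l) (c.z l * g) = c.z l * c.diffOp (incr γ l) g + c.diffOp γ g := by
  classical
  induction γ using multiIndex_induction with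
  | h0 =>
    rw [c.diffOp_incr, c.diffOp_incr, c.diffOp_zero, c.diffOp_zero,
      Derivation.leibniz, c.der_apply, if_pos rfl]
    simp
  | hs γ i ih =>
    rw [incr_comm, c.diffOp_incr, ih, c.diffOp_incr (incr γ l) i g, map_add, Derivation.leibniz,
      c.der_apply, smul_add, smul_add, c.der_diffOp γ i g, smul_smul, smul_eq_mul,
      mul_smul_comm, add_assoc]
    congr 1
    by_cases hil : i = l
    · subst hil
      rw [if_pos rfl, incr_self, smul_eq_mul, mul_one, ← one_smul K (c.diffOp (incr γ i) g),
        smul_smul, smul_smul, ← add_smul]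
      congr 1
      have : ((γ i + 1 + 1 : ℕ) : K) ≠ 0 := Nat.cast_ne_zero.2 (Nat.succ_ne_zero _)
      rw [mul_one, mul_one, ← mul_one_add, inv_mul_eq_one₀ this]
      push_cast; ring
    · rw [if_neg hil, incr_of_ne _ hil, smul_zero, smul_zero, zero_add, inv_mul_cancel₀, one_smul]
      exact Nat.cast_ne_zero.2 (Nat.succ_ne_zero _)

/-- The contact ideal is the cotangent ideal for a suitable choice of the generators: the products
of the given generators and coordinates have to be added. -/
theorem exists_cotangentIdeal_eq (hn : n ≠ 0) {s : ℕ} (f : Fin s → A) (b : Fin s → ℚ≥0) (a : ℚ≥0) :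
    ∃ (s' : ℕ) (f' : Fin s' → A) (b' : Fin s' → ℚ≥0),
      Algebra.adjoin A (Set.range fun j => mono (b' j) (f' j)) =
        Algebra.adjoin A (Set.range fun j => mono (b j) (f j)) ∧
      cotangentIdeal c f' b' a = contactIdeal K f b a := by
  classical
  obtain ⟨M, hM⟩ : ∃ M : ℕ, ∀ (j : Fin s) (m : ℕ), (m : ℚ≥0) + 1 = b j * a → m ≤ M := by
    refine ⟨Finset.univ.sup fun j => ⌊b j * a⌋₊, fun j m hm => ?_⟩
    refine le_trans ?_ (Finset.le_sup (f := fun j => ⌊b j * a⌋₊) (Finset.mem_univ j))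
    rw [← hm]
    exact Nat.le_floor (by simp)
  have hfin : Finite {w : List (Fin n) // w.length ≤ M} := List.finite_length_le (Fin n) M
  have := Fintype.ofFinite {w : List (Fin n) // w.length ≤ M}
  let ι := Fin s × {w : List (Fin n) // w.length ≤ M}
  let e : Fin (Fintype.card ι) ≃ ι := (Fintype.equivFin ι).symm
  -- the products of the generators with monomials of bounded degree in the coordinates
  refine ⟨Fintype.card ι, fun k => ((e k).2.1.map c.z).prod * f (e k).1, fun k => b (e k).1, ?_, ?_⟩
  · apply le_antisymm
    · refine Algebra.adjoin_le ?_
      rintro _ ⟨k, rfl⟩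
      change mono (b (e k).1) (((e k).2.1.map c.z).prod * f (e k).1) ∈ _
      rw [← smul_mono]
      exact Subalgebra.smul_mem _ (Algebra.subset_adjoin (Set.mem_range_self (e k).1)) _
    · refine Algebra.adjoin_le ?_
      rintro _ ⟨j, rfl⟩
      have : mono (b j) (f j) ∈ Set.range (fun k : Fin (Fintype.card ι) =>
          mono (b (e k).1) (((e k).2.1.map c.z).prod * f (e k).1)) := by
        refine Set.mem_range.2 ⟨e.symm (j, Subtype.mk [] (Nat.zero_le M)), ?_⟩
        rw [Equiv.apply_symm_apply]
        simp
      exact Algebra.subset_adjoin this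
  · apply le_antisymm
    · rw [cotangentIdeal, Ideal.span_le]
      rintro _ ⟨k, α, hα, rfl⟩
      refine (le_iSup_of_le (e k).1 (le_iSup_of_le (∑ i, α i) (le_iSup_of_le hα le_rfl)) :
        (diffIdeal K)^[∑ i, α i] (Ideal.span {f (e k).1}) ≤ contactIdeal K f b a) ?_
      exact c.diffOp_mem_iterate_diffIdeal
        (Ideal.mul_mem_left _ _ (Ideal.mem_span_singleton_self _)) α
    · refine iSup_le fun j => iSup_le fun m => iSup_le fun hm => ?_
      refine (c.iterate_diffIdeal_le_span (f j) m).trans ?_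
      rw [Ideal.span_le]
      rintro _ ⟨γ, hγ, rfl⟩
      set T := cotangentIdeal c (fun k => ((e k).2.1.map c.z).prod * f (e k).1)
        (fun k => b (e k).1) a with hT
      -- `D_γ(g)` is a combination of `D_{γ + e_l}(z_l g)` and `D_{γ + e_l}(g)`, which raises the
      -- order of the derivatives up to the order `m` which defines the cotangent ideal
      have key : ∀ k, k ≤ m → ∀ (γ : Fin n → ℕ) (w : List (Fin n)), ∑ i, γ i + k = m →
          w.length + k ≤ m → c.diffOp γ ((w.map c.z).prod * f j) ∈ T := by
        intro k
        induction k with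
        | zero =>
          intro _ γ w hγ hw
          refine Ideal.subset_span ⟨e.symm (j, ⟨w, ?_⟩), γ, ?_, by simp⟩
          · have := hM j m hm; omega
          · simp only [Equiv.apply_symm_apply]
            rw [← hm, ← hγ, add_zero]
        | succ k ih =>
          intro hk γ w hγ hw
          let l : Fin n := ⟨0, Nat.pos_of_ne_zero hn⟩
          have h1 := ih (by omega) (incr γ l) (l :: w) (by rw [sum_incr]; omega)
            (by rw [List.length_cons]; omega)
          have h2 := ih (by omega) (incr γ l) w (by rw [sum_incr]; omega) (by omega)
          rw [List.map_cons, List.prod_cons, mul_assoc, c.diffOp_incr_z_mul] at h1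
          exact (Ideal.add_mem_iff_right _ (Ideal.mul_mem_left _ _ h2)).1 h1
      have := key (m - ∑ i, γ i) (Nat.sub_le _ _) γ [] (by omega) (by simp)
      simpa using this

end CoordSystem

end Cotangent

/-! ### Existence of maximal contacts -/

section Existence

variable {K : Type u} [Field K] {A : Type u} [CommRing A] [Algebra K A]
  {𝔪 : Ideal A} {E : Set (Ideal A)}

theorem isMulFamily_pow_ceil (𝔪 : Ideal A) (a : ℚ≥0) : IsMulFamily fun b => 𝔪 ^ ⌈b * a⌉₊ where
  zero := by simp
  mul_le p q := by
    rw [← pow_add, add_mul]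
    exact Ideal.pow_le_pow_right (Nat.ceil_add_le _ _)

theorem CoordSystem.Compatible.quot {n : ℕ} {c : CoordSystem K A 𝔪 n} (hc : c.Compatible E)
    {P : Ideal A} {τ : Finset (Fin n)} (hP : P = c.paramIdeal τ) {n' : ℕ}
    (e : Fin n' ≃ {i // i ∉ τ}) : (c.quot P τ hP e).Compatible (restrictDiv E P) := by
  rintro _ ⟨hne, J, hJ, rfl⟩
  obtain ⟨i, rfl⟩ := hc J hJ
  rw [Ideal.map_span, Set.image_singleton] at hne ⊢
  by_cases hi : i ∈ τ
  · refine absurd ?_ hne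
    rw [Ideal.span_singleton_eq_bot, Ideal.Quotient.eq_zero_iff_mem, hP]
    exact c.z_mem_paramIdeal hi
  · exact ⟨e.symm ⟨i, hi⟩, by rw [c.quot_z, Equiv.apply_symm_apply]⟩

variable [CharZero K] [IsLocalRing A] [IsNoetherianRing A]

theorem exists_isOrder (h𝔪 : 𝔪 = IsLocalRing.maximalIdeal A) {m : ℕ} {f : Fin m → A}
    {b : Fin m → ℚ≥0} (h : ∃ j, 0 < b j ∧ f j ≠ 0) :
    ∃ a, IsOrder 𝔪 (Algebra.adjoin A (Set.range fun j => mono (b j) (f j))) a := by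
  classical
  have hord : ∀ j, ∃ d, f j ≠ 0 → f j ∈ 𝔪 ^ d ∧ f j ∉ 𝔪 ^ (d + 1) := fun j => by
    by_cases hj : f j = 0
    · exact ⟨0, fun h => absurd hj h⟩
    · obtain ⟨d, hd⟩ := exists_order h𝔪 hj
      exact ⟨d, fun _ => hd⟩
  choose d hd using hord
  -- the order is attained at one of the generators
  obtain ⟨j₀, hj₀, hmin⟩ := Finset.exists_min_image
    (Finset.univ.filter fun j => 0 < b j ∧ f j ≠ 0) (fun j => (d j : ℚ≥0) / b j)
    (by obtain ⟨j, hj⟩ := h; exact ⟨j, by simpa using hj⟩)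
  obtain ⟨hb₀, hf₀⟩ := (Finset.mem_filter.1 hj₀).2
  refine ⟨(d j₀ : ℚ≥0) / b j₀, ⟨b j₀, f j₀, d j₀, hb₀,
    Algebra.subset_adjoin (Set.mem_range_self j₀), (hd _ hf₀).1, (hd _ hf₀).2, rfl⟩, ?_⟩
  rintro _ ⟨β, g, k, hβ, hg, -, hgk, rfl⟩
  set a := (d j₀ : ℚ≥0) / b j₀ with ha
  have hle : Algebra.adjoin A (Set.range fun j => mono (b j) (f j)) ≤
      filtAlg _ (isMulFamily_pow_ceil 𝔪 a) := by
    refine adjoin_mono_le_filtAlg fun j => ?_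
    by_cases hfj : f j = 0
    · rw [hfj]; exact Ideal.zero_mem _
    rcases (zero_le : 0 ≤ b j).eq_or_lt with hb | hb
    · simp [← hb]
    refine Ideal.pow_le_pow_right ?_ (hd j hfj).1
    rw [Nat.ceil_le]
    have := hmin j (by simp [hb, hfj])
    rwa [le_div_iff₀ hb, mul_comm] at this
  have hg' := mono_mem_filtAlg.1 (hle hg)
  have : ⌈β * a⌉₊ ≤ k := by
    by_contra hlt
    exact hgk (Ideal.pow_le_pow_right (by omega) hg')
  rw [le_div_iff₀ hβ, mul_comm]
  exact Nat.ceil_le.1 this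

theorem extend_intPart (h𝔪 : 𝔪 = IsLocalRing.maximalIdeal A) {n : ℕ} (c : CoordSystem K A 𝔪 n)
    {bl : List (List A × ℚ≥0)} (hL : c.Extends ((coords bl).map Prod.fst))
    (ha : ∀ y ∈ coords bl, 0 < y.2) (S : Subalgebra A (TAlg A)) :
    extend (Ideal.Quotient.mk (idealOf bl)) (intPart S bl) = ⊥ := by
  refine le_bot_iff.1 ((extend_le_iff _ (isHomog_intPart h𝔪 c hL ha)).2 fun q f hf => ?_)
  rw [c.intPart_eq h𝔪 hL ha] at hf
  rcases (zero_le : 0 ≤ q).eq_or_lt with hq | hq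
  · rw [← hq]; exact mono_zero_mem _ _
  · have : f ∈ idealOf bl :=
      wIdeal_coords_le_idealOf (by exact_mod_cast hq) (mono_mem_monoAlg.1 hf.1)
    rw [Ideal.Quotient.eq_zero_iff_mem.2 this]
    simp [mono]

theorem extend_eq_adjoin (h𝔪 : 𝔪 = IsLocalRing.maximalIdeal A) {n : ℕ} (c : CoordSystem K A 𝔪 n)
    {s : State A} (hL : c.Extends ((coords s.1).map Prod.fst))
    (ha : ∀ y ∈ coords s.1, 0 < y.2) {m : ℕ} {f : Fin m → A} {b : Fin m → ℚ≥0}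
    (hg : s.2 = intPart s.2 s.1 ⊔ Algebra.adjoin A (Set.range fun j => mono (b j) (f j))) :
    extend (Ideal.Quotient.mk (idealOf s.1)) s.2 = Algebra.adjoin _
      (Set.range fun j => mono (b j) (Ideal.Quotient.mk (idealOf s.1) (f j))) := by
  rw [hg, extend_sup _ (isHomog_intPart h𝔪 c hL ha)
    (isHomog_adjoin (by rintro _ ⟨j, rfl⟩; exact ⟨_, _, rfl⟩)), extend_intPart h𝔪 c hL ha,
    bot_sup_eq, extend_adjoin]

/-- A state which is not terminal admits a step which uses prescribed generators. The coordinates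
of the step agree with given ones along the previous blocks, and their derivatives do so up to a
prescribed order. -/
theorem Reached.exists_step (h𝔪 : 𝔪 = IsLocalRing.maximalIdeal A) {R : Subalgebra A (TAlg A)}
    {s : State A} (hs : Reached K 𝔪 E R s) (hT : ¬ Terminated s) {n : ℕ}
    (c : CoordSystem K A 𝔪 n) (hcE : c.Compatible E)
    (hL : c.Extends ((coords s.1).map Prod.fst)) {m : ℕ} {f : Fin m → A} {b : Fin m → ℚ≥0}
    (hg : s.2 = intPart s.2 s.1 ⊔ Algebra.adjoin A (Set.range fun j => mono (b j) (f j)))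
    (N : ℕ) :
    ∃ (s' : State A) (x : List A) (a : ℚ≥0) (c' : CoordSystem K A 𝔪 n),
      StepData K 𝔪 E s s' x a c' f b ∧
      ∀ l, c'.z l ∈ (coords s.1).map Prod.fst →
        c.z l = c'.z l ∧ ∀ g, c'.der l g - c.der l g ∈ idealOf s.1 ^ N := by
  classical
  have hpos := hs.pos_coords
  have hPtop := hs.ne_top h𝔪
  have hS := extend_eq_adjoin h𝔪 c hL hpos hg
  obtain ⟨τ, hτ, hτi, hτP⟩ := c.exists_indices hL
  rw [← idealOf_eq] at hτP
  have hT' : extend (Ideal.Quotient.mk (idealOf s.1)) s.2 ≠ ⊥ := hT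
  generalize hPdef : idealOf s.1 = P at *
  have : IsLocalRing (A ⧸ P) := isLocalRing_quot hPtop
  have hP𝔪 : P ≤ 𝔪 := hτP ▸ c.paramIdeal_le_maximal hτ
  have h𝔪B : 𝔪.map (Ideal.Quotient.mk P) = IsLocalRing.maximalIdeal (A ⧸ P) :=
    CoordSystem.maximalIdeal_quot h𝔪
  have hmem : ∀ g, Ideal.Quotient.mk P g ∈ 𝔪.map (Ideal.Quotient.mk P) ↔ g ∈ 𝔪 := fun g => by
    rw [← Ideal.mem_comap, Ideal.comap_map_of_surjective _ Ideal.Quotient.mk_surjective,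
      ← RingHom.ker_eq_comap_bot, Ideal.mk_ker, sup_eq_left.2 hP𝔪]
  -- the restriction is non-trivial in positive degrees
  have hex : ∃ j, 0 < b j ∧ Ideal.Quotient.mk P (f j) ≠ 0 := by
    by_contra hno
    push Not at hno
    apply hT'
    rw [hS, eq_bot_iff]
    refine Algebra.adjoin_le ?_
    rintro _ ⟨j, rfl⟩
    rcases (zero_le : 0 ≤ b j).eq_or_lt with hb | hb
    · change mono (b j) _ ∈ _
      rw [← hb]; exact mono_zero_mem _ _
    · change mono (b j) _ ∈ _
      rw [hno j hb]; simp [mono]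
  obtain ⟨a, ha⟩ := exists_isOrder h𝔪B hex
  have ha0 : 0 < a := by
    have := (hs.lt_order h𝔪 (a := a) (by rw [hPdef, hS]; exact ha)).2
    exact this
  have hfa : ∀ j, Ideal.Quotient.mk P (f j) ∈ 𝔪.map (Ideal.Quotient.mk P) ^ ⌈b j * a⌉₊ := fun j =>
    ha.mem_pow h𝔪B (Algebra.subset_adjoin (Set.mem_range_self j))
  set T₀ := contactIdeal K (fun j => Ideal.Quotient.mk P (f j)) b a with hT₀
  have hT₀𝔪 : T₀ ≤ 𝔪.map (Ideal.Quotient.mk P) := contactIdeal_le hfa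
  have hT𝔪 : T₀.comap (Ideal.Quotient.mk P) ≤ 𝔪 := fun g hg => (hmem g).1 (hT₀𝔪 hg)
  have hPT : c.paramIdeal τ ≤ T₀.comap (Ideal.Quotient.mk P) := by
    rw [← hτP]
    intro g hg
    rw [Ideal.mem_comap, Ideal.Quotient.eq_zero_iff_mem.2 hg]
    exact Ideal.zero_mem _
  -- coordinates such that the free parameters of the maximal contact are those with indices in `Mk`
  obtain ⟨c', Mk, hc'E, hc'z, hc'd, hMk, hrest⟩ := c.exists_contact h𝔪 hcE hτ hT𝔪 hPT N ∅ (by simp)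
  have hτ' : τ ⊆ c'.vanishing := fun i hi => by
    rw [c'.mem_vanishing, hc'z i hi]; exact c.mem_vanishing.1 (hτ hi)
  have hP' : P = c'.paramIdeal τ := by
    rw [hτP]
    apply le_antisymm
    · exact c.paramIdeal_le.2 fun i hi => hc'z i hi ▸ c'.z_mem_paramIdeal hi
    · exact c'.paramIdeal_le.2 fun i hi => (hc'z i hi).symm ▸ c.z_mem_paramIdeal hi
  obtain ⟨n', ⟨e⟩⟩ := CoordSystem.exists_enum τ
  set cB := c'.quot P τ hP' e with hcB
  -- without coordinates the restricted ring would be a field, and the restriction would be trivial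
  have hn' : n' ≠ 0 := by
    rintro rfl
    obtain ⟨j, hbj, hfj⟩ := hex
    apply hfj
    have h0 : 𝔪.map (Ideal.Quotient.mk P) = ⊥ := by
      rw [← cB.span_param, eq_bot_iff, Ideal.span_le]
      rintro _ ⟨⟨i, -⟩, -⟩
      exact i.elim0
    have := Ideal.pow_le_self (Nat.ceil_pos.2 (mul_pos hbj ha0)).ne' (hfa j)
    rwa [h0, Ideal.mem_bot] at this
  -- generators whose cotangent ideal is as large as possible
  obtain ⟨m', f', b', hadj, hcot⟩ := cB.exists_cotangentIdeal_eq hn'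
    (fun j => Ideal.Quotient.mk P (f j)) b a
  -- the divisorial parameters of the maximal contact
  set D := c'.vanishing.filter fun i => i ∉ τ ∧ IsDivisorial E (c'.z i) ∧
    ∃ g ∈ T₀.comap (Ideal.Quotient.mk P), c'.der i g ∉ 𝔪 with hD
  set L := Mk.toList ++ D.toList with hLdef
  have hLmem : ∀ i, i ∈ L ↔ i ∈ Mk ∨ i ∈ D := fun i => by simp [hLdef]
  have hDmem : ∀ i, i ∈ D ↔ c'.z i ∈ 𝔪 ∧ i ∉ τ ∧ IsDivisorial E (c'.z i) ∧
      ∃ g ∈ T₀.comap (Ideal.Quotient.mk P), c'.der i g ∉ 𝔪 := fun i => by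
    rw [hD, Finset.mem_filter, c'.mem_vanishing]
  have hLτ : ∀ i ∈ L, i ∉ τ ∧ c'.z i ∈ 𝔪 := fun i hi => by
    rcases (hLmem i).1 hi with h | h
    · exact ⟨(hMk i h).2.1, hT𝔪 (hMk i h).1⟩
    · exact ⟨((hDmem i).1 h).2.1, ((hDmem i).1 h).1⟩
  have hLnodup : L.Nodup := by
    refine List.Nodup.append (Finset.nodup_toList _) (Finset.nodup_toList _) fun i h1 h2 => ?_
    rw [Finset.mem_toList] at h1 h2
    exact (hMk i h1).2.2 ((hDmem i).1 h2).2.2.1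
  have hdiv : ∀ i ∈ c'.vanishing, i ∉ τ → (IsDivisorial (restrictDiv E P)
      (Ideal.Quotient.mk P (c'.z i)) ↔ IsDivisorial E (c'.z i)) := fun i hi hiτ =>
    isDivisorial_quot_iff h𝔪 c' hc'E hτ' hi hiτ hP'
  have hzB : ∀ i (hi : i ∉ τ), Ideal.Quotient.mk P (c'.z i) =
      cB.z (e.symm ⟨i, hi⟩) := fun i hi => by
    rw [hcB, c'.quot_z, Equiv.apply_symm_apply]
  have hxB : ∀ j, cB.z j ∈ (L.map c'.z).map (Ideal.Quotient.mk P) ↔ (e j : Fin n) ∈ L := fun j => by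
    rw [List.map_map, List.mem_map]
    constructor
    · rintro ⟨i, hi, hij⟩
      rw [Function.comp_apply, hzB i (hLτ i hi).1] at hij
      rw [← cB.z_injective hij, Equiv.apply_symm_apply]
      exact hi
    · intro h
      exact ⟨e j, h, rfl⟩
  have hfst : ∀ y ∈ (coords s.1).map Prod.fst, ∃ i ∈ τ, y = c'.z i := fun y hy => by
    obtain ⟨i, hi⟩ := (hL.2 y hy).1
    have hiτ : i ∈ τ := (hτi i).2 (hi ▸ hy)
    exact ⟨i, hiτ, by rw [hc'z i hiτ, hi]⟩
  refine ⟨(s.1 ++ [(L.map c'.z, a)], coeffAlg s.2 (s.1 ++ [(L.map c'.z, a)]) c' (L.map c'.z) a f b),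
    L.map c'.z, a, c', ⟨rfl, ?_, hc'E, ?_, hg, rfl⟩, ?_⟩
  · rw [hPdef, hS]
    refine ⟨ha, ?_, n', cB, m', f', b', hc'E.quot hP' e, ⟨?_, ?_⟩, hadj.symm, ?_, ?_, ?_⟩
    · rw [List.map_map, hLdef, List.map_append, List.pairwise_append]
      refine ⟨?_, ?_, ?_⟩
      · rw [List.pairwise_map]
        refine List.pairwise_of_forall_mem_list fun i hi k _ hdi => ?_
        rw [Finset.mem_toList] at hi
        exact absurd ((hdiv i (c'.mem_vanishing.2 (hT𝔪 (hMk i hi).1)) (hMk i hi).2.1).1 hdi)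
          (hMk i hi).2.2
      · rw [List.pairwise_map]
        refine List.pairwise_of_forall_mem_list fun i _ k hk _ => ?_
        rw [Finset.mem_toList, hDmem] at hk
        exact (hdiv k (c'.mem_vanishing.2 hk.1) hk.2.1).2 hk.2.2.1
      · intro y _ y' hy' _
        obtain ⟨k, hk, rfl⟩ := List.mem_map.1 hy'
        rw [Finset.mem_toList, hDmem] at hk
        exact (hdiv k (c'.mem_vanishing.2 hk.1) hk.2.1).2 hk.2.2.1
    · rw [List.map_map]
      refine hLnodup.map_on fun i hi k hk hik => ?_
      rw [Function.comp_apply, Function.comp_apply, hzB i (hLτ i hi).1, hzB k (hLτ k hk).1] at hik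
      simpa using cB.z_injective hik
    · intro y hy
      rw [List.map_map, List.mem_map] at hy
      obtain ⟨i, hi, rfl⟩ := hy
      exact ⟨⟨_, (hzB i (hLτ i hi).1).symm⟩, Ideal.mem_map_of_mem _ (hLτ i hi).2⟩
    · intro j hj hnd
      rw [hxB] at hj
      rw [hcot]
      rcases (hLmem _).1 hj with h | h
      · exact (hMk _ h).1
      · rw [hDmem] at h
        exact absurd ((hdiv _ (c'.mem_vanishing.2 h.1) h.2.1).2 h.2.2.1) hnd
    · intro j hj hd
      rw [hxB] at hj
      rw [hcot]
      rcases (hLmem _).1 hj with h | h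
      · exact absurd ((hdiv _ (c'.mem_vanishing.2 (hT𝔪 (hMk _ h).1)) (hMk _ h).2.1).1 hd)
          (hMk _ h).2.2
      · rw [hDmem] at h
        obtain ⟨-, -, -, g, hgT, hgd⟩ := h
        by_contra hne
        have hle := le_of_span_ne_top h𝔪B hne
          (Set.mem_image_of_mem (fun h => cB.der j h) (show Ideal.Quotient.mk P g ∈ _ from hgT))
        exact hgd ((hmem _).1 hle)
    · intro j hj hnot htop
      rw [hxB] at hnot
      rw [hcot] at htop
      have hv : c'.z (e j) ∈ 𝔪 := (hmem _).1 hj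
      have hall : ∀ g ∈ T₀.comap (Ideal.Quotient.mk P), c'.der (e j) g ∈ 𝔪 := by
        rw [hLmem, not_or] at hnot
        by_cases hd : IsDivisorial E (c'.z (e j))
        · by_contra hno
          push Not at hno
          exact hnot.2 ((hDmem _).2 ⟨hv, (e j).2, hd, hno⟩)
        · exact hrest _ (c'.mem_vanishing.2 hv) (e j).2 hnot.1 hd
      have hle : Ideal.span ((fun h => cB.der j h) '' (T₀ : Set (A ⧸ P))) ≤
          𝔪.map (Ideal.Quotient.mk P) := by
        rw [Ideal.span_le]
        rintro _ ⟨y, hy, rfl⟩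
        obtain ⟨g, rfl⟩ := Ideal.Quotient.mk_surjective y
        exact (hmem _).2 (hall g hy)
      rw [htop, h𝔪B] at hle
      exact (IsLocalRing.maximalIdeal.isMaximal (A ⧸ P)).ne_top (top_unique hle)
  · have h1 : (coords (s.1 ++ [(L.map c'.z, a)])).map Prod.fst =
        (coords s.1).map Prod.fst ++ L.map c'.z := by
      rw [coords_append, coords_singleton, List.map_append, List.map_map]
      congr 1
      simp
    change c'.Extends ((coords (s.1 ++ [(L.map c'.z, a)])).map Prod.fst)
    rw [h1]
    refine ⟨hL.1.append (hLnodup.map c'.z_injective) fun y hy hy' => ?_, fun y hy => ?_⟩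
    · obtain ⟨i, hi, rfl⟩ := hfst y hy
      obtain ⟨k, hk, hki⟩ := List.mem_map.1 hy'
      exact (hLτ k hk).1 (c'.z_injective hki ▸ hi)
    · rcases List.mem_append.1 hy with hy | hy
      · obtain ⟨i, hi, rfl⟩ := hfst y hy
        exact ⟨⟨i, rfl⟩, c'.mem_vanishing.1 (hτ' hi)⟩
      · obtain ⟨i, hi, rfl⟩ := List.mem_map.1 hy
        exact ⟨⟨i, rfl⟩, (hLτ i hi).2⟩
  · intro l hl
    obtain ⟨i, hi, hli⟩ := hfst _ hl
    obtain rfl := c'.z_injective hli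
    rw [hτP]
    exact ⟨(hc'z l hi).symm, hc'd l hi⟩

theorem StepData.millingStep {s s' : State A} {x : List A} {a : ℚ≥0} {n : ℕ}
    {c : CoordSystem K A 𝔪 n} {m : ℕ} {f : Fin m → A} {b : Fin m → ℚ≥0}
    (h : StepData K 𝔪 E s s' x a c f b) : MillingStep K 𝔪 E s s' :=
  ⟨x, a, h.fst, h.contact, n, c, m, f, b, h.compat, h.extends_coords, h.gens, h.snd⟩

/-- Each step enlarges the ideal of the blocks; since `A` is Noetherian, a procedure which can
always be continued by a step with some property terminates. -/
theorem Reached.exists_terminated (h𝔪 : 𝔪 = IsLocalRing.maximalIdeal A)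
    {R : Subalgebra A (TAlg A)} {p : State A → Prop} {r : State A → State A → Prop}
    (hr : ∀ s s', r s s' → MillingStep K 𝔪 E s s')
    (hstep : ∀ s, Reached K 𝔪 E R s → p s → ¬ Terminated s → ∃ s', r s s' ∧ p s')
    {s : State A} (hs : Reached K 𝔪 E R s) (hp : p s) :
    ∃ s', Relation.ReflTransGen r s s' ∧ Terminated s' := by
  obtain ⟨I, hI⟩ : ∃ I, I = idealOf s.1 := ⟨_, rfl⟩
  induction I using WellFoundedGT.induction generalizing s with
  | ind I ih =>
    by_cases hT : Terminated s
    · exact ⟨s, Relation.ReflTransGen.refl, hT⟩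
    · obtain ⟨s₁, h₁, hp₁⟩ := hstep s hs hp hT
      obtain ⟨x, a, n, c, m, f, b, hd⟩ := (hr _ _ h₁).exists_stepData
      obtain ⟨s', hs', hT'⟩ := ih _ (hI ▸ hd.idealOf_lt h𝔪 hs) (hd.reached h𝔪 hs) hp₁ rfl
      exact ⟨s', Relation.ReflTransGen.head h₁ hs', hT'⟩

theorem Reached.exists_run (h𝔪 : 𝔪 = IsLocalRing.maximalIdeal A) {R : Subalgebra A (TAlg A)}
    {s : State A} (hs : Reached K 𝔪 E R s) :
    ∃ s', MillingRun K 𝔪 E s s' ∧ Terminated s' := by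
  refine Reached.exists_terminated h𝔪 (p := fun _ => True) (fun _ _ h => h)
    (fun s hs _ hT => ?_) hs trivial
  obtain ⟨n, c, hcE, hL⟩ := hs.coord
  obtain ⟨m, f, b, hg⟩ := hs.gens
  obtain ⟨s', x, a, c', hd, -⟩ := hs.exists_step h𝔪 hT c hcE hL hg 0
  exact ⟨s', hd.millingStep, trivial⟩

end Existence

/-! ### Splittings of the completed local ring -/

section Completion

/-- The extension of an ideal to the completion is closed. -/
theorem mem_map_of_forall_eval {A : Type u} [CommRing A] [IsNoetherianRing A] (𝔪 Q : Ideal A)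
    (z : AdicCompletion 𝔪 A)
    (h : ∀ k, ∃ q ∈ Q, AdicCompletion.evalₐ 𝔪 k z = Ideal.Quotient.mk (𝔪 ^ k) q) :
    z ∈ Q.map (algebraMap A (AdicCompletion 𝔪 A)) := by
  have h0 : AdicCompletion.map 𝔪 Q.mkQ z = 0 := by
    ext k
    obtain ⟨q, hq, hqz⟩ := h k
    have h1 : z.val k = Submodule.Quotient.mk q := by
      have := AdicCompletion.factor_evalₐ_eq_eval 𝔪 z (n := k) (by simp)
      rw [hqz] at this
      exact this.symm
    rw [AdicCompletion.map_val_apply, h1, AdicCompletion.val_zero]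
    have hq0 : Q.mkQ q = 0 := (Submodule.Quotient.mk_eq_zero Q).2 hq
    change Submodule.Quotient.mk (Q.mkQ q) = _
    rw [hq0]; rfl
  obtain ⟨w, rfl⟩ := (AdicCompletion.map_exact (I := 𝔪) (f := Q.subtype) (g := Q.mkQ)
    (Submodule.subtype_injective Q) (LinearMap.exact_subtype_mkQ Q)
    (Submodule.mkQ_surjective Q) z).1 h0
  obtain ⟨t, rfl⟩ := AdicCompletion.ofTensorProduct_surjective_of_finite 𝔪 Q w
  clear h h0
  induction t using TensorProduct.induction_on with
  | zero => simp
  | add x y hx hy =>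
    rw [map_add, map_add]
    exact Ideal.add_mem _ hx hy
  | tmul r x =>
    rw [AdicCompletion.ofTensorProduct_tmul, map_smul, AdicCompletion.map_of]
    exact Ideal.mul_mem_left _ _ (Ideal.mem_map_of_mem (algebraMap A (AdicCompletion 𝔪 A)) x.2)

variable {K : Type u} [Field K] {A : Type u} [CommRing A] [Algebra K A] {𝔪 : Ideal A} {n : ℕ}

namespace CoordSystem

variable (c : CoordSystem K A 𝔪 n)

theorem flatten_add (τ : Finset (Fin n)) (k : ℕ) (f g : A) :
    c.flatten τ k (f + g) = c.flatten τ k f + c.flatten τ k g := by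
  induction k with
  | zero => rfl
  | succ k ih => rw [flatten_succ, flatten_succ, flatten_succ, ih, map_add, smul_add]; ring

theorem flatten_algebraMap (τ : Finset (Fin n)) (k : ℕ) (r : K) :
    c.flatten τ k (algebraMap K A r) = algebraMap K A r := by
  induction k with
  | zero => rfl
  | succ k ih => rw [flatten_succ, ih, Derivation.map_algebraMap, smul_zero, sub_zero]

theorem flatten_mem {τ : Finset (Fin n)} {V : Ideal A} (hV : ∀ g ∈ V, c.euler τ g ∈ V) {f : A}
    (hf : f ∈ V) (k : ℕ) : c.flatten τ k f ∈ V := by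
  have := Ideal.sub_mem _ hf (c.flatten_sub_mem τ hV (hV f hf) k)
  rwa [sub_sub_cancel] at this

theorem euler_mem_pow {τ : Finset (Fin n)} (hτ : τ ⊆ c.vanishing) (k : ℕ) {f : A}
    (hf : f ∈ 𝔪 ^ k) : c.euler τ f ∈ 𝔪 ^ k :=
  derivation_pow_of_le _ (fun x _ => c.paramIdeal_le_maximal hτ (c.euler_mem τ x)) k hf

variable [CharZero K]

theorem flatten_mul_sub_mem (τ : Finset (Fin n)) (k : ℕ) (f g : A) :
    c.flatten τ k (f * g) - c.flatten τ k f * c.flatten τ k g ∈ c.paramIdeal τ ^ (k + 1) := by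
  refine c.mem_pow_of_flat ?_ fun l hl => ?_
  · have h1 := c.sub_flatten_mem τ k (f * g)
    have h2 := Ideal.mul_mem_left _ g (c.sub_flatten_mem τ k f)
    have h3 := Ideal.mul_mem_left _ (c.flatten τ k f) (c.sub_flatten_mem τ k g)
    have := Ideal.sub_mem _ (Ideal.add_mem _ h2 h3) h1
    convert this using 1
    ring
  · rw [map_sub, Derivation.leibniz, smul_eq_mul, smul_eq_mul]
    exact Ideal.sub_mem _ (c.der_flatten_mem hl k _) (Ideal.add_mem _
      (Ideal.mul_mem_left _ _ (c.der_flatten_mem hl k _))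
      (Ideal.mul_mem_left _ _ (c.der_flatten_mem hl k _)))

theorem flatten_sub_flatten_mem (τ : Finset (Fin n)) {k k' : ℕ} (h : k ≤ k') (f : A) :
    c.flatten τ k' f - c.flatten τ k f ∈ c.paramIdeal τ ^ (k + 1) := by
  refine c.mem_pow_of_flat ?_ fun l hl => ?_
  · have := Ideal.sub_mem _ (c.sub_flatten_mem τ k f) (c.sub_flatten_mem τ k' f)
    rwa [sub_sub_sub_cancel_left] at this
  · rw [map_sub]
    exact Ideal.sub_mem _ (Ideal.pow_le_pow_right h (c.der_flatten_mem hl k' f))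
      (c.der_flatten_mem hl k f)

theorem flatten_mem_pow {τ : Finset (Fin n)} {f : A} (hf : f ∈ c.paramIdeal τ) (k : ℕ) :
    c.flatten τ k f ∈ c.paramIdeal τ ^ (k + 1) := by
  refine c.mem_pow_of_flat ?_ fun l hl => c.der_flatten_mem hl k f
  exact c.flatten_mem (fun g _ => c.euler_mem τ g) hf k

theorem pow_le_pow {τ : Finset (Fin n)} (hτ : τ ⊆ c.vanishing) (k : ℕ) :
    c.paramIdeal τ ^ (k + 1) ≤ 𝔪 ^ k :=
  (Ideal.pow_le_pow_right k.le_succ).trans (Ideal.pow_right_mono (c.paramIdeal_le_maximal hτ) k)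

/-- The projection of `A ⧸ 𝔪 ^ k` onto the functions which are constant along the parameters
in `τ`. -/
noncomputable def retraction {τ : Finset (Fin n)} (hτ : τ ⊆ c.vanishing) (k : ℕ) :
    A ⧸ 𝔪 ^ k →ₐ[K] A ⧸ 𝔪 ^ k :=
  Ideal.Quotient.liftₐ (𝔪 ^ k)
    { toFun := fun f => Ideal.Quotient.mk (𝔪 ^ k) (c.flatten τ k f)
      map_one' := by
        rw [← map_one (algebraMap K A), c.flatten_algebraMap, map_one, map_one]
      map_zero' := by
        rw [← map_zero (algebraMap K A), c.flatten_algebraMap, map_zero, map_zero]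
      map_mul' := fun f g => by
        rw [← map_mul, Ideal.Quotient.eq]
        exact c.pow_le_pow hτ k (c.flatten_mul_sub_mem τ k f g)
      map_add' := fun f g => by rw [c.flatten_add, map_add]
      commutes' := fun r => by rw [c.flatten_algebraMap]; rfl }
    fun f hf => Ideal.Quotient.eq_zero_iff_mem.2
      (c.flatten_mem (fun _ hg => c.euler_mem_pow hτ k hg) hf k)

theorem retraction_mk {τ : Finset (Fin n)} (hτ : τ ⊆ c.vanishing) (k : ℕ) (f : A) :
    c.retraction hτ k (Ideal.Quotient.mk (𝔪 ^ k) f) =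
      Ideal.Quotient.mk (𝔪 ^ k) (c.flatten τ k f) := rfl

theorem exists_retraction {τ : Finset (Fin n)} (hτ : τ ⊆ c.vanishing) :
    ∃ σ : AdicCompletion 𝔪 A →ₐ[K] AdicCompletion 𝔪 A, ∀ (k : ℕ) (y : AdicCompletion 𝔪 A) (f : A),
      AdicCompletion.evalₐ 𝔪 k y = Ideal.Quotient.mk (𝔪 ^ k) f →
      AdicCompletion.evalₐ 𝔪 k (σ y) = Ideal.Quotient.mk (𝔪 ^ k) (c.flatten τ k f) := by
  have : IsScalarTower K A (AdicCompletion 𝔪 A) := IsScalarTower.of_algebraMap_eq fun _ => rfl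
  have hcomp : ∀ {k k' : ℕ} (hk : k ≤ k'),
      (Ideal.Quotient.factorₐ K (Ideal.pow_le_pow_right hk)).comp
        ((c.retraction hτ k').comp ((AdicCompletion.evalₐ 𝔪 k').restrictScalars K)) =
      (c.retraction hτ k).comp ((AdicCompletion.evalₐ 𝔪 k).restrictScalars K) := by
    intro k k' hk
    ext y
    obtain ⟨g, rfl⟩ := AdicCompletion.mk_surjective 𝔪 A y
    have hg : AdicCompletion.evalₐ 𝔪 k (AdicCompletion.mk 𝔪 A g) =
        Ideal.Quotient.mk (𝔪 ^ k) (g.val k') := by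
      rw [AdicCompletion.evalₐ_mk, AdicCompletion.Ideal.mk_eq_mk 𝔪 hk]
    rw [AlgHom.comp_apply, AlgHom.comp_apply, AlgHom.comp_apply, AlgHom.restrictScalars_apply,
      AlgHom.restrictScalars_apply, hg, AdicCompletion.evalₐ_mk, retraction_mk, retraction_mk]
    change Ideal.Quotient.mk (𝔪 ^ k) _ = _
    rw [Ideal.Quotient.eq]
    exact c.pow_le_pow hτ k (c.flatten_sub_flatten_mem τ hk _)
  refine ⟨AdicCompletion.liftAlgHom (R := K) 𝔪
    (fun k => (c.retraction hτ k).comp ((AdicCompletion.evalₐ 𝔪 k).restrictScalars K)) hcomp,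
    fun k y f hf => ?_⟩
  rw [AdicCompletion.evalₐ_liftAlgHom]
  change c.retraction hτ k (AdicCompletion.evalₐ 𝔪 k y) = _
  rw [hf, retraction_mk]

/-- There is a splitting of `Â → Â ⧸ P Â`, where `P` is generated by coordinates, whose image
consists of functions which are constant along these coordinates. -/
theorem exists_splitting [IsNoetherianRing A] {τ : Finset (Fin n)} (hτ : τ ⊆ c.vanishing)
    {P : Ideal A} (hP : P = c.paramIdeal τ) :
    ∃ σ : (AdicCompletion 𝔪 A ⧸ P.map (algebraMap A (AdicCompletion 𝔪 A))) →ₐ[K]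
      AdicCompletion 𝔪 A,
      (∀ y, Ideal.Quotient.mk _ (σ y) = y) ∧
      ∀ (V : Ideal A), (∀ g ∈ V, c.euler τ g ∈ V) → ∀ f, c.euler τ f ∈ V →
        algebraMap A (AdicCompletion 𝔪 A) f -
          σ (Ideal.Quotient.mk _ (algebraMap A (AdicCompletion 𝔪 A) f)) ∈
        V.map (algebraMap A (AdicCompletion 𝔪 A)) := by
  obtain ⟨σ, hσ⟩ := c.exists_retraction hτ
  have hof : ∀ k f, AdicCompletion.evalₐ 𝔪 k (algebraMap A (AdicCompletion 𝔪 A) f) =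
      Ideal.Quotient.mk (𝔪 ^ k) f := fun k f => AdicCompletion.evalₐ_of 𝔪 k f
  -- the limit of the retractions vanishes on the extension of `P`
  have h0 : ∀ y ∈ P.map (algebraMap A (AdicCompletion 𝔪 A)), σ y = 0 := by
    have hle : P.map (algebraMap A (AdicCompletion 𝔪 A)) ≤ RingHom.ker σ := by
      rw [Ideal.map_le_iff_le_comap]
      intro f hf
      rw [Ideal.mem_comap, RingHom.mem_ker]
      refine AdicCompletion.ext_evalₐ fun k => ?_
      rw [hσ k _ f (hof k f), map_zero, Ideal.Quotient.eq_zero_iff_mem]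
      exact c.pow_le_pow hτ k (c.flatten_mem_pow (hP ▸ hf) k)
    exact fun y hy => hle hy
  refine ⟨Ideal.Quotient.liftₐ _ σ h0, fun y => ?_, fun V hV f hf => ?_⟩
  · obtain ⟨y, rfl⟩ := Ideal.Quotient.mk_surjective y
    change Ideal.Quotient.mk _ (σ y) = _
    rw [eq_comm, Ideal.Quotient.eq]
    refine mem_map_of_forall_eval 𝔪 P _ fun k => ?_
    obtain ⟨f, hf⟩ := Ideal.Quotient.mk_surjective (AdicCompletion.evalₐ 𝔪 k y)
    refine ⟨f - c.flatten τ k f, hP ▸ c.sub_flatten_mem τ k f, ?_⟩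
    rw [map_sub, map_sub, hσ k y f hf.symm, hf]
  · change _ - σ _ ∈ _
    refine mem_map_of_forall_eval 𝔪 V _ fun k => ?_
    refine ⟨f - c.flatten τ k f, c.flatten_sub_mem τ hV hf k, ?_⟩
    rw [map_sub, map_sub, hσ k _ f (hof k f), hof]

end CoordSystem

end Completion

section Nested

variable {K : Type u} [Field K] [CharZero K] {A : Type u} [CommRing A] [Algebra K A]
  [IsLocalRing A] [IsNoetherianRing A] {𝔪 : Ideal A} {E : Set (Ideal A)}

/-- Generators which are constant along the previous blocks, up to the order `N`, where `P ^ N` is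
contained in the weighted ideals of their degrees. -/
structure FlatGens (E : Set (Ideal A)) (s : State A) {n : ℕ} (c : CoordSystem K A 𝔪 n) {m : ℕ}
    (f : Fin m → A) (b : Fin m → ℚ≥0) (N : ℕ) : Prop where
  compat : c.Compatible E
  extends_coords : c.Extends ((coords s.1).map Prod.fst)
  gens : s.2 = intPart s.2 s.1 ⊔ Algebra.adjoin A (Set.range fun j => mono (b j) (f j))
  der_mem : ∀ l, c.z l ∈ (coords s.1).map Prod.fst → ∀ j, c.der l (f j) ∈ idealOf s.1 ^ N
  pow_le : ∀ j, idealOf s.1 ^ N ≤ wIdeal (coords s.1) (b j)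

theorem euler_wIdeal {n : ℕ} {c : CoordSystem K A 𝔪 n} {L : List (A × ℚ≥0)}
    {τ : Finset (Fin n)} (hL : c.Extends (L.map Prod.fst))
    (hτ : ∀ i, i ∈ τ ↔ c.z i ∈ L.map Prod.fst) {q : ℚ} {f : A} (hf : f ∈ wIdeal L q) :
    c.euler τ f ∈ wIdeal L q := by
  have := derivation_wIdeal (c.euler τ) le_rfl (fun y hy => ?_) hf
  · rwa [sub_zero] at this
  · have hy' := List.mem_map_of_mem (f := Prod.fst) hy
    obtain ⟨i, hi⟩ := (hL.2 _ hy').1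
    rw [← hi, c.euler_z ((hτ i).2 (hi ▸ hy')), hi, sub_zero]
    exact mem_wIdeal hy le_rfl

/-- A splitting onto the functions which are constant along the blocks changes flat generators only
by elements of the part of the blocks. -/
theorem FlatGens.isNested (h𝔪 : 𝔪 = IsLocalRing.maximalIdeal A) {s : State A}
    (hpos : ∀ y ∈ coords s.1, 0 < y.2) {n : ℕ} {c : CoordSystem K A 𝔪 n} {m : ℕ}
    {f : Fin m → A} {b : Fin m → ℚ≥0} {N : ℕ} (h : FlatGens E s c f b N) : IsNested K 𝔪 s := by
  classical
  obtain ⟨τ, hτ, hτi, hτP⟩ := c.exists_indices h.extends_coords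
  rw [← idealOf_eq] at hτP
  have hint := c.intPart_eq h𝔪 h.extends_coords hpos s.2
  have hle : intPart s.2 s.1 ≤ s.2 := le_sup_left.trans h.gens.ge
  have hhom := isHomog_intPart (S := s.2) h𝔪 c h.extends_coords hpos
  have hgen : ∀ j, mono (b j) (f j) ∈ s.2 := fun j => by
    rw [h.gens]
    exact (le_sup_right : _ ≤ intPart s.2 s.1 ⊔ _) (Algebra.subset_adjoin (Set.mem_range_self j))
  have hhoms : IsHomog s.2 := by
    rw [h.gens]
    exact hhom.sup (isHomog_adjoin (by rintro _ ⟨j, rfl⟩; exact ⟨_, _, rfl⟩))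
  have hsplit := c.exists_splitting hτ hτP
  obtain ⟨σ, hσ, hσV⟩ := hsplit
  refine ⟨hle, σ, hσ, ?_⟩
  have hdiff : ∀ j, mono (b j) (algebraMap A (AdicCompletion 𝔪 A) (f j) - σ
      (Ideal.Quotient.mk _ (algebraMap A (AdicCompletion 𝔪 A) (f j)))) ∈
      extend (algebraMap A (AdicCompletion 𝔪 A)) (intPart s.2 s.1) := fun j => by
    by_cases hfj : f j = 0
    · rw [hfj, map_zero, map_zero, map_zero, sub_zero]
      simp [mono]
    -- the splitting changes `f j` by an element of the weighted ideal of degree `b j`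
    have hmem := hσV (wIdeal (coords s.1) (b j)) (fun g hg => euler_wIdeal h.extends_coords hτi hg)
      (f j) (c.euler_mem_of_der_mem fun i hi => Ideal.mul_mem_left _ _
        (h.pow_le j (h.der_mem i ((hτi i).1 hi) j)))
    have hV : (wIdeal (coords s.1) (b j)).map (algebraMap A (AdicCompletion 𝔪 A)) ≤ degIdeal
        (extend (algebraMap A (AdicCompletion 𝔪 A)) (intPart s.2 s.1)) (b j) := by
      rw [Ideal.map_le_iff_le_comap]
      intro v hv
      refine mono_mem_extend (algebraMap A (AdicCompletion 𝔪 A)) ?_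
      rw [hint]
      refine ⟨mono_mem_monoAlg.2 hv, mono_mem_supportedIn.2 fun _ => ?_⟩
      exact (le_sup_left : degreeGroup s.2 ≤ _)
        (AddSubgroup.subset_closure ⟨b j, rfl, f j, hfj, hgen j⟩)
    exact hV hmem
  apply le_antisymm
  · conv_lhs => rw [h.gens]
    rw [extend_sup _ hhom (isHomog_adjoin (by rintro _ ⟨j, rfl⟩; exact ⟨_, _, rfl⟩)),
      extend_adjoin]
    refine sup_le le_sup_left (Algebra.adjoin_le ?_)
    rintro _ ⟨j, rfl⟩
    change mono (b j) (algebraMap A (AdicCompletion 𝔪 A) (f j)) ∈ _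
    rw [← sub_add_cancel (algebraMap A (AdicCompletion 𝔪 A) (f j))
        (σ (Ideal.Quotient.mk _ (algebraMap A (AdicCompletion 𝔪 A) (f j)))), mono_add]
    refine Subalgebra.add_mem _ ((le_sup_left : extend (algebraMap A (AdicCompletion 𝔪 A))
        (intPart s.2 s.1) ≤ _) (hdiff j)) ?_
    exact (le_sup_right : _ ≤ extend (algebraMap A (AdicCompletion 𝔪 A)) (intPart s.2 s.1) ⊔ _)
      (Algebra.subset_adjoin ⟨b j, f j, hgen j, rfl⟩)
  · refine sup_le (extend_mono _ hle) (Algebra.adjoin_le ?_)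
    -- the elements whose image under the splitting lies in the extended algebra form an algebra
    have hJ := ((isMulFamily_degIdeal (extend (algebraMap A (AdicCompletion 𝔪 A)) s.2)).comap
      (σ.toRingHom.comp ((Ideal.Quotient.mk _).comp (algebraMap A (AdicCompletion 𝔪 A)))))
    have key : s.2 ≤ filtAlg _ hJ := by
      conv_lhs => rw [h.gens]
      refine sup_le ((hhom.le_filtAlg_iff hJ).2 fun q g hg => ?_)
          (adjoin_mono_le_filtAlg fun j => ?_)
      · change mono q (σ (Ideal.Quotient.mk _ (algebraMap A (AdicCompletion 𝔪 A) g))) ∈ extend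
            (algebraMap A (AdicCompletion 𝔪 A)) s.2
        rcases (zero_le : 0 ≤ q).eq_or_lt with hq | hq
        · rw [← hq]; exact mono_zero_mem _ _
        · rw [hint] at hg
          have hgP : g ∈ idealOf s.1 :=
            wIdeal_coords_le_idealOf (by exact_mod_cast hq) (mono_mem_monoAlg.1 hg.1)
          rw [Ideal.Quotient.eq_zero_iff_mem.2 (Ideal.mem_map_of_mem _ hgP), map_zero]
          simp [mono]
      · change mono (b j) (σ (Ideal.Quotient.mk _ (algebraMap A (AdicCompletion 𝔪 A) (f j)))) ∈
            extend (algebraMap A (AdicCompletion 𝔪 A)) s.2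
        have h1 := mono_mem_extend (algebraMap A (AdicCompletion 𝔪 A)) (hgen j)
        have h2 := extend_mono (algebraMap A (AdicCompletion 𝔪 A)) hle (hdiff j)
        have h3 : mono (b j) (σ (Ideal.Quotient.mk _ (algebraMap A (AdicCompletion 𝔪 A) (f j)))) =
            mono (b j) (algebraMap A (AdicCompletion 𝔪 A) (f j)) - mono (b j)
                (algebraMap A (AdicCompletion 𝔪 A) (f j) - σ
                (Ideal.Quotient.mk _ (algebraMap A (AdicCompletion 𝔪 A) (f j)))) := by
          rw [eq_sub_iff_add_eq, ← mono_add, add_sub_cancel]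
        rw [h3]
        exact Subalgebra.sub_mem _ h1 h2
    rintro _ ⟨q, g, hg, rfl⟩
    exact mono_mem_filtAlg.1 (key hg)

end Nested

/-! ### Flat generators -/

section FlatSteps

variable {K : Type u} [Field K] {A : Type u} [CommRing A] [Algebra K A]

/-- A graded algebra is stable under a derivation of the coefficients if this holds for its
generators. -/
theorem derivation_stable {S₀ S : Subalgebra A (TAlg A)} (h₀ : IsHomog S₀) (δ : Derivation K A A)
    {m : ℕ} {f : Fin m → A} {b : Fin m → ℚ≥0}
    (hS : S = S₀ ⊔ Algebra.adjoin A (Set.range fun j => mono (b j) (f j)))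
    (hδ₀ : ∀ q g, mono q g ∈ S₀ → mono q (δ g) ∈ S) (hδ : ∀ j, mono (b j) (δ (f j)) ∈ S)
    {q : ℚ≥0} {g : A} (hg : mono q g ∈ S) : mono q (δ g) ∈ S := by
  -- the homogeneous elements of `S` which `δ` maps into `S` form a subalgebra, by the Leibniz rule
  let J : ℚ≥0 → Ideal A := fun q =>
    { carrier := {g | g ∈ degIdeal S q ∧ δ g ∈ degIdeal S q}
      add_mem' := fun {x y} hx hy => ⟨Ideal.add_mem _ hx.1 hy.1, by
        rw [map_add]; exact Ideal.add_mem _ hx.2 hy.2⟩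
      zero_mem' := ⟨Ideal.zero_mem _, by rw [map_zero]; exact Ideal.zero_mem _⟩
      smul_mem' := fun r x hx => ⟨Ideal.mul_mem_left _ r hx.1, by
        rw [smul_eq_mul, Derivation.leibniz, smul_eq_mul, smul_eq_mul]
        exact Ideal.add_mem _ (Ideal.mul_mem_left _ _ hx.2) (Ideal.mul_mem_right _ _ hx.1)⟩ }
  have hJ : IsMulFamily J :=
    { zero := by
        rw [Ideal.eq_top_iff_one]
        exact ⟨mono_zero_mem _ _, mono_zero_mem _ _⟩
      mul_le := fun q r => by
        rw [Ideal.mul_le]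
        intro x hx y hy
        have hm := (isMulFamily_degIdeal S).mul_le q r
        refine ⟨hm (Ideal.mul_mem_mul hx.1 hy.1), ?_⟩
        rw [Derivation.leibniz, smul_eq_mul, smul_eq_mul]
        refine Ideal.add_mem _ (hm (Ideal.mul_mem_mul hx.1 hy.2)) ?_
        rw [mul_comm]
        exact hm (Ideal.mul_mem_mul hx.2 hy.1) }
  have hle : S ≤ filtAlg J hJ := by
    conv_lhs => rw [hS]
    refine sup_le ((h₀.le_filtAlg_iff hJ).2 fun q g hg => ⟨?_, hδ₀ q g hg⟩)
      (adjoin_mono_le_filtAlg fun j => ⟨?_, hδ j⟩)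
    · change mono q g ∈ S
      rw [hS]
      exact (le_sup_left : S₀ ≤ S₀ ⊔ _) hg
    · change mono (b j) (f j) ∈ S
      rw [hS]
      exact (le_sup_right : _ ≤ S₀ ⊔ _) (Algebra.subset_adjoin (Set.mem_range_self j))
  exact (mono_mem_filtAlg.1 (hle hg)).2

variable {𝔪 : Ideal A} {E : Set (Ideal A)} [CharZero K] [IsLocalRing A] [IsNoetherianRing A]
  {R : Subalgebra A (TAlg A)}
  {s s' : State A} {x : List A} {a : ℚ≥0} {n : ℕ} {c : CoordSystem K A 𝔪 n} {m : ℕ}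
  {f : Fin m → A} {b : Fin m → ℚ≥0}

theorem StepData.intPart_eq (h𝔪 : 𝔪 = IsLocalRing.maximalIdeal A)
    (h : StepData K 𝔪 E s s' x a c f b) (hs : Reached K 𝔪 E R s) :
    intPart s.2 s'.1 = intPart s'.2 s'.1 := by
  rw [c.intPart_eq h𝔪 h.extends_coords (h.pos_coords h𝔪 hs),
    c.intPart_eq h𝔪 h.extends_coords (h.pos_coords h𝔪 hs), h.degreeGroup_eq h𝔪 hs]

theorem StepData.mono_mem_intPart (h𝔪 : 𝔪 = IsLocalRing.maximalIdeal A)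
    (h : StepData K 𝔪 E s s' x a c f b) (hs : Reached K 𝔪 E R s) (j : Fin m) (hj : f j ≠ 0) {k : ℕ}
    (hk : (k : ℚ≥0) < b j * a) {v : A} (hv : v ∈ wIdeal (coords s'.1) (b j - k * (1 / a))) :
    mono (b j - (k : ℚ≥0) / a) v ∈ intPart s'.2 s'.1 := by
  have ha := h.weight_pos h𝔪 hs
  have hle : (k : ℚ≥0) / a ≤ b j := (div_le_iff₀ ha).2 hk.le
  have hcast : ((b j - (k : ℚ≥0) / a : ℚ≥0) : ℚ) = b j - k * (1 / a) := by
    rw [NNRat.coe_sub hle]; push_cast; ring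
  rw [← h.intPart_eq h𝔪 hs, c.intPart_eq h𝔪 h.extends_coords (h.pos_coords h𝔪 hs)]
  refine ⟨mono_mem_monoAlg.2 (by rwa [hcast]), mono_mem_supportedIn.2 fun _ => ?_⟩
  rw [hcast]
  refine sub_mem ((le_sup_left : degreeGroup s.2 ≤ _)
    (AddSubgroup.subset_closure ⟨b j, rfl, f j, hj, h.gen_mem j⟩)) ?_
  rw [← nsmul_eq_mul]
  exact nsmul_mem ((le_sup_right : weightGroup (coords s'.1) ≤ _)
    (h.weight_mem (h.ne_nil h𝔪 hs))) k

/-- Up to terms in the part generated by the blocks, the Euler field of the blocks maps the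
derivatives of the generators to derivatives of higher order. -/
theorem StepData.euler_diffOp_mem (h𝔪 : 𝔪 = IsLocalRing.maximalIdeal A)
    (h : StepData K 𝔪 E s s' x a c f b) (hs : Reached K 𝔪 E R s) {N : ℕ}
    (hd : ∀ l, c.z l ∈ (coords s.1).map Prod.fst → ∀ j, c.der l (f j) ∈ idealOf s.1 ^ N)
    (hN : ∀ j, idealOf s.1 ^ N ≤ wIdeal (coords s.1) (b j)) {τ : Finset (Fin n)}
    (hτ : ∀ i, i ∈ τ ↔ c.z i ∈ (coords s'.1).map Prod.fst) {S : Subalgebra A (TAlg A)}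
    (hS : intPart s'.2 s'.1 ≤ S) (j : Fin m) {α : Fin n → ℕ} (hα : ∀ i, c.z i ∉ x → α i = 0)
    (hα' : ((∑ i, α i : ℕ) : ℚ≥0) < b j * a)
    (hnext : ∀ i, c.z i ∈ x → ((∑ k, incr α i k : ℕ) : ℚ≥0) < b j * a →
      mono (b j - ((∑ k, incr α i k : ℕ) : ℚ≥0) / a) (c.diffOp (incr α i) (f j)) ∈ S) :
    mono (b j - ((∑ i, α i : ℕ) : ℚ≥0) / a) (c.euler τ (c.diffOp α (f j))) ∈ S := by
  classical
  have ha := h.weight_pos h𝔪 hs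
  by_cases hj : f j = 0
  · have h0 : c.diffOp α (f j) = 0 := by
      have := c.diffOp_add α (f j) (f j)
      rw [hj, add_zero] at this
      rw [hj]
      exact left_eq_add.1 this
    rw [h0, map_zero]
    simp [mono]
  obtain ⟨τ₀, σ, -, -, -, hτ₀, hσ, hP, -⟩ := h.exists_indices
  have hw : ∀ v ∈ wIdeal (coords s'.1) (b j - (∑ i, α i : ℕ) * (1 / a)),
      v ∈ degIdeal S (b j - ((∑ i, α i : ℕ) : ℚ≥0) / a) := fun v hv =>
    hS (h.mono_mem_intPart h𝔪 hs j hj hα' hv)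
  change _ ∈ degIdeal S _
  refine c.euler_mem_of_der_mem fun l hl => ?_
  rw [hτ, h.fst_coords_eq, List.mem_append] at hl
  rcases hl with hl | hl
  · -- along the previous blocks the generators are constant
    refine hw _ (Ideal.mul_mem_left _ _ ?_)
    rw [← c.diffOp_der]
    have h1 : c.diffOp α (c.der l (f j)) ∈ idealOf s.1 ^ N := by
      refine c.diffOp_mem_of_der (J := fun _ => idealOf s.1 ^ N) (τ := σ) (w := 0) (q := 0)
        (fun i hi _ g hg => ?_) (hd l hl j) α fun i hi => hα i fun hx => hi ((hσ i).2 hx)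
      refine derivation_pow_of_le _ (fun y hy => ?_) N hg
      rw [hP] at hy ⊢
      refine c.der_paramIdeal (fun hi' => ?_) hy
      have h2 := h.extends_coords.1
      rw [h.fst_coords_eq] at h2
      exact (List.nodup_append.1 h2).2.2 _ ((hτ₀ i).1 hi') _ ((hσ i).1 hi) rfl
    refine (isFiltration_wIdeal _).antitone ?_ (wIdeal_mono (fun y hy => ?_) _ (hN j h1))
    · have : (0 : ℚ) ≤ (∑ i, α i : ℕ) * (1 / a) := by positivity
      linarith
    · rw [h.coords_eq]; exact List.mem_append_left _ hy
  -- along the new block, `z_l ∂_l` raises the order of the derivative by one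
  · have hzl : c.z l ∈ wIdeal (coords s'.1) (1 / a) := by
      refine mem_wIdeal (y := (c.z l, a)) ?_ le_rfl
      rw [h.coords_eq]
      exact List.mem_append_right _ (List.mem_map.2 ⟨_, hl, rfl⟩)
    rw [c.der_diffOp, mul_smul_comm]
    refine algebra_smul_mem _ ?_
    by_cases hlt : ((∑ k, incr α l k : ℕ) : ℚ≥0) < b j * a
    · have h1 := hnext l hl hlt
      have h2 : mono (1 / a) (c.z l) ∈ S := by
        refine hS ?_
        rw [← h.intPart_eq h𝔪 hs, c.intPart_eq h𝔪 h.extends_coords (h.pos_coords h𝔪 hs)]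
        refine ⟨mono_mem_monoAlg.2 (by simpa using hzl), mono_mem_supportedIn.2 fun _ => ?_⟩
        have := (le_sup_right : weightGroup (coords s'.1) ≤ degreeGroup s.2 ⊔ _)
          (h.weight_mem (h.ne_nil h𝔪 hs))
        simpa using this
      have h3 := S.mul_mem h2 h1
      rw [mono_mul_mono] at h3
      have h4 : 1 / a + (b j - ((∑ k, incr α l k : ℕ) : ℚ≥0) / a) =
          b j - ((∑ i, α i : ℕ) : ℚ≥0) / a := by
        apply NNRat.coe_injective
        rw [NNRat.coe_add, NNRat.coe_sub ((div_le_iff₀ ha).2 hlt.le),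
          NNRat.coe_sub ((div_le_iff₀ ha).2 hα'.le), sum_incr]
        push_cast
        ring
      rwa [h4] at h3
    · refine hw _ (Ideal.mul_mem_right _ _ ((isFiltration_wIdeal _).antitone ?_ hzl))
      rw [sum_incr, not_lt] at hlt
      have h1 : (b j : ℚ) * a ≤ (∑ i, α i : ℕ) + 1 := by exact_mod_cast hlt
      have ha' : (0 : ℚ) < a := by exact_mod_cast ha
      rw [sub_le_iff_le_add, mul_one_div, ← add_div, le_div_iff₀ ha']
      linarith

/-- The derivatives of the generators, made constant along the blocks, generate together with the
part of the blocks. -/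
theorem StepData.exists_flatGens (h𝔪 : 𝔪 = IsLocalRing.maximalIdeal A)
    (h : StepData K 𝔪 E s s' x a c f b) (hs : Reached K 𝔪 E R s) {N : ℕ}
    (hd : ∀ l, c.z l ∈ (coords s.1).map Prod.fst → ∀ j, c.der l (f j) ∈ idealOf s.1 ^ N)
    (hN : ∀ j, idealOf s.1 ^ N ≤ wIdeal (coords s.1) (b j)) :
    ∃ (m' : ℕ) (f' : Fin m' → A) (b' : Fin m' → ℚ≥0) (N' : ℕ), FlatGens E s' c f' b' N' := by
  classical
  have ha := h.weight_pos h𝔪 hs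
  have ha' : (0 : ℚ) < a := by exact_mod_cast ha
  have hpos := h.pos_coords h𝔪 hs
  obtain ⟨τ, hτ, hτi, hτP⟩ := c.exists_indices h.extends_coords
  rw [← WeightedCenters.idealOf_eq] at hτP
  -- the finite set of the derivatives which occur
  let D : Set (Fin m × (Fin n → ℕ)) := {p | (∀ i, c.z i ∉ x → p.2 i = 0) ∧
    ((∑ i, p.2 i : ℕ) : ℚ≥0) < b p.1 * a}
  have hD : D.Finite := by
    have : D ⊆ ⋃ j : Fin m, Prod.mk j '' Set.Icc 0 fun _ => ⌊b j * a⌋₊ := by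
      rintro ⟨j, α⟩ ⟨-, hα⟩
      refine Set.mem_iUnion.2 ⟨j, α, ⟨fun _ => Nat.zero_le _, fun i => ?_⟩, rfl⟩
      exact (Finset.single_le_sum (f := α) (fun _ _ => Nat.zero_le _) (Finset.mem_univ i)).trans
        (Nat.le_floor hα.le)
    exact (Set.finite_iUnion fun j => (Set.finite_Icc _ _).image _).subset this
  have := hD.to_subtype
  obtain ⟨m', ⟨e⟩⟩ := Finite.exists_equiv_fin D
  let d : Fin m' → A := fun k => c.diffOp (e.symm k).1.2 (f (e.symm k).1.1)
  let b' : Fin m' → ℚ≥0 := fun k =>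
    b (e.symm k).1.1 - ((∑ i, (e.symm k).1.2 i : ℕ) : ℚ≥0) / a
  have hs' : s'.2 = intPart s'.2 s'.1 ⊔
      Algebra.adjoin A (Set.range fun k => mono (b' k) (d k)) := by
    conv_lhs => rw [h.snd, coeffAlg, h.intPart_eq h𝔪 hs]
    congr 2
    ext F
    constructor
    · rintro ⟨j, α, hα, hα', rfl⟩
      exact ⟨e ⟨(j, α), hα, hα'⟩, by simp only [b', d, Equiv.symm_apply_apply]⟩
    · rintro ⟨k, rfl⟩
      exact ⟨_, _, (e.symm k).2.1, (e.symm k).2.2, rfl⟩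
  -- the order up to which the generators are made constant
  obtain ⟨M, hM⟩ : ∃ M : ℕ, ∀ k, b' k * a ≤ M := by
    refine ⟨Finset.univ.sup fun k => ⌈b' k * a⌉₊, fun k => (Nat.le_ceil _).trans ?_⟩
    exact_mod_cast Finset.le_sup (f := fun k => ⌈b' k * a⌉₊) (Finset.mem_univ k)
  have hPa : idealOf s'.1 ≤ wIdeal (coords s'.1) (1 / a) := by
    rw [WeightedCenters.idealOf_eq, Ideal.span_le]
    intro y hy
    obtain ⟨z, hz, rfl⟩ := List.mem_map.1 hy
    refine mem_wIdeal hz (one_div_le_one_div_of_le (by exact_mod_cast hpos z hz) ?_)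
    rw [h.coords_eq, List.mem_append] at hz
    rcases hz with hz | hz
    · obtain ⟨y, hy, -, hy2⟩ := mem_coords.1 hz
      rw [hy2]
      exact_mod_cast ((hs.lt_order h𝔪 h.contact.1).1 y hy).le
    · obtain ⟨y, -, rfl⟩ := List.mem_map.1 hz
      exact le_rfl
  have hPM : ∀ k, idealOf s'.1 ^ M ≤ wIdeal (coords s'.1) (b' k) := fun k => by
    refine ((isFiltration_wIdeal _).pow_mem hPa M).trans ((isFiltration_wIdeal _).antitone ?_)
    rw [mul_one_div, le_div_iff₀ ha']
    exact_mod_cast hM k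
  let f' : Fin m' → A := fun k => c.flatten τ M (d k)
  refine ⟨m', f', b', M, h.compat, h.extends_coords, ?_, fun l hl k => ?_, hPM⟩
  swap
  · rw [hτP]
    exact c.der_flatten_mem ((hτi l).2 hl) M _
  have hhom := isHomog_intPart (S := s'.2) h𝔪 c h.extends_coords hpos
  have hint := c.intPart_eq h𝔪 h.extends_coords hpos s'.2
  have hEint : ∀ q g, mono q g ∈ intPart s'.2 s'.1 →
      mono q (c.euler τ g) ∈ intPart s'.2 s'.1 := fun q g hg => by
    rw [hint] at hg ⊢
    refine ⟨mono_mem_monoAlg.2 (euler_wIdeal h.extends_coords hτi (mono_mem_monoAlg.1 hg.1)),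
      mono_mem_supportedIn.2 fun h0 => mono_mem_supportedIn.1 hg.2 fun hg0 => h0 ?_⟩
    rw [hg0, map_zero]
  have hdmem : ∀ (j : Fin m) (α : Fin n → ℕ), (∀ i, c.z i ∉ x → α i = 0) →
      ((∑ i, α i : ℕ) : ℚ≥0) < b j * a →
      mono (b j - ((∑ i, α i : ℕ) : ℚ≥0) / a) (c.diffOp α (f j)) ∈ s'.2 := fun j α h1 h2 => by
    rw [h.snd]; exact mono_mem_coeffAlg j h1 h2
  have hincr : ∀ {α : Fin n → ℕ}, (∀ i, c.z i ∉ x → α i = 0) → ∀ i, c.z i ∈ x →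
      ∀ k, c.z k ∉ x → incr α i k = 0 := fun hα i hi k hk => by
    have hki : k ≠ i := fun hki => hk (by rwa [hki])
    rw [incr_of_ne _ hki, hα k hk]
  have hint_le : intPart s'.2 s'.1 ≤ s'.2 := le_sup_left.trans hs'.ge
  -- `s'.2` is stable under the Euler field, hence contains the new generators
  have hstab : ∀ q g, mono q g ∈ s'.2 → mono q (c.euler τ g) ∈ s'.2 := fun q g hg => by
    refine derivation_stable hhom (c.euler τ) hs' (fun q g hg => hint_le (hEint q g hg))
      (fun k => ?_) hg
    exact h.euler_diffOp_mem h𝔪 hs hd hN hτi hint_le _ (e.symm k).2.1 (e.symm k).2.2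
      fun i hi hlt => hdmem _ _ (hincr (e.symm k).2.1 i hi) hlt
  have hd' : ∀ k, mono (b' k) (d k) ∈ s'.2 := fun k => hdmem _ _ (e.symm k).2.1 (e.symm k).2.2
  set W := intPart s'.2 s'.1 ⊔ Algebra.adjoin A (Set.range fun k => mono (b' k) (f' k)) with hW
  have hintW : intPart s'.2 s'.1 ≤ W := le_sup_left
  have hf'W : ∀ k, mono (b' k) (f' k) ∈ W := fun k =>
    (le_sup_right : _ ≤ intPart s'.2 s'.1 ⊔ _) (Algebra.subset_adjoin (Set.mem_range_self k))
  -- so is the algebra `W` which is generated by the new generators, as they are nearly constant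
  have hWstab : ∀ q g, mono q g ∈ W → mono q (c.euler τ g) ∈ W := fun q g hg => by
    refine derivation_stable hhom (c.euler τ) hW (fun q g hg => hintW (hEint q g hg))
      (fun k => ?_) hg
    by_cases hk : d k = 0
    · have : f' k = 0 := by
        change c.flatten τ M (d k) = 0
        rw [hk, ← map_zero (algebraMap K A), c.flatten_algebraMap, map_zero]
      rw [this, map_zero]
      simp [mono]
    refine hintW ?_
    rw [hint]
    refine ⟨mono_mem_monoAlg.2 (hPM k (c.euler_mem_of_der_mem fun i hi =>
      Ideal.mul_mem_left _ _ ?_)), mono_mem_supportedIn.2 fun _ => ?_⟩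
    · rw [hτP]
      exact c.der_flatten_mem hi M _
    · exact (le_sup_left : degreeGroup s'.2 ≤ _)
        (AddSubgroup.subset_closure ⟨_, rfl, _, hk, hd' k⟩)
  apply le_antisymm
  · conv_lhs => rw [hs']
    refine sup_le hintW (Algebra.adjoin_le ?_)
    -- descending induction on the order of the derivative
    have key : ∀ (t : ℕ) (j : Fin m) (α : Fin n → ℕ), (∀ i, c.z i ∉ x → α i = 0) →
        ((∑ i, α i : ℕ) : ℚ≥0) < b j * a → ⌈b j * a⌉₊ ≤ ∑ i, α i + t →
        mono (b j - ((∑ i, α i : ℕ) : ℚ≥0) / a) (c.diffOp α (f j)) ∈ W := by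
      intro t
      induction t with
      | zero =>
        intro j α _ h2 h3
        have := (Nat.le_ceil (b j * a)).trans (Nat.cast_le.2 h3)
        rw [add_zero] at this
        exact absurd h2 (not_lt.2 this)
      | succ t ih =>
        intro j α h1 h2 h3
        have hE := h.euler_diffOp_mem h𝔪 hs hd hN hτi hintW j h1 h2
          fun i hi hlt => ih j _ (hincr h1 i hi) hlt (by rw [sum_incr]; omega)
        have hV := c.flatten_sub_mem τ
          (V := degIdeal W (b j - ((∑ i, α i : ℕ) : ℚ≥0) / a))
          (fun g hg => hWstab _ g hg) hE M
        have hfl : c.flatten τ M (c.diffOp α (f j)) ∈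
            degIdeal W (b j - ((∑ i, α i : ℕ) : ℚ≥0) / a) := by
          have := hf'W (e ⟨(j, α), h1, h2⟩)
          simp only [b', f', d, Equiv.symm_apply_apply] at this
          exact this
        have := Ideal.add_mem _ hV hfl
        rwa [sub_add_cancel] at this
    rintro _ ⟨k, rfl⟩
    exact key _ _ _ (e.symm k).2.1 (e.symm k).2.2 (Nat.le_add_left _ _)
  · refine sup_le hint_le (Algebra.adjoin_le ?_)
    rintro _ ⟨k, rfl⟩
    have hV := c.flatten_sub_mem τ (V := degIdeal s'.2 (b' k))
      (fun g hg => hstab _ g hg) (hstab _ _ (hd' k)) M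
    have h2 := Ideal.sub_mem _ (show d k ∈ degIdeal s'.2 (b' k) from hd' k) hV
    rw [sub_sub_cancel] at h2
    exact h2

/-- A state with flat generators admits a step to another one. -/
theorem Reached.exists_nested_step (h𝔪 : 𝔪 = IsLocalRing.maximalIdeal A)
    (hs : Reached K 𝔪 E R s) (hT : ¬ Terminated s) {N : ℕ} (hf : FlatGens E s c f b N) :
    ∃ s', MillingStep K 𝔪 E s s' ∧ IsNested K 𝔪 s' ∧
      ∃ (c' : CoordSystem K A 𝔪 n) (m' : ℕ) (f' : Fin m' → A) (b' : Fin m' → ℚ≥0) (N' : ℕ),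
        FlatGens E s' c' f' b' N' := by
  obtain ⟨s', x, a, c', hd, hc'⟩ := hs.exists_step h𝔪 hT c hf.compat hf.extends_coords hf.gens N
  obtain ⟨m', f', b', N', h'⟩ := hd.exists_flatGens h𝔪 hs (N := N) (fun l hl j => by
    obtain ⟨h1, h2⟩ := hc' l hl
    have := Ideal.add_mem _ (h2 (f j)) (hf.der_mem l (h1 ▸ hl) j)
    rwa [sub_add_cancel] at this) hf.pow_le
  exact ⟨s', hd.millingStep, h'.isNested h𝔪 (hd.pos_coords h𝔪 hs), c', m', f', b', N', h'⟩

theorem Reached.exists_nested_run (h𝔪 : 𝔪 = IsLocalRing.maximalIdeal A)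
    (hs : Reached K 𝔪 E R ([], R)) :
    ∃ s', NestedMillingRun K 𝔪 E ([], R) s' ∧ Terminated s' := by
  obtain ⟨n, c, hcE, hL⟩ := hs.coord
  obtain ⟨m, f, b, hg⟩ := hs.gens
  have h0 : idealOf ([] : List (List A × ℚ≥0)) = ⊥ := by simp [idealOf]
  refine Reached.exists_terminated (K := K) (E := E) h𝔪 (p := fun s => ∃ (c : CoordSystem K A 𝔪 n)
      (m : ℕ) (f : Fin m → A) (b : Fin m → ℚ≥0) (N : ℕ), FlatGens E s c f b N)
    (fun _ _ h => h.1) (fun s hs hp hT => ?_) hs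
    ⟨c, m, f, b, 1, hcE, hL, hg, fun l hl => by simp [coords] at hl, fun j => ?_⟩
  · obtain ⟨c, m, f, b, N, hf⟩ := hp
    obtain ⟨s', h1, h2, h3⟩ := hs.exists_nested_step h𝔪 hT hf
    exact ⟨s', ⟨h1, h2⟩, h3⟩
  · rw [pow_one, h0]
    exact bot_le

end FlatSteps

/-! ### Existence of coordinates -/

section SmoothCoordinates

open IsLocalRing TensorProduct

variable {K : Type u} [Field K] [CharZero K] {A : Type u} [CommRing A] [Algebra K A]
  [IsLocalRing A]

/-- The residue field is formally smooth over `K`, so that `A ⧸ 𝔪 ^ 2` is a split extension of it;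
hence there is a derivation which is the identity on `𝔪 ⧸ 𝔪 ^ 2`. -/
theorem exists_derivation_square [Algebra.EssFiniteType K A] :
    ∃ δ : Derivation K A (A ⧸ maximalIdeal A ^ 2),
      (∀ y ∈ maximalIdeal A, δ y = Ideal.Quotient.mk _ y) ∧
      ∀ y ∈ maximalIdeal A, ∀ a, y • δ a = 0 := by
  have : Algebra.EssFiniteType K (ResidueField A) :=
    inferInstanceAs (Algebra.EssFiniteType K (A ⧸ maximalIdeal A))
  let r : A →ₐ[K] ResidueField A := IsScalarTower.toAlgHom K A (ResidueField A)
  have hr : ∀ y, r y = 0 ↔ y ∈ maximalIdeal A := fun y => residue_eq_zero_iff y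
  let g : (A ⧸ maximalIdeal A ^ 2) →ₐ[K] ResidueField A :=
    Ideal.Quotient.liftₐ _ r fun y hy => (hr y).2 (Ideal.pow_le_self two_ne_zero hy)
  have hg : ∀ y, g (Ideal.Quotient.mk _ y) = r y := fun _ => rfl
  have hgs : Function.Surjective g := fun y => by
    obtain ⟨a, rfl⟩ := residue_surjective y
    exact ⟨Ideal.Quotient.mk _ a, rfl⟩
  have hmul : ∀ u v, g u = 0 → g v = 0 → u * v = 0 := fun u v hu hv => by
    obtain ⟨a, rfl⟩ := Ideal.Quotient.mk_surjective u
    obtain ⟨b, rfl⟩ := Ideal.Quotient.mk_surjective v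
    rw [hg, hr] at hu hv
    rw [← map_mul, Ideal.Quotient.eq_zero_iff_mem, pow_two]
    exact Ideal.mul_mem_mul hu hv
  have hnil : IsNilpotent (RingHom.ker (g : (A ⧸ maximalIdeal A ^ 2) →+* ResidueField A)) := by
    refine ⟨2, ?_⟩
    refine (pow_two _).trans (eq_bot_iff.2 (Ideal.mul_le.2 fun u hu v hv => ?_))
    exact hmul u v hu hv
  let t : ResidueField A →ₐ[K] A ⧸ maximalIdeal A ^ 2 :=
    Algebra.FormallySmooth.liftOfSurjective (AlgHom.id K _) g hgs hnil
  have ht : ∀ y, g (t y) = y := fun y =>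
    Algebra.FormallySmooth.liftOfSurjective_apply (AlgHom.id K _) g hgs hnil y
  have hker : ∀ a, g (Ideal.Quotient.mk _ a - t (r a)) = 0 := fun a => by
    rw [map_sub, ht, hg, sub_self]
  let δ : Derivation K A (A ⧸ maximalIdeal A ^ 2) := Derivation.mk'
    ((Ideal.Quotient.mkₐ K (maximalIdeal A ^ 2)).toLinearMap - (t.comp r).toLinearMap)
    fun a b => by
      have h := hmul _ _ (hker a) (hker b)
      change Ideal.Quotient.mk _ (a * b) - t (r (a * b)) =
        Ideal.Quotient.mk _ a * (Ideal.Quotient.mk _ b - t (r b)) +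
        Ideal.Quotient.mk _ b * (Ideal.Quotient.mk _ a - t (r a))
      rw [map_mul, map_mul, map_mul]
      linear_combination (-1 : A ⧸ maximalIdeal A ^ 2) * h
  have hδ : ∀ a, δ a = Ideal.Quotient.mk _ a - t (r a) := fun _ => rfl
  refine ⟨δ, fun y hy => ?_, fun y hy a => ?_⟩
  · rw [hδ, (hr y).2 hy, map_zero, sub_zero]
  · rw [hδ]
    exact hmul (Ideal.Quotient.mk _ y) _ ((hr y).2 hy) (hker a)

theorem mem_maximalIdeal_of_sum_mem_sq [IsNoetherianRing A] {d : ℕ} {x : Fin d → A}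
    (hd : ringKrullDim A = d) (hx : Ideal.span (Set.range x) = maximalIdeal A) {a : Fin d → A}
    (h : ∑ i, a i * x i ∈ maximalIdeal A ^ 2) (i : Fin d) : a i ∈ maximalIdeal A := by
  have hxm : ∀ i, x i ∈ maximalIdeal A := fun i => hx ▸ Ideal.subset_span (Set.mem_range_self i)
  let y : Fin d → maximalIdeal A := fun i => ⟨x i, hxm i⟩
  have hspan : Submodule.span A (Set.range y) = ⊤ := by
    apply Submodule.map_injective_of_injective (maximalIdeal A).injective_subtype
    rw [Submodule.map_span, ← Set.range_comp, Submodule.map_top, Submodule.range_subtype]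
    exact hx
  have h1 : Submodule.span (ResidueField A) (Set.range fun i => (maximalIdeal A).toCotangent (y i))
      = ⊤ := by
    have := (CotangentSpace.span_image_eq_top_iff (R := A) (s := Set.range y)).2 hspan
    rwa [← Set.range_comp] at this
  have hfr : d ≤ Module.finrank (ResidueField A) (CotangentSpace A) := by
    rw [← IsLocalRing.spanFinrank_maximalIdeal_eq_finrank_cotangentSpace]
    have := ringKrullDim_le_spanFinrank_maximalIdeal A
    rw [hd] at this
    exact_mod_cast this
  have hli := linearIndependent_of_top_le_span_of_card_le_finrank (R := ResidueField A)
    (b := fun i => ((maximalIdeal A).toCotangent (y i) : CotangentSpace A)) h1.ge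
    (by rw [Fintype.card_fin]; exact hfr)
  have h2 := (Fintype.linearIndependent_iff.1 hli) (fun i => residue A (a i)) (by
    have h3 : (maximalIdeal A).toCotangent (∑ i, a i • y i) = 0 := by
      rw [Ideal.toCotangent_eq_zero]
      simpa [y] using h
    rw [map_sum] at h3
    simp only [map_smul] at h3
    exact h3) i
  exact (residue_eq_zero_iff _).1 h2

/-- A system of regular parameters of a smooth local algebra can be extended to a coordinate
system. -/
theorem exists_coordSystem [IsNoetherianRing A] [Algebra.EssFiniteType K A]
    [Algebra.FormallySmooth K A] {d : ℕ} (x : Fin d → A) (hd : ringKrullDim A = d)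
    (hx : Ideal.span (Set.range x) = maximalIdeal A) :
    ∃ (n : ℕ) (c : CoordSystem K A (maximalIdeal A) n), ∀ i, x i ∈ Set.range c.z := by
  classical
  let w : A → ResidueField A ⊗[A] Ω[A⁄K] := fun a => 1 ⊗ₜ KaehlerDifferential.D K A a
  obtain ⟨δ, hδ, hδ0⟩ := exists_derivation_square (K := K) (A := A)
  have hxm : ∀ i, x i ∈ maximalIdeal A := fun i => hx ▸ Ideal.subset_span (Set.mem_range_self i)
  -- the differentials of the parameters are independent at the point
  have hli : LinearIndependent (ResidueField A) fun i => w (x i) := by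
    rw [Fintype.linearIndependent_iff]
    intro g hg i
    choose a ha using fun i => residue_surjective (g i)
    rw [← ha i, residue_eq_zero_iff]
    refine mem_maximalIdeal_of_sum_mem_sq hd hx (a := a) ?_ i
    have h1 : (1 : ResidueField A) ⊗ₜ[A] (∑ i, a i • KaehlerDifferential.D K A (x i)) = 0 := by
      rw [TensorProduct.tmul_sum, ← hg]
      refine Finset.sum_congr rfl fun i _ => ?_
      rw [TensorProduct.tmul_smul, ← ha i]
      rfl
    have h2 : ∑ i, a i • KaehlerDifferential.D K A (x i) ∈
        maximalIdeal A • (⊤ : Submodule A Ω[A⁄K]) := by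
      rw [← LinearMap.ker_tensorProductMk]
      exact h1
    have h3 : maximalIdeal A • (⊤ : Submodule A Ω[A⁄K]) ≤
        LinearMap.ker δ.liftKaehlerDifferential := by
      rw [Submodule.smul_le]
      intro y hy ω _
      rw [LinearMap.mem_ker, map_smul]
      have h4 : ω ∈ Submodule.span A (Set.range (KaehlerDifferential.D K A)) := by
        rw [KaehlerDifferential.span_range_derivation]; trivial
      induction h4 using Submodule.span_induction with
      | mem ω hω =>
        obtain ⟨b, rfl⟩ := hω
        rw [Derivation.liftKaehlerDifferential_comp_D]
        exact hδ0 y hy b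
      | zero => rw [map_zero, smul_zero]
      | add u v _ _ hu hv => rw [map_add, smul_add, hu trivial, hv trivial, add_zero]
      | smul b u _ hu => rw [map_smul, smul_comm, hu trivial, smul_zero]
    have h5 := h3 h2
    rw [LinearMap.mem_ker, map_sum] at h5
    simp only [map_smul, Derivation.liftKaehlerDifferential_comp_D, hδ _ (hxm _)] at h5
    rw [← Ideal.Quotient.eq_zero_iff_mem, map_sum]
    simpa [Algebra.smul_def] using h5
  have hwspan : Submodule.span (ResidueField A) (Set.range w) = ⊤ := by
    have h1 := (map_tensorProduct_mk_eq_top (R := A) (M := Ω[A⁄K])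
      (N := Submodule.span A (Set.range (KaehlerDifferential.D K A)))).2
      (KaehlerDifferential.span_range_derivation K A)
    rw [Submodule.map_span, ← Set.range_comp] at h1
    rw [eq_top_iff]
    intro v _
    have h2 : v ∈ Submodule.span A (Set.range w) := by
      change v ∈ Submodule.span A (Set.range (TensorProduct.mk A (ResidueField A) Ω[A⁄K] 1 ∘
        KaehlerDifferential.D K A))
      rw [h1]; trivial
    exact Submodule.span_subset_span A (ResidueField A) _ h2
  have hinj : Function.Injective fun i => w (x i) := hli.injective
  obtain ⟨B, hBr, hxB, hrB, hB⟩ := exists_linearIndepOn_id_extension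
    (s := Set.range fun i => w (x i)) (t := Set.range w) hli.linearIndepOn_id
    (by rintro _ ⟨i, rfl⟩; exact ⟨_, rfl⟩)
  have hchoose : ∀ y : B, ∃ a, w a = y ∧ ∀ i, w (x i) = y → a = x i := fun y => by
    by_cases hy : ∃ i, w (x i) = y
    · obtain ⟨i, hi⟩ := hy
      exact ⟨x i, hi, fun k hk => by rw [hinj (hi.trans hk.symm)]⟩
    · obtain ⟨a, ha⟩ := hBr y.2
      exact ⟨a, ha, fun i hi => absurd ⟨i, hi⟩ hy⟩
  choose v hv hvx using hchoose
  have hcomp : (TensorProduct.mk A (ResidueField A) Ω[A⁄K] 1 ∘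
      fun y : B => KaehlerDifferential.D K A (v y)) = fun y : B =>
          (y : ResidueField A ⊗[A] Ω[A⁄K]) :=
    funext fun y => hv y
  obtain ⟨β, hβ⟩ := Module.exists_basis_of_basis_baseChange
    (fun y : B => KaehlerDifferential.D K A (v y)) (by rw [hcomp]; exact hB)
    (by
      rw [hcomp, Subtype.range_coe, eq_top_iff, ← hwspan, Submodule.span_le]
      exact hrB)
    (Module.Flat.rTensor_preserves_injective_linearMap _ Subtype.val_injective)
  have hfin : Finite B := Module.Finite.finite_basis β
  obtain ⟨n, ⟨e⟩⟩ := Finite.exists_equiv_fin B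
  have hmem : ∀ i, x i ∈ Set.range fun k => v (e.symm k) := fun i => by
    refine ⟨e ⟨w (x i), hxB ⟨i, rfl⟩⟩, ?_⟩
    change v (e.symm (e _)) = _
    rw [Equiv.symm_apply_apply]
    exact hvx _ i rfl
  refine ⟨n, ⟨fun i => v (e.symm i),
    fun i => (β.coord (e.symm i)).compDer (KaehlerDifferential.D K A), fun i j => ?_, ?_, ?_⟩,
    fun i => ?_⟩
  · change β.coord (e.symm i) (KaehlerDifferential.D K A (v (e.symm j))) = _
    rw [← hβ, Module.Basis.coord_apply, Module.Basis.repr_self, Finsupp.single_apply]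
    simp [eq_comm]
  · rw [← β.span_eq]
    congr 1
    ext ω
    constructor
    · rintro ⟨i, rfl⟩
      exact ⟨e.symm i, hβ _⟩
    · rintro ⟨y, rfl⟩
      exact ⟨e y, by simp only [hβ, Equiv.symm_apply_apply]⟩
  · refine le_antisymm (Ideal.span_le.2 fun y hy => hy.2) ?_
    conv_lhs => rw [← hx]
    refine Ideal.span_mono ?_
    rintro _ ⟨i, rfl⟩
    exact ⟨hmem i, hxm i⟩
  · exact hmem i

end SmoothCoordinates

/-! ### The initial state -/

section Initial

variable {K : Type u} [Field K] {A : Type u} [CommRing A] [Algebra K A]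
  {𝔪 : Ideal A} {E : Set (Ideal A)} [CharZero K] [IsLocalRing A] [IsNoetherianRing A]

theorem Reached.initial (h𝔪 : 𝔪 = IsLocalRing.maximalIdeal A) {R : Subalgebra A (TAlg A)} {n : ℕ}
    (c : CoordSystem K A 𝔪 n) (hc : c.Compatible E)
    (hR : ∃ (m : ℕ) (f : Fin m → A) (b : Fin m → ℚ≥0),
      R = Algebra.adjoin A (Set.range fun j => mono (b j) (f j)))
    (hv : ∀ b : ℚ≥0, 0 < b → ∀ f, mono b f ∈ R → f ∈ 𝔪) : Reached K 𝔪 E R ([], R) where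
  coord := ⟨n, c, hc, List.nodup_nil, by simp [coords]⟩
  pos := by simp
  incr := List.Pairwise.nil
  sorted := List.Pairwise.nil
  gens := by
    obtain ⟨m, f, b, hf⟩ := hR
    refine ⟨m, f, b, ?_⟩
    have h1 : intPart R [] ≤ R := by
      rw [c.intPart_eq h𝔪 (bl := []) ⟨List.nodup_nil, by simp [coords]⟩ (by simp [coords])]
      refine inf_le_left.trans ((isHomog_monoAlg _).le_iff.2 fun q g hg => ?_)
      rw [mono_mem_monoAlg] at hg
      rcases (zero_le : 0 ≤ q).eq_or_lt with rfl | hq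
      · exact mono_zero_mem R g
      · have h2 := wIdeal_le_span (by exact_mod_cast hq) hg
        have h3 : {x : A | ∃ y ∈ coords ([] : List (List A × ℚ≥0)), y.1 = x} = ∅ := by
          ext x; simp [coords]
        rw [h3, Ideal.span_empty, Ideal.mem_bot] at h2
        rw [h2, mono, AddMonoidAlgebra.single_zero]
        exact R.zero_mem
    change R = intPart R [] ⊔ _
    rw [← hf, sup_eq_right.2 h1]
  group := rfl
  order := ⟨0, by simp, fun b hb f hf => by
    simpa using Ideal.mem_sup_right (hv b hb f hf)⟩

end Initial

/-! ### Local rings and germs on a smooth scheme -/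

section Localization

/-- The local rings of a smooth algebra are noetherian, formally smooth and essentially of finite
type. -/
theorem localization_of_smooth {K B A : Type u} [Field K] [CommRing B] [CommRing A] [Algebra K A]
    {φ : K →+* B} (hφ : φ.Smooth) (ψ : B →+* A) (q : Ideal B) [q.IsPrime]
    (hloc : @IsLocalization.AtPrime B _ A _ ψ.toAlgebra q _) (h : algebraMap K A = ψ.comp φ) :
    IsNoetherianRing A ∧ Algebra.EssFiniteType K A ∧ Algebra.FormallySmooth K A := by
  let := φ.toAlgebra
  let := ψ.toAlgebra
  have : IsScalarTower K B A := IsScalarTower.of_algebraMap_eq' h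
  have hs : Algebra.Smooth K B := hφ
  have h1 : IsNoetherianRing B := Algebra.FiniteType.isNoetherianRing K B
  have h2 : Algebra.EssFiniteType B A := Algebra.EssFiniteType.of_isLocalization A q.primeCompl
  have h3 : Algebra.FormallySmooth B A := Algebra.FormallySmooth.of_isLocalization q.primeCompl
  exact ⟨IsLocalization.isNoetherianRing q.primeCompl A h1, Algebra.EssFiniteType.comp K B A,
    Algebra.FormallySmooth.comp K B A⟩

end Localization

section Germs

open CategoryTheory AlgebraicGeometry

variable {K : Type u} [Field K] {X : Scheme.{u}}

theorem exists_affine_mem {p : X} {U : X.Opens} (hp : p ∈ U) :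
    ∃ V : X.affineOpens, p ∈ V.1 ∧ V.1 ≤ U := by
  obtain ⟨_, ⟨V, hV, rfl⟩, hpV, hVU⟩ := X.isBasis_affineOpens.exists_subset_of_mem_open hp U.2
  exact ⟨⟨V, hV⟩, hpV, hVU⟩

theorem stalkIdeal_eq (I : X.IdealSheafData) {p : X} (U : X.affineOpens) (hp : p ∈ U.1) :
    stalkIdeal I p = (I.ideal U).map (X.presheaf.germ U.1 p hp).hom := by
  have key : ∀ (V W : X.affineOpens) (hV : p ∈ V.1) (hW : p ∈ W.1), W ≤ V →
      (I.ideal V).map (X.presheaf.germ V.1 p hV).hom =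
        (I.ideal W).map (X.presheaf.germ W.1 p hW).hom := by
    intro V W hV hW h
    rw [← I.map_ideal h, Ideal.map_map, ← CommRingCat.hom_comp]
    congr 2
    exact (X.presheaf.germ_res (homOfLE h) p hW).symm
  refine le_antisymm (iSup₂_le fun V hV => ?_) (le_iSup₂_of_le U hp le_rfl)
  obtain ⟨W, hpW, hW⟩ := exists_affine_mem (X := X) (p := p) (U := U.1 ⊓ V.1) ⟨hp, hV⟩
  rw [key V W hV hpW (hW.trans inf_le_right), key U W hp hpW (hW.trans inf_le_left)]

theorem stalkIdeal_le_maxIdeal {I : X.IdealSheafData} {p : X} (hp : p ∈ I.support) :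
    stalkIdeal I p ≤ IsLocalRing.maximalIdeal (X.presheaf.stalk p) := by
  obtain ⟨U, hpU, -⟩ := exists_affine_mem (X := X) (p := p) (U := ⊤) trivial
  rw [stalkIdeal_eq I U hpU, Ideal.map_le_iff_le_comap]
  intro f hf
  rw [Scheme.IdealSheafData.mem_support_iff_of_mem hpU, Scheme.mem_zeroLocus_iff] at hp
  have := hp f hf
  rw [Scheme.mem_basicOpen _ _ _ hpU] at this
  exact (IsLocalRing.mem_maximalIdeal _).2 this

theorem RationalRees.isMulFamily_ideal (R : RationalRees X) (U : X.affineOpens) :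
    IsMulFamily fun q => (R.ideal q).ideal U where
  zero := by rw [R.ideal_zero]; rfl
  mul_le q r := R.mul_le q r U

theorem RationalRees.isMulFamily_stalkIdeal (R : RationalRees X) (p : X) :
    IsMulFamily fun q => stalkIdeal (R.ideal q) p := by
  obtain ⟨U, hpU, -⟩ := exists_affine_mem (X := X) (p := p) (U := ⊤) trivial
  simp only [stalkIdeal_eq _ U hpU]
  exact (R.isMulFamily_ideal U).map _

variable (π : X ⟶ Spec (CommRingCat.of K))

theorem RationalRees.mono_mem_germ (R : RationalRees X) {p : X} {q : ℚ≥0}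
    {f : LocalRing π p} (h : mono q f ∈ R.germ π p) : f ∈ stalkIdeal (R.ideal q) p := by
  have h1 : R.germ π p ≤ filtAlg (A := LocalRing π p) _ (R.isMulFamily_stalkIdeal p) := by
    refine Algebra.adjoin_le ?_
    rintro _ ⟨q, f, hf, rfl⟩
    exact (mono_mem_filtAlg (A := LocalRing π p) (hJ := R.isMulFamily_stalkIdeal p)).2 hf
  exact (mono_mem_filtAlg (A := LocalRing π p) (hJ := R.isMulFamily_stalkIdeal p)).1 (h1 h)

/-- A finitely generated homogeneous algebra has finitely many homogeneous generators. -/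
theorem exists_mono_generators {A : Type u} [CommRing A] {S : Subalgebra A (TAlg A)}
    (hS : IsHomog S) (hfg : S.FG) : ∃ (m : ℕ) (f : Fin m → A) (b : Fin m → ℚ≥0),
      S = Algebra.adjoin A (Set.range fun j => mono (b j) (f j)) := by
  classical
  obtain ⟨t, ht⟩ := hfg
  let s : Set (TAlg A) :=
    ⋃ F ∈ (t : Set (TAlg A)), (fun q => mono q (F.coeff q)) '' (F.coeff.support : Set ℚ≥0)
  have hs : s.Finite := t.finite_toSet.biUnion fun F _ => (Finset.finite_toSet _).image _
  obtain ⟨m, f, b, h⟩ := exists_range_eq hs (by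
    intro F hF
    obtain ⟨G, -, q, -, rfl⟩ := Set.mem_iUnion₂.1 hF
    exact ⟨_, _, rfl⟩)
  refine ⟨m, f, b, ?_⟩
  rw [← h]
  apply le_antisymm
  · rw [← ht]
    refine Algebra.adjoin_le fun F hF => ?_
    rw [← sum_mono F]
    refine Subalgebra.sum_mem _ fun q hq => Algebra.subset_adjoin ?_
    exact Set.mem_iUnion₂.2 ⟨F, hF, q, hq, rfl⟩
  · refine Algebra.adjoin_le fun F hF => ?_
    obtain ⟨G, hG, q, -, rfl⟩ := Set.mem_iUnion₂.1 hF
    exact hS G (ht ▸ Algebra.subset_adjoin hG) q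

theorem RationalRees.exists_germ_generators (R : RationalRees X) (p : X) :
    ∃ (m : ℕ) (f : Fin m → LocalRing π p) (b : Fin m → ℚ≥0),
      R.germ π p = Algebra.adjoin _ (Set.range fun j => mono (b j) (f j)) := by
  obtain ⟨U, hpU, -⟩ := exists_affine_mem (X := X) (p := p) (U := ⊤) trivial
  let ψ : Γ(X, U) →+* LocalRing π p := (X.presheaf.germ U.1 p hpU).hom
  let S : Subalgebra Γ(X, U) (TAlg Γ(X, U)) := Algebra.adjoin Γ(X, U)
    {F : TAlg Γ(X, U) | ∃ q, ∃ f ∈ (R.ideal q).ideal U, F = mono q f}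
  have hS : IsHomog S := isHomog_adjoin fun F ⟨q, f, _, h⟩ => ⟨q, f, h⟩
  obtain ⟨m, f, b, h⟩ := exists_mono_generators hS (R.fg U)
  refine ⟨m, fun j => ψ (f j), b, ?_⟩
  rw [← extend_adjoin ψ, ← h]
  apply le_antisymm
  · refine Algebra.adjoin_le ?_
    rintro _ ⟨q, g, hg, rfl⟩
    rw [stalkIdeal_eq _ U hpU] at hg
    have h1 : ((R.ideal q).ideal U).map ψ ≤ degIdeal (extend ψ S) q := by
      rw [Ideal.map_le_iff_le_comap]
      intro g hg
      exact mono_mem_extend ψ (Algebra.subset_adjoin ⟨q, g, hg, rfl⟩)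
    exact h1 hg
  · rw [extend_le_iff ψ hS]
    intro q g hg
    have h1 : S ≤ filtAlg _ (R.isMulFamily_ideal U) := by
      refine Algebra.adjoin_le ?_
      rintro _ ⟨q, f, hf, rfl⟩
      exact (mono_mem_filtAlg (hJ := R.isMulFamily_ideal U)).2 hf
    refine Algebra.subset_adjoin ⟨q, ψ g, ?_, rfl⟩
    rw [stalkIdeal_eq _ U hpU]
    exact Ideal.mem_map_of_mem _ ((mono_mem_filtAlg (hJ := R.isMulFamily_ideal U)).1 (h1 hg))

theorem localRing_of_smooth [Smooth π] (p : X) :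
    IsNoetherianRing (LocalRing π p) ∧ Algebra.EssFiniteType K (LocalRing π p) ∧
      Algebra.FormallySmooth K (LocalRing π p) := by
  obtain ⟨U, hpU, -⟩ := exists_affine_mem (X := X) (p := p) (U := ⊤) trivial
  have h1 : (π.appLE ⊤ U.1 le_top).hom.Smooth := π.smooth_appLE (isAffineOpen_top _) U.2 _
  have h2 : ((Scheme.ΓSpecIso (CommRingCat.of K)).inv ≫ π.appLE ⊤ U.1 le_top).hom.Smooth := by
    rw [CommRingCat.hom_comp]
    refine RingHom.Smooth.comp ?_ h1
    exact RingHom.Smooth.of_bijective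
      (ConcreteCategory.bijective_of_isIso (Scheme.ΓSpecIso (CommRingCat.of K)).inv)
  refine localization_of_smooth h2 (A := LocalRing π p) (X.presheaf.germ U.1 p hpU).hom
    (U.2.primeIdealOf ⟨p, hpU⟩).asIdeal (U.2.isLocalization_stalk ⟨p, hpU⟩) ?_
  have key : (Scheme.ΓSpecIso (CommRingCat.of K)).inv ≫ π.appTop ≫ X.presheaf.germ ⊤ p trivial =
      ((Scheme.ΓSpecIso (CommRingCat.of K)).inv ≫ π.appLE ⊤ U.1 le_top) ≫
        X.presheaf.germ U.1 p hpU := by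
    rw [Category.assoc]
    congr 1
    change _ = (π.app ⊤ ≫ X.presheaf.map (homOfLE le_top).op) ≫ X.presheaf.germ U.1 p hpU
    rw [Category.assoc]
    exact congrArg (π.appTop ≫ ·) (X.presheaf.germ_res (homOfLE (le_top : U.1 ≤ ⊤)) p hpU).symm
  exact congrArg CommRingCat.Hom.hom key

/-- The procedure can be started at a point of the vertex. -/
theorem RationalRees.reached [CharZero K] [Smooth π] (E : SNCDivisor X) (R : RationalRees X)
    {p : X} (hp : R.MemVertex p) :
    Reached K (maxIdeal π p) (E.germs π p) (R.germ π p) ([], R.germ π p) := by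
  obtain ⟨h1, h2, h3⟩ := localRing_of_smooth π p
  obtain ⟨d, (x : Fin d → LocalRing π p), hd, hx, hE⟩ := E.snc p
  have hd' : ringKrullDim (LocalRing π p) = d := hd
  have hx' : Ideal.span (Set.range x) = IsLocalRing.maximalIdeal (LocalRing π p) := hx
  obtain ⟨n, c, hc⟩ := exists_coordSystem (K := K) (A := LocalRing π p) x hd' hx'
  refine Reached.initial rfl c ?_ (R.exists_germ_generators π p) fun b hb f hf => ?_
  · rintro _ ⟨I, hI, hpI, rfl⟩
    obtain ⟨j, hj⟩ := hE I hI hpI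
    obtain ⟨i, hi⟩ := hc j
    exact ⟨i, by rw [hi]; exact hj⟩
  · exact stalkIdeal_le_maxIdeal (hp b hb) (R.mono_mem_germ π hf)

end Germs

end WeightedCenters

open WeightedCenters AlgebraicGeometry CategoryTheory in
theorem proposition3 {K : Type u} [Field K] [CharZero K] {X : Scheme.{u}}
    (π : X ⟶ Spec (CommRingCat.of K)) [IsIntegral X] [IsSeparated π] [LocallyOfFiniteType π]
    [QuasiCompact π] [Smooth π] (E : SNCDivisor X) (R : RationalRees X) (p : X)
    (hp : R.MemVertex p) :
    ∃ 𝒜 : Subalgebra (LocalRing π p) (TAlg (LocalRing π p)),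
      -- `𝒜` is the only maximal admissible center for `R` at `p`
      IsMaximalAdmissible K (maxIdeal π p) (E.germs π p) (R.germ π p) 𝒜 ∧
      (∀ 𝒜', IsMaximalAdmissible K (maxIdeal π p) (E.germs π p) (R.germ π p) 𝒜' → 𝒜' = 𝒜) ∧
      -- the procedure can be carried out to its end in such a way that all the `R_i` are nested
      (∃ s, NestedMillingRun K (maxIdeal π p) (E.germs π p) ([], R.germ π p) s ∧ Terminated s) ∧
      -- each run can be continued until it terminates
      (∀ s, MillingRun K (maxIdeal π p) (E.germs π p) ([], R.germ π p) s →
        ∃ s', MillingRun K (maxIdeal π p) (E.germs π p) s s' ∧ Terminated s') ∧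
      -- each run which terminates, whatever the choices, yields `𝒜` and the invariant
      (∀ s, MillingRun K (maxIdeal π p) (E.germs π p) ([], R.germ π p) s → Terminated s →
        s.1.Pairwise (fun y y' => y.2 < y'.2) ∧
        𝒜 = center (coords s.1) ∧
        s.2 = IntFor (R.germ π p) 𝒜 ∧
        IsResolutionInv K (maxIdeal π p) (E.germs π p) (R.germ π p)
          (toInvSeq (s.1.flatMap fun y => blockInv (E.germs π p) y.2 y.1))) := by
  have h𝔪 : maxIdeal π p = IsLocalRing.maximalIdeal (LocalRing π p) := rfl
  have hR := R.reached π E hp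
  obtain ⟨hN, -, -⟩ := localRing_of_smooth π p
  obtain ⟨s, hs, hst⟩ := hR.exists_nested_run h𝔪
  have hsm : MillingRun K (maxIdeal π p) (E.germs π p) ([], R.germ π p) s :=
    Relation.ReflTransGen.mono (fun _ _ h => h.1) _ _ hs
  have hmax := hsm.isMaximalAdmissible h𝔪 hR hst
  refine ⟨center (coords s.1), hmax, fun 𝒜' h' => hsm.eq_center h𝔪 hR hst h', ⟨s, hs, hst⟩,
    fun s' hs' => (MillingRun.reached h𝔪 hR hs').exists_run h𝔪, fun s' hs' hst' => ?_⟩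
  have hc : center (coords s.1) = center (coords s'.1) := hs'.eq_center h𝔪 hR hst' hmax
  refine ⟨(MillingRun.reached h𝔪 hR hs').incr, hc, ?_, ?_⟩
  · rw [hc]
    exact hs'.snd_eq h𝔪 hR hst'
  · rw [toInvSeq_blockInv]
    exact hs'.isResolutionInv h𝔪 hR hst'
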